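/- Let $n\ge 2$, $[n]=\{1,\dots,n\}$ and $[\pm n]=\{\pm1,\dots,\pm n\}$. **Partitions.** A $B_n$-partition is a set partition $\pi$ of $[\pm n]$ such that $-B\in\pi$ for every block $B\in\pi$ and at most one block $B_0$ (the zero block; we write $B_0=\emptyset$ if there is none) satisfies $-B_0=B_0$. It is a $D_n$-partition if its zero block, when present, has more than two elements. For a block $B$ let $B^p$ and $B^n$ be the sets of its positive and of its negative elements, $s(B)=\min B^p$ and $w(B)=s(-B)$; call $B$ *mixed* if $B^p$ and $B^n$ are both non-empty. The set $op(\pi)$ consists of the least elements of the blocks contained in $[n]$; $cl(\pi)$ consists of the greatest elements of the blocks contained in $[n]$ and of the absolute values of the least and greatest elements of the mixed blocks; $tr(\pi)=[n]\setminus(op(\pi)\cup cl(\pi))$. **Noncrossing partitions.** $NC^B(n)$ is the set of $B_n$-partitions such that, when the vertices of a regular $2n$-gon are labeled $1,\dots,n,-1,\dots,-n$ clockwise, the convex hulls of any two distinct blocks are disjoint. Now label the vertices of a regular $(2n-2)$-gon $2,\dots,n,-2,\dots,-n$ clockwise and its centroid by both $1$ and $-1$; let $\rho(B)$ be the convex hull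 of the points labeled by $B$. Two distinct blocks $B,B'$ cross if $\rho(B)\ne\rho(B')$ and one of $\rho(B),\rho(B')$ contains a point of the other in its relative interior. $NC^D(n)$ is the set of $D_n$-partitions without crossing blocks. **Nonnesting partitions.** The positive roots of type $D_n$ are $e_i\pm e_j$ ($1\le j<i\le n$); those of type $B_n$ are these and $e_1,\dots,e_n$. In each type order the positive roots by $\alpha\le\beta$ iff $\beta-\alpha$ is a sum of (zero or more) positive roots of that type. To an antichain associate the graph on $[\pm n]\cup\{0\}$ with edges $\{i,j\},\{-i,-j\}$ for each root $e_i-e_j$ in it, $\{i,-j\},\{-i,j\}$ for each root $e_i+e_j$, and $\{i,0\},\{-i,0\}$ for each root $e_i$, and the partition of $[\pm n]$ into the connected components of this graph, after dropping $0$. $NN^B(n)$ and $NN^D(n)$ are the sets of the partitions so obtained from the antichains of type $B_n$ and $D_n$. **The map $\iota$ on $NN^D(n)$.** Let $\pi\in NN^D(n)$ and let $B_0$ be its zero block. In each case the listed blocks and their negatives are replaced, and all other blocks are kept. 1. If $B_0=\emptyset$, the block $B_1\ni 1$ is mixed, and $s(B_1\setminus\{1\})<w(B_1)$ (in particular $B_1\setminus\{1\}$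 has a positive element): replace $B_1$ by $C_0=\pm(B_1^p\setminus\{1\})$ and $C_1=-B_1^n\cup\{1\}$. 2. If $1\in B_0$ and the nonzero mixed blocks are $\pm B_1,\dots,\pm B_s$, $s\ge1$, with $w(B_s)<\dots<w(B_1)<s(B_1)<\dots<s(B_s)$: replace $B_0,B_1,\dots,B_s$ by $C_0=\pm B_s^p$, $C_1=-B_{s-1}^p\cup B_0^p$, $C_2=B_2^n\cup -B_1^n$, and $C_i=B_i^n\cup B_{i-2}^p$ for $3\le i\le s$; for $s=1$, by $C_0=\pm B_1^p$ and $C_1=B_1^n\cup B_0^p$. 3. Otherwise $\iota(\pi)=\pi$. **The map $f:NN^B(n)\to NC^B(n)$.** $f(\pi)$ is the unique element of $NC^B(n)$ with the same openers, closers and transients as $\pi$. **The map $\xi$ on $(f\circ\iota)(NN^D(n))$.** Let $\pi$ be in this set, $B_0$ its zero block, $B_1\ni1$ and $R=B_1\setminus\{1\}$. Let $\pm B_2,\dots,\pm B_k$ ($k\ge1$) be the nonzero mixed blocks other than $\pm B_1$, with signs and order chosen so that $s(B_i)<s(-B_i)$ and $s(B_2)<\dots<s(B_k)$. Again the listed blocks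 and their negatives are replaced, and all other blocks are kept. 1. If $1\notin B_0\neq\emptyset$ and $R$ is mixed: replace $B_0,B_1$ by $B_0\cup\{\pm1\}$, $R$. 2. If $B_0=\emptyset$, $R$ is mixed and $k\ge2$: replace $B_1,B_k$ by $R$, $B_k\cup\{1\}$. 3. If $B_0=\emptyset\neq R$, all elements of $R$ are positive and $k\ge2$: replace $B_1,\dots,B_k$ by $R\cup B_2^n$, $B_i^p\cup B_{i+1}^n$ ($2\le i<k$), $B_k^p\cup\{1\}$. 4. If $B_0=\emptyset\neq R$, all elements of $R$ are negative and $k\ge2$: replace $B_1,\dots,B_k$ by $R\cup B_2^p$, $B_i^n\cup B_{i+1}^p$ ($2\le i<k$), $B_k^n\cup\{1\}$. 5. If $1\notin B_0\ne\emptyset$ and all elements of $B_1$ are positive: replace $B_0,B_1,\dots,B_k$ by $R\cup B_2^n$, $B_i^p\cup B_{i+1}^n$ ($2\le i<k$), $B_k^p\cup\{-1\}\cup B_0^n$; for $k=1$, replace $B_0,B_1$ by $R\cup\{-1\}\cup B_0^n$. 6. Otherwise $\xi(\pi)=\pi$. **Theorem.** The set $(f\circ\iota)(NN^D(n))$ is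 well defined and contained in $NC^B(n)$; $\xi$ is the identity on $(f\circ\iota)(NN^D(n))\cap NC^D(n)$; $\xi:(f\circ\iota)(NN^D(n))\to NC^D(n)$ is a bijection; and $\xi$ maps $(f\circ\iota)(NN^D(n))\setminus NC^D(n)$ onto $NC^D(n)\setminus NC^B(n)$. -/

import Mathlib

namespace NCNN

/-! ### Set partitions of `[±n]`

A set partition of `[±n] = {-n, …, -1, 1, …, n}` is given by its finite set of blocks; the
element `ī` is the integer `-i`. -/

/-- The ground set `[±n]`. -/
noncomputable def ground (n : ℕ) : Finset ℤ := (Finset.Icc (-(n : ℤ)) n).erase 0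

/-- `-B`, the set of the negatives of the elements of `B`. -/
def neg (B : Finset ℤ) : Finset ℤ := B.image (fun x => -x)

/-- `Bᵖ`, the set of the positive elements of `B`. -/
def pos (B : Finset ℤ) : Finset ℤ := B.filter (fun x => 0 < x)

/-- `Bⁿ`, the set of the negative elements of `B`. -/
def ngt (B : Finset ℤ) : Finset ℤ := B.filter (fun x => x < 0)

/-- `B` contains both positive and negative integers. -/
abbrev Mixed (B : Finset ℤ) : Prop := (pos B).Nonempty ∧ (ngt B).Nonempty

/-- `s(B)`: the least positive element of `B` (`⊤` if there is none). -/
def sMin (B : Finset ℤ) : WithTop ℤ := (pos B).min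

/-- `w(B) = s(-B)`: the absolute value of the largest negative element of `B`
(`⊤` if there is none). -/
def wMin (B : Finset ℤ) : WithTop ℤ := sMin (neg B)

/-- `B_n`-partitions. -/
structure IsBPartition (n : ℕ) (P : Finset (Finset ℤ)) : Prop where
  nonempty : ∀ B ∈ P, B.Nonempty
  disjoint : ∀ B ∈ P, ∀ C ∈ P, B ≠ C → Disjoint B C
  cover : P.biUnion id = ground n
  neg_mem : ∀ B ∈ P, neg B ∈ P
  zero_unique : ∀ B ∈ P, ∀ C ∈ P, neg B = B → neg C = C → B = C

/-- `D_n`-partitions. -/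
structure IsDPartition (n : ℕ) (P : Finset (Finset ℤ)) : Prop extends IsBPartition n P where
  two_lt_card : ∀ B ∈ P, neg B = B → 2 < B.card

/-- The zero block of `P` (empty if there is none). -/
def zeroBlock (P : Finset (Finset ℤ)) : Finset ℤ := (P.filter (fun B => neg B = B)).biUnion id

/-- The block of `P` containing `a`. -/
def blockOf (P : Finset (Finset ℤ)) (a : ℤ) : Finset ℤ := (P.filter (fun B => a ∈ B)).biUnion id

/-! ### Openers, closers, transients -/

/-- `op(P)`: the least elements of the blocks with only positive elements. -/
def openers (P : Finset (Finset ℤ)) : Set ℤ :=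
  {i | ∃ B ∈ P, (∀ x ∈ B, 0 < x) ∧ IsLeast (B : Set ℤ) i}

/-- `cl(P)`: the greatest elements of the blocks with only positive elements, and the absolute
values of the least and of the greatest elements of the blocks with elements of both signs. -/
def closers (P : Finset (Finset ℤ)) : Set ℤ :=
  {i | ∃ B ∈ P, (∀ x ∈ B, 0 < x) ∧ IsGreatest (B : Set ℤ) i} ∪
  {i | ∃ B ∈ P, Mixed B ∧ ∃ x, (IsLeast (B : Set ℤ) x ∨ IsGreatest (B : Set ℤ) x) ∧ i = |x|}

/-- `tr(P)`: the elements of `[n]` that are neither openers nor closers. -/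
def transients (n : ℕ) (P : Finset (Finset ℤ)) : Set ℤ :=
  Set.Icc 1 (n : ℤ) \ (openers P ∪ closers P)

/-! ### Noncrossing partitions -/

/-- The vertices of a regular polygon with `N` sides inscribed in the unit circle,
numbered clockwise. -/
noncomputable def vertex (N : ℤ) (k : ℤ) : ℂ := Complex.exp (-(2 * Real.pi * k / N) * Complex.I)

/-- The vertices of the `2n`-gon are labeled `1, …, n, -1, …, -n` clockwise. -/
noncomputable def pointB (n : ℕ) (a : ℤ) : ℂ :=
  if 0 < a then vertex (2 * n) (a - 1) else vertex (2 * n) (n + (-a - 1))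

/-- The vertices of the `(2n-2)`-gon are labeled `2, …, n, -2, …, -n` clockwise; both `1` and `-1`
label its centroid. -/
noncomputable def pointD (n : ℕ) (a : ℤ) : ℂ :=
  if a = 1 ∨ a = -1 then 0
  else if 0 < a then vertex (2 * n - 2) (a - 2)
  else vertex (2 * n - 2) ((n - 1) + (-a - 2))

/-- `ρ(B)` in the `2n`-gon. -/
noncomputable def hullB (n : ℕ) (B : Finset ℤ) : Set ℂ := convexHull ℝ (pointB n '' (B : Set ℤ))

/-- `ρ(B)` in the `(2n-2)`-gon. -/
noncomputable def hullD (n : ℕ) (B : Finset ℤ) : Set ℂ := convexHull ℝ (pointD n '' (B : Set ℤ))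

/-- `NC^B(n)`. -/
def NCB (n : ℕ) : Set (Finset (Finset ℤ)) :=
  {P | IsBPartition n P ∧ ∀ B ∈ P, ∀ C ∈ P, B ≠ C → Disjoint (hullB n B) (hullB n C)}

/-- Two blocks cross (type `D`): their hulls do not coincide, and one of the hulls contains a point
of the other in its relative interior. -/
def CrossD (n : ℕ) (B C : Finset ℤ) : Prop :=
  hullD n B ≠ hullD n C ∧
    ((intrinsicInterior ℝ (hullD n B) ∩ hullD n C).Nonempty ∨
      (intrinsicInterior ℝ (hullD n C) ∩ hullD n B).Nonempty)

/-- `NC^D(n)`. -/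
def NCD (n : ℕ) : Set (Finset (Finset ℤ)) :=
  {P | IsDPartition n P ∧ ∀ B ∈ P, ∀ C ∈ P, B ≠ C → ¬ CrossD n B C}

/-! ### Nonnesting partitions -/

/-- The vectors `e_1, …, e_n`, with the conventions `e_0 = 0` and `e_{-a} = -e_a`. -/
def e (a : ℤ) : ℤ → ℤ := a.sign • Pi.single |a| (1 : ℤ)

/-- The positive roots of type `D_n`. -/
def rootsD (n : ℕ) : Set (ℤ → ℤ) :=
  {v | ∃ i j : ℤ, 1 ≤ j ∧ j < i ∧ i ≤ n ∧ (v = e i - e j ∨ v = e i + e j)}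

/-- The positive roots of type `B_n`. -/
def rootsB (n : ℕ) : Set (ℤ → ℤ) := {v | ∃ i : ℤ, 1 ≤ i ∧ i ≤ n ∧ v = e i} ∪ rootsD n

/-- The order of the root poset: `v - u` is a sum of positive roots. -/
def RootLE (R : Set (ℤ → ℤ)) (u v : ℤ → ℤ) : Prop := v - u ∈ AddSubmonoid.closure R

/-- The arcs of the diagram of an antichain `A`. As `e_0 = 0` and `e_{-a} = -e_a`, a root
`e_i - e_j` of `A` gives the arcs `{i, j}` and `{-i, -j}`, a root `e_i + e_j` gives the arcs
`{i, -j}` and `{-i, j}`, and a root `e_i` gives the arcs `{i, 0}` and `{-i, 0}`. -/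
def Arc (A : Set (ℤ → ℤ)) (a b : ℤ) : Prop := e a - e b ∈ A

open Classical in
/-- The partition of `[±n]` associated to an antichain: its blocks are the sets of elements joined
by chains of arcs, after dropping `0`. -/
noncomputable def chainPartition (n : ℕ) (A : Set (ℤ → ℤ)) : Finset (Finset ℤ) :=
  (ground n).image (fun a => (ground n).filter (fun b => Relation.EqvGen (Arc A) a b))

/-- `NN^B(n)`: the partitions associated to the antichains of the root poset of type `B_n`. -/
def NNB (n : ℕ) : Set (Finset (Finset ℤ)) :=
  {P | ∃ A ⊆ rootsB n, IsAntichain (RootLE (rootsB n)) A ∧ P = chainPartition n A}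

/-- `NN^D(n)`: the partitions associated to the antichains of the root poset of type `D_n`. -/
def NND (n : ℕ) : Set (Finset (Finset ℤ)) :=
  {P | ∃ A ⊆ rootsD n, IsAntichain (RootLE (rootsD n)) A ∧ P = chainPartition n A}

/-! ### The three maps -/

/-- Remove from `P` the blocks `B` and `-B`, for `B` in the list `old`, and add the blocks `C` and
`-C`, for `C` in the list `new`. -/
def replaceBlocks (P : Finset (Finset ℤ)) (old new : List (Finset ℤ)) : Finset (Finset ℤ) :=
  (P \ (old ++ old.map neg).toFinset) ∪ (new ++ new.map neg).toFinset

/-- The list of the blocks `B` of `P` that have a positive element and satisfy `p`, by increasing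
`s(B)`. -/
noncomputable def sortedBlocks (n : ℕ) (P : Finset (Finset ℤ)) (p : Finset ℤ → Prop) [DecidablePred p] :
    List (Finset ℤ) :=
  (((Finset.Icc 1 (n : ℤ)).filter
    (fun x => sMin (blockOf P x) = (x : WithTop ℤ) ∧ p (blockOf P x))).sort (· ≤ ·)).map (blockOf P)

/-- The map `ι`. In the second case, `L = [B_1, …, B_s]` with
`w(B_s) < ⋯ < w(B_1) < s(B_1) < ⋯ < s(B_s)`, and the new blocks are `±B_sᵖ`,
`B_2ⁿ ∪ -B_1ⁿ`, `B_iⁿ ∪ B_{i-2}ᵖ` for `3 ≤ i ≤ s`, `B_0ⁿ ∪ B_{s-1}ᵖ`, and their negatives; for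
`s = 1` they are `±B_1ᵖ`, `B_0ⁿ ∪ -B_1ⁿ`, and its negative. -/
noncomputable def iota (n : ℕ) (P : Finset (Finset ℤ)) : Finset (Finset ℤ) :=
  let B₀ := zeroBlock P
  let B₁ := blockOf P 1
  let L := sortedBlocks n P (fun B => Mixed B ∧ neg B ≠ B ∧ wMin B < sMin B)
  if B₀ = ∅ ∧ Mixed B₁ ∧ sMin (B₁.erase 1) < wMin B₁ then
    replaceBlocks P [B₁] [(pos B₁).erase 1 ∪ neg ((pos B₁).erase 1), neg (ngt B₁) ∪ {1}]
  else if 1 ∈ B₀ ∧ L ≠ [] ∧ L.Pairwise (fun B C => wMin C < wMin B) then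
    replaceBlocks P (B₀ :: L)
      ((pos (L.getLastD ∅) ∪ neg (pos (L.getLastD ∅))) ::
        List.zipWith (· ∪ ·) (L.tail.map ngt ++ [ngt B₀])
          (neg (ngt (L.headD ∅)) :: L.dropLast.map pos))
  else P

open Classical in
/-- The map `f : NN^B(n) → NC^B(n)`: the image of `P` is the only noncrossing `B_n`-partition with
the same openers, closers and transients as `P`. -/
noncomputable def f (n : ℕ) (P : Finset (Finset ℤ)) : Finset (Finset ℤ) :=
  if h : P ∈ NNB n ∧ ∃! Q, Q ∈ NCB n ∧ openers Q = openers P ∧ closers Q = closers P ∧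
      transients n Q = transients n P
  then h.2.choose else ∅

/-- The map `ξ`. Here `B₁` is the block containing `1`, `R = B₁ \ {1}`, and `L = [B_2, …, B_k]`
lists, by increasing `s(B)`, the blocks `B ≠ ±B₁` with elements of both signs and `B ≠ -B`, one
from each pair `B, -B`: the one with `s(B) < s(-B)`. -/
noncomputable def xi (n : ℕ) (P : Finset (Finset ℤ)) : Finset (Finset ℤ) :=
  let B₀ := zeroBlock P
  let B₁ := blockOf P 1
  let R := B₁.erase 1
  let L := sortedBlocks n P
    (fun B => Mixed B ∧ neg B ≠ B ∧ B ≠ B₁ ∧ B ≠ neg B₁ ∧ sMin B < sMin (neg B))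
  if (1 ∉ B₀ ∧ B₀ ≠ ∅) ∧ Mixed R then
    replaceBlocks P [B₀, B₁] [B₀ ∪ {1, -1}, R]
  else if B₀ = ∅ ∧ Mixed R ∧ L ≠ [] then
    replaceBlocks P [B₁, L.getLastD ∅] [R, L.getLastD ∅ ∪ {1}]
  else if B₀ = ∅ ∧ R ≠ ∅ ∧ (∀ x ∈ R, 0 < x) ∧ L ≠ [] then
    replaceBlocks P (B₁ :: L) (List.zipWith (· ∪ ·) (R :: L.map pos) (L.map ngt ++ [{1}]))
  else if B₀ = ∅ ∧ R ≠ ∅ ∧ (∀ x ∈ R, x < 0) ∧ L ≠ [] then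
    replaceBlocks P (B₁ :: L) (List.zipWith (· ∪ ·) (R :: L.map ngt) (L.map pos ++ [{1}]))
  else if (1 ∉ B₀ ∧ B₀ ≠ ∅) ∧ ∀ x ∈ B₁, 0 < x then
    replaceBlocks P (B₀ :: B₁ :: L)
      (List.zipWith (· ∪ ·) (R :: L.map pos) (L.map ngt ++ [{-1} ∪ ngt B₀]))
  else P

end NCNN

namespace NCNN

/-! ### Chords and arcs of the unit circle -/

/-! All the partitions involved are coded by words, and `iota`, `f` and `xi` do nothing but keep the
word. The letter of `i` is its status: opener and closer, closer only, neither, opener only. A word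
is read from its last letter, the letter of `n`, downwards (`Build`): a closer starts a new piece, a
transient element is added to an unfinished piece, an opener is added to an unfinished piece and
finishes it, and an element that is both is a block by itself. The only choice is which unfinished
piece is continued. The one with the smallest least element gives noncrossing partitions, the one
with the largest least element gives nonnesting ones. Hence neither the readability of a word nor
the number of pieces that stay unfinished depends on the rule (`Build.exists_of_build`).

In type `B` the unfinished pieces are joined in pairs to mixed blocks `X ∪ -Y`, from the outside to
the inside, and if their number is odd one piece `M` is left over and gives the zero block `±M`: the
middle piece on the noncrossing side, the last one on the nonnesting side. The word is recovered
from the openers and closers, so `f` sends the nonnesting partition of a word to the noncrossing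
partition of the same word (`f_nonnesting`).

In type `D` only the letters of `n, …, 2` are read. At most two unfinished pieces are then put
together with `1` to a central block (`CenterD`), and the others are paired as before. The six kinds
of central block carry a letter of `1` on each side, chosen such that `iota` sends a nonnesting
partition of type `D` to the nonnesting partition of type `B` with the same word
(`iota_nonnesting`), and `xi` sends a noncrossing partition of type `B` to the noncrossing partition
of type `D` with the same word (`xi_noncrossing`). A mixed central block has letter `tr` or `op`
according to the sign of `1` in it, and the two sides use opposite conventions; so for each number
of central pieces the same letters occur on both sides (`CenterD.exists_swap`).

Hence the image of `f ∘ iota` consists of the noncrossing partitions of type `B` whose words are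
also words of type `D`. A word determines the partition (`ncB_unique`, and through `xi` also in type
`D`) and is determined by it (`ncD_word_unique`), so `xi` is a bijection. A partition that is
noncrossing in both types has the same word in both (`nc_word_unique`). This makes `xi` the identity
on such partitions, and it forces `Q = xi Q` whenever `xi Q` is still noncrossing of type `B`.

To apply this, disjointness and crossing of hulls are translated into alternation in the clockwise
order (`mem_NCB_iff`, `noncrossingD_of_mem_NCD`, `mem_NCD_of_noncrossingD`), and antichains of roots
into families of arcs that do not lie under each other (`rootLE_imp`, `arc_antichain`). -/

theorem mem_intrinsicInterior_iff {s : Set ℂ} {x : ℂ} :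
    x ∈ intrinsicInterior ℝ s ↔
      x ∈ affineSpan ℝ s ∧ ∃ ε > 0, ∀ y ∈ affineSpan ℝ s, dist y x < ε → y ∈ s := by
  rw [mem_intrinsicInterior]
  constructor
  · rintro ⟨y, hy, rfl⟩
    refine ⟨y.2, ?_⟩
    rw [mem_interior_iff_mem_nhds, Metric.mem_nhds_iff] at hy
    obtain ⟨ε, hε, h⟩ := hy
    exact ⟨ε, hε, fun z hz hd => h (show (⟨z, hz⟩ : affineSpan ℝ s) ∈ Metric.ball y ε from hd)⟩
  · rintro ⟨hx, ε, hε, h⟩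
    refine ⟨⟨x, hx⟩, ?_, rfl⟩
    rw [mem_interior_iff_mem_nhds, Metric.mem_nhds_iff]
    exact ⟨ε, hε, fun z hz => h z z.2 hz⟩

/-- The homothety with centre `q` and ratio `1 - t` maps a relative ball about `z` contained in the
convex set to a relative ball about the new point, still contained in the set. -/
theorem combo_mem_intrinsicInterior {s : Set ℂ} (hs : Convex ℝ s) {z q : ℂ}
    (hz : z ∈ intrinsicInterior ℝ s) (hq : q ∈ s) {t : ℝ} (h0 : 0 ≤ t) (h1 : t < 1) :
    (1 - t) • z + t • q ∈ intrinsicInterior ℝ s := by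
  rw [mem_intrinsicInterior_iff] at hz ⊢
  obtain ⟨hza, ε, hε, h⟩ := hz
  have h1' : 0 < 1 - t := by linarith
  have hqa : q ∈ affineSpan ℝ s := subset_affineSpan ℝ s hq
  have hcombo : ∀ u ∈ affineSpan ℝ s, ∀ v ∈ affineSpan ℝ s, ∀ c : ℝ,
      u + c • (v - u) ∈ affineSpan ℝ s := by
    intro u hu v hv c
    have := AffineMap.lineMap_mem c hu hv
    rwa [AffineMap.lineMap_apply, vsub_eq_sub, vadd_eq_add, add_comm] at this
  refine ⟨?_, (1 - t) * ε, by positivity, ?_⟩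
  · have := hcombo z hza q hqa t
    convert this using 1
    module
  · intro y hy hd
    -- `y'` is the preimage of `y` under the homothety, so that `y` lies between `y'` and `q`.
    set y' := q + (1 - t)⁻¹ • (y - q) with hy'
    have hmem : y' ∈ affineSpan ℝ s := hcombo q hqa y hy _
    have hyy : y = (1 - t) • y' + t • q := by
      rw [hy', smul_add, smul_smul, mul_inv_cancel₀ h1'.ne']
      module
    have : y' ∈ s := by
      apply h y' hmem
      have e1 : y - ((1 - t) • z + t • q) = (1 - t) • (y' - z) := by
        conv_lhs => rw [hyy]
        module
      rw [dist_eq_norm, e1, norm_smul, Real.norm_of_nonneg h1'.le] at hd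
      rw [dist_eq_norm]
      exact lt_of_mul_lt_mul_left hd h1'.le
    rw [hyy]
    exact hs this hq h1'.le h0 (by ring)

/-- From a point of the relative interior one can move a little away from any point of the set. -/
theorem exists_extend_of_mem_intrinsicInterior {s : Set ℂ} {z q : ℂ}
    (hz : z ∈ intrinsicInterior ℝ s) (hq : q ∈ s) : ∃ ε > (0 : ℝ), z + ε • (z - q) ∈ s := by
  rw [mem_intrinsicInterior_iff] at hz
  obtain ⟨hza, ε, hε, h⟩ := hz
  have hqa : q ∈ affineSpan ℝ s := subset_affineSpan ℝ s hq
  refine ⟨ε / (2 * (‖z - q‖ + 1)), by positivity, h _ ?_ ?_⟩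
  · have := AffineMap.lineMap_mem (-(ε / (2 * (‖z - q‖ + 1)))) hza hqa
    rw [AffineMap.lineMap_apply, vsub_eq_sub, vadd_eq_add, add_comm] at this
    convert this using 1
    module
  · rw [dist_eq_norm, add_sub_cancel_left, norm_smul, Real.norm_of_nonneg (by positivity)]
    have : 0 ≤ ‖z - q‖ := norm_nonneg _
    rw [div_mul_eq_mul_div, div_lt_iff₀ (by positivity)]
    nlinarith

/-- The point of the unit circle at clockwise angle `t`. -/
noncomputable def circ (t : ℝ) : ℂ := ⟨Real.cos t, -Real.sin t⟩

/-- An affine function vanishing on the chord from `circ α` to `circ β`. -/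
noncomputable def side (α β : ℝ) (z : ℂ) : ℝ :=
  z.re * Real.cos ((α + β) / 2) - z.im * Real.sin ((α + β) / 2) - Real.cos ((β - α) / 2)

theorem side_circ (α β t : ℝ) :
    side α β (circ t) = Real.cos (t - (α + β) / 2) - Real.cos ((β - α) / 2) := by
  simp only [side, circ, Real.cos_sub t]
  ring

theorem side_combo (α β : ℝ) (z w : ℂ) {a b : ℝ} (hab : a + b = 1) :
    side α β (a • z + b • w) = a * side α β z + b * side α β w := by
  obtain rfl : b = 1 - a := by linarith
  simp only [side, Complex.add_re, Complex.add_im, Complex.real_smul, Complex.re_ofReal_mul,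
    Complex.im_ofReal_mul]
  ring

/-- By `side_circ` the sign is found by comparing the cosine of the angular distance from the middle
of the arc with the cosine of half the arc. -/
theorem side_pos {α β t : ℝ} (h1 : α < t) (h2 : t < β) (h3 : β - α < 2 * Real.pi) :
    0 < side α β (circ t) := by
  rw [side_circ, sub_pos, ← Real.cos_abs (t - (α + β) / 2)]
  apply Real.cos_lt_cos_of_nonneg_of_le_pi (abs_nonneg _) (by linarith)
  rw [abs_lt]
  constructor <;> linarith

theorem side_neg_right {α β t : ℝ} (h0 : α < β) (h1 : β < t) (h2 : t < α + 2 * Real.pi) :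
    side α β (circ t) < 0 := by
  rw [side_circ, sub_neg]
  rcases le_total (t - (α + β) / 2) Real.pi with h | h
  · exact Real.cos_lt_cos_of_nonneg_of_le_pi (by linarith) h (by linarith)
  · rw [← Real.cos_two_pi_sub (t - (α + β) / 2)]
    exact Real.cos_lt_cos_of_nonneg_of_le_pi (by linarith) (by linarith) (by linarith)

theorem circ_add_two_pi (t : ℝ) : circ (t + 2 * Real.pi) = circ t := by
  simp [circ]

theorem side_neg_left {α β t : ℝ} (h0 : α < β) (h1 : t < α) (h2 : β - 2 * Real.pi < t) :
    side α β (circ t) < 0 := by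
  rw [← circ_add_two_pi]
  exact side_neg_right h0 (by linarith) (by linarith)

theorem norm_circ (t : ℝ) : ‖circ t‖ = 1 := by
  have : ‖circ t‖ ^ 2 = 1 := by
    rw [Complex.sq_norm, Complex.normSq_apply, circ]
    nlinarith [Real.cos_sq_add_sin_sq t]
  nlinarith [norm_nonneg (circ t)]

/-- In coordinates turned towards the middle `m` of the arc, the line `side = 0` has normal
coordinate `cos h`, and the disk leaves only the values `|y| ≤ sin h` of the coordinate along it.
These are the points of the chord. -/
theorem mem_segment_of_side_eq_zero {α β : ℝ} (h0 : α < β) (h1 : β < α + 2 * Real.pi) {z : ℂ}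
    (hz : ‖z‖ ≤ 1) (hs : side α β z = 0) : z ∈ segment ℝ (circ α) (circ β) := by
  set m := (α + β) / 2 with hm
  set h := (β - α) / 2 with hh
  have hα : α = m - h := by rw [hm, hh]; ring
  have hβ : β = m + h := by rw [hm, hh]; ring
  have hsin : 0 < Real.sin h := Real.sin_pos_of_pos_of_lt_pi (by linarith) (by linarith)
  have hn : z.re ^ 2 + z.im ^ 2 ≤ 1 := by
    have := Complex.sq_norm z
    rw [Complex.normSq_apply] at this
    nlinarith [norm_nonneg z]
  set y := z.re * Real.sin m + z.im * Real.cos m with hy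
  have hc : z.re * Real.cos m - z.im * Real.sin m = Real.cos h := by
    rw [side, ← hm, ← hh] at hs
    linarith
  have e1 := Real.sin_sq_add_cos_sq m
  have e2 := Real.sin_sq_add_cos_sq h
  have hre : z.re = Real.cos m * Real.cos h + Real.sin m * y := by
    rw [hy, ← hc]
    linear_combination (-z.re) * e1
  have him : z.im = -(Real.sin m * Real.cos h) + Real.cos m * y := by
    rw [hy, ← hc]
    linear_combination (-z.im) * e1
  have hyy : y ^ 2 ≤ Real.sin h ^ 2 := by
    have : y ^ 2 + Real.cos h ^ 2 = z.re ^ 2 + z.im ^ 2 := by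
      rw [hre, him]
      linear_combination (-(y ^ 2 + Real.cos h ^ 2)) * e1
    nlinarith
  have hyl := abs_le_of_sq_le_sq' hyy hsin.le
  refine ⟨(1 + y / Real.sin h) / 2, (1 - y / Real.sin h) / 2, ?_, ?_, by ring, ?_⟩
  · have : -1 ≤ y / Real.sin h := by rw [le_div_iff₀ hsin]; linarith
    linarith
  · have : y / Real.sin h ≤ 1 := by rw [div_le_iff₀ hsin]; linarith
    linarith
  · apply Complex.ext
    · simp only [circ, Complex.add_re, Complex.real_smul, Complex.re_ofReal_mul]
      rw [hre, hα, hβ, Real.cos_sub, Real.cos_add]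
      field_simp
      ring
    · simp only [circ, Complex.add_im, Complex.real_smul, Complex.im_ofReal_mul]
      rw [him, hα, hβ, Real.sin_sub, Real.sin_add]
      field_simp
      ring

/-- A convex subset of the disk with points on both sides of a chord meets the chord in its
relative interior. -/
theorem intrinsicInterior_inter_segment_nonempty {α β : ℝ} (h0 : α < β)
    (h1 : β < α + 2 * Real.pi) {K : Set ℂ} (hK : Convex ℝ K) (hd : ∀ z ∈ K, ‖z‖ ≤ 1) {p q : ℂ}
    (hp : p ∈ K) (hq : q ∈ K) (hps : 0 < side α β p) (hqs : side α β q < 0) :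
    (intrinsicInterior ℝ K ∩ segment ℝ (circ α) (circ β)).Nonempty := by
  -- From `z` one moves towards the one of `p`, `q` on the other side of the chord. The line of the
  -- chord is met strictly before the end of the way, hence still in the relative interior; `t` is
  -- the zero of the affine function `(1 - t) a + t b`.
  obtain ⟨z, hz⟩ := Set.Nonempty.intrinsicInterior hK ⟨p, hp⟩
  have key : ∀ r ∈ K, side α β z * side α β r < 0 →
      (intrinsicInterior ℝ K ∩ segment ℝ (circ α) (circ β)).Nonempty := by
    intro r hr hlt
    set a := side α β z
    set b := side α β r
    have hab : a - b ≠ 0 := by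
      intro h
      have : a = b := by linarith
      rw [this] at hlt
      nlinarith [mul_self_nonneg b]
    set t := a / (a - b) with ht
    have h2 : 0 < (a - b) ^ 2 := by positivity
    have ht0 : 0 ≤ t := by
      have : t = (a * (a - b)) / (a - b) ^ 2 := by rw [ht]; field_simp
      rw [this]
      apply div_nonneg _ h2.le
      nlinarith [mul_self_nonneg a]
    have ht1 : t < 1 := by
      have : 1 - t = (-b * (a - b)) / (a - b) ^ 2 := by rw [ht]; field_simp; ring
      have hb : b ≠ 0 := by rintro hb; rw [hb] at hlt; simp at hlt
      have : 0 < 1 - t := by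
        rw [this]
        apply div_pos _ h2
        have : 0 < b * b := mul_self_pos.2 hb
        nlinarith
      linarith
    have hmem := combo_mem_intrinsicInterior hK hz hr ht0 ht1
    refine ⟨_, hmem, mem_segment_of_side_eq_zero h0 h1 (hd _ (intrinsicInterior_subset hmem)) ?_⟩
    rw [side_combo _ _ _ _ (by ring)]
    change (1 - t) * a + t * b = 0
    rw [ht]
    field_simp
    ring
  rcases lt_trichotomy (side α β z) 0 with h | h | h
  · exact key p hp (mul_neg_of_neg_of_pos h hps)
  · exact ⟨z, hz, mem_segment_of_side_eq_zero h0 h1 (hd z (intrinsicInterior_subset hz)) h⟩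
  · exact key q hq (mul_neg_of_pos_of_neg h hqs)


/-! ### Hulls of vertices of a regular polygon -/

/-- Two sets of integers alternate. -/
def AltZ (S T : Finset ℤ) : Prop :=
  ∃ s₁ ∈ S, ∃ t₁ ∈ T, ∃ s₂ ∈ S, ∃ t₂ ∈ T,
    (s₁ < t₁ ∧ t₁ < s₂ ∧ s₂ < t₂) ∨ (t₁ < s₁ ∧ s₁ < t₂ ∧ t₂ < s₂)

/-- If no point of `T` lies between the extreme points of `S`, the range of `S` is avoided by `T`.
Otherwise such a point, a point of `S` inside the range of `T` and suitable extreme points would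
alternate, so `S` avoids the range of `T`. -/
theorem exists_gap {S T : Finset ℤ} (hS : S.Nonempty) (hT : T.Nonempty) (hd : Disjoint S T)
    (h : ¬ AltZ S T) :
    (∃ x y, (∀ s ∈ S, x ≤ s ∧ s ≤ y) ∧ ∀ t ∈ T, t < x ∨ y < t) ∨
    (∃ x y, (∀ t ∈ T, x ≤ t ∧ t ≤ y) ∧ ∀ s ∈ S, s < x ∨ y < s) := by
  have hne : ∀ s ∈ S, ∀ t ∈ T, s ≠ t := fun s hs t ht e =>
    (Finset.disjoint_left.1 hd hs) (e ▸ ht)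
  by_cases hin : ∃ t ∈ T, S.min' hS < t ∧ t < S.max' hS
  · right
    obtain ⟨t, ht, h1, h2⟩ := hin
    refine ⟨T.min' hT, T.max' hT,
      fun u hu => ⟨T.min'_le u hu, T.le_max' u hu⟩, fun s hs => ?_⟩
    by_contra hcon
    push Not at hcon
    obtain ⟨h3, h4⟩ := hcon
    have h3' := lt_of_le_of_ne h3 (hne s hs _ (T.min'_mem hT)).symm
    have h4' := lt_of_le_of_ne h4 (hne s hs _ (T.max'_mem hT))
    rcases lt_trichotomy s t with hst | hst | hst
    · exact h ⟨s, hs, T.min' hT, T.min'_mem hT, S.max' hS, S.max'_mem hS, t, ht,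
        Or.inr ⟨h3', hst, h2⟩⟩
    · exact hne s hs t ht hst
    · exact h ⟨S.min' hS, S.min'_mem hS, t, ht, s, hs, T.max' hT, T.max'_mem hT,
        Or.inl ⟨h1, hst, h4'⟩⟩
  · left
    push Not at hin
    refine ⟨S.min' hS, S.max' hS,
      fun u hu => ⟨S.min'_le u hu, S.le_max' u hu⟩, fun t ht => ?_⟩
    by_contra hcon
    push Not at hcon
    have h3 := lt_of_le_of_ne hcon.1 (hne _ (S.min'_mem hS) t ht)
    exact absurd (hin t ht h3) (not_le.2 (lt_of_le_of_ne hcon.2 (hne _ (S.max'_mem hS) t ht).symm))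

theorem vertex_eq_circ (N k : ℤ) : vertex N k = circ (2 * Real.pi * k / N) := by
  have : (-(2 * (Real.pi : ℂ) * k / N) * Complex.I) = ((-(2 * Real.pi * k / N) : ℝ) : ℂ) * Complex.I := by
    push_cast; ring
  rw [vertex, this, Complex.exp_mul_I, ← Complex.ofReal_cos, ← Complex.ofReal_sin, circ]
  apply Complex.ext <;>
    simp only [Complex.add_re, Complex.add_im, Complex.mul_re, Complex.mul_im, Complex.ofReal_re,
      Complex.ofReal_im, Complex.I_re, Complex.I_im, Real.cos_neg, Real.sin_neg] <;> ring

section polygon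

variable {N : ℤ}

theorem angle_lt (hN : 0 < N) {x y : ℝ} (h : x < y) :
    2 * Real.pi * x / N < 2 * Real.pi * y / N := by
  have : (0 : ℝ) < N := by exact_mod_cast hN
  have := Real.pi_pos
  gcongr

theorem angle_add (hN : 0 < N) (x : ℝ) :
    2 * Real.pi * (x + N) / N = 2 * Real.pi * x / N + 2 * Real.pi := by
  have : (0 : ℝ) < N := by exact_mod_cast hN
  field_simp

/-- The function `side` for the chord between the angles of index `x` and `y`. -/
noncomputable def sideN (N : ℤ) (x y : ℝ) (z : ℂ) : ℝ :=
  side (2 * Real.pi * x / N) (2 * Real.pi * y / N) z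

theorem sideN_pos (hN : 0 < N) {x y : ℝ} {k : ℤ} (h1 : x < k) (h2 : k < y) (h3 : y < x + N) :
    0 < sideN N x y (vertex N k) := by
  rw [vertex_eq_circ]
  apply side_pos (angle_lt hN h1) (angle_lt hN h2)
  have := angle_lt hN h3
  rw [angle_add hN] at this
  linarith

theorem sideN_neg_right (hN : 0 < N) {x y : ℝ} {k : ℤ} (h0 : x < y) (h1 : y < k) (h2 : k < x + N) :
    sideN N x y (vertex N k) < 0 := by
  rw [vertex_eq_circ]
  apply side_neg_right (angle_lt hN h0) (angle_lt hN h1)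
  rw [← angle_add hN]
  exact angle_lt hN h2

theorem sideN_neg_left (hN : 0 < N) {x y : ℝ} {k : ℤ} (h0 : x < y) (h1 : k < x) (h2 : y < k + N) :
    sideN N x y (vertex N k) < 0 := by
  rw [vertex_eq_circ]
  apply side_neg_left (angle_lt hN h0) (angle_lt hN h1)
  have := angle_lt hN h2
  rw [angle_add hN] at this
  linarith

/-- The bounds on `x` and `y` leave room for chords whose ends lie half a step outside the vertices,
where `x` may be `-1/2`. -/
theorem sideN_neg (hN : 0 < N) {x y : ℝ} {k : ℤ} (h0 : x < y) (hk0 : 0 ≤ k) (hk : k < N)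
    (hx : -1 < x) (hx' : y < N) (h : k < x ∨ y < k) : sideN N x y (vertex N k) < 0 := by
  have hk0' : (0 : ℝ) ≤ k := by exact_mod_cast hk0
  have hk' : (k : ℝ) + 1 ≤ N := by exact_mod_cast hk
  rcases h with h | h
  · exact sideN_neg_left hN h0 h (by linarith)
  · exact sideN_neg_right hN h0 h (by linarith)

theorem convex_sideN_pos (x y : ℝ) : Convex ℝ {z | 0 < sideN N x y z} := by
  intro z hz w hw a b ha hb hab
  simp only [Set.mem_ofPred_eq, sideN] at hz hw ⊢
  rw [side_combo _ _ _ _ hab]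
  rcases ha.eq_or_lt with rfl | ha'
  · have : b = 1 := by linarith
    subst this; simpa using hw
  · nlinarith [mul_pos ha' hz, mul_nonneg hb hw.le]

theorem convex_sideN_neg (x y : ℝ) : Convex ℝ {z | sideN N x y z < 0} := by
  intro z hz w hw a b ha hb hab
  simp only [Set.mem_ofPred_eq, sideN] at hz hw ⊢
  rw [side_combo _ _ _ _ hab]
  rcases ha.eq_or_lt with rfl | ha'
  · have : b = 1 := by linarith
    subst this; simpa using hw
  · nlinarith [mul_neg_of_pos_of_neg ha' hz, mul_nonneg hb (neg_nonneg.2 hw.le)]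

theorem convex_sideN_nonpos (x y : ℝ) : Convex ℝ {z | sideN N x y z ≤ 0} := by
  intro z hz w hw a b ha hb hab
  simp only [Set.mem_ofPred_eq, sideN] at hz hw ⊢
  rw [side_combo _ _ _ _ hab]
  nlinarith [mul_nonneg ha (neg_nonneg.2 hz), mul_nonneg hb (neg_nonneg.2 hw)]

/-- The chord whose ends lie half a step outside the range of `S` strictly separates the two hulls.
-/
theorem disjoint_hull_of_gap (hN : 0 < N) {S T : Finset ℤ} (hS : ∀ s ∈ S, 0 ≤ s ∧ s < N)
    (hT : ∀ t ∈ T, 0 ≤ t ∧ t < N) {x y : ℤ} (hxS : ∀ s ∈ S, x ≤ s ∧ s ≤ y)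
    (hyT : ∀ t ∈ T, t < x ∨ y < t) (hSn : S.Nonempty) (hTn : T.Nonempty) :
    Disjoint (convexHull ℝ (vertex N '' S)) (convexHull ℝ (vertex N '' T)) := by
  obtain ⟨x', hx', y', hy', h0, h1, h2, h3⟩ : ∃ x' ∈ S, ∃ y' ∈ S, 0 ≤ x' ∧ x' ≤ y' ∧ y' < N ∧
      (∀ s ∈ S, x' ≤ s ∧ s ≤ y') :=
    ⟨S.min' hSn, S.min'_mem hSn, S.max' hSn, S.max'_mem hSn, (hS _ (S.min'_mem hSn)).1,
      S.min'_le_max' hSn, (hS _ (S.max'_mem hSn)).2, fun s hs => ⟨S.min'_le s hs, S.le_max' s hs⟩⟩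
  have hyT' : ∀ t ∈ T, t < x' ∨ y' < t := fun t ht => by
    have := hyT t ht; have := hxS x' hx'; have := hxS y' hy'; omega
  -- Since `T` has a vertex outside the range of `S`, the arc stays shorter than the circle even
  -- after being widened by half a step at both ends.
  have hlen : y' + 1 < x' + N := by
    obtain ⟨t, ht⟩ := hTn
    have := hyT' t ht; have := hT t ht; omega
  have h1' : (x' : ℝ) ≤ y' := by exact_mod_cast h1
  have h0' : (0 : ℝ) ≤ x' := by exact_mod_cast h0
  have h2' : (y' : ℝ) + 1 ≤ N := by exact_mod_cast h2
  have hlen' : (y' : ℝ) + 1 < x' + N := by exact_mod_cast hlen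
  have hA : convexHull ℝ (vertex N '' S) ⊆ {z | 0 < sideN N (x' - 1 / 2) (y' + 1 / 2) z} := by
    apply convexHull_min _ (convex_sideN_pos _ _)
    rintro _ ⟨s, hs, rfl⟩
    have a1 : (x' : ℝ) ≤ s := by exact_mod_cast (h3 s hs).1
    have a2 : (s : ℝ) ≤ y' := by exact_mod_cast (h3 s hs).2
    exact sideN_pos hN (by linarith) (by linarith) (by linarith)
  have hB : convexHull ℝ (vertex N '' T) ⊆ {z | sideN N (x' - 1 / 2) (y' + 1 / 2) z < 0} := by
    apply convexHull_min _ (convex_sideN_neg _ _)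
    rintro _ ⟨t, ht, rfl⟩
    apply sideN_neg hN (by linarith) (hT t ht).1 (hT t ht).2 (by linarith) (by linarith)
    rcases hyT' t ht with h | h
    · left
      have : (t : ℝ) + 1 ≤ x' := by exact_mod_cast h
      linarith
    · right
      have : (y' : ℝ) + 1 ≤ t := by exact_mod_cast h
      linarith
  rw [Set.disjoint_left]
  intro z hz hz'
  have h5 := hA hz
  have h6 := hB hz'
  rw [Set.mem_ofPred_eq] at h5 h6
  exact lt_asymm h5 h6

/-- Hulls of disjoint nonalternating sets of vertices are disjoint. -/
theorem disjoint_hull (hN : 0 < N) {S T : Finset ℤ} (hS : ∀ s ∈ S, 0 ≤ s ∧ s < N)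
    (hT : ∀ t ∈ T, 0 ≤ t ∧ t < N) (hd : Disjoint S T) (h : ¬ AltZ S T) :
    Disjoint (convexHull ℝ (vertex N '' S)) (convexHull ℝ (vertex N '' T)) := by
  rcases S.eq_empty_or_nonempty with rfl | hSn
  · simp
  rcases T.eq_empty_or_nonempty with rfl | hTn
  · simp
  rcases exists_gap hSn hTn hd h with ⟨x, y, h2, h3⟩ | ⟨x, y, h2, h3⟩
  · exact disjoint_hull_of_gap hN hS hT h2 h3 hSn hTn
  · exact (disjoint_hull_of_gap hN hT hS h2 h3 hTn hSn).symm

theorem norm_vertex (N k : ℤ) : ‖vertex N k‖ = 1 := by rw [vertex_eq_circ, norm_circ]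

/-- A convex subset of the disk with points on both sides of the chord between two vertices meets
the chord in its relative interior. -/
theorem chord_inter (hN : 0 < N) {K : Set ℂ} (hK : Convex ℝ K) (hd : ∀ z ∈ K, ‖z‖ ≤ 1)
    {c₁ c₂ : ℤ} (h0 : 0 ≤ c₁) (h1 : c₁ < c₂) (h2 : c₂ < N) {p q : ℂ} (hp : p ∈ K) (hq : q ∈ K)
    (hps : 0 < sideN N c₁ c₂ p) (hqs : sideN N c₁ c₂ q < 0) :
    (intrinsicInterior ℝ K ∩ segment ℝ (vertex N c₁) (vertex N c₂)).Nonempty := by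
  rw [vertex_eq_circ, vertex_eq_circ]
  refine intrinsicInterior_inter_segment_nonempty (angle_lt hN (by exact_mod_cast h1)) ?_ hK hd hp hq
    hps hqs
  rw [← angle_add hN]
  have : c₂ < c₁ + N := by omega
  exact angle_lt hN (by exact_mod_cast this)

theorem side_pos_of_between (hN : 0 < N) {c₁ c₂ k : ℤ} (h0 : 0 ≤ c₁) (h1 : c₁ < k) (h2 : k < c₂)
    (h3 : c₂ < N) : 0 < sideN N c₁ c₂ (vertex N k) := by
  have : c₂ < c₁ + N := by omega
  exact sideN_pos hN (by exact_mod_cast h1) (by exact_mod_cast h2) (by exact_mod_cast this)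

theorem side_neg_of_outside (hN : 0 < N) {c₁ c₂ k : ℤ} (h0 : 0 ≤ c₁) (h1 : c₁ < c₂) (h2 : c₂ < N)
    (hk0 : 0 ≤ k) (hk : k < N) (h : k < c₁ ∨ c₂ < k) : sideN N c₁ c₂ (vertex N k) < 0 := by
  have : (0 : ℝ) ≤ c₁ := by exact_mod_cast h0
  exact sideN_neg hN (by exact_mod_cast h1) hk0 hk (by linarith) (by exact_mod_cast h2)
    (by exact_mod_cast h)

theorem vertex_add_half (hN : 0 < N) (M k : ℤ) (h : N = 2 * M) :
    vertex N (k + M) = - vertex N k := by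
  have hM : (M : ℝ) ≠ 0 := by
    have : (M : ℤ) ≠ 0 := by omega
    exact_mod_cast this
  have e : 2 * Real.pi * ((k + M : ℤ) : ℝ) / N = 2 * Real.pi * k / N + Real.pi := by
    rw [h]; push_cast; field_simp
  rw [vertex_eq_circ, vertex_eq_circ, e, circ, circ, Real.cos_add_pi, Real.sin_add_pi]
  apply Complex.ext <;> simp

/-- A hull of vertices and the centroid contains no other vertex. -/
theorem mem_of_vertex_mem_hull (hN : 2 ≤ N) {S : Finset ℤ} (hS : ∀ s ∈ S, 0 ≤ s ∧ s < N) {k : ℤ}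
    (hk0 : 0 ≤ k) (hk : k < N) (h : vertex N k ∈ convexHull ℝ (insert 0 (vertex N '' S))) :
    k ∈ S := by
  by_contra hkS
  have hN0 : 0 < N := by omega
  have hk0' : (0 : ℝ) ≤ k := by exact_mod_cast hk0
  have hk' : (k : ℝ) + 1 ≤ N := by exact_mod_cast hk
  have hN' : (2 : ℝ) ≤ N := by exact_mod_cast hN
  -- The chord from half a step before `k` to half a step after `k` cuts off the vertex `k` alone.
  -- The centroid is not on the side of `k` because `π / N ≤ π / 2`.
  have hsub : convexHull ℝ (insert 0 (vertex N '' S)) ⊆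
      {z | sideN N (k - 1 / 2) (k + 1 / 2) z ≤ 0} := by
    apply convexHull_min _ (convex_sideN_nonpos _ _)
    rintro _ (rfl | ⟨s, hs, rfl⟩)
    · simp only [Set.mem_ofPred_eq, sideN, side, Complex.zero_re, Complex.zero_im, zero_mul, zero_sub,
        neg_zero, Left.neg_nonpos_iff]
      have e : (2 * Real.pi * (k + 1 / 2) / N - 2 * Real.pi * (k - 1 / 2) / N) / 2
          = Real.pi / N := by field_simp; ring
      rw [e]
      have : Real.pi / N ≤ Real.pi / 2 := by
        have := Real.pi_pos
        gcongr
      exact Real.cos_nonneg_of_neg_pi_div_two_le_of_le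
        (by have : 0 ≤ Real.pi / N := by positivity
            linarith [Real.pi_pos]) this
    · rw [Set.mem_ofPred_eq]
      apply le_of_lt
      apply sideN_neg hN0 (by linarith) (hS s hs).1 (hS s hs).2 (by linarith) (by linarith)
      rcases lt_or_gt_of_ne (fun e => hkS (e ▸ hs) : s ≠ k) with h | h
      · left
        have : (s : ℝ) + 1 ≤ k := by exact_mod_cast h
        linarith
      · right
        have : (k : ℝ) + 1 ≤ s := by exact_mod_cast h
        linarith
  have := hsub h
  rw [Set.mem_ofPred_eq] at this
  exact absurd (sideN_pos hN0 (k := k) (x := k - 1 / 2) (y := k + 1 / 2) (by linarith)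
    (by linarith) (by linarith)) (not_lt.2 this)

end polygon


/-! ### Noncrossing partitions and the cyclic order -/

theorem mem_ground {n : ℕ} {a : ℤ} : a ∈ ground n ↔ a ≠ 0 ∧ -(n : ℤ) ≤ a ∧ a ≤ n := by
  simp [ground]

theorem mem_neg {B : Finset ℤ} {a : ℤ} : a ∈ neg B ↔ -a ∈ B := by
  simp only [neg, Finset.mem_image]
  exact ⟨fun ⟨x, hx, h⟩ => by rw [← h, neg_neg]; exact hx, fun h => ⟨-a, h, neg_neg a⟩⟩

@[simp] theorem neg_neg_block (B : Finset ℤ) : neg (neg B) = B := by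
  ext a; simp [mem_neg]

theorem neg_injective : Function.Injective neg := fun B C h => by
  rw [← neg_neg_block B, h, neg_neg_block]

/-- The position of a label in the clockwise order `1, …, n, -1, …, -n`. -/
def key (n : ℕ) (a : ℤ) : ℤ := if 0 < a then a else n - a

/-- The sets `B` and `C` of labels alternate in the clockwise order. -/
def Alt (n : ℕ) (B C : Finset ℤ) : Prop :=
  ∃ b₁ ∈ B, ∃ c₁ ∈ C, ∃ b₂ ∈ B, ∃ c₂ ∈ C,
    (key n b₁ < key n c₁ ∧ key n c₁ < key n b₂ ∧ key n b₂ < key n c₂) ∨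
    (key n c₁ < key n b₁ ∧ key n b₁ < key n c₂ ∧ key n c₂ < key n b₂)

theorem Alt.symm {n : ℕ} {B C : Finset ℤ} (h : Alt n B C) : Alt n C B := by
  obtain ⟨s₁, h1, t₁, h2, s₂, h3, t₂, h4, h⟩ := h
  exact ⟨t₁, h2, s₁, h1, t₂, h4, s₂, h3, h.symm⟩

theorem Alt.mono {n : ℕ} {B C B' C' : Finset ℤ} (h : Alt n B C) (hB : B ⊆ B') (hC : C ⊆ C') :
    Alt n B' C' := by
  obtain ⟨s₁, h1, t₁, h2, s₂, h3, t₂, h4, h⟩ := h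
  exact ⟨s₁, hB h1, t₁, hC h2, s₂, hB h3, t₂, hC h4, h⟩

/-- Alternation depends only on the order of the positions; so the indices in the `2n`-gon and in
the `(2n-2)`-gon can both be compared with `key`. -/
theorem altZ_image_iff {n : ℕ} {B C : Finset ℤ} (k : ℤ → ℤ)
    (hk : ∀ a ∈ B ∪ C, ∀ b ∈ B ∪ C, k a < k b ↔ key n a < key n b) :
    AltZ (B.image k) (C.image k) ↔ Alt n B C := by
  simp only [AltZ, Alt, Finset.exists_mem_image]
  have hB : ∀ b ∈ B, b ∈ B ∪ C := fun b hb => Finset.mem_union_left _ hb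
  have hC : ∀ b ∈ C, b ∈ B ∪ C := fun b hb => Finset.mem_union_right _ hb
  constructor
  · rintro ⟨s₁, h1, t₁, h2, s₂, h3, t₂, h4, h⟩
    refine ⟨s₁, h1, t₁, h2, s₂, h3, t₂, h4, ?_⟩
    rwa [hk _ (hB _ h1) _ (hC _ h2), hk _ (hC _ h2) _ (hB _ h3), hk _ (hB _ h3) _ (hC _ h4),
      hk _ (hC _ h2) _ (hB _ h1), hk _ (hB _ h1) _ (hC _ h4), hk _ (hC _ h4) _ (hB _ h3)] at h
  · rintro ⟨s₁, h1, t₁, h2, s₂, h3, t₂, h4, h⟩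
    refine ⟨s₁, h1, t₁, h2, s₂, h3, t₂, h4, ?_⟩
    rwa [hk _ (hB _ h1) _ (hC _ h2), hk _ (hC _ h2) _ (hB _ h3), hk _ (hB _ h3) _ (hC _ h4),
      hk _ (hC _ h2) _ (hB _ h1), hk _ (hB _ h1) _ (hC _ h4), hk _ (hC _ h4) _ (hB _ h3)]

theorem disjoint_image_of_key {B C : Finset ℤ} (k : ℤ → ℤ)
    (hk : ∀ a ∈ B ∪ C, ∀ b ∈ B ∪ C, k a = k b → a = b) (hd : Disjoint B C) :
    Disjoint (B.image k) (C.image k) := by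
  rw [Finset.disjoint_left]
  intro x hx hx'
  rw [Finset.mem_image] at hx hx'
  obtain ⟨b, hb, rfl⟩ := hx
  obtain ⟨c, hc, h⟩ := hx'
  have := hk c (Finset.mem_union_right _ hc) b (Finset.mem_union_left _ hb) h
  exact Finset.disjoint_left.1 hd hb (this ▸ hc)

theorem pointB_eq (n : ℕ) (a : ℤ) : pointB n a = vertex (2 * n) (key n a - 1) := by
  unfold pointB key
  split_ifs
  · rfl
  · congr 1; ring

theorem hullB_eq (n : ℕ) (B : Finset ℤ) :
    hullB n B = convexHull ℝ (vertex ((2 * n : ℕ) : ℤ) '' (B.image (fun a => key n a - 1) : Finset ℤ)) := by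
  rw [hullB, Finset.coe_image, Set.image_image]
  congr 2
  ext a
  simp [pointB_eq]

theorem key_bounds {n : ℕ} {a : ℤ} (h : a ∈ ground n) :
    0 ≤ key n a - 1 ∧ key n a - 1 < ((2 * n : ℕ) : ℤ) := by
  rw [mem_ground] at h
  unfold key
  split_ifs <;> push_cast <;> omega

theorem key_inj {n : ℕ} {a b : ℤ} (ha : a ∈ ground n) (hb : b ∈ ground n) (h : key n a = key n b) :
    a = b := by
  rw [mem_ground] at ha hb
  unfold key at h
  split_ifs at h <;> omega

/-- If the blocks alternate, a chord of one of them separates two points of the other, whose hull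
therefore meets the chord. If they do not, one of them sits in a gap of the other. -/
theorem disjoint_hullB_iff {n : ℕ} (hn : 1 ≤ n) {B C : Finset ℤ} (hB : B ⊆ ground n)
    (hC : C ⊆ ground n) (hd : Disjoint B C) :
    Disjoint (hullB n B) (hullB n C) ↔ ¬ Alt n B C := by
  have hBC : B ∪ C ⊆ ground n := Finset.union_subset hB hC
  have hN : (0 : ℤ) < ((2 * n : ℕ) : ℤ) := by push_cast; omega
  constructor
  · rintro hdis halt
    have main : ∀ B C : Finset ℤ, B ⊆ ground n → C ⊆ ground n → ∀ b₁ ∈ B, ∀ c₁ ∈ C, ∀ b₂ ∈ B,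
        ∀ c₂ ∈ C, (key n b₁ < key n c₁ ∧ key n c₁ < key n b₂ ∧ key n b₂ < key n c₂) →
        (hullB n B ∩ hullB n C).Nonempty := by
      rintro B C hB hC b₁ hb₁ c₁ hc₁ b₂ hb₂ c₂ hc₂ ⟨h1, h2, h3⟩
      have k1 := key_bounds (hC hc₁)
      have k2 := key_bounds (hC hc₂)
      have k3 := key_bounds (hB hb₁)
      have k4 := key_bounds (hB hb₂)
      have hmem : ∀ {B : Finset ℤ} {b}, b ∈ B →
          vertex ((2 * n : ℕ) : ℤ) (key n b - 1) ∈ hullB n B := by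
        intro B b hb
        rw [hullB_eq]
        apply subset_convexHull
        exact ⟨_, Finset.mem_coe.2 (Finset.mem_image_of_mem _ hb), rfl⟩
      have hdisk : ∀ z ∈ hullB n B, ‖z‖ ≤ 1 := by
        intro z hz
        rw [hullB_eq] at hz
        have := convexHull_min (t := Metric.closedBall (0 : ℂ) 1) (by
          rintro _ ⟨x, -, rfl⟩
          simp [norm_vertex]) (convex_closedBall _ _) hz
        simpa using this
      obtain ⟨z, hz1, hz2⟩ := chord_inter hN (K := hullB n B) (convex_convexHull _ _) hdisk k1.1
        (c₂ := key n c₂ - 1) (by omega) k2.2 (hmem hb₂) (hmem hb₁)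
        (side_pos_of_between hN k1.1 (by omega) (by omega) k2.2)
        (side_neg_of_outside hN k1.1 (by omega) k2.2 k3.1 k3.2 (by omega))
      exact ⟨z, intrinsicInterior_subset hz1,
        (convex_convexHull ℝ _).segment_subset (hmem hc₁) (hmem hc₂) hz2⟩
    rw [Set.disjoint_iff_inter_eq_empty] at hdis
    obtain ⟨b₁, hb₁, c₁, hc₁, b₂, hb₂, c₂, hc₂, h | h⟩ := halt
    · have := main B C hB hC b₁ hb₁ c₁ hc₁ b₂ hb₂ c₂ hc₂ h
      rw [hdis] at this
      exact Set.not_nonempty_empty this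
    · have := main C B hC hB c₁ hc₁ b₁ hb₁ c₂ hc₂ b₂ hb₂ h
      rw [Set.inter_comm, hdis] at this
      exact Set.not_nonempty_empty this
  · intro h
    rw [hullB_eq, hullB_eq]
    have hb : ∀ B : Finset ℤ, B ⊆ ground n → ∀ s ∈ B.image (fun a => key n a - 1),
        0 ≤ s ∧ s < ((2 * n : ℕ) : ℤ) := by
      intro B hB s hs
      rw [Finset.mem_image] at hs
      obtain ⟨a, ha, rfl⟩ := hs
      exact key_bounds (hB ha)
    apply disjoint_hull hN (hb B hB) (hb C hC)
    · exact disjoint_image_of_key _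
        (fun a ha b hb h => key_inj (hBC ha) (hBC hb) (by simpa using h)) hd
    · rwa [altZ_image_iff (n := n) _ (fun a _ b _ => by simp)]

theorem IsBPartition.subset_ground {n : ℕ} {P : Finset (Finset ℤ)} (hP : IsBPartition n P)
    {B : Finset ℤ} (hB : B ∈ P) : B ⊆ ground n := by
  rw [← hP.cover]
  exact Finset.subset_biUnion_of_mem id hB

theorem mem_NCB_iff {n : ℕ} (hn : 1 ≤ n) {P : Finset (Finset ℤ)} :
    P ∈ NCB n ↔ IsBPartition n P ∧ ∀ B ∈ P, ∀ C ∈ P, B ≠ C → ¬ Alt n B C := by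
  rw [NCB, Set.mem_ofPred_eq]
  refine and_congr_right fun hP => ?_
  refine forall₂_congr fun B hB => forall₂_congr fun C hC => forall_congr' fun hne => ?_
  exact disjoint_hullB_iff hn (hP.subset_ground hB) (hP.subset_ground hC) (hP.disjoint B hB C hC hne)

/-! ### Blocks in the `(2n-2)`-gon with its centroid -/

/-- `B` without `1` and `-1`. -/
def strip (B : Finset ℤ) : Finset ℤ := (B.erase 1).erase (-1)

theorem mem_strip {B : Finset ℤ} {a : ℤ} : a ∈ strip B ↔ a ≠ -1 ∧ a ≠ 1 ∧ a ∈ B := by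
  simp [strip]

theorem strip_eq_self {B : Finset ℤ} (h : 1 ∉ B) (h' : -1 ∉ B) : strip B = B := by
  rw [strip, Finset.erase_eq_of_notMem h, Finset.erase_eq_of_notMem h']

/-- The index of the vertex labeled `a` in the `(2n-2)`-gon. -/
def keyD (n : ℕ) (a : ℤ) : ℤ := if 0 < a then a - 2 else (n - 1) + (-a - 2)

theorem pointD_eq (n : ℕ) {a : ℤ} (h1 : a ≠ 1) (h2 : a ≠ -1) :
    pointD n a = vertex (2 * n - 2) (keyD n a) := by
  unfold pointD keyD
  rw [if_neg (by tauto)]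
  split_ifs <;> rfl

theorem pointD_one (n : ℕ) : pointD n 1 = 0 := by simp [pointD]

theorem pointD_neg_one (n : ℕ) : pointD n (-1) = 0 := by simp [pointD]

theorem keyD_bounds {n : ℕ} {a : ℤ} (h : a ∈ ground n) (h1 : a ≠ 1) (h2 : a ≠ -1) :
    0 ≤ keyD n a ∧ keyD n a < 2 * n - 2 := by
  rw [mem_ground] at h
  unfold keyD
  split_ifs <;> omega

theorem keyD_lt_iff {n : ℕ} {a b : ℤ} (ha : a ∈ ground n) (ha1 : a ≠ 1) (ha2 : a ≠ -1)
    (hb : b ∈ ground n) (hb1 : b ≠ 1) (hb2 : b ≠ -1) :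
    keyD n a < keyD n b ↔ key n a < key n b := by
  rw [mem_ground] at ha hb
  unfold keyD key
  split_ifs <;> omega

theorem keyD_inj {n : ℕ} {a b : ℤ} (ha : a ∈ ground n) (ha1 : a ≠ 1) (ha2 : a ≠ -1)
    (hb : b ∈ ground n) (hb1 : b ≠ 1) (hb2 : b ≠ -1) (h : keyD n a = keyD n b) : a = b := by
  rw [mem_ground] at ha hb
  unfold keyD at h
  split_ifs at h <;> omega

theorem keyD_neg {n : ℕ} {a : ℤ} (h : 0 < a) : keyD n (-a) = keyD n a + (n - 1) := by
  unfold keyD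
  rw [if_pos h, if_neg (by omega)]
  ring

section typeD

variable {n : ℕ}

theorem pointD_neg (hn : 2 ≤ n) {a : ℤ} (ha : a ∈ ground n) : pointD n (-a) = - pointD n a := by
  have key : ∀ b : ℤ, 0 < b → b ≠ 1 → pointD n (-b) = - pointD n b := by
    intro b hb hb1
    rw [pointD_eq n hb1 (by omega), pointD_eq n (by omega) (by omega), keyD_neg hb]
    exact vertex_add_half (by omega) _ _ (by ring)
  by_cases h1 : a = 1
  · subst h1; rw [pointD_one, pointD_neg_one, neg_zero]
  by_cases h2 : a = -1
  · subst h2; rw [neg_neg, pointD_one, pointD_neg_one, neg_zero]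
  rw [mem_ground] at ha
  rcases lt_or_gt_of_ne ha.1 with h | h
  · have := key (-a) (by omega) (by omega)
    rw [neg_neg] at this
    rw [this, neg_neg]
  · exact key a h h1

theorem mem_hullD {B : Finset ℤ} {a : ℤ} (ha : a ∈ B) : pointD n a ∈ hullD n B :=
  subset_convexHull _ _ ⟨a, ha, rfl⟩

theorem vertex_mem_hullD {B : Finset ℤ} {a : ℤ} (ha : a ∈ strip B) :
    vertex (2 * n - 2) (keyD n a) ∈ hullD n B := by
  rw [mem_strip] at ha
  rw [← pointD_eq n ha.2.1 ha.1]
  exact mem_hullD ha.2.2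

theorem hullD_strip (n : ℕ) (B : Finset ℤ) :
    hullD n (strip B) = convexHull ℝ (vertex (2 * n - 2) '' ((strip B).image (keyD n) : Finset ℤ)) := by
  rw [hullD, Finset.coe_image, Set.image_image]
  congr 1
  apply Set.image_congr
  intro a ha
  rw [Finset.mem_coe, mem_strip] at ha
  exact pointD_eq n ha.2.1 ha.1

theorem hullD_subset_insert (n : ℕ) (B : Finset ℤ) :
    hullD n B ⊆ convexHull ℝ (insert 0 (vertex (2 * n - 2) '' ((strip B).image (keyD n) : Finset ℤ))) := by
  apply convexHull_mono
  rintro _ ⟨a, ha, rfl⟩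
  by_cases h1 : a = 1
  · left; rw [h1, pointD_one]
  by_cases h2 : a = -1
  · left; rw [h2, pointD_neg_one]
  · right
    exact ⟨keyD n a, Finset.mem_coe.2 (Finset.mem_image_of_mem _ (mem_strip.2 ⟨h2, h1, ha⟩)),
      (pointD_eq n h1 h2).symm⟩

theorem norm_le_of_mem_hullD {B : Finset ℤ} {z : ℂ} (hz : z ∈ hullD n B) : ‖z‖ ≤ 1 := by
  have := convexHull_min (t := Metric.closedBall (0 : ℂ) 1) (by
    rintro _ (rfl | ⟨x, -, rfl⟩)
    · simp
    · simp [norm_vertex]) (convex_closedBall _ _) (hullD_subset_insert n B hz)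
  simpa using this

theorem keyD_image_bounds {B : Finset ℤ} (hB : B ⊆ ground n) :
    ∀ s ∈ (strip B).image (keyD n), 0 ≤ s ∧ s < 2 * (n : ℤ) - 2 := by
  intro s hs
  rw [Finset.mem_image] at hs
  obtain ⟨a, ha, rfl⟩ := hs
  rw [mem_strip] at ha
  exact keyD_bounds (hB ha.2.2) ha.2.1 ha.1

theorem mem_of_pointD_mem_hullD (hn : 2 ≤ n) {B : Finset ℤ} (hB : B ⊆ ground n) {a : ℤ}
    (ha : a ∈ ground n) (h1 : a ≠ 1) (h2 : a ≠ -1) (h : pointD n a ∈ hullD n B) : a ∈ B := by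
  rw [pointD_eq n h1 h2] at h
  have hb := keyD_bounds ha h1 h2
  have := mem_of_vertex_mem_hull (by omega) (keyD_image_bounds hB) hb.1 hb.2
    (hullD_subset_insert n B h)
  rw [Finset.mem_image] at this
  obtain ⟨b, hb, hba⟩ := this
  rw [mem_strip] at hb
  rw [← keyD_inj (hB hb.2.2) hb.2.1 hb.1 ha h1 h2 hba]
  exact hb.2.2

theorem disjoint_hullD_strip (hn : 2 ≤ n) {B C : Finset ℤ} (hB : B ⊆ ground n)
    (hC : C ⊆ ground n) (hd : Disjoint (strip B) (strip C)) (h : ¬ Alt n (strip B) (strip C)) :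
    Disjoint (hullD n (strip B)) (hullD n (strip C)) := by
  have hst : ∀ a ∈ strip B ∪ strip C, a ∈ ground n ∧ a ≠ 1 ∧ a ≠ -1 := by
    intro a ha
    rw [Finset.mem_union, mem_strip, mem_strip] at ha
    rcases ha with ha | ha
    · exact ⟨hB ha.2.2, ha.2.1, ha.1⟩
    · exact ⟨hC ha.2.2, ha.2.1, ha.1⟩
  rw [hullD_strip, hullD_strip]
  apply disjoint_hull (by omega) (keyD_image_bounds hB) (keyD_image_bounds hC)
  · refine disjoint_image_of_key _ (fun a ha b hb h => ?_) hd
    obtain ⟨a1, a2, a3⟩ := hst a ha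
    obtain ⟨b1, b2, b3⟩ := hst b hb
    exact keyD_inj a1 a2 a3 b1 b2 b3 h
  · rwa [altZ_image_iff (n := n) _ (fun a ha b hb => ?_)]
    obtain ⟨a1, a2, a3⟩ := hst a ha
    obtain ⟨b1, b2, b3⟩ := hst b hb
    exact keyD_lt_iff a1 a2 a3 b1 b2 b3

theorem crossD_symm {B C : Finset ℤ} (h : CrossD n B C) : CrossD n C B :=
  ⟨h.1.symm, h.2.symm⟩

theorem hullD_ne (hn : 2 ≤ n) {B C : Finset ℤ} (hB : B ⊆ ground n) (hC : C ⊆ ground n)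
    (hd : Disjoint B C) {b : ℤ} (hb : b ∈ strip B) : hullD n B ≠ hullD n C := by
  intro h
  rw [mem_strip] at hb
  have := mem_of_pointD_mem_hullD hn hC (hB hb.2.2) hb.2.1 hb.1 (h ▸ mem_hullD hb.2.2)
  exact Finset.disjoint_left.1 hd hb.2.2 this

/-- A block crosses another one if it has points on both sides of a chord of the other one. -/
theorem crossD_of_sides (hn : 2 ≤ n) {B C : Finset ℤ} (hB : B ⊆ ground n) (hC : C ⊆ ground n)
    (hd : Disjoint B C) {c₁ c₂ : ℤ} (hc₁ : c₁ ∈ strip C) (hc₂ : c₂ ∈ strip C)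
    (hlt : keyD n c₁ < keyD n c₂) {p q : ℂ} (hp : p ∈ hullD n B) (hq : q ∈ hullD n B)
    (hps : 0 < sideN (2 * n - 2) (keyD n c₁) (keyD n c₂) p)
    (hqs : sideN (2 * n - 2) (keyD n c₁) (keyD n c₂) q < 0) : CrossD n B C := by
  have b1 := keyD_image_bounds hC _ (Finset.mem_image_of_mem _ hc₁)
  have b2 := keyD_image_bounds hC _ (Finset.mem_image_of_mem _ hc₂)
  refine ⟨(hullD_ne hn hC hB hd.symm hc₁).symm, Or.inl ?_⟩
  obtain ⟨z, hz1, hz2⟩ := chord_inter (by omega) (K := hullD n B) (convex_convexHull _ _)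
    (fun z hz => norm_le_of_mem_hullD hz) b1.1 hlt b2.2 hp hq hps hqs
  exact ⟨z, hz1, (convex_convexHull ℝ _).segment_subset (vertex_mem_hullD hc₁)
    (vertex_mem_hullD hc₂) hz2⟩

/-- Three labels in clockwise order give vertices on both sides of the chord. -/
theorem side_keyD (hn : 2 ≤ n) {c₁ c₂ b₁ b₂ : ℤ}
    (hc₁ : c₁ ∈ strip (ground n)) (hc₂ : c₂ ∈ strip (ground n)) (hb₁ : b₁ ∈ strip (ground n))
    (hb₂ : b₂ ∈ strip (ground n)) (h1 : key n c₁ < key n b₂) (h2 : key n b₂ < key n c₂)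
    (h3 : key n b₁ < key n c₁ ∨ key n c₂ < key n b₁) :
    keyD n c₁ < keyD n c₂ ∧
    0 < sideN (2 * n - 2) (keyD n c₁) (keyD n c₂) (vertex (2 * n - 2) (keyD n b₂)) ∧
    sideN (2 * n - 2) (keyD n c₁) (keyD n c₂) (vertex (2 * n - 2) (keyD n b₁)) < 0 := by
  rw [mem_strip] at hc₁ hc₂ hb₁ hb₂
  obtain ⟨x1, x2, x3⟩ := hc₁
  obtain ⟨y1, y2, y3⟩ := hc₂
  obtain ⟨z1, z2, z3⟩ := hb₁
  obtain ⟨w1, w2, w3⟩ := hb₂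
  rw [← keyD_lt_iff x3 x2 x1 w3 w2 w1] at h1
  rw [← keyD_lt_iff w3 w2 w1 y3 y2 y1] at h2
  rw [← keyD_lt_iff z3 z2 z1 x3 x2 x1, ← keyD_lt_iff y3 y2 y1 z3 z2 z1] at h3
  have k1 := keyD_bounds x3 x2 x1
  have k2 := keyD_bounds y3 y2 y1
  have k3 := keyD_bounds z3 z2 z1
  have hN : (0 : ℤ) < 2 * n - 2 := by omega
  have hside := side_neg_of_outside hN k1.1 (by omega) k2.2 k3.1 k3.2 h3
  have hside' := side_pos_of_between hN k1.1 h1 h2 k2.2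
  exact ⟨by omega, hside', hside⟩

theorem strip_mono {B C : Finset ℤ} (h : B ⊆ C) : strip B ⊆ strip C :=
  Finset.erase_subset_erase _ (Finset.erase_subset_erase _ h)

theorem crossD_of_alt (hn : 2 ≤ n) {B C : Finset ℤ} (hB : B ⊆ ground n) (hC : C ⊆ ground n)
    (hd : Disjoint B C) (h : Alt n (strip B) (strip C)) : CrossD n B C := by
  obtain ⟨b₁, hb₁, c₁, hc₁, b₂, hb₂, c₂, hc₂, h | h⟩ := h
  · obtain ⟨h1, h2, h3⟩ := side_keyD hn (strip_mono hC hc₁) (strip_mono hC hc₂)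
      (strip_mono hB hb₁) (strip_mono hB hb₂) h.2.1 h.2.2 (Or.inl h.1)
    exact crossD_of_sides hn hB hC hd hc₁ hc₂ h1 (vertex_mem_hullD hb₂) (vertex_mem_hullD hb₁) h2 h3
  · obtain ⟨h1, h2, h3⟩ := side_keyD hn (strip_mono hB hb₁) (strip_mono hB hb₂)
      (strip_mono hC hc₁) (strip_mono hC hc₂) h.2.1 h.2.2 (Or.inl h.1)
    exact crossD_symm (crossD_of_sides hn hC hB hd.symm hb₁ hb₂ h1 (vertex_mem_hullD hc₂)
      (vertex_mem_hullD hc₁) h2 h3)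

theorem hullD_neg (hn : 2 ≤ n) {B : Finset ℤ} (hB : B ⊆ ground n) :
    hullD n (neg B) = - hullD n B := by
  rw [hullD, hullD, ← convexHull_neg]
  congr 1
  ext z
  simp only [Set.mem_image, Set.mem_neg, Finset.mem_coe]
  constructor
  · rintro ⟨a, ha, rfl⟩
    rw [mem_neg] at ha
    have := pointD_neg hn (hB ha)
    rw [neg_neg] at this
    exact ⟨-a, ha, by rw [this, neg_neg]⟩
  · rintro ⟨a, ha, h⟩
    exact ⟨-a, by rwa [mem_neg, neg_neg], by rw [pointD_neg hn (hB ha), h, neg_neg]⟩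

end typeD


variable {n : ℕ}

theorem zero_mem_hull_of_mem {K : Set ℂ} (hK : Convex ℝ K) {z : ℂ} (h1 : z ∈ K) (h2 : -z ∈ K) :
    (0 : ℂ) ∈ K := by
  have := hK h1 h2 (a := 1 / 2) (b := 1 / 2) (by norm_num) (by norm_num) (by norm_num)
  rwa [smul_neg, add_neg_cancel] at this

theorem mem_strip_neg {B : Finset ℤ} {a : ℤ} : a ∈ strip (neg B) ↔ -a ∈ strip B := by
  simp only [mem_strip, mem_neg]
  constructor <;> rintro ⟨h1, h2, h3⟩ <;> refine ⟨by omega, by omega, h3⟩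

theorem strip_neg (B : Finset ℤ) : strip (neg B) = neg (strip B) := by
  ext a; rw [mem_strip_neg, mem_neg]

theorem strip_subset (B : Finset ℤ) : strip B ⊆ B := fun _ h => (mem_strip.1 h).2.2

theorem strip_union (B C : Finset ℤ) : strip (B ∪ C) = strip B ∪ strip C := by
  ext a; simp only [mem_strip, Finset.mem_union]; tauto

theorem neg_union (B C : Finset ℤ) : neg (B ∪ C) = neg B ∪ neg C := Finset.image_union _ _

theorem neg_subset_ground {B : Finset ℤ} (hB : B ⊆ ground n) : neg B ⊆ ground n := by
  intro a ha
  have := hB (mem_neg.1 ha)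
  rw [mem_ground] at this ⊢
  omega

/-- The combinatorial description of the noncrossing condition of type `D`. -/
structure NoncrossingD (n : ℕ) (P : Finset (Finset ℤ)) : Prop where
  one_mem : ∀ B ∈ P, neg B = B → 1 ∈ B
  not_alt : ∀ B ∈ P, ∀ C ∈ P, B ≠ C → ¬ Alt n (strip B) (strip C)
  center : (∀ B ∈ P, neg B ≠ B) → ∀ B ∈ P, 1 ∈ B → ∀ C ∈ P, C ≠ B → C ≠ neg B →
    ¬ Alt n (strip B ∪ neg (strip B)) (strip C)

theorem IsBPartition.eq_of_mem {P : Finset (Finset ℤ)} (hP : IsBPartition n P) {B C : Finset ℤ}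
    (hB : B ∈ P) (hC : C ∈ P) {a : ℤ} (h1 : a ∈ B) (h2 : a ∈ C) : B = C := by
  by_contra h
  exact Finset.disjoint_left.1 (hP.disjoint B hB C hC h) h1 h2

theorem IsBPartition.exists_mem {P : Finset (Finset ℤ)} (hP : IsBPartition n P) {a : ℤ}
    (ha : a ∈ ground n) : ∃ B ∈ P, a ∈ B := by
  rw [← hP.cover, Finset.mem_biUnion] at ha
  exact ha

/-- At the centroid `side` is minus the cosine of half the arc, so only a diameter passes through
it. -/
theorem side_zero_center {c₁ c₂ : ℤ} {N : ℤ} (hN : 0 < N) (h1 : c₁ < c₂) (h2 : c₂ < c₁ + N)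
    (h : sideN N c₁ c₂ 0 = 0) : 2 * (c₂ - c₁) = N := by
  have hN' : (0 : ℝ) < N := by exact_mod_cast hN
  have h1' : (c₁ : ℝ) < c₂ := by exact_mod_cast h1
  have h2' : (c₂ : ℝ) < c₁ + N := by exact_mod_cast h2
  simp only [sideN, side, Complex.zero_re, Complex.zero_im, zero_mul, zero_sub, neg_zero,
    neg_eq_zero] at h
  have e : (2 * Real.pi * (c₂ : ℝ) / N - 2 * Real.pi * c₁ / N) / 2
      = Real.pi * ((c₂ - c₁) / N) := by field_simp
  rw [e] at h
  have hpi := Real.pi_pos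
  have hx0 : 0 < ((c₂ : ℝ) - c₁) / N := by apply div_pos <;> linarith
  have hx1 : ((c₂ : ℝ) - c₁) / N < 1 := by rw [div_lt_one hN']; linarith
  have : Real.pi * (((c₂ : ℝ) - c₁) / N) = Real.pi / 2 := by
    apply Real.injOn_cos ⟨by positivity, by nlinarith⟩ ⟨by positivity, by linarith⟩
    rw [h, Real.cos_pi_div_two]
  have h3 : ((c₂ : ℝ) - c₁) / N = 1 / 2 := by
    have := mul_left_cancel₀ hpi.ne' (this.trans (by ring : Real.pi / 2 = Real.pi * (1 / 2)))
    exact this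
  rw [div_eq_iff hN'.ne'] at h3
  have : (2 * ((c₂ : ℝ) - c₁)) = N := by linarith
  exact_mod_cast this

/-- Each violation produces a crossing. A zero block without `1` has the centroid in its relative
interior. Alternating blocks have points on both sides of a chord. A chord of `C` that separates two
points of `B ∪ -B` also separates one of them from the centroid, which belongs to the hulls of `B`
and of `-B`. -/
theorem noncrossingD_of_mem_NCD (hn : 2 ≤ n) {P : Finset (Finset ℤ)} (h : P ∈ NCD n) :
    NoncrossingD n P := by
  rw [NCD, Set.mem_ofPred_eq] at h
  obtain ⟨hP, hcr⟩ := h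
  have hB' := hP.toIsBPartition
  have hone : (1 : ℤ) ∈ ground n := by rw [mem_ground]; omega
  have hsub := fun {B} (hB : B ∈ P) => hB'.subset_ground hB
  refine ⟨?_, ?_, ?_⟩
  · intro B hB hz
    by_contra h1
    have h1' : (-1 : ℤ) ∉ B := by rw [← hz, mem_neg, neg_neg]; exact h1
    obtain ⟨C, hC, h1C⟩ := hB'.exists_mem hone
    have hne : B ≠ C := by rintro rfl; exact h1 h1C
    obtain ⟨b, hb⟩ := hB'.nonempty B hB
    have hbs : b ∈ strip B := by rwa [strip_eq_self h1 h1']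
    apply hcr B hB C hC hne
    refine ⟨hullD_ne hn (hsub hB) (hsub hC) (hB'.disjoint B hB C hC hne) hbs, Or.inl ⟨0, ?_, ?_⟩⟩
    · have hcv : Convex ℝ (hullD n B) := convex_convexHull _ _
      -- The centroid is the midpoint of `z` and `-z`, hence in the relative interior together with
      -- `z`; it also lies in the hull of the block of `1`.
      obtain ⟨z, hz'⟩ := Set.Nonempty.intrinsicInterior hcv ⟨_, mem_hullD hb⟩
      have hzn : -z ∈ hullD n B := by
        rw [← hz, hullD_neg hn (hsub hB), Set.neg_mem_neg]
        exact intrinsicInterior_subset hz'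
      have := combo_mem_intrinsicInterior hcv hz' hzn (t := 1 / 2) (by norm_num) (by norm_num)
      convert this using 1
      module
    · rw [← pointD_one n]
      exact mem_hullD h1C
  · intro B hB C hC hne halt
    exact hcr B hB C hC hne (crossD_of_alt hn (hsub hB) (hsub hC) (hB'.disjoint B hB C hC hne) halt)
  · intro hnz B hB h1 C hC hCB hCB' halt
    have h1C : 1 ∉ C := fun h => hCB (hB'.eq_of_mem hC hB h h1)
    have h1C' : -1 ∉ C := fun h =>
      hCB' (hB'.eq_of_mem hC (hB'.neg_mem B hB) h (by rw [mem_neg, neg_neg]; exact h1))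
    have hBg := hsub hB
    have hCg := hsub hC
    have hRg : strip B ∪ neg (strip B) ⊆ strip (ground n) := by
      apply Finset.union_subset (strip_mono hBg)
      rw [← strip_neg]
      exact strip_mono (neg_subset_ground hBg)
    -- each point of the two blocks lies in a block whose hull contains the centroid
    have hblock : ∀ r ∈ strip B ∪ neg (strip B), ∃ B' ∈ P, B' ≠ C ∧ r ∈ strip B' ∧
        (0 : ℂ) ∈ hullD n B' := by
      intro r hr
      rw [Finset.mem_union] at hr
      rcases hr with hr | hr
      · exact ⟨B, hB, hCB.symm, hr, by rw [← pointD_one n]; exact mem_hullD h1⟩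
      · refine ⟨neg B, hB'.neg_mem B hB, hCB'.symm, by rwa [strip_neg], ?_⟩
        rw [← pointD_neg_one n]
        exact mem_hullD (by rwa [mem_neg, neg_neg])
    have main : ∀ c₁ ∈ strip C, ∀ c₂ ∈ strip C, ∀ r₁ ∈ strip B ∪ neg (strip B),
        ∀ r₂ ∈ strip B ∪ neg (strip B), key n c₁ < key n r₂ → key n r₂ < key n c₂ →
        (key n r₁ < key n c₁ ∨ key n c₂ < key n r₁) → False := by
      intro c₁ hc₁ c₂ hc₂ r₁ hr₁ r₂ hr₂ e1 e2 e3
      obtain ⟨h1, h2, h3⟩ := side_keyD hn (strip_mono hCg hc₁) (strip_mono hCg hc₂)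
        (hRg hr₁) (hRg hr₂) e1 e2 e3
      obtain ⟨B₁, hB₁, hB₁C, hr₁', h0₁⟩ := hblock r₁ hr₁
      obtain ⟨B₂, hB₂, hB₂C, hr₂', h0₂⟩ := hblock r₂ hr₂
      -- `r₂` lies on the positive side and `r₁` on the negative one, so the block of one of them is
      -- cut unless the centroid is on the chord. In that case `c₁` and `c₂` are opposite, and `C`
      -- would be a zero block.
      rcases lt_trichotomy (sideN (2 * n - 2) (keyD n c₁) (keyD n c₂) 0) 0 with h0 | h0 | h0
      · exact hcr B₂ hB₂ C hC hB₂C (crossD_of_sides hn (hsub hB₂) hCg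
          (hB'.disjoint _ hB₂ _ hC hB₂C) hc₁ hc₂ h1 (vertex_mem_hullD hr₂') h0₂ h2 h0)
      · rw [mem_strip] at hc₁ hc₂
        have k1 := keyD_bounds (hCg hc₁.2.2) hc₁.2.1 hc₁.1
        have k2 := keyD_bounds (hCg hc₂.2.2) hc₂.2.1 hc₂.1
        have := side_zero_center (by omega) h1 (by omega) h0
        have g1 := mem_ground.1 (hCg hc₁.2.2)
        have g2 := mem_ground.1 (hCg hc₂.2.2)
        have : c₂ = -c₁ := by
          unfold keyD at this k1 k2 h1
          split_ifs at this k1 k2 h1 <;> omega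
        apply hnz C hC
        exact hB'.eq_of_mem (hB'.neg_mem C hC) hC (a := c₁)
          (by rw [mem_neg, ← this]; exact hc₂.2.2) hc₁.2.2
      · exact hcr B₁ hB₁ C hC hB₁C (crossD_of_sides hn (hsub hB₁) hCg
          (hB'.disjoint _ hB₁ _ hC hB₁C) hc₁ hc₂ h1 h0₁ (vertex_mem_hullD hr₁') h0 h3)
    obtain ⟨b₁, hb₁, c₁, hc₁, b₂, hb₂, c₂, hc₂, h | h⟩ := halt
    · exact main c₁ hc₁ c₂ hc₂ b₁ hb₁ b₂ hb₂ h.2.1 h.2.2 (Or.inl h.1)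
    · exact main c₁ hc₁ c₂ hc₂ b₂ hb₂ b₁ hb₁ h.1 h.2.1 (Or.inr h.2.2)

theorem not_crossD_of_disjoint {B C : Finset ℤ} (h : Disjoint (hullD n B) (hullD n C)) :
    ¬ CrossD n B C := by
  rintro ⟨-, ⟨z, h1, h2⟩ | ⟨z, h1, h2⟩⟩
  · exact Set.disjoint_left.1 h (intrinsicInterior_subset h1) h2
  · exact Set.disjoint_left.1 h h2 (intrinsicInterior_subset h1)

theorem hullD_subset_of_zero_mem {B D : Finset ℤ} (h : strip B ⊆ D) (h0 : (0 : ℂ) ∈ hullD n D) :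
    hullD n B ⊆ hullD n D := by
  apply convexHull_min _ (convex_convexHull _ _)
  rintro _ ⟨a, ha, rfl⟩
  by_cases h1 : a = 1
  · rw [h1, pointD_one]; exact h0
  by_cases h2 : a = -1
  · rw [h2, pointD_neg_one]; exact h0
  exact mem_hullD (h (mem_strip.2 ⟨h2, h1, ha⟩))

theorem zero_mem_hullD_symm (hn : 2 ≤ n) {B : Finset ℤ} (hB : B ⊆ ground n) {a : ℤ} (h1 : a ∈ B)
    (h2 : -a ∈ B) : (0 : ℂ) ∈ hullD n B :=
  zero_mem_hull_of_mem (convex_convexHull _ _) (mem_hullD h1)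
    (by rw [← pointD_neg hn (hB h1)]; exact mem_hullD h2)

/-- Opposite blocks do not cross if a line through the centroid separates them. -/
theorem not_crossD_neg (hn : 2 ≤ n) {B : Finset ℤ} (hB : B ⊆ ground n) (hd : Disjoint B (neg B))
    (h1 : 1 ∈ B ∨ -1 ∈ B) (h : ¬ Alt n (strip B) (strip (neg B))) : ¬ CrossD n B (neg B) := by
  have h0 : (0 : ℂ) ∈ hullD n B := by
    rcases h1 with h1 | h1
    · rw [← pointD_one n]; exact mem_hullD h1
    · rw [← pointD_neg_one n]; exact mem_hullD h1
  have hstrip : hullD n (strip (neg B)) = - hullD n (strip B) := by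
    rw [strip_neg, hullD_neg hn ((strip_subset B).trans hB)]
  have hdis := disjoint_hullD_strip hn hB (neg_subset_ground hB)
    (Finset.disjoint_of_subset_left (strip_subset _)
      (Finset.disjoint_of_subset_right (strip_subset _) hd)) h
  have h0' : (0 : ℂ) ∉ hullD n (strip B) := fun h0 => by
    refine Set.disjoint_left.1 hdis h0 ?_
    rw [hstrip, Set.mem_neg, neg_zero]
    exact h0
  -- the only common point of the two hulls is the centroid
  have hcone : ∃ φ : ℂ →L[ℝ] ℝ, ∀ a ∈ strip B, 0 < φ (pointD n a) := by
    obtain ⟨φ, u, hu0, hu⟩ := geometric_hahn_banach_point_closed (x := (0 : ℂ))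
      (t := hullD n (strip B)) (convex_convexHull _ _)
      ((((strip B).finite_toSet.image _).isCompact_convexHull (𝕜 := ℝ)).isClosed) h0'
    refine ⟨φ, fun a ha => ?_⟩
    have := hu _ (mem_hullD ha)
    rw [map_zero] at hu0
    exact hu0.trans this
  obtain ⟨φ, hφ⟩ := hcone
  have hnonneg : ∀ z ∈ hullD n B, 0 ≤ φ z := by
    intro z hz
    have : hullD n B ⊆ {z | 0 ≤ φ z} := by
      apply convexHull_min _ (convex_halfSpace_ge φ.isLinear 0)
      rintro _ ⟨a, ha, rfl⟩
      rw [Set.mem_ofPred_eq]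
      by_cases h1 : a = 1
      · rw [h1, pointD_one, map_zero]
      by_cases h2 : a = -1
      · rw [h2, pointD_neg_one, map_zero]
      exact (hφ a (mem_strip.2 ⟨h2, h1, ha⟩)).le
    exact this hz
  -- A common point of both hulls lies in the kernel of `φ`. If it were a relative interior point,
  -- one could move from it a little away from the vertex `r` inside the hull, to a negative value
  -- of `φ`.
  have hnotmem : ∀ z ∈ hullD n B, -z ∈ hullD n B → ∀ r ∈ strip B,
      z ∉ intrinsicInterior ℝ (hullD n B) := by
    intro z hz hz' r hr hi
    have e1 : φ z = 0 := by
      have := hnonneg _ hz'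
      rw [map_neg] at this
      linarith [hnonneg z hz]
    obtain ⟨ε, hε, hmem⟩ := exists_extend_of_mem_intrinsicInterior hi
      (mem_hullD (strip_subset _ hr))
    have := hnonneg _ hmem
    rw [map_add, map_smul, map_sub, e1, smul_eq_mul] at this
    nlinarith [hφ r hr]
  rintro ⟨hne, hcross⟩
  rw [hullD_neg hn hB] at hne hcross
  -- Without vertices both hulls consist of the centroid, and blocks with equal hulls do not cross
  -- by definition.
  rcases (strip B).eq_empty_or_nonempty with he | ⟨r, hr⟩
  · apply hne
    have : hullD n B = {0} := by
      apply Set.Subset.antisymm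
      · have := hullD_subset_insert n B
        rw [he] at this
        simpa using this
      · simpa using h0
    rw [this]
    simp
  · rcases hcross with ⟨z, hz1, hz2⟩ | ⟨z, hz1, hz2⟩
    · exact hnotmem z (intrinsicInterior_subset hz1) (Set.mem_neg.1 hz2) r hr hz1
    · -- the situation is symmetric under `z ↦ -z`
      have hz1' : -z ∈ intrinsicInterior ℝ (hullD n B) := by
        rw [mem_intrinsicInterior_iff] at hz1 ⊢
        obtain ⟨hza, ε, hε, hball⟩ := hz1
        have hspan : ∀ w, w ∈ affineSpan ℝ (- hullD n B) → -w ∈ affineSpan ℝ (hullD n B) := by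
          intro w hw
          have e := AffineSubspace.map_span (-(AffineMap.id ℝ ℂ)) (hullD n B)
          have himg : (-(AffineMap.id ℝ ℂ)) '' (hullD n B) = - hullD n B := by
            ext x
            simp
          rw [himg] at e
          rw [← e, AffineSubspace.mem_map] at hw
          obtain ⟨y, hy, rfl⟩ := hw
          simpa using hy
        have hspan' : ∀ w, w ∈ affineSpan ℝ (hullD n B) → -w ∈ affineSpan ℝ (- hullD n B) := by
          intro w hw
          have e := AffineSubspace.map_span (-(AffineMap.id ℝ ℂ)) (hullD n B)
          have himg : (-(AffineMap.id ℝ ℂ)) '' (hullD n B) = - hullD n B := by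
            ext x
            simp
          rw [himg] at e
          rw [← e, AffineSubspace.mem_map]
          exact ⟨w, hw, by simp⟩
        refine ⟨hspan z hza, ε, hε, fun y hy hd => ?_⟩
        have := hball (-y) (hspan' y hy) (by
          rw [dist_eq_norm] at hd ⊢
          rw [← norm_neg]
          rwa [show -(-y - z) = y - -z by ring])
        rwa [Set.neg_mem_neg] at this
      exact hnotmem (-z) (intrinsicInterior_subset hz1') (by rw [neg_neg]; exact hz2) r hr hz1'

/-- A block without `±1` has a hull disjoint from all other hulls. To see this for a second block
`B` that contains `1` or `-1`, the hull of `B` is put into the hull of a set of vertices that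
contains the centroid: the vertices of `B` if it is the zero block, those of `B ∪ -B` otherwise.
Then nonalternation applies. The only remaining pair is that of `B` and `-B`. -/
theorem mem_NCD_of_noncrossingD (hn : 2 ≤ n) {P : Finset (Finset ℤ)} (hP : IsDPartition n P)
    (h : NoncrossingD n P) : P ∈ NCD n := by
  rw [NCD, Set.mem_ofPred_eq]
  refine ⟨hP, ?_⟩
  have hB' := hP.toIsBPartition
  have hsub := fun {B} (hB : B ∈ P) => hB'.subset_ground hB
  have hstripd : ∀ {B C : Finset ℤ}, Disjoint B C → Disjoint (strip B) (strip C) := fun hd =>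
    Finset.disjoint_of_subset_left (strip_subset _)
      (Finset.disjoint_of_subset_right (strip_subset _) hd)
  -- two blocks the second of which does not contain `1` or `-1`
  have main : ∀ B ∈ P, ∀ C ∈ P, B ≠ C → 1 ∉ C → -1 ∉ C → Disjoint (hullD n B) (hullD n C) := by
    intro B hB C hC hne h1C h1C'
    have hd := hB'.disjoint B hB C hC hne
    have hCs : strip C = C := strip_eq_self h1C h1C'
    have base := disjoint_hullD_strip hn (hsub hB) (hsub hC) (hstripd hd) (h.not_alt B hB C hC hne)
    rw [hCs] at base
    by_cases hp : 1 ∈ B ∨ -1 ∈ B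
    · by_cases hz : neg B = B
      -- The condition on the size of the zero block guarantees a vertex `r`, so that the centroid
      -- is the midpoint of `r` and `-r`.
      · have hcard := hP.two_lt_card B hB hz
        have : (strip B).Nonempty := by
          rw [Finset.nonempty_iff_ne_empty]
          intro he
          have : B ⊆ {1, -1} := by
            intro a ha
            by_contra hcon
            rw [Finset.mem_insert, Finset.mem_singleton, not_or] at hcon
            have : a ∈ strip B := mem_strip.2 ⟨hcon.2, hcon.1, ha⟩
            rw [he] at this
            exact absurd this (Finset.notMem_empty a)
          have := Finset.card_le_card this
          have h2 : ({1, -1} : Finset ℤ).card = 2 := by decide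
          omega
        obtain ⟨r, hr⟩ := this
        have hr' : -r ∈ strip B := by rw [← mem_strip_neg, hz]; exact hr
        exact base.mono_left (hullD_subset_of_zero_mem subset_rfl
          (zero_mem_hullD_symm hn ((strip_subset B).trans (hsub hB)) hr hr'))
      · have hnz : ∀ D ∈ P, neg D ≠ D := by
          intro D hD hDz
          have h1 := h.one_mem D hD hDz
          apply hz
          rcases hp with hp | hp
          · rw [hB'.eq_of_mem hB hD hp h1, hDz]
          · have : (-1 : ℤ) ∈ D := by rw [← hDz, mem_neg, neg_neg]; exact h1
            rw [hB'.eq_of_mem hB hD hp this, hDz]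
        have hCneg : C ≠ neg B := by
          rintro rfl
          rw [mem_neg] at h1C h1C'
          rw [neg_neg] at h1C'
          tauto
        have hcen : ¬ Alt n (strip B ∪ neg (strip B)) (strip C) := by
          rcases hp with hp | hp
          · exact h.center hnz B hB hp C hC hne.symm hCneg
          · have := h.center hnz (neg B) (hB'.neg_mem B hB) (mem_neg.2 hp) C hC hCneg
              (by rw [neg_neg_block]; exact hne.symm)
            rwa [strip_neg, neg_neg_block, Finset.union_comm] at this
        have hRs : strip (B ∪ neg B) = strip B ∪ neg (strip B) := by rw [strip_union, strip_neg]
        have hdC : Disjoint (B ∪ neg B) C := by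
          rw [Finset.disjoint_union_left]
          exact ⟨hd, hB'.disjoint _ (hB'.neg_mem B hB) _ hC hCneg.symm⟩
        have hU : B ∪ neg B ⊆ ground n :=
          Finset.union_subset (hsub hB) (neg_subset_ground (hsub hB))
        have hdis := disjoint_hullD_strip hn hU (hsub hC) (hstripd hdC) (by rwa [hRs])
        rw [hCs] at hdis
        -- If `B` has no vertices, its hull is the centroid. This is not in the hull of `C`, for it
        -- would also be in the hull of `-C`, which is disjoint from the former.
        rcases (strip B).eq_empty_or_nonempty with he | ⟨r, hr⟩
        · have hB0 : hullD n B ⊆ {0} := by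
            have := hullD_subset_insert n B
            rw [he] at this
            simpa using this
          rw [Set.disjoint_left]
          intro z hz hzC
          obtain rfl : z = 0 := hB0 hz
          have hCC : C ≠ neg C := (hnz C hC).symm
          have := disjoint_hullD_strip hn (hsub hC) (neg_subset_ground (hsub hC))
            (hstripd (hB'.disjoint C hC _ (hB'.neg_mem C hC) hCC))
            (h.not_alt C hC _ (hB'.neg_mem C hC) hCC)
          rw [strip_neg, hCs, hullD_neg hn (hsub hC)] at this
          exact Set.disjoint_left.1 this hzC (by rw [Set.mem_neg, neg_zero]; exact hzC)
        · apply hdis.mono_left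
          apply hullD_subset_of_zero_mem
          · rw [hRs]; exact Finset.subset_union_left
          · apply zero_mem_hullD_symm hn ((strip_subset _).trans hU) (a := r)
            · rw [hRs]; exact Finset.mem_union_left _ hr
            · rw [hRs]; exact Finset.mem_union_right _ (by rwa [mem_neg, neg_neg])
    · push Not at hp
      rwa [strip_eq_self hp.1 hp.2] at base
  intro B hB C hC hne
  by_cases hC1 : 1 ∈ C ∨ -1 ∈ C
  · by_cases hB1 : 1 ∈ B ∨ -1 ∈ B
    · have hCB : C = neg B := by
        rcases hC1 with hc | hc <;> rcases hB1 with hb | hb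
        · exact absurd (hB'.eq_of_mem hB hC hb hc) hne
        · exact hB'.eq_of_mem hC (hB'.neg_mem B hB) hc (mem_neg.2 hb)
        · exact hB'.eq_of_mem hC (hB'.neg_mem B hB) hc (by rwa [mem_neg, neg_neg])
        · exact absurd (hB'.eq_of_mem hB hC hb hc) hne
      subst hCB
      exact not_crossD_neg hn (hsub hB) (hB'.disjoint _ hB _ hC hne) hB1 (h.not_alt _ hB _ hC hne)
    · push Not at hB1
      exact fun hcr => not_crossD_of_disjoint (main C hC B hB hne.symm hB1.1 hB1.2) (crossD_symm hcr)
  · push Not at hC1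
    exact not_crossD_of_disjoint (main B hB C hC hne hC1.1 hC1.2)


/-! ### Symmetric families of blocks -/

/-- The blocks of `X` and their negatives. -/
def pm (X : Finset (Finset ℤ)) : Finset (Finset ℤ) := X ∪ X.image neg

theorem mem_pm {X : Finset (Finset ℤ)} {B : Finset ℤ} : B ∈ pm X ↔ B ∈ X ∨ neg B ∈ X := by
  simp only [pm, Finset.mem_union, Finset.mem_image]
  refine or_congr_right ⟨?_, fun h => ⟨neg B, h, neg_neg_block B⟩⟩
  rintro ⟨C, hC, rfl⟩
  rwa [neg_neg_block]

theorem neg_mem_pm {X : Finset (Finset ℤ)} {B : Finset ℤ} : neg B ∈ pm X ↔ B ∈ pm X := by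
  rw [mem_pm, mem_pm, neg_neg_block, or_comm]

theorem pm_union (X Y : Finset (Finset ℤ)) : pm (X ∪ Y) = pm X ∪ pm Y := by
  ext B; simp only [mem_pm, Finset.mem_union]; tauto

theorem neg_nonempty {B : Finset ℤ} : (neg B).Nonempty ↔ B.Nonempty := by
  simp [neg]

/-- One block from each pair `B`, `-B` of a `B_n`-partition. -/
structure SignedPart (n : ℕ) (X : Finset (Finset ℤ)) : Prop where
  nonempty : ∀ B ∈ X, B.Nonempty
  range : ∀ B ∈ X, B ⊆ ground n
  eq_of_abs : ∀ B ∈ X, ∀ C ∈ X, ∀ b ∈ B, ∀ c ∈ C, |b| = |c| → B = C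
  cover : ∀ i : ℤ, 1 ≤ i → i ≤ n → ∃ B ∈ X, i ∈ B ∨ -i ∈ B
  sign : ∀ B ∈ X, ∀ b ∈ B, -b ∈ B → neg B = B
  zero_unique : ∀ B ∈ X, ∀ C ∈ X, neg B = B → neg C = C → B = C

theorem SignedPart.isBPartition {n : ℕ} {X : Finset (Finset ℤ)} (h : SignedPart n X) :
    IsBPartition n (pm X) := by
  refine ⟨?_, ?_, ?_, fun B hB => neg_mem_pm.2 hB, ?_⟩
  · intro B hB
    rcases mem_pm.1 hB with hB | hB
    · exact h.nonempty B hB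
    · exact neg_nonempty.1 (h.nonempty _ hB)
  · intro B hB C hC hne
    rw [Finset.disjoint_left]
    intro x hx hx'
    apply hne
    rcases mem_pm.1 hB with hB | hB <;> rcases mem_pm.1 hC with hC | hC
    · exact h.eq_of_abs B hB C hC x hx x hx' rfl
    · have hx2 : -x ∈ neg C := by rwa [mem_neg, neg_neg]
      have e := h.eq_of_abs B hB _ hC x hx (-x) hx2 (abs_neg x).symm
      have := h.sign B hB x hx (by rw [e]; exact hx2)
      rw [← neg_neg_block C, ← e, this]
    · have hx2 : -x ∈ neg B := by rwa [mem_neg, neg_neg]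
      have e := h.eq_of_abs C hC _ hB x hx' (-x) hx2 (abs_neg x).symm
      have := h.sign C hC x hx' (by rw [e]; exact hx2)
      rw [← neg_neg_block B, ← e, this]
    · exact neg_injective (h.eq_of_abs _ hB _ hC (-x) (by rwa [mem_neg, neg_neg]) (-x)
        (by rwa [mem_neg, neg_neg]) rfl)
  · ext x
    rw [Finset.mem_biUnion]
    constructor
    · rintro ⟨B, hB, hx⟩
      rcases mem_pm.1 hB with hB | hB
      · exact h.range B hB hx
      · have := h.range _ hB (show -x ∈ neg B by rw [mem_neg, neg_neg]; exact hx)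
        rw [mem_ground] at this ⊢
        omega
    · intro hx
      rw [mem_ground] at hx
      have key : ∀ i : ℤ, 1 ≤ i → i ≤ n → (∃ B ∈ pm X, i ∈ B) ∧ ∃ B ∈ pm X, -i ∈ B := by
        intro i h1 h2
        obtain ⟨B, hB, hi⟩ := h.cover i h1 h2
        have hB1 : B ∈ pm X := mem_pm.2 (Or.inl hB)
        have hB2 : neg B ∈ pm X := neg_mem_pm.2 hB1
        rcases hi with hi | hi
        · exact ⟨⟨B, hB1, hi⟩, neg B, hB2, by rwa [mem_neg, neg_neg]⟩
        · exact ⟨⟨neg B, hB2, by rwa [mem_neg]⟩, B, hB1, hi⟩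
      rcases lt_or_gt_of_ne hx.1 with h0 | h0
      · have := (key (-x) (by omega) (by omega)).2
        rwa [neg_neg] at this
      · exact (key x (by omega) (by omega)).1
  · intro B hB C hC hzB hzC
    rw [mem_pm, hzB, or_self] at hB
    rw [mem_pm, hzC, or_self] at hC
    exact h.zero_unique B hB C hC hzB hzC

theorem blockOf_eq {n : ℕ} {P : Finset (Finset ℤ)} (hP : IsBPartition n P) {B : Finset ℤ}
    (hB : B ∈ P) {a : ℤ} (ha : a ∈ B) : blockOf P a = B := by
  have : P.filter (fun B => a ∈ B) = {B} := by
    ext C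
    rw [Finset.mem_filter, Finset.mem_singleton]
    exact ⟨fun h => hP.eq_of_mem h.1 hB h.2 ha, fun h => h ▸ ⟨hB, ha⟩⟩
  rw [blockOf, this, Finset.singleton_biUnion, id]

theorem zeroBlock_eq {n : ℕ} {P : Finset (Finset ℤ)} (hP : IsBPartition n P) {B : Finset ℤ}
    (hB : B ∈ P) (hz : neg B = B) : zeroBlock P = B := by
  have : P.filter (fun B => neg B = B) = {B} := by
    ext C
    rw [Finset.mem_filter, Finset.mem_singleton]
    exact ⟨fun h => hP.zero_unique C h.1 B hB h.2 hz, fun h => h ▸ ⟨hB, hz⟩⟩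
  rw [zeroBlock, this, Finset.singleton_biUnion, id]

theorem zeroBlock_eq_empty {P : Finset (Finset ℤ)} (h : ∀ B ∈ P, neg B ≠ B) : zeroBlock P = ∅ := by
  rw [zeroBlock, Finset.filter_false_of_mem h, Finset.biUnion_empty]

/-- The lists matter only up to signs, so a replacement can be computed on sets of representatives;
the kept blocks must not be among the removed ones. -/
theorem replaceBlocks_pm {X O N : Finset (Finset ℤ)} {old new : List (Finset ℤ)}
    (hO : ∀ B, (B ∈ old ∨ neg B ∈ old) ↔ B ∈ pm O) (hN : ∀ B, (B ∈ new ∨ neg B ∈ new) ↔ B ∈ pm N)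
    (hd : ∀ B ∈ X, B ∉ pm O) : replaceBlocks (pm (X ∪ O)) old new = pm (X ∪ N) := by
  have hl : ∀ (l : List (Finset ℤ)) (B : Finset ℤ), B ∈ (l ++ l.map neg).toFinset ↔
      B ∈ l ∨ neg B ∈ l := by
    intro l B
    rw [List.mem_toFinset, List.mem_append, List.mem_map]
    refine or_congr_right ⟨?_, fun h => ⟨_, h, neg_neg_block B⟩⟩
    rintro ⟨C, hC, rfl⟩
    rwa [neg_neg_block]
  ext B
  rw [replaceBlocks, Finset.mem_union, Finset.mem_sdiff, hl, hl, hO, hN, pm_union, pm_union,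
    Finset.mem_union, Finset.mem_union]
  have : B ∈ pm X → B ∉ pm O := by
    intro h hb
    rcases mem_pm.1 h with h | h
    · exact hd B h hb
    · exact hd _ h (neg_mem_pm.2 hb)
  tauto

/-! ### Openers and closers -/

/-- A block whose least element is positive lies in `[n]`, so no condition on signs is needed. -/
theorem mem_openers_iff {P : Finset (Finset ℤ)} {i : ℤ} :
    i ∈ openers P ↔ 0 < i ∧ ∃ B ∈ P, IsLeast (B : Set ℤ) i := by
  rw [openers, Set.mem_ofPred_eq]
  constructor
  · rintro ⟨B, hB, hpos, hl⟩
    exact ⟨hpos i (Finset.mem_coe.1 hl.1), B, hB, hl⟩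
  · rintro ⟨hi, B, hB, hl⟩
    exact ⟨B, hB, fun x hx => hi.trans_le (hl.2 (Finset.mem_coe.2 hx)), hl⟩

theorem mem_pos {B : Finset ℤ} {x : ℤ} : x ∈ pos B ↔ x ∈ B ∧ 0 < x := by simp [pos]

theorem mem_ngt {B : Finset ℤ} {x : ℤ} : x ∈ ngt B ↔ x ∈ B ∧ x < 0 := by simp [ngt]

/-- The least element of a mixed block `B` is the negative of the greatest element of `-B`. So all
closers are positive greatest elements of blocks, and conversely. -/
theorem mem_closers_iff {n : ℕ} {P : Finset (Finset ℤ)} (hP : IsBPartition n P) {i : ℤ} :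
    i ∈ closers P ↔ 0 < i ∧ ∃ B ∈ P, IsGreatest (B : Set ℤ) i := by
  rw [closers, Set.mem_union, Set.mem_ofPred_eq, Set.mem_ofPred_eq]
  constructor
  · rintro (⟨B, hB, hpos, hl⟩ | ⟨B, hB, ⟨⟨p, hp⟩, ⟨q, hq⟩⟩, x, hx | hx, rfl⟩)
    · exact ⟨hpos i (Finset.mem_coe.1 hl.1), B, hB, hl⟩
    · rw [mem_ngt] at hq
      have hx0 : x < 0 := (hx.2 (Finset.mem_coe.2 hq.1)).trans_lt hq.2
      rw [abs_of_neg hx0]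
      refine ⟨by omega, neg B, hP.neg_mem B hB, ?_, ?_⟩
      · rw [Finset.mem_coe, mem_neg, neg_neg]
        exact hx.1
      · intro y hy
        rw [Finset.mem_coe, mem_neg] at hy
        have := hx.2 (Finset.mem_coe.2 hy)
        omega
    · rw [mem_pos] at hp
      have hx0 : 0 < x := hp.2.trans_le (hx.2 (Finset.mem_coe.2 hp.1))
      rw [abs_of_pos hx0]
      exact ⟨hx0, B, hB, hx⟩
  · rintro ⟨hi, B, hB, hl⟩
    by_cases hpos : ∀ x ∈ B, 0 < x
    · exact Or.inl ⟨B, hB, hpos, hl⟩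
    · right
      push Not at hpos
      obtain ⟨x, hx, hx0⟩ := hpos
      have := (mem_ground.1 (hP.subset_ground hB hx)).1
      exact ⟨B, hB, ⟨⟨i, mem_pos.2 ⟨Finset.mem_coe.1 hl.1, hi⟩⟩,
        ⟨x, mem_ngt.2 ⟨hx, by omega⟩⟩⟩, i, Or.inr hl, (abs_of_pos hi).symm⟩

/-! ### Words of statuses and the partitions built from them -/

/-- The status of an element: opener and closer, closer only, neither, opener only. -/
inductive Status
  | both | cl | tr | op

/-- The openers of a word; the last letter of a word is the status of `n`. -/
def opSet (n : ℕ) : List Status → Set ℤ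
  | [] => ∅
  | .both :: u => insert (n - u.length : ℤ) (opSet n u)
  | .cl :: u => opSet n u
  | .tr :: u => opSet n u
  | .op :: u => insert (n - u.length : ℤ) (opSet n u)

/-- The closers of a word. -/
def clSet (n : ℕ) : List Status → Set ℤ
  | [] => ∅
  | .both :: u => insert (n - u.length : ℤ) (clSet n u)
  | .cl :: u => insert (n - u.length : ℤ) (clSet n u)
  | .tr :: u => clSet n u
  | .op :: u => clSet n u

theorem lt_of_mem_opSet {n : ℕ} : ∀ {u : List Status} {i : ℤ}, i ∈ opSet n u → n - u.length < i
  | [], i, h => h.elim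
  | s :: u, i, h => by
    rw [List.length_cons]
    push_cast
    have ih := fun h => @lt_of_mem_opSet n u i h
    cases s <;> simp only [opSet, Set.mem_insert_iff] at h
    · rcases h with h | h
      · omega
      · have := ih h; omega
    · have := ih h; omega
    · have := ih h; omega
    · rcases h with h | h
      · omega
      · have := ih h; omega

theorem lt_of_mem_clSet {n : ℕ} : ∀ {u : List Status} {i : ℤ}, i ∈ clSet n u → n - u.length < i
  | [], i, h => h.elim
  | s :: u, i, h => by
    rw [List.length_cons]
    push_cast
    have ih := fun h => @lt_of_mem_clSet n u i h
    cases s <;> simp only [clSet, Set.mem_insert_iff] at h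
    · rcases h with h | h
      · omega
      · have := ih h; omega
    · rcases h with h | h
      · omega
      · have := ih h; omega
    · have := ih h; omega
    · have := ih h; omega

/-- The first letter is read off from whether its position `n - u.length` is in the two sets, since
the later letters contribute only larger numbers. -/
theorem word_ext {n : ℕ} : ∀ {u v : List Status}, u.length = v.length →
    opSet n u = opSet n v → clSet n u = clSet n v → u = v
  | [], [], _, _, _ => rfl
  | [], _ :: _, h, _, _ => by simp at h
  | _ :: _, [], h, _, _ => by simp at h
  | s :: u, t :: v, h, ho, hc => by
    have hl : u.length = v.length := by simpa using h
    have no1 : (n - u.length : ℤ) ∉ opSet n u := fun h => lt_irrefl _ (lt_of_mem_opSet h)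
    have no2 : (n - u.length : ℤ) ∉ opSet n v := fun h => by
      have := lt_of_mem_opSet h; rw [hl] at this; exact lt_irrefl _ this
    have nc1 : (n - u.length : ℤ) ∉ clSet n u := fun h => lt_irrefl _ (lt_of_mem_clSet h)
    have nc2 : (n - u.length : ℤ) ∉ clSet n v := fun h => by
      have := lt_of_mem_clSet h; rw [hl] at this; exact lt_irrefl _ this
    have ins : ∀ {x : ℤ} {A B : Set ℤ}, x ∉ A → x ∉ B → insert x A = insert x B → A = B := by
      intro x A B hA hB e
      rw [← Set.insert_sdiff_self_of_notMem hA, e, Set.insert_sdiff_self_of_notMem hB]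
    have ih := @word_ext n u v hl
    have nins : ∀ {x : ℤ} {A B : Set ℤ}, x ∉ B → insert x A ≠ B := fun hB e =>
      hB (e ▸ Set.mem_insert _ _)
    cases s <;> cases t <;> simp only [opSet, clSet, ← hl] at ho hc
    · rw [ih (ins no1 no2 ho) (ins nc1 nc2 hc)]
    · exact absurd ho (nins no2)
    · exact absurd ho (nins no2)
    · exact absurd hc (nins nc2)
    · exact absurd ho.symm (nins no1)
    · rw [ih ho (ins nc1 nc2 hc)]
    · exact absurd hc (nins nc2)
    · exact absurd hc (nins nc2)
    · exact absurd ho.symm (nins no1)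
    · exact absurd hc.symm (nins nc1)
    · rw [ih ho hc]
    · exact absurd ho.symm (nins no1)
    · exact absurd hc.symm (nins nc1)
    · exact absurd ho (nins no2)
    · exact absurd ho (nins no2)
    · rw [ih (ins no1 no2 ho) hc]

/-- Reading a word from its last letter, one builds the list `l` of the blocks that are still to be
continued below, and the set `D` of the finished blocks. The relation `ok l₁ l₂` tells whether the
block between `l₁` and `l₂` may be continued. -/
inductive Build (ok : List (Finset ℤ) → List (Finset ℤ) → Prop) (n : ℕ) :
    List Status → List (Finset ℤ) → Finset (Finset ℤ) → Prop
  | nil : Build ok n [] [] ∅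
  | both {u l D} (h : Build ok n u l D) : Build ok n (.both :: u) l (insert {(n - u.length : ℤ)} D)
  | cl {u l D} (h : Build ok n u l D) : Build ok n (.cl :: u) ({(n - u.length : ℤ)} :: l) D
  | tr {u l₁ N l₂ D} (h : Build ok n u (l₁ ++ N :: l₂) D) (hok : ok l₁ l₂) :
      Build ok n (.tr :: u) (insert (n - u.length : ℤ) N :: (l₁ ++ l₂)) D
  | op {u l₁ N l₂ D} (h : Build ok n u (l₁ ++ N :: l₂) D) (hok : ok l₁ l₂) :
      Build ok n (.op :: u) (l₁ ++ l₂) (insert (insert (n - u.length : ℤ) N) D)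

/-- Some element of `B` is smaller than all elements of `C`. -/
def MinLT (B C : Finset ℤ) : Prop := ∃ b ∈ B, ∀ c ∈ C, b < c

/-- The lists `l` and `D` form a partition of `{j, …, n}`. -/
structure Pieces (n : ℕ) (j : ℤ) (l : List (Finset ℤ)) (D : Finset (Finset ℤ)) : Prop where
  nonempty : ∀ B, B ∈ l ∨ B ∈ D → B.Nonempty
  range : ∀ B, B ∈ l ∨ B ∈ D → ∀ b ∈ B, j ≤ b ∧ b ≤ n
  eq_of_mem : ∀ B C, B ∈ l ∨ B ∈ D → C ∈ l ∨ C ∈ D → ∀ x, x ∈ B → x ∈ C → B = C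
  cover : ∀ i, j ≤ i → i ≤ n → ∃ B, (B ∈ l ∨ B ∈ D) ∧ i ∈ B
  sorted : l.Pairwise MinLT
  notMem : ∀ B ∈ l, B ∉ D

theorem MinLT.ne {B C : Finset ℤ} (h : MinLT B C) : B ≠ C := by
  rintro rfl
  obtain ⟨b, hb, h⟩ := h
  exact lt_irrefl b (h b hb)

theorem Pieces.nodup {n : ℕ} {j : ℤ} {l : List (Finset ℤ)} {D : Finset (Finset ℤ)}
    (h : Pieces n j l D) : l.Nodup := h.sorted.imp MinLT.ne

theorem mem_middle {α : Type*} {x N : α} {l₁ l₂ : List α} :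
    x ∈ l₁ ++ N :: l₂ ↔ x = N ∨ x ∈ l₁ ++ l₂ := by
  simp only [List.mem_append, List.mem_cons]; tauto

/-- The new element is smaller than everything read before, so the piece that receives it may be put
at the head of the list without disturbing the order by least elements. -/
theorem Build.pieces {ok : List (Finset ℤ) → List (Finset ℤ) → Prop} {n : ℕ} {u : List Status}
    {l : List (Finset ℤ)} {D : Finset (Finset ℤ)} (h : Build ok n u l D) :
    Pieces n (n - u.length + 1) l D := by
  have hlen : ∀ (s : Status) (u : List Status),
      (n : ℤ) - ((s :: u).length : ℕ) + 1 = n - u.length := by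
    intro s u; rw [List.length_cons]; push_cast; ring
  -- the new element is below all old pieces
  have hself : ∀ {u : List Status} {l D}, Pieces n (n - u.length + 1) l D → ∀ B, B ∈ l ∨ B ∈ D →
      (n - u.length : ℤ) ∉ B := fun hp B hB hm => by have := (hp.range B hB _ hm).1; omega
  -- inserting the new element into a piece
  have hjoin : ∀ {u : List Status} {l₁ N l₂ D}, Pieces n (n - u.length + 1) (l₁ ++ N :: l₂) D →
      ∀ {l' : List (Finset ℤ)} {D' : Finset (Finset ℤ)},
      (∀ B, B ∈ l' ∨ B ∈ D' ↔ B = insert (n - u.length : ℤ) N ∨ B ∈ l₁ ++ l₂ ∨ B ∈ D) →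
      l'.Pairwise MinLT → (∀ B ∈ l', B ∉ D') → Pieces n (n - u.length) l' D' := by
    intro u l₁ N l₂ D ih l' D' hmem hsort hnot
    have hN : N ∈ l₁ ++ N :: l₂ ∨ N ∈ D := Or.inl (mem_middle.2 (Or.inl rfl))
    have hnd := ih.nodup
    rw [List.nodup_middle, List.nodup_cons] at hnd
    have old : ∀ B, B ∈ l₁ ++ l₂ ∨ B ∈ D → (B ∈ l₁ ++ N :: l₂ ∨ B ∈ D) := fun B hB =>
      hB.imp_left fun h => mem_middle.2 (Or.inr h)
    have hNold : ¬ (N ∈ l₁ ++ l₂ ∨ N ∈ D) := by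
      rintro (h | h)
      · exact hnd.1 h
      · exact ih.notMem N (mem_middle.2 (Or.inl rfl)) h
    have hr : ∀ B, B = insert (n - u.length : ℤ) N ∨ B ∈ l₁ ++ l₂ ∨ B ∈ D → ∀ b ∈ B,
        (n - u.length : ℤ) ≤ b ∧ b ≤ n := by
      rintro B (rfl | hB) b hb
      · rcases Finset.mem_insert.1 hb with rfl | hb
        · omega
        · have := ih.range N hN b hb; omega
      · have := ih.range B (old B hB) b hb; omega
    refine ⟨?_, ?_, ?_, ?_, hsort, hnot⟩
    · intro B hB
      rw [hmem] at hB
      rcases hB with rfl | hB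
      · exact Finset.insert_nonempty _ _
      · exact ih.nonempty B (old B hB)
    · intro B hB
      rw [hmem] at hB
      exact hr B hB
    · intro B C hB hC x hx hx'
      rw [hmem] at hB hC
      have main : ∀ C, C ∈ l₁ ++ l₂ ∨ C ∈ D → x ∈ insert (n - u.length : ℤ) N → x ∉ C := by
        intro C hC hx hx'
        rcases Finset.mem_insert.1 hx with rfl | hx
        · exact hself ih C (old C hC) hx'
        · have := ih.eq_of_mem N C hN (old C hC) x hx hx'
          exact hNold (this ▸ hC)
      rcases hB with rfl | hB <;> rcases hC with rfl | hC
      · rfl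
      · exact absurd hx' (main C hC hx)
      · exact absurd hx (main B hB hx')
      · exact ih.eq_of_mem B C (old B hB) (old C hC) x hx hx'
    · intro i h1 h2
      rcases h1.eq_or_lt with rfl | h1
      · exact ⟨_, (hmem _).2 (Or.inl rfl), Finset.mem_insert_self _ _⟩
      · obtain ⟨B, hB, hi⟩ := ih.cover i (by omega) h2
        by_cases hBN : B = N
        · exact ⟨_, (hmem _).2 (Or.inl rfl), Finset.mem_insert_of_mem (hBN ▸ hi)⟩
        · refine ⟨B, (hmem _).2 (Or.inr ?_), hi⟩
          exact hB.imp_left fun h => (mem_middle.1 h).resolve_left hBN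
  induction h with
  | nil =>
    refine ⟨by simp, by simp, by simp, ?_, by simp, by simp⟩
    intro i h1 h2
    simp at h1
    omega
  | @both u l D h ih =>
    rw [hlen]
    refine ⟨?_, ?_, ?_, ?_, ih.sorted, ?_⟩
    · rintro B hB
      rw [Finset.mem_insert, or_left_comm] at hB
      rcases hB with rfl | hB
      · exact Finset.singleton_nonempty _
      · exact ih.nonempty B hB
    · rintro B hB b hb
      rw [Finset.mem_insert, or_left_comm] at hB
      rcases hB with rfl | hB
      · rw [Finset.mem_singleton] at hb; omega
      · have := ih.range B hB b hb; omega
    · intro B C hB hC x hx hx'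
      rw [Finset.mem_insert, or_left_comm] at hB hC
      rcases hB with rfl | hB <;> rcases hC with rfl | hC
      · rfl
      · rw [Finset.mem_singleton] at hx
        subst hx
        exact absurd hx' (hself ih C hC)
      · rw [Finset.mem_singleton] at hx'
        subst hx'
        exact absurd hx (hself ih B hB)
      · exact ih.eq_of_mem B C hB hC x hx hx'
    · intro i h1 h2
      rcases h1.eq_or_lt with rfl | h1
      · exact ⟨_, Or.inr (Finset.mem_insert_self _ _), Finset.mem_singleton_self _⟩
      · obtain ⟨B, hB, hi⟩ := ih.cover i (by omega) h2
        exact ⟨B, hB.imp_right Finset.mem_insert_of_mem, hi⟩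
    · intro B hB hB'
      rcases Finset.mem_insert.1 hB' with rfl | hB'
      · exact hself ih _ (Or.inl hB) (Finset.mem_singleton_self _)
      · exact ih.notMem B hB hB'
  | @cl u l D h ih =>
    rw [hlen]
    refine ⟨?_, ?_, ?_, ?_, ?_, ?_⟩
    · rintro B hB
      rw [List.mem_cons, or_assoc] at hB
      rcases hB with rfl | hB
      · exact Finset.singleton_nonempty _
      · exact ih.nonempty B hB
    · rintro B hB b hb
      rw [List.mem_cons, or_assoc] at hB
      rcases hB with rfl | hB
      · rw [Finset.mem_singleton] at hb; omega
      · have := ih.range B hB b hb; omega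
    · intro B C hB hC x hx hx'
      rw [List.mem_cons, or_assoc] at hB hC
      rcases hB with rfl | hB <;> rcases hC with rfl | hC
      · rfl
      · rw [Finset.mem_singleton] at hx
        subst hx
        exact absurd hx' (hself ih C hC)
      · rw [Finset.mem_singleton] at hx'
        subst hx'
        exact absurd hx (hself ih B hB)
      · exact ih.eq_of_mem B C hB hC x hx hx'
    · intro i h1 h2
      rcases h1.eq_or_lt with rfl | h1
      · exact ⟨_, Or.inl List.mem_cons_self, Finset.mem_singleton_self _⟩
      · obtain ⟨B, hB, hi⟩ := ih.cover i (by omega) h2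
        exact ⟨B, hB.imp_left (List.mem_cons_of_mem _), hi⟩
    · rw [List.pairwise_cons]
      refine ⟨fun B hB => ⟨_, Finset.mem_singleton_self _, fun c hc => ?_⟩, ih.sorted⟩
      have := (ih.range B (Or.inl hB) c hc).1
      omega
    · intro B hB hB'
      rcases List.mem_cons.1 hB with rfl | hB
      · exact hself ih _ (Or.inr hB') (Finset.mem_singleton_self _)
      · exact ih.notMem B hB hB'
  | @tr u l₁ N l₂ D h hok ih =>
    rw [hlen]
    apply hjoin ih
    · intro B; rw [List.mem_cons, or_assoc]
    · rw [List.pairwise_cons]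
      refine ⟨fun B hB => ⟨_, Finset.mem_insert_self _ _, fun c hc => ?_⟩,
        ih.sorted.sublist (List.Sublist.append_left (List.sublist_cons_self _ _) _)⟩
      have := (ih.range B (Or.inl (mem_middle.2 (Or.inr hB))) c hc).1
      omega
    · intro B hB hB'
      rcases List.mem_cons.1 hB with rfl | hB
      · exact hself ih _ (Or.inr hB') (Finset.mem_insert_self _ _)
      · exact ih.notMem B (mem_middle.2 (Or.inr hB)) hB'
  | @op u l₁ N l₂ D h hok ih =>
    rw [hlen]
    apply hjoin ih
    · intro B; rw [Finset.mem_insert, or_left_comm]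
    · exact ih.sorted.sublist (List.Sublist.append_left (List.sublist_cons_self _ _) _)
    · intro B hB hB'
      rcases Finset.mem_insert.1 hB' with rfl | hB'
      · exact hself ih _ (Or.inl (mem_middle.2 (Or.inr hB))) (Finset.mem_insert_self _ _)
      · exact ih.notMem B (mem_middle.2 (Or.inr hB)) hB'


/-- A piece is finished exactly when its least element is read. -/
theorem mem_opSet_iff {ok : List (Finset ℤ) → List (Finset ℤ) → Prop} {n : ℕ} {u : List Status}
    {l : List (Finset ℤ)} {D : Finset (Finset ℤ)} (h : Build ok n u l D) {i : ℤ} :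
    i ∈ opSet n u ↔ ∃ B ∈ D, IsLeast (B : Set ℤ) i := by
  induction h with
  | nil => simp [opSet]
  | @both u l D h ih =>
    simp only [opSet, Set.mem_insert_iff, ih, Finset.exists_mem_insert, Finset.coe_singleton]
    refine or_congr_left ⟨fun h => h ▸ isLeast_singleton, fun h => h.1⟩
  | @cl u l D h ih => simpa only [opSet] using ih
  | @tr u l₁ N l₂ D h hok ih => simpa only [opSet] using ih
  | @op u l₁ N l₂ D h hok ih =>
    simp only [opSet, Set.mem_insert_iff, ih, Finset.exists_mem_insert]
    refine or_congr_left ?_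
    have hleast : IsLeast ((insert (n - u.length : ℤ) N : Finset ℤ) : Set ℤ) (n - u.length) := by
      refine ⟨by simp, fun x hx => ?_⟩
      rcases Finset.mem_insert.1 (Finset.mem_coe.1 hx) with rfl | hx
      · exact le_rfl
      · have := (h.pieces.range N (Or.inl (mem_middle.2 (Or.inl rfl))) x hx).1
        omega
    exact ⟨fun e => e ▸ hleast, fun h => h.unique hleast⟩

theorem isGreatest_insert_iff {N : Finset ℤ} {a i : ℤ} (hN : N.Nonempty) (h : ∀ x ∈ N, a < x) :
    IsGreatest ((insert a N : Finset ℤ) : Set ℤ) i ↔ IsGreatest (N : Set ℤ) i := by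
  obtain ⟨y, hy⟩ := hN
  constructor
  · rintro ⟨h1, h2⟩
    rcases Finset.mem_insert.1 (Finset.mem_coe.1 h1) with rfl | h1
    · exact absurd (h2 (Finset.mem_coe.2 (Finset.mem_insert_of_mem hy))) (not_le.2 (h y hy))
    · exact ⟨h1, fun x hx => h2 (Finset.mem_coe.2 (Finset.mem_insert_of_mem hx))⟩
  · rintro ⟨h1, h2⟩
    refine ⟨Finset.mem_coe.2 (Finset.mem_insert_of_mem h1), fun x hx => ?_⟩
    rcases Finset.mem_insert.1 (Finset.mem_coe.1 hx) with rfl | hx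
    · exact (h i h1).le
    · exact h2 hx

/-- Elements are added at the lower end, so the greatest element of a piece, finished or not, is the
one that started it. -/
theorem mem_clSet_iff {ok : List (Finset ℤ) → List (Finset ℤ) → Prop} {n : ℕ} {u : List Status}
    {l : List (Finset ℤ)} {D : Finset (Finset ℤ)} (h : Build ok n u l D) {i : ℤ} :
    i ∈ clSet n u ↔ ∃ B, (B ∈ l ∨ B ∈ D) ∧ IsGreatest (B : Set ℤ) i := by
  have hsing : ∀ {x : ℤ}, i = x ↔ IsGreatest (({x} : Finset ℤ) : Set ℤ) i := by
    intro x
    rw [Finset.coe_singleton]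
    exact ⟨fun h => h ▸ isGreatest_singleton, fun h => h.1⟩
  induction h with
  | nil => simp [clSet]
  | @both u l D h ih =>
    rw [clSet, Set.mem_insert_iff, show i ∈ clSet n u ↔ _ from ih, hsing]
    constructor
    · rintro (h | ⟨B, hB, h⟩)
      · exact ⟨_, Or.inr (Finset.mem_insert_self _ _), h⟩
      · exact ⟨B, hB.imp_right Finset.mem_insert_of_mem, h⟩
    · rintro ⟨B, hB | hB, h⟩
      · exact Or.inr ⟨B, Or.inl hB, h⟩
      · rcases Finset.mem_insert.1 hB with rfl | hB
        · exact Or.inl h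
        · exact Or.inr ⟨B, Or.inr hB, h⟩
  | @cl u l D h ih =>
    rw [clSet, Set.mem_insert_iff, show i ∈ clSet n u ↔ _ from ih, hsing]
    constructor
    · rintro (h | ⟨B, hB, h⟩)
      · exact ⟨_, Or.inl List.mem_cons_self, h⟩
      · exact ⟨B, hB.imp_left (List.mem_cons_of_mem _), h⟩
    · rintro ⟨B, hB | hB, h⟩
      · rcases List.mem_cons.1 hB with rfl | hB
        · exact Or.inl h
        · exact Or.inr ⟨B, Or.inl hB, h⟩
      · exact Or.inr ⟨B, Or.inr hB, h⟩
  | @tr u l₁ N l₂ D h hok ih =>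
    have hN : N ∈ l₁ ++ N :: l₂ ∨ N ∈ D := Or.inl (mem_middle.2 (Or.inl rfl))
    have key := isGreatest_insert_iff (a := n - u.length) (i := i) (h.pieces.nonempty N hN)
      (fun x hx => by have := (h.pieces.range N hN x hx).1; omega)
    rw [clSet, show i ∈ clSet n u ↔ _ from ih]
    constructor
    · rintro ⟨B, hB | hB, hg⟩
      · rcases mem_middle.1 hB with rfl | hB
        · exact ⟨_, Or.inl List.mem_cons_self, key.2 hg⟩
        · exact ⟨B, Or.inl (List.mem_cons_of_mem _ hB), hg⟩
      · exact ⟨B, Or.inr hB, hg⟩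
    · rintro ⟨B, hB | hB, hg⟩
      · rcases List.mem_cons.1 hB with rfl | hB
        · exact ⟨_, hN, key.1 hg⟩
        · exact ⟨B, Or.inl (mem_middle.2 (Or.inr hB)), hg⟩
      · exact ⟨B, Or.inr hB, hg⟩
  | @op u l₁ N l₂ D h hok ih =>
    have hN : N ∈ l₁ ++ N :: l₂ ∨ N ∈ D := Or.inl (mem_middle.2 (Or.inl rfl))
    have key := isGreatest_insert_iff (a := n - u.length) (i := i) (h.pieces.nonempty N hN)
      (fun x hx => by have := (h.pieces.range N hN x hx).1; omega)
    rw [clSet, show i ∈ clSet n u ↔ _ from ih]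
    constructor
    · rintro ⟨B, hB | hB, hg⟩
      · rcases mem_middle.1 hB with rfl | hB
        · exact ⟨_, Or.inr (Finset.mem_insert_self _ _), key.2 hg⟩
        · exact ⟨B, Or.inl hB, hg⟩
      · exact ⟨B, Or.inr (Finset.mem_insert_of_mem hB), hg⟩
    · rintro ⟨B, hB | hB, hg⟩
      · exact ⟨B, Or.inl (mem_middle.2 (Or.inr hB)), hg⟩
      · rcases Finset.mem_insert.1 hB with rfl | hB
        · exact ⟨_, hN, key.1 hg⟩
        · exact ⟨B, Or.inr hB, hg⟩

/-- A letter can be read unless it asks for an unfinished piece when there is none, and it changes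
the number of unfinished pieces in the same way under every rule. -/
theorem Build.exists_of_build {ok ok' : List (Finset ℤ) → List (Finset ℤ) → Prop}
    (hok' : ∀ l : List (Finset ℤ), l ≠ [] → ∃ l₁ N l₂, l = l₁ ++ N :: l₂ ∧ ok' l₁ l₂) {n : ℕ}
    {u : List Status} {l : List (Finset ℤ)} {D : Finset (Finset ℤ)} (h : Build ok n u l D) :
    ∃ l' D', Build ok' n u l' D' ∧ l'.length = l.length := by
  induction h with
  | nil => exact ⟨_, _, .nil, rfl⟩
  | both h ih =>
    obtain ⟨l', D', h', hl⟩ := ih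
    exact ⟨_, _, h'.both, hl⟩
  | cl h ih =>
    obtain ⟨l', D', h', hl⟩ := ih
    exact ⟨_, _, h'.cl, by simp [hl]⟩
  | tr h hok ih =>
    obtain ⟨l', D', h', hl⟩ := ih
    obtain ⟨a, N, b, rfl, hab⟩ := hok' l' (by rintro rfl; simp at hl)
    refine ⟨_, _, h'.tr hab, ?_⟩
    simp only [List.length_append, List.length_cons] at hl ⊢
    omega
  | op h hok ih =>
    obtain ⟨l', D', h', hl⟩ := ih
    obtain ⟨a, N, b, rfl, hab⟩ := hok' l' (by rintro rfl; simp at hl)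
    refine ⟨_, _, h'.op hab, ?_⟩
    simp only [List.length_append, List.length_cons] at hl ⊢
    omega

/-- The rule for noncrossing partitions: the first block of the list is continued. -/
abbrev BuildNC := Build (fun l₁ _ => l₁ = [])

/-- The rule for nonnesting partitions: the last block of the list is continued. -/
abbrev BuildNN := Build (fun _ l₂ => l₂ = [])

theorem BuildNN.exists_NC {n : ℕ} {u : List Status} {l : List (Finset ℤ)} {D : Finset (Finset ℤ)}
    (h : BuildNN n u l D) : ∃ l' D', BuildNC n u l' D' ∧ l'.length = l.length := by
  refine Build.exists_of_build (fun l hl => ?_) h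
  obtain ⟨N, l₂, rfl⟩ := List.exists_cons_of_ne_nil hl
  exact ⟨[], N, l₂, rfl, rfl⟩

theorem BuildNC.exists_NN {n : ℕ} {u : List Status} {l : List (Finset ℤ)} {D : Finset (Finset ℤ)}
    (h : BuildNC n u l D) : ∃ l' D', BuildNN n u l' D' ∧ l'.length = l.length := by
  refine Build.exists_of_build (fun l hl => ?_) h
  exact ⟨l.dropLast, l.getLast hl, [], (List.dropLast_append_getLast hl).symm, rfl⟩

/-- The rule leaves no choice, so the pieces are a function of the word. -/
theorem BuildNC.unique {n : ℕ} {u : List Status} {l : List (Finset ℤ)} {D : Finset (Finset ℤ)}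
    (h : BuildNC n u l D) : ∀ {l' D'}, BuildNC n u l' D' → l' = l ∧ D' = D := by
  induction h with
  | nil => rintro l' D' ⟨⟩; exact ⟨rfl, rfl⟩
  | both h ih =>
    rintro l' D' h'
    cases h' with
    | both h' => obtain ⟨rfl, rfl⟩ := ih h'; exact ⟨rfl, rfl⟩
  | cl h ih =>
    rintro l' D' h'
    cases h' with
    | cl h' => obtain ⟨rfl, rfl⟩ := ih h'; exact ⟨rfl, rfl⟩
  | tr h hok ih =>
    rintro l' D' h'
    subst hok
    cases h' with
    | tr h' hok' =>
      subst hok'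
      obtain ⟨h1, rfl⟩ := ih h'
      simp only [List.nil_append, List.cons.injEq] at h1
      obtain ⟨rfl, rfl⟩ := h1
      exact ⟨rfl, rfl⟩
  | op h hok ih =>
    rintro l' D' h'
    subst hok
    cases h' with
    | op h' hok' =>
      subst hok'
      obtain ⟨h1, rfl⟩ := ih h'
      simp only [List.nil_append, List.cons.injEq] at h1
      obtain ⟨rfl, rfl⟩ := h1
      exact ⟨rfl, rfl⟩

/-- The part of `B` in `{j, …, n}` is `N`, and `B` has further elements. -/
def Carry (j : ℤ) (B N : Finset ℤ) : Prop := N ⊆ B ∧ (∀ x ∈ B, j ≤ x → x ∈ N) ∧ ∃ x ∈ B, x < j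

/-- The family `D ∪ Y` completes the pieces `l`, `D` to a `B_n`-partition. -/
structure Config (n : ℕ) (j : ℤ) (l : List (Finset ℤ)) (D Y : Finset (Finset ℤ)) : Prop where
  signed : SignedPart n (D ∪ Y)
  carry : ∀ B ∈ pm Y, (∀ x ∈ B, x < j) ∨ ∃ N ∈ l, Carry j B N
  exists_carry : ∀ N ∈ l, ∃ B ∈ pm Y, Carry j B N

section data

variable {ok : List (Finset ℤ) → List (Finset ℤ) → Prop} {n : ℕ} {u : List Status}
  {l : List (Finset ℤ)} {D Y : Finset (Finset ℤ)}

/-- The block of an unfinished piece has elements below `j`, and the negative of a finished piece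
has no positive elements; so only finished pieces have their least element in the part already read.
-/
theorem Config.least_iff (hb : Build ok n u l D) (hc : Config n (n - u.length + 1) l D Y)
    (hu : u.length ≤ n) {i : ℤ} (hi : n - u.length < i) :
    (∃ B ∈ pm (D ∪ Y), IsLeast (B : Set ℤ) i) ↔ i ∈ opSet n u := by
  rw [mem_opSet_iff hb]
  constructor
  · rintro ⟨B, hB, hl⟩
    have hiB : i ∈ B := Finset.mem_coe.1 hl.1
    rw [pm_union, Finset.mem_union, mem_pm] at hB
    rcases hB with (hB | hB) | hB
    · exact ⟨B, hB, hl⟩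
    · have := (hb.pieces.range _ (Or.inr hB) (-i) (by rwa [mem_neg, neg_neg])).1
      omega
    · rcases hc.carry B hB with h | ⟨N, -, -, -, x, hx, hxj⟩
      · have := h i hiB; omega
      · have := hl.2 (Finset.mem_coe.2 hx); omega
  · rintro ⟨B, hB, hl⟩
    exact ⟨B, by rw [pm_union, Finset.mem_union, mem_pm]; exact Or.inl (Or.inl hB), hl⟩

/-- Besides its unfinished piece, a block has only elements below those of the piece, so both have
the same greatest element. -/
theorem Config.greatest_iff (hb : Build ok n u l D) (hc : Config n (n - u.length + 1) l D Y)
    (hu : u.length ≤ n) {i : ℤ} (hi : n - u.length < i) :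
    (∃ B ∈ pm (D ∪ Y), IsGreatest (B : Set ℤ) i) ↔ i ∈ clSet n u := by
  rw [mem_clSet_iff hb]
  have carried : ∀ {B N : Finset ℤ}, Carry (n - u.length + 1) B N → N.Nonempty →
      (∀ x ∈ N, (n - u.length + 1 : ℤ) ≤ x) → (IsGreatest (B : Set ℤ) i ↔ IsGreatest (N : Set ℤ) i) := by
    rintro B N ⟨h1, h2, -⟩ ⟨y, hy⟩ h3
    constructor
    · rintro ⟨h4, h5⟩
      exact ⟨h2 i (Finset.mem_coe.1 h4) (by omega), fun x hx => h5 (h1 hx)⟩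
    · rintro ⟨h4, h5⟩
      refine ⟨h1 h4, fun x hx => ?_⟩
      by_cases hxj : (n - u.length + 1 : ℤ) ≤ x
      · exact h5 (h2 x hx hxj)
      · omega
  constructor
  · rintro ⟨B, hB, hl⟩
    have hiB : i ∈ B := Finset.mem_coe.1 hl.1
    rw [pm_union, Finset.mem_union, mem_pm] at hB
    rcases hB with (hB | hB) | hB
    · exact ⟨B, Or.inr hB, hl⟩
    · have := (hb.pieces.range _ (Or.inr hB) (-i) (by rwa [mem_neg, neg_neg])).1
      omega
    · rcases hc.carry B hB with h | ⟨N, hN, hcar⟩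
      · have := h i hiB; omega
      · exact ⟨N, Or.inl hN, (carried hcar (hb.pieces.nonempty N (Or.inl hN))
          (fun x hx => (hb.pieces.range N (Or.inl hN) x hx).1)).1 hl⟩
  · rintro ⟨B, hB | hB, hl⟩
    · obtain ⟨B', hB', hcar⟩ := hc.exists_carry B hB
      refine ⟨B', by rw [pm_union, Finset.mem_union]; exact Or.inr hB', ?_⟩
      exact (carried hcar (hb.pieces.nonempty B (Or.inl hB))
          (fun x hx => (hb.pieces.range B (Or.inl hB) x hx).1)).2 hl
    · exact ⟨B, by rw [pm_union, Finset.mem_union, mem_pm]; exact Or.inl (Or.inl hB), hl⟩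

theorem Config.openers_eq (hb : Build ok n u l D) (hc : Config n 1 l D Y) (hu : u.length = n) :
    openers (pm (D ∪ Y)) = opSet n u := by
  have hc' : Config n (n - u.length + 1) l D Y := by rwa [hu, sub_self, zero_add]
  ext i
  rw [mem_openers_iff]
  constructor
  · rintro ⟨h1, h2⟩
    exact (Config.least_iff hb hc' hu.le (by omega)).1 h2
  · intro h
    have := lt_of_mem_opSet h
    rw [hu, sub_self] at this
    exact ⟨this, (Config.least_iff hb hc' hu.le (by omega)).2 h⟩

theorem Config.closers_eq (hb : Build ok n u l D) (hc : Config n 1 l D Y) (hu : u.length = n) :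
    closers (pm (D ∪ Y)) = clSet n u := by
  have hc' : Config n (n - u.length + 1) l D Y := by rwa [hu, sub_self, zero_add]
  ext i
  rw [mem_closers_iff hc.signed.isBPartition]
  constructor
  · rintro ⟨h1, h2⟩
    exact (Config.greatest_iff hb hc' hu.le (by omega)).1 h2
  · intro h
    have := lt_of_mem_clSet h
    rw [hu, sub_self] at this
    exact ⟨this, (Config.greatest_iff hb hc' hu.le (by omega)).2 h⟩

/-- A word can be recovered from a partition built from it. -/
theorem Config.word_unique {ok' : List (Finset ℤ) → List (Finset ℤ) → Prop} {v : List Status}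
    {l' : List (Finset ℤ)} {D' Y' : Finset (Finset ℤ)} (hb : Build ok n u l D)
    (hc : Config n (n - u.length + 1) l D Y) (hb' : Build ok' n v l' D')
    (hc' : Config n (n - v.length + 1) l' D' Y') (huv : u.length = v.length) (hu : u.length ≤ n)
    (h : pm (D ∪ Y) = pm (D' ∪ Y')) : u = v := by
  apply word_ext huv
  · ext i
    constructor <;> intro hi
    · have := lt_of_mem_opSet hi
      rw [← Config.least_iff hb' hc' (huv ▸ hu) (huv ▸ this), ← h]
      exact (Config.least_iff hb hc hu this).2 hi
    · have := lt_of_mem_opSet hi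
      rw [← Config.least_iff hb hc hu (huv ▸ this), h]
      exact (Config.least_iff hb' hc' (huv ▸ hu) this).2 hi
  · ext i
    constructor <;> intro hi
    · have := lt_of_mem_clSet hi
      rw [← Config.greatest_iff hb' hc' (huv ▸ hu) (huv ▸ this), ← h]
      exact (Config.greatest_iff hb hc hu this).2 hi
    · have := lt_of_mem_clSet hi
      rw [← Config.greatest_iff hb hc hu (huv ▸ this), h]
      exact (Config.greatest_iff hb' hc' (huv ▸ hu) this).2 hi

end data

/-! ### Pairing the unfinished pieces -/

/-- The mixed block with positive part `p.1` and negative part `-p.2`. -/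
def pr (p : Finset ℤ × Finset ℤ) : Finset ℤ := p.1 ∪ neg p.2

theorem mem_pr {p : Finset ℤ × Finset ℤ} {x : ℤ} : x ∈ pr p ↔ x ∈ p.1 ∨ -x ∈ p.2 := by
  rw [pr, Finset.mem_union, mem_neg]

theorem neg_pr (p : Finset ℤ × Finset ℤ) : neg (pr p) = pr p.swap := by
  ext x; rw [mem_neg, mem_pr, mem_pr, neg_neg, or_comm]; rfl

/-- The mixed blocks obtained from a list of pairs. -/
def cross (ps : List (Finset ℤ × Finset ℤ)) : Finset (Finset ℤ) := (ps.map pr).toFinset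

theorem mem_cross {ps : List (Finset ℤ × Finset ℤ)} {B : Finset ℤ} :
    B ∈ cross ps ↔ ∃ p ∈ ps, pr p = B := by
  simp [cross]

theorem nodup_pairs {ps : List (Finset ℤ × Finset ℤ)} {c : List (Finset ℤ)}
    (h : (ps.map Prod.fst ++ ps.map Prod.snd ++ c).Nodup) :
    (∀ p ∈ ps, ∀ q ∈ ps, p.1 = q.1 → p = q) ∧ (∀ p ∈ ps, ∀ q ∈ ps, p.2 = q.2 → p = q) ∧
    (∀ p ∈ ps, ∀ q ∈ ps, p.1 ≠ q.2) ∧ ∀ p ∈ ps, p.1 ∉ c ∧ p.2 ∉ c := by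
  rw [List.nodup_append', List.nodup_append'] at h
  obtain ⟨⟨h1, h2, h3⟩, -, h4⟩ := h
  refine ⟨fun p hp q hq e => List.inj_on_of_nodup_map h1 hp hq e,
    fun p hp q hq e => List.inj_on_of_nodup_map h2 hp hq e, fun p hp q hq e => ?_, fun p hp => ?_⟩
  · exact h3 (List.mem_map_of_mem hp) (e ▸ List.mem_map_of_mem hq)
  · exact ⟨fun hc => h4 (List.mem_append_left _ (List.mem_map_of_mem hp)) hc,
      fun hc => h4 (List.mem_append_right _ (List.mem_map_of_mem hp)) hc⟩

/-- `C` holds at most one block, the central one, made of the pieces in `c` and of elements of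
absolute value less than `j`. An element of absolute value at least `j` belongs, up to sign, to one
piece only, and each piece is used by one block only; this gives the disjointness of the blocks. -/
theorem config_of_pairs {n : ℕ} {j : ℤ} {l : List (Finset ℤ)} {D : Finset (Finset ℤ)}
    (hP : Pieces n j l D) (hj : 1 ≤ j) {ps : List (Finset ℤ × Finset ℤ)} {c : List (Finset ℤ)}
    (hl : l.Perm (ps.map Prod.fst ++ ps.map Prod.snd ++ c)) {C : Finset (Finset ℤ)}
    (hne : ∀ K ∈ C, K.Nonempty) (hone : ∀ K ∈ C, ∀ K' ∈ C, K = K')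
    (hcar : ∀ K ∈ C, ∀ x ∈ K, x ≠ 0 ∧ ((|x| < j ∧ |x| ≤ n) ∨ ∃ N ∈ c, |x| ∈ N))
    (hcov : ∀ i : ℤ, 1 ≤ i → i ≤ n → (i < j ∨ ∃ N ∈ c, i ∈ N) → ∃ K ∈ C, i ∈ K ∨ -i ∈ K)
    (hsign : ∀ K ∈ C, ∀ x ∈ K, -x ∈ K → neg K = K)
    (hcarry : ∀ K ∈ pm C, (∀ x ∈ K, x < j) ∨ ∃ N ∈ c, Carry j K N)
    (hex : ∀ N ∈ c, ∃ K ∈ pm C, Carry j K N) : Config n j l D (cross ps ∪ C) := by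
  have hnd := nodup_pairs (hl.nodup_iff.1 hP.nodup)
  obtain ⟨n1, n2, n3, n4⟩ := hnd
  have hml : ∀ N, N ∈ l ↔ (∃ p ∈ ps, N = p.1 ∨ N = p.2) ∨ N ∈ c := by
    intro N
    rw [hl.mem_iff]
    simp only [List.mem_append, List.mem_map]
    constructor
    · rintro ((⟨p, hp, rfl⟩ | ⟨p, hp, rfl⟩) | h)
      · exact Or.inl ⟨p, hp, Or.inl rfl⟩
      · exact Or.inl ⟨p, hp, Or.inr rfl⟩
      · exact Or.inr h
    · rintro (⟨p, hp, rfl | rfl⟩ | h)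
      · exact Or.inl (Or.inl ⟨p, hp, rfl⟩)
      · exact Or.inl (Or.inr ⟨p, hp, rfl⟩)
      · exact Or.inr h
  have hp1 : ∀ p ∈ ps, p.1 ∈ l := fun p hp => (hml _).2 (Or.inl ⟨p, hp, Or.inl rfl⟩)
  have hp2 : ∀ p ∈ ps, p.2 ∈ l := fun p hp => (hml _).2 (Or.inl ⟨p, hp, Or.inr rfl⟩)
  have hcl : ∀ N ∈ c, N ∈ l := fun N hN => (hml _).2 (Or.inr hN)
  have hposl : ∀ N ∈ l, ∀ x ∈ N, j ≤ x ∧ x ≤ n := fun N hN => hP.range N (Or.inl hN)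
  have hposD : ∀ N ∈ D, ∀ x ∈ N, j ≤ x ∧ x ≤ n := fun N hN => hP.range N (Or.inr hN)
  have hprabs : ∀ p ∈ ps, ∀ x ∈ pr p, (x ∈ p.1 ∧ |x| = x) ∨ (-x ∈ p.2 ∧ |x| = -x) := by
    intro p hp x hx
    rcases mem_pr.1 hx with h | h
    · have := hposl _ (hp1 p hp) x h
      exact Or.inl ⟨h, abs_of_pos (by omega)⟩
    · have := hposl _ (hp2 p hp) _ h
      exact Or.inr ⟨h, abs_of_neg (by omega)⟩
  -- the piece to which an element belongs
  have own : ∀ B ∈ D ∪ (cross ps ∪ C), ∀ b ∈ B, (|b| < j ∧ B ∈ C) ∨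
      ∃ N, |b| ∈ N ∧ ((B = N ∧ N ∈ D) ∨ (∃ p ∈ ps, B = pr p ∧ (N = p.1 ∨ N = p.2)) ∨
        (B ∈ C ∧ N ∈ c)) := by
    intro B hB b hb
    rw [Finset.mem_union, Finset.mem_union] at hB
    rcases hB with hB | hB | hB
    · have := hposD B hB b hb
      exact Or.inr ⟨B, by rwa [abs_of_pos (by omega)], Or.inl ⟨rfl, hB⟩⟩
    · obtain ⟨p, hp, rfl⟩ := mem_cross.1 hB
      rcases hprabs p hp b hb with ⟨h, e⟩ | ⟨h, e⟩
      · exact Or.inr ⟨p.1, by rwa [e], Or.inr (Or.inl ⟨p, hp, rfl, Or.inl rfl⟩)⟩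
      · exact Or.inr ⟨p.2, by rwa [e], Or.inr (Or.inl ⟨p, hp, rfl, Or.inr rfl⟩)⟩
    · rcases (hcar B hB b hb).2 with h | ⟨N, hN, h⟩
      · exact Or.inl ⟨h.1, hB⟩
      · exact Or.inr ⟨N, h, Or.inr (Or.inr ⟨hB, hN⟩)⟩
  have ownl : ∀ {B N}, ((B = N ∧ N ∈ D) ∨ (∃ p ∈ ps, B = pr p ∧ (N = p.1 ∨ N = p.2)) ∨
        (B ∈ C ∧ N ∈ c)) → N ∈ l ∨ N ∈ D := by
    rintro B N (⟨-, h⟩ | ⟨p, hp, -, rfl | rfl⟩ | ⟨-, h⟩)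
    · exact Or.inr h
    · exact Or.inl (hp1 p hp)
    · exact Or.inl (hp2 p hp)
    · exact Or.inl (hcl N h)
  have nosign : ∀ B ∈ D ∪ cross ps, ∀ b ∈ B, -b ∉ B := by
    intro B hB b hb hb'
    rw [Finset.mem_union] at hB
    rcases hB with hB | hB
    · have := hposD B hB b hb; have := hposD B hB _ hb'; omega
    · obtain ⟨p, hp, rfl⟩ := mem_cross.1 hB
      rw [mem_pr] at hb hb'
      rw [neg_neg] at hb'
      rcases hb with hb | hb <;> rcases hb' with hb' | hb'
      · have := hposl _ (hp1 p hp) _ hb; have := hposl _ (hp1 p hp) _ hb'; omega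
      · exact n3 p hp p hp (hP.eq_of_mem _ _ (Or.inl (hp1 p hp)) (Or.inl (hp2 p hp)) b hb hb')
      · exact n3 p hp p hp (hP.eq_of_mem _ _ (Or.inl (hp1 p hp)) (Or.inl (hp2 p hp)) (-b) hb' hb)
      · have := hposl _ (hp2 p hp) _ hb; have := hposl _ (hp2 p hp) _ hb'; omega
  have hnonempty : ∀ B ∈ D ∪ (cross ps ∪ C), B.Nonempty := by
    intro B hB
    rw [Finset.mem_union, Finset.mem_union] at hB
    rcases hB with hB | hB | hB
    · exact hP.nonempty B (Or.inr hB)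
    · obtain ⟨p, hp, rfl⟩ := mem_cross.1 hB
      exact (hP.nonempty _ (Or.inl (hp1 p hp))).mono Finset.subset_union_left
    · exact hne B hB
  refine ⟨⟨hnonempty, ?_, ?_, ?_, ?_, ?_⟩, ?_, ?_⟩
  · intro B hB b hb
    rw [mem_ground]
    have h0 : b ≠ 0 ∧ |b| ≤ n := by
      rw [Finset.mem_union, Finset.mem_union] at hB
      rcases hB with hB | hB | hB
      · have := hposD B hB b hb
        exact ⟨by omega, by rw [abs_of_pos (by omega)]; omega⟩
      · obtain ⟨p, hp, rfl⟩ := mem_cross.1 hB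
        rcases hprabs p hp b hb with ⟨h, e⟩ | ⟨h, e⟩
        · have := hposl _ (hp1 p hp) _ h
          exact ⟨by omega, by omega⟩
        · have := hposl _ (hp2 p hp) _ h
          exact ⟨by omega, by omega⟩
      · obtain ⟨h1, h2⟩ := hcar B hB b hb
        refine ⟨h1, ?_⟩
        rcases h2 with h2 | ⟨N, hN, h2⟩
        · exact h2.2
        · exact (hposl N (hcl N hN) _ h2).2
    have := abs_le.1 h0.2
    exact ⟨h0.1, this.1, this.2⟩
  · intro B hB B' hB' b hb b' hb' e
    rcases own B hB b hb with ⟨h1, h2⟩ | ⟨N, hN, h⟩ <;>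
      rcases own B' hB' b' hb' with ⟨h1', h2'⟩ | ⟨N', hN', h'⟩
    · exact hone B h2 B' h2'
    · have := (hP.range N' (ownl h') _ hN').1
      omega
    · have := (hP.range N (ownl h) _ hN).1
      omega
    · have eN : N = N' := hP.eq_of_mem N N' (ownl h) (ownl h') _ hN (e ▸ hN')
      subst eN
      rcases h with ⟨rfl, h⟩ | ⟨p, hp, rfl, hN1⟩ | ⟨h1, h2⟩ <;>
        rcases h' with ⟨rfl, h'⟩ | ⟨q, hq, rfl, hN2⟩ | ⟨h1', h2'⟩
      · rfl
      · rcases hN2 with rfl | rfl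
        · exact absurd h (hP.notMem _ (hp1 q hq))
        · exact absurd h (hP.notMem _ (hp2 q hq))
      · exact absurd h (hP.notMem _ (hcl _ h2'))
      · rcases hN1 with rfl | rfl
        · exact absurd h' (hP.notMem _ (hp1 p hp))
        · exact absurd h' (hP.notMem _ (hp2 p hp))
      · rcases hN1 with rfl | rfl <;> rcases hN2 with e2 | e2
        · rw [n1 p hp q hq e2]
        · exact absurd e2 (n3 p hp q hq)
        · exact absurd e2.symm (n3 q hq p hp)
        · rw [n2 p hp q hq e2]
      · rcases hN1 with rfl | rfl
        · exact absurd h2' (n4 p hp).1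
        · exact absurd h2' (n4 p hp).2
      · exact absurd h' (hP.notMem _ (hcl _ h2))
      · rcases hN2 with rfl | rfl
        · exact absurd h2 (n4 q hq).1
        · exact absurd h2 (n4 q hq).2
      · exact hone B h1 B' h1'
  · intro i h1 h2
    have fromC : (i < j ∨ ∃ N ∈ c, i ∈ N) → ∃ B ∈ D ∪ (cross ps ∪ C), i ∈ B ∨ -i ∈ B := by
      intro h
      obtain ⟨K, hK, h⟩ := hcov i h1 h2 h
      exact ⟨K, by simp [hK], h⟩
    by_cases hij : i < j
    · exact fromC (Or.inl hij)
    · obtain ⟨N, hN, hi⟩ := hP.cover i (by omega) h2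
      rw [hml] at hN
      rcases hN with (⟨p, hp, rfl | rfl⟩ | hN) | hN
      · exact ⟨pr p, by simp only [Finset.mem_union, mem_cross]; exact Or.inr (Or.inl ⟨p, hp, rfl⟩),
          Or.inl (mem_pr.2 (Or.inl hi))⟩
      · exact ⟨pr p, by simp only [Finset.mem_union, mem_cross]; exact Or.inr (Or.inl ⟨p, hp, rfl⟩),
          Or.inr (mem_pr.2 (Or.inr (by rwa [neg_neg])))⟩
      · exact fromC (Or.inr ⟨N, hN, hi⟩)
      · exact ⟨N, by simp [hN], Or.inl hi⟩
  · intro B hB b hb hb'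
    rw [← Finset.union_assoc, Finset.mem_union] at hB
    rcases hB with hB | hB
    · exact absurd hb' (nosign B hB b hb)
    · exact hsign B hB b hb hb'
  · have : ∀ B ∈ D ∪ (cross ps ∪ C), neg B = B → B ∈ C := by
      intro B hB hz
      obtain ⟨b, hb⟩ := hnonempty B hB
      rw [← Finset.union_assoc, Finset.mem_union] at hB
      refine hB.resolve_left fun hB => ?_
      exact nosign B hB b hb (by rw [← hz, mem_neg, neg_neg]; exact hb)
    intro B hB B' hB' hz hz'
    exact hone B (this B hB hz) B' (this B' hB' hz')
  · intro B hB
    rw [pm_union, Finset.mem_union, mem_pm, mem_cross, mem_cross] at hB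
    have key : ∀ N ∈ l, ∀ N' ∈ l, Carry j (pr (N, N')) N := by
      intro N hN N' hN'
      refine ⟨fun x hx => mem_pr.2 (Or.inl hx), fun x hx hxj => ?_, ?_⟩
      · rcases mem_pr.1 hx with h | h
        · exact h
        · have := hposl _ hN' _ h
          omega
      · obtain ⟨y, hy⟩ := hP.nonempty N' (Or.inl hN')
        have := hposl _ hN' _ hy
        exact ⟨-y, mem_pr.2 (Or.inr (by rwa [neg_neg])), by omega⟩
    rcases hB with (⟨p, hp, rfl⟩ | ⟨p, hp, e⟩) | hB
    · exact Or.inr ⟨p.1, hp1 p hp, key _ (hp1 p hp) _ (hp2 p hp)⟩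
    · rw [← neg_neg_block B, ← e, neg_pr]
      exact Or.inr ⟨p.2, hp2 p hp, key _ (hp2 p hp) _ (hp1 p hp)⟩
    · rcases hcarry B hB with h | ⟨N, hN, h⟩
      · exact Or.inl h
      · exact Or.inr ⟨N, hcl N hN, h⟩
  · intro N hN
    have key : ∀ N ∈ l, ∀ N' ∈ l, Carry j (pr (N, N')) N := by
      intro N hN N' hN'
      refine ⟨fun x hx => mem_pr.2 (Or.inl hx), fun x hx hxj => ?_, ?_⟩
      · rcases mem_pr.1 hx with h | h
        · exact h
        · have := hposl _ hN' _ h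
          omega
      · obtain ⟨y, hy⟩ := hP.nonempty N' (Or.inl hN')
        have := hposl _ hN' _ hy
        exact ⟨-y, mem_pr.2 (Or.inr (by rwa [neg_neg])), by omega⟩
    rcases (hml N).1 hN with ⟨p, hp, rfl | rfl⟩ | h
    · refine ⟨pr p, ?_, key _ (hp1 p hp) _ (hp2 p hp)⟩
      rw [pm_union, Finset.mem_union, mem_pm, mem_cross]
      exact Or.inl (Or.inl ⟨p, hp, rfl⟩)
    · refine ⟨pr p.swap, ?_, key _ (hp2 p hp) _ (hp1 p hp)⟩
      rw [pm_union, Finset.mem_union, mem_pm, mem_cross, mem_cross]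
      exact Or.inl (Or.inr ⟨p, hp, by rw [neg_pr, Prod.swap_swap]⟩)
    · obtain ⟨K, hK, h⟩ := hex N h
      exact ⟨K, by rw [pm_union, Finset.mem_union]; exact Or.inr hK, h⟩


/-- A configuration with one central block made of `U`, `-V` and some elements of absolute value
less than `j`. -/
theorem config_of_center {n : ℕ} {j : ℤ} {l : List (Finset ℤ)} {D : Finset (Finset ℤ)}
    (hP : Pieces n j l D) (hj : 1 ≤ j) {ps : List (Finset ℤ × Finset ℤ)} {c : List (Finset ℤ)}
    (hl : l.Perm (ps.map Prod.fst ++ ps.map Prod.snd ++ c)) {S U V : Finset ℤ}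
    (hU : U = ∅ ∨ U ∈ c) (hV : V = ∅ ∨ V ∈ c) (hc : ∀ N ∈ c, N = U ∨ N = V)
    (hS : ∀ s ∈ S, s ≠ 0 ∧ |s| < j ∧ |s| ≤ n) (hcov : ∀ i, 1 ≤ i → i < j → i ∈ S ∨ -i ∈ S)
    (hsign : (U = V ∧ neg S = S) ∨ (U ≠ V ∨ U = ∅) ∧ ∀ s ∈ S, -s ∉ S)
    (hne : S.Nonempty ∨ U.Nonempty ∧ V.Nonempty) :
    Config n j l D (cross ps ∪ {S ∪ pr (U, V)}) := by
  have hcl : ∀ N ∈ c, N ∈ l := fun N hN => hl.mem_iff.2 (List.mem_append_right _ hN)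
  have hr : ∀ N ∈ c, ∀ x ∈ N, j ≤ x ∧ x ≤ n := fun N hN => hP.range N (Or.inl (hcl N hN))
  have hUc : ∀ x ∈ U, U ∈ c := fun x hx => hU.resolve_left (by rintro rfl; simp at hx)
  have hVc : ∀ x ∈ V, V ∈ c := fun x hx => hV.resolve_left (by rintro rfl; simp at hx)
  have hUr : ∀ x ∈ U, j ≤ x ∧ x ≤ n := fun x hx => hr U (hUc x hx) x hx
  have hVr : ∀ x ∈ V, j ≤ x ∧ x ≤ n := fun x hx => hr V (hVc x hx) x hx
  have hSr : ∀ s ∈ S, s ≠ 0 ∧ -j < s ∧ s < j := fun s hs => by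
    have := hS s hs
    exact ⟨this.1, abs_lt.1 this.2.1⟩
  have hmem : ∀ x, x ∈ S ∪ pr (U, V) ↔ x ∈ S ∨ x ∈ U ∨ -x ∈ V := by
    intro x; rw [Finset.mem_union, mem_pr]
  have hmem' : ∀ x, x ∈ neg (S ∪ pr (U, V)) ↔ -x ∈ S ∨ -x ∈ U ∨ x ∈ V := by
    intro x; rw [mem_neg, hmem, neg_neg]
  have hcarry1 : U.Nonempty → Carry j (S ∪ pr (U, V)) U := by
    intro hUn
    refine ⟨fun x hx => (hmem x).2 (Or.inr (Or.inl hx)), fun x hx hjx => ?_, ?_⟩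
    · rcases (hmem x).1 hx with h | h | h
      · have := hSr x h; omega
      · exact h
      · have := hVr _ h; omega
    · rcases hne with ⟨s, hs⟩ | ⟨-, ⟨v, hv⟩⟩
      · exact ⟨s, (hmem s).2 (Or.inl hs), (hSr s hs).2.2⟩
      · exact ⟨-v, (hmem _).2 (Or.inr (Or.inr (by rwa [neg_neg]))), by have := hVr v hv; omega⟩
  have hcarry2 : V.Nonempty → Carry j (neg (S ∪ pr (U, V))) V := by
    intro hVn
    refine ⟨fun x hx => (hmem' x).2 (Or.inr (Or.inr hx)), fun x hx hjx => ?_, ?_⟩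
    · rcases (hmem' x).1 hx with h | h | h
      · have := hSr _ h; omega
      · have := hUr _ h; omega
      · exact h
    · rcases hne with ⟨s, hs⟩ | ⟨⟨u, hu⟩, -⟩
      · exact ⟨-s, (hmem' _).2 (Or.inl (by rwa [neg_neg])), by have := hSr s hs; omega⟩
      · exact ⟨-u, (hmem' _).2 (Or.inr (Or.inl (by rwa [neg_neg]))), by have := hUr u hu; omega⟩
  refine config_of_pairs hP hj hl ?_ ?_ ?_ ?_ ?_ ?_ ?_
  · intro K hK
    rw [Finset.mem_singleton] at hK
    subst hK
    rcases hne with ⟨s, hs⟩ | ⟨⟨u, hu⟩, -⟩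
    · exact ⟨s, (hmem s).2 (Or.inl hs)⟩
    · exact ⟨u, (hmem u).2 (Or.inr (Or.inl hu))⟩
  · intro K hK K' hK'
    rw [Finset.mem_singleton] at hK hK'
    rw [hK, hK']
  · intro K hK x hx
    rw [Finset.mem_singleton] at hK
    subst hK
    rcases (hmem x).1 hx with h | h | h
    · exact ⟨(hS x h).1, Or.inl (hS x h).2⟩
    · have := hUr x h
      exact ⟨by omega, Or.inr ⟨U, hUc x h, by rwa [abs_of_pos (by omega)]⟩⟩
    · have := hVr _ h
      exact ⟨by omega, Or.inr ⟨V, hVc _ h, by rwa [abs_of_neg (by omega)]⟩⟩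
  · intro i h1 h2 h
    refine ⟨_, Finset.mem_singleton_self _, ?_⟩
    rw [hmem, hmem, neg_neg]
    rcases h with h | ⟨N, hN, h⟩
    · exact (hcov i h1 h).imp Or.inl Or.inl
    · rcases hc N hN with e | e
      · exact Or.inl (Or.inr (Or.inl (e ▸ h)))
      · exact Or.inr (Or.inr (Or.inr (e ▸ h)))
  · intro K hK x hx hx'
    rw [Finset.mem_singleton] at hK
    subst hK
    rcases hsign with ⟨rfl, hS'⟩ | ⟨hd, hs⟩
    · ext y
      rw [hmem', hmem, ← mem_neg, hS']
      tauto
    · exfalso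
      have hno : ∀ y, y ∈ U → y ∈ V → False := fun y h1 h2 => by
        rcases hd with hd | rfl
        · exact hd (hP.eq_of_mem U V (Or.inl (hcl U (hUc y h1))) (Or.inl (hcl V (hVc y h2))) y h1 h2)
        · simp at h1
      rw [hmem] at hx hx'
      rw [neg_neg] at hx'
      rcases hx with h | h | h <;> rcases hx' with h' | h' | h'
      · exact hs x h h'
      · have := hSr x h; have := hUr _ h'; omega
      · have := hSr x h; have := hVr _ h'; omega
      · have := hSr _ h'; have := hUr _ h; omega
      · have := hUr _ h'; have := hUr _ h; omega
      · exact hno x h h'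
      · have := hSr _ h'; have := hVr _ h; omega
      · exact hno _ h' h
      · have := hVr _ h'; have := hVr _ h; omega
  · intro K hK
    rw [mem_pm, Finset.mem_singleton, Finset.mem_singleton] at hK
    rcases hK with rfl | hK
    · rcases U.eq_empty_or_nonempty with rfl | hUn
      · left
        intro x hx
        rcases (hmem x).1 hx with h | h | h
        · exact (hSr x h).2.2
        · simp at h
        · have := hVr _ h; omega
      · exact Or.inr ⟨U, hUc _ hUn.choose_spec, hcarry1 hUn⟩
    · rw [← neg_neg_block K, hK]
      rcases V.eq_empty_or_nonempty with rfl | hVn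
      · left
        intro x hx
        rcases (hmem' x).1 hx with h | h | h
        · have := hSr _ h; omega
        · have := hUr _ h; omega
        · simp at h
      · exact Or.inr ⟨V, hVc _ hVn.choose_spec, hcarry2 hVn⟩
  · intro N hN
    have hNn := hP.nonempty N (Or.inl (hcl N hN))
    rcases hc N hN with rfl | rfl
    · exact ⟨_, mem_pm.2 (Or.inl (Finset.mem_singleton_self _)), hcarry1 hNn⟩
    · exact ⟨_, neg_mem_pm.2 (mem_pm.2 (Or.inl (Finset.mem_singleton_self _))), hcarry2 hNn⟩

/-- The central blocks of type `B`. -/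
inductive CenterB : List (Finset ℤ) → Finset (Finset ℤ) → Prop
  | none : CenterB [] ∅
  | zero (M : Finset ℤ) : CenterB [M] {pr (M, M)}

/-- The central block `S ∪ U ∪ -V` of type `D`; the status of `1` on the noncrossing side comes
first, the one on the nonnesting side second. -/
inductive CenterD : Status → Status → List (Finset ℤ) → Finset ℤ → Finset ℤ → Finset ℤ → Prop
  | both : CenterD .both .both [] {1} ∅ ∅
  | zero (M : Finset ℤ) : CenterD .tr .tr [M] {1, -1} M M
  | posit (M : Finset ℤ) : CenterD .op .op [M] {1} M ∅
  | negat (M : Finset ℤ) : CenterD .cl .cl [M] {1} ∅ M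
  -- In the applications the pieces stand in the order of the list, so `M` has the smaller least
  -- element. The letters `tr` and `op` record whether `1` goes with `M` or with `N`, in opposite
  -- ways on the two sides.
  | mix (M N : Finset ℤ) : CenterD .tr .op [M, N] {1} M N
  | mixNeg (M N : Finset ℤ) : CenterD .op .tr [M, N] {-1} M N

theorem config_B {n : ℕ} {l : List (Finset ℤ)} {D : Finset (Finset ℤ)} (hP : Pieces n 1 l D)
    {ps : List (Finset ℤ × Finset ℤ)} {c : List (Finset ℤ)} {C : Finset (Finset ℤ)}
    (hl : l.Perm (ps.map Prod.fst ++ ps.map Prod.snd ++ c)) (hc : CenterB c C) :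
    Config n 1 l D (cross ps ∪ C) := by
  cases hc with
  | none =>
    exact config_of_pairs hP le_rfl hl (by simp) (by simp) (by simp)
      (fun i h1 _ h2 => by simp at h2; omega) (by simp) (by simp [pm]) (by simp)
  | zero M =>
    have hM : M.Nonempty := hP.nonempty M (Or.inl (hl.mem_iff.2 (by simp)))
    have := config_of_center hP le_rfl hl (S := ∅) (U := M) (V := M) (by simp) (by simp) (by simp)
      (by simp) (fun i h1 h2 => by omega) (Or.inl ⟨rfl, rfl⟩) (Or.inr ⟨hM, hM⟩)
    rwa [Finset.empty_union] at this

theorem config_D {n : ℕ} (hn : 1 ≤ n) {l : List (Finset ℤ)} {D : Finset (Finset ℤ)}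
    (hP : Pieces n 2 l D) {ps : List (Finset ℤ × Finset ℤ)} {c : List (Finset ℤ)} {s t : Status}
    {S U V : Finset ℤ} (hl : l.Perm (ps.map Prod.fst ++ ps.map Prod.snd ++ c))
    (hc : CenterD s t c S U V) : Config n 2 l D (cross ps ∪ {S ∪ pr (U, V)}) := by
  have h1 : ∀ s ∈ ({1} : Finset ℤ), s ≠ 0 ∧ |s| < 2 ∧ |s| ≤ n := by
    intro s hs
    rw [Finset.mem_singleton] at hs
    subst hs
    simp only [abs_one]
    omega
  have h2 : ∀ s ∈ ({-1} : Finset ℤ), s ≠ 0 ∧ |s| < 2 ∧ |s| ≤ n := by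
    intro s hs
    rw [Finset.mem_singleton] at hs
    subst hs
    simp only [abs_neg, abs_one]
    omega
  have hnd := hl.nodup_iff.1 hP.nodup
  have hnec : ∀ N ∈ c, N.Nonempty := fun N hN =>
    hP.nonempty N (Or.inl (hl.mem_iff.2 (List.mem_append_right _ hN)))
  have hle : ∀ i : ℤ, 1 ≤ i → i < 2 → i = 1 := fun i _ _ => by omega
  cases hc with
  | both =>
    refine config_of_center hP (by norm_num) hl (by simp) (by simp) (by simp) h1 ?_
      (Or.inr ⟨Or.inr rfl, by simp⟩) (by simp)
    intro i h1 h2; simp [hle i h1 h2]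
  | zero M =>
    refine config_of_center hP (by norm_num) hl (by simp) (by simp) (by simp) ?_ ?_
      (Or.inl ⟨rfl, by decide⟩) (by simp)
    · intro s hs
      rcases Finset.mem_insert.1 hs with rfl | hs
      · exact h1 1 (by simp)
      · exact h2 s hs
    · intro i h1 h2; simp [hle i h1 h2]
  | posit M =>
    refine config_of_center hP (by norm_num) hl (by simp) (by simp) (by simp) h1 ?_
      (Or.inr ⟨Or.inl (hnec _ (List.mem_singleton.2 rfl)).ne_empty, by simp⟩) (by simp)
    intro i h1 h2; simp [hle i h1 h2]
  | negat M =>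
    refine config_of_center hP (by norm_num) hl (by simp) (by simp) (by simp) h1 ?_
      (Or.inr ⟨Or.inl (hnec _ (List.mem_singleton.2 rfl)).ne_empty.symm, by simp⟩) (by simp)
    intro i h1 h2; simp [hle i h1 h2]
  | mix M N =>
    have hMN : U ≠ V := by rintro rfl; simp [List.nodup_append] at hnd
    refine config_of_center hP (by norm_num) hl (by simp) (by simp) (by simp) h1 ?_
      (Or.inr ⟨Or.inl hMN, by simp⟩) (by simp)
    intro i h1 h2; simp [hle i h1 h2]
  | mixNeg M N =>
    have hMN : U ≠ V := by rintro rfl; simp [List.nodup_append] at hnd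
    refine config_of_center hP (by norm_num) hl (by simp) (by simp) (by simp) h2 ?_
      (Or.inr ⟨Or.inl hMN, by simp⟩) (by simp)
    intro i h1 h2; simp [hle i h1 h2]

/-! ### The noncrossing invariants -/

/-- All elements of `B` are smaller than all elements of `C`. -/
def Below (B C : Finset ℤ) : Prop := ∀ b ∈ B, ∀ c ∈ C, b < c

/-- The unfinished pieces are separated from each other and not covered by finished pieces; the
finished pieces do not cross. -/
structure NCInv (l : List (Finset ℤ)) (D : Finset (Finset ℤ)) : Prop where
  below : l.Pairwise Below
  nest : ∀ B ∈ D, ∀ C ∈ l, ∀ b ∈ B, ∀ c ∈ C, ∀ b' ∈ B, ¬ (b < c ∧ c < b')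
  alt : ∀ B ∈ D, ∀ C ∈ D, B ≠ C → ∀ b ∈ B, ∀ c ∈ C, ∀ b' ∈ B, ∀ c' ∈ C,
    ¬ (b < c ∧ c < b' ∧ b' < c')

/-- Only the first piece is continued, and it lies entirely below the other unfinished pieces.
Extending it downwards keeps the pieces separated, and once finished it encloses none of the others.
-/
theorem BuildNC.inv {n : ℕ} {u : List Status} {l : List (Finset ℤ)} {D : Finset (Finset ℤ)}
    (h : BuildNC n u l D) : NCInv l D := by
  induction h with
  | nil => exact ⟨by simp, by simp, by simp⟩
  | @both u l D h ih =>
    have hp := h.pieces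
    refine ⟨ih.below, ?_, ?_⟩
    · intro B hB C hC b hb c hc b' hb'
      rcases Finset.mem_insert.1 hB with rfl | hB
      · rw [Finset.mem_singleton] at hb hb'; omega
      · exact ih.nest B hB C hC b hb c hc b' hb'
    · intro B hB C hC hne b hb c hc b' hb' c' hc'
      rcases Finset.mem_insert.1 hB with rfl | hB
      · rw [Finset.mem_singleton] at hb hb'; omega
      · rcases Finset.mem_insert.1 hC with rfl | hC
        · rw [Finset.mem_singleton] at hc hc'; omega
        · exact ih.alt B hB C hC hne b hb c hc b' hb' c' hc'
  | @cl u l D h ih =>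
    have hp := h.pieces
    refine ⟨?_, ?_, ih.alt⟩
    · rw [List.pairwise_cons]
      refine ⟨fun B hB b hb c hc => ?_, ih.below⟩
      rw [Finset.mem_singleton] at hb
      have := hp.range B (Or.inl hB) c hc
      omega
    · intro B hB C hC b hb c hc b' hb'
      rcases List.mem_cons.1 hC with rfl | hC
      · rw [Finset.mem_singleton] at hc
        have := hp.range B (Or.inr hB) b hb
        omega
      · exact ih.nest B hB C hC b hb c hc b' hb'
  | @tr u l₁ N l₂ D h hok ih =>
    have hp := h.pieces
    subst hok
    rw [List.nil_append] at *
    refine ⟨?_, ?_, ih.alt⟩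
    · rw [List.pairwise_cons]
      refine ⟨fun B hB b hb c hc => ?_, (List.pairwise_cons.1 ih.below).2⟩
      rcases Finset.mem_insert.1 hb with rfl | hb
      · have := hp.range B (Or.inl (List.mem_cons_of_mem _ hB)) c hc
        omega
      · exact (List.pairwise_cons.1 ih.below).1 B hB b hb c hc
    · intro B hB C hC b hb c hc b' hb'
      rcases List.mem_cons.1 hC with rfl | hC
      · rcases Finset.mem_insert.1 hc with rfl | hc
        · have := hp.range B (Or.inr hB) b hb
          omega
        · exact ih.nest B hB N List.mem_cons_self b hb c hc b' hb'
      · exact ih.nest B hB C (List.mem_cons_of_mem _ hC) b hb c hc b' hb'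
  | @op u l₁ N l₂ D h hok ih =>
    have hp := h.pieces
    subst hok
    rw [List.nil_append] at *
    have hNj : ∀ x ∈ N, (n - u.length : ℤ) < x := fun x hx => by
      have := hp.range N (Or.inl List.mem_cons_self) x hx
      omega
    have hDj : ∀ B ∈ D, ∀ x ∈ B, (n - u.length : ℤ) < x := fun B hB x hx => by
      have := hp.range B (Or.inr hB) x hx
      omega
    have hnest : ∀ B ∈ D, ∀ b ∈ B, ∀ c ∈ N, ∀ b' ∈ B, ¬ (b < c ∧ c < b') := fun B hB =>
      ih.nest B hB N List.mem_cons_self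
    refine ⟨(List.pairwise_cons.1 ih.below).2, ?_, ?_⟩
    · intro B hB C hC b hb c hc b' hb'
      rcases Finset.mem_insert.1 hB with rfl | hB
      · rintro ⟨h1, h2⟩
        rcases Finset.mem_insert.1 hb' with rfl | hb'
        · have := hp.range C (Or.inl (List.mem_cons_of_mem _ hC)) c hc
          omega
        · have := (List.pairwise_cons.1 ih.below).1 C hC b' hb' c hc
          omega
      · exact ih.nest B hB C (List.mem_cons_of_mem _ hC) b hb c hc b' hb'
    · intro B hB C hC hne b hb c hc b' hb' c' hc'
      rintro ⟨h1, h2, h3⟩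
      rcases Finset.mem_insert.1 hB with rfl | hB <;> rcases Finset.mem_insert.1 hC with rfl | hC
      · exact hne rfl
      · rcases Finset.mem_insert.1 hb' with rfl | hb'
        · have := hDj C hC c hc; omega
        · exact hnest C hC c hc b' hb' c' hc' ⟨h2, h3⟩
      · rcases Finset.mem_insert.1 hc with rfl | hc
        · have := hDj B hB b hb; omega
        · exact hnest B hB b hb c hc b' hb' ⟨h1, h2⟩
      · exact ih.alt B hB C hC hne b hb c hc b' hb' c' hc' ⟨h1, h2, h3⟩

theorem key_of_pos {n : ℕ} {a : ℤ} (h : 0 < a) : key n a = a := if_pos h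

theorem key_of_neg {n : ℕ} {a : ℤ} (h : a < 0) : key n a = n - a := if_neg (by omega)

theorem key_cases (n : ℕ) {x : ℤ} (h : x ≠ 0) : (0 < x ∧ key n x = x ∧ key n (-x) = n + x) ∨
    (x < 0 ∧ key n x = n - x ∧ key n (-x) = -x) := by
  rcases lt_or_gt_of_ne h with h | h
  · exact Or.inr ⟨h, key_of_neg h, key_of_pos (by omega)⟩
  · exact Or.inl ⟨h, key_of_pos h, by rw [key_of_neg (by omega)]; ring⟩

theorem pairwise_total {α : Type*} {R : α → α → Prop} {l : List α} (h : l.Pairwise R) {x y : α}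
    (hx : x ∈ l) (hy : y ∈ l) : x = y ∨ R x y ∨ R y x := by
  induction l with
  | nil => simp at hx
  | cons a l ih =>
    rw [List.pairwise_cons] at h
    rcases List.mem_cons.1 hx with e | hx' <;> rcases List.mem_cons.1 hy with e' | hy'
    · exact Or.inl (e.trans e'.symm)
    · exact Or.inr (Or.inl (e ▸ h.1 y hy'))
    · exact Or.inr (Or.inr (e' ▸ h.1 x hx'))
    · exact ih h.2 hx' hy'

/-- The clockwise order is invariant under the half turn. -/
theorem Alt.neg {n : ℕ} {B C : Finset ℤ} (hB : B ⊆ ground n) (hC : C ⊆ ground n)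
    (h : Alt n B C) : Alt n (neg B) (neg C) := by
  have main : ∀ B C : Finset ℤ, B ⊆ ground n → C ⊆ ground n → ∀ b₁ ∈ B, ∀ c₁ ∈ C, ∀ b₂ ∈ B,
      ∀ c₂ ∈ C, (key n b₁ < key n c₁ ∧ key n c₁ < key n b₂ ∧ key n b₂ < key n c₂) →
      Alt n (NCNN.neg B) (NCNN.neg C) := by
    rintro B C hB hC b₁ hb₁ c₁ hc₁ b₂ hb₂ c₂ hc₂ ⟨h1, h2, h3⟩
    have m : ∀ {B : Finset ℤ} {x : ℤ}, x ∈ B → -x ∈ NCNN.neg B := fun hx => by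
      rwa [mem_neg, neg_neg]
    have g1 := mem_ground.1 (hB hb₁)
    have g2 := mem_ground.1 (hB hb₂)
    have g3 := mem_ground.1 (hC hc₁)
    have g4 := mem_ground.1 (hC hc₂)
    have k1 := key_cases n g1.1
    have k2 := key_cases n g2.1
    have k3 := key_cases n g3.1
    have k4 := key_cases n g4.1
    -- The half turn rotates the quadruple cyclically. Which of the four images comes first depends
    -- on where the quadruple passes from positive to negative labels.
    by_cases p1 : b₁ < 0
    · exact ⟨-b₁, m hb₁, -c₁, m hc₁, -b₂, m hb₂, -c₂, m hc₂, Or.inl (by omega)⟩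
    by_cases p2 : c₁ < 0
    · exact ⟨-b₂, m hb₂, -c₁, m hc₁, -b₁, m hb₁, -c₂, m hc₂, Or.inr (by omega)⟩
    by_cases p3 : b₂ < 0
    · exact ⟨-b₂, m hb₂, -c₂, m hc₂, -b₁, m hb₁, -c₁, m hc₁, Or.inl (by omega)⟩
    by_cases p4 : c₂ < 0
    · exact ⟨-b₁, m hb₁, -c₂, m hc₂, -b₂, m hb₂, -c₁, m hc₁, Or.inr (by omega)⟩
    · exact ⟨-b₁, m hb₁, -c₁, m hc₁, -b₂, m hb₂, -c₂, m hc₂, Or.inl (by omega)⟩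
  obtain ⟨b₁, hb₁, c₁, hc₁, b₂, hb₂, c₂, hc₂, h | h⟩ := h
  · exact main B C hB hC b₁ hb₁ c₁ hc₁ b₂ hb₂ c₂ hc₂ h
  · exact (main C B hC hB c₁ hc₁ b₁ hb₁ c₂ hc₂ b₂ hb₂ h).symm

/-- All positions of `B` are at most `n`, so an element of `C` placed between two elements of `B` is
a positive number between them. -/
theorem not_alt_of_nest {n : ℕ} {B C : Finset ℤ} (hB : ∀ b ∈ B, 0 < b ∧ b ≤ n)
    (hC : C ⊆ ground n) (h : ∀ b ∈ B, ∀ c ∈ C, ∀ b' ∈ B, ¬ (b < c ∧ c < b')) : ¬ Alt n B C := by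
  rintro ⟨b₁, hb₁, c₁, hc₁, b₂, hb₂, c₂, hc₂, h' | h'⟩
  · have := h b₁ hb₁ c₁ hc₁ b₂ hb₂
    have := hB b₁ hb₁
    have := hB b₂ hb₂
    have := mem_ground.1 (hC hc₁)
    unfold key at h'
    split_ifs at h' <;> omega
  · have := h b₁ hb₁ c₂ hc₂ b₂ hb₂
    have := hB b₁ hb₁
    have := hB b₂ hb₂
    have := mem_ground.1 (hC hc₂)
    unfold key at h'
    split_ifs at h' <;> omega

/-- In the clockwise order the parts follow each other as `p.1`, `q.1`, `-q.2`, `-p.2`, so no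
element of the first block lies between two elements of the second one. -/
theorem not_alt_of_opposite {n : ℕ} {p q : Finset ℤ × Finset ℤ}
    (h1 : ∀ x ∈ p.1, 0 < x ∧ x ≤ n) (h2 : ∀ x ∈ p.2, 0 < x ∧ x ≤ n)
    (h3 : ∀ x ∈ q.1, 0 < x ∧ x ≤ n) (h4 : ∀ x ∈ q.2, 0 < x ∧ x ≤ n)
    (h : Below p.1 q.1) (h' : Below q.2 p.2) : ¬ Alt n (pr p) (pr q) := by
  have hk : ∀ b ∈ pr p, ∀ c ∈ pr q, ∀ c' ∈ pr q, key n c < key n b → key n b < key n c' → False := by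
    intro b hb c hc c' hc' e1 e2
    rw [mem_pr] at hb hc hc'
    rcases hb with hb | hb
    · have k1 := h1 b hb
      have k1' := key_of_pos (n := n) k1.1
      rcases hc with hc | hc
      · have k2 := h3 c hc
        have := h b hb c hc
        have := key_of_pos (n := n) k2.1
        omega
      · have k2 := h4 _ hc
        have := key_of_neg (n := n) (a := c) (by omega)
        omega
    · have k1 := h2 _ hb
      have k1' := key_of_neg (n := n) (a := b) (by omega)
      rcases hc' with hc | hc
      · have k2 := h3 _ hc
        have := key_of_pos (n := n) k2.1
        omega
      · have k2 := h4 _ hc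
        have := h' _ hc _ hb
        have := key_of_neg (n := n) (a := c') (by omega)
        omega
  rintro ⟨b₁, hb₁, c₁, hc₁, b₂, hb₂, c₂, hc₂, e | e⟩
  · exact hk b₂ hb₂ c₁ hc₁ c₂ hc₂ e.2.1 e.2.2
  · exact hk b₁ hb₁ c₁ hc₁ c₂ hc₂ e.1 e.2.1

/-- The symmetric family made of the finished pieces and of blocks joining unfinished pieces does
not cross if the latter blocks do not cross. -/
theorem not_alt_family {n : ℕ} {j : ℤ} {l : List (Finset ℤ)} {D E : Finset (Finset ℤ)}
    (hP : Pieces n j l D) (hj : 1 ≤ j) (hI : NCInv l D) (hEg : ∀ B ∈ pm E, B ⊆ ground n)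
    (hE : ∀ B ∈ pm E, ∀ x ∈ B, 0 < x → ∃ N ∈ l, x ∈ N)
    (hEE : ∀ B ∈ pm E, ∀ C ∈ pm E, B ≠ C → ¬ Alt n B C) :
    ∀ B ∈ pm (D ∪ E), ∀ C ∈ pm (D ∪ E), B ≠ C → ¬ Alt n B C := by
  have hD : ∀ B ∈ D, ∀ b ∈ B, 0 < b ∧ b ≤ n := fun B hB b hb => by
    have := hP.range B (Or.inr hB) b hb; omega
  have hg : ∀ B ∈ pm (D ∪ E), B ⊆ ground n := by
    intro B hB
    rw [pm_union, Finset.mem_union, mem_pm] at hB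
    have hDg : ∀ B ∈ D, B ⊆ ground n := fun B hB x hx => by
      have := hD B hB x hx
      rw [mem_ground]; omega
    rcases hB with (hB | hB) | hB
    · exact hDg B hB
    · rw [← neg_neg_block B]; exact neg_subset_ground (hDg _ hB)
    · exact hEg B hB
  have h1 : ∀ B ∈ D, ∀ C ∈ pm (D ∪ E), B ≠ C → ¬ Alt n B C := by
    intro B hB C hC hne
    by_cases hCD : C ∈ D
    · rintro ⟨b₁, hb₁, c₁, hc₁, b₂, hb₂, c₂, hc₂, h | h⟩
      · rw [key_of_pos (hD B hB _ hb₁).1, key_of_pos (hD B hB _ hb₂).1, key_of_pos (hD C hCD _ hc₁).1,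
          key_of_pos (hD C hCD _ hc₂).1] at h
        exact hI.alt B hB C hCD hne b₁ hb₁ c₁ hc₁ b₂ hb₂ c₂ hc₂ h
      · rw [key_of_pos (hD B hB _ hb₁).1, key_of_pos (hD B hB _ hb₂).1, key_of_pos (hD C hCD _ hc₁).1,
          key_of_pos (hD C hCD _ hc₂).1] at h
        exact hI.alt C hCD B hB hne.symm c₁ hc₁ b₁ hb₁ c₂ hc₂ b₂ hb₂ h
    · apply not_alt_of_nest (hD B hB) (hg C hC)
      rintro b hb c hc b' hb' ⟨e1, e2⟩
      have hb0 := hD B hB b hb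
      rw [pm_union, Finset.mem_union, mem_pm] at hC
      rcases hC with (hC | hC) | hC
      · exact hCD hC
      · have := hD _ hC (-c) (by rwa [mem_neg, neg_neg]); omega
      · obtain ⟨N, hN, hcN⟩ := hE C hC c hc (by omega)
        exact hI.nest B hB N hN b hb c hcN b' hb' ⟨e1, e2⟩
  have h2 : ∀ B ∈ pm D, ∀ C ∈ pm (D ∪ E), B ≠ C → ¬ Alt n B C := by
    intro B hB C hC hne halt
    rcases mem_pm.1 hB with h | h
    · exact h1 B h C hC hne halt
    · refine h1 _ h (neg C) (neg_mem_pm.2 hC) (fun e => hne (neg_injective e)) ?_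
      exact halt.neg (hg B (by rw [pm_union]; exact Finset.mem_union_left _ hB)) (hg C hC)
  intro B hB C hC hne halt
  have hB' := hB
  have hC' := hC
  rw [pm_union, Finset.mem_union] at hB' hC'
  rcases hB' with hB' | hB'
  · exact h2 B hB' C hC hne halt
  · rcases hC' with hC' | hC'
    · exact h2 C hC' B hB hne.symm halt.symm
    · exact hEE B hB' C hC' hne halt

/-- A family of blocks obtained by pairing the unfinished pieces from the outside to the inside does
not cross. -/
theorem not_alt_pairs {n : ℕ} {j : ℤ} {l : List (Finset ℤ)} {D : Finset (Finset ℤ)}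
    (hP : Pieces n j l D) (hj : 1 ≤ j) (hI : NCInv l D) {ps : List (Finset ℤ × Finset ℤ)}
    {c : List (Finset ℤ)} (hl : l = ps.map Prod.fst ++ c ++ (ps.map Prod.snd).reverse)
    {U V : Finset ℤ} (hU : ∀ x ∈ U, ∃ N ∈ c, x ∈ N) (hV : ∀ x ∈ V, ∃ N ∈ c, x ∈ N)
    (hUV : U = V ∨ Below U V) :
    ∀ B ∈ pm (D ∪ (cross ps ∪ {pr (U, V)})), ∀ C ∈ pm (D ∪ (cross ps ∪ {pr (U, V)})), B ≠ C →
      ¬ Alt n B C := by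
  have hb := hI.below
  rw [hl, List.pairwise_append, List.pairwise_append] at hb
  obtain ⟨⟨hb1, -, hb2⟩, hb3, hb4⟩ := hb
  rw [List.pairwise_reverse, List.pairwise_map] at hb3
  rw [List.pairwise_map] at hb1
  have hps1 : ∀ p ∈ ps, p.1 ∈ l := fun p hp => by
    rw [hl]; simp only [List.mem_append, List.mem_map]; exact Or.inl (Or.inl ⟨p, hp, rfl⟩)
  have hps2 : ∀ p ∈ ps, p.2 ∈ l := fun p hp => by
    rw [hl]; simp only [List.mem_append, List.mem_reverse, List.mem_map]; exact Or.inr ⟨p, hp, rfl⟩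
  have hcl : ∀ N ∈ c, N ∈ l := fun N hN => by rw [hl]; simp [hN]
  have h12 : ∀ p ∈ ps, ∀ q ∈ ps, Below p.1 q.2 := fun p hp q hq =>
    hb4 p.1 (List.mem_append_left _ (List.mem_map_of_mem hp)) q.2
      (List.mem_reverse.2 (List.mem_map_of_mem hq))
  have hc1 : ∀ p ∈ ps, ∀ W : Finset ℤ, (∀ x ∈ W, ∃ N ∈ c, x ∈ N) → Below p.1 W ∧ Below W p.2 := by
    intro p hp W hW
    refine ⟨fun x hx y hy => ?_, fun x hx y hy => ?_⟩
    · obtain ⟨N, hN, hyN⟩ := hW y hy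
      exact hb2 p.1 (List.mem_map_of_mem hp) N hN x hx y hyN
    · obtain ⟨N, hN, hyN⟩ := hW x hx
      exact hb4 N (List.mem_append_right _ hN) p.2
        (List.mem_reverse.2 (List.mem_map_of_mem hp)) x hyN y hy
  -- the blocks are given by pairs
  set Q : Set (Finset ℤ × Finset ℤ) := {q | q ∈ ps ∨ q = (U, V)} with hQ
  have hr : ∀ q ∈ Q, (∀ x ∈ q.1, ∃ N ∈ l, x ∈ N) ∧ ∀ x ∈ q.2, ∃ N ∈ l, x ∈ N := by
    rintro q (hq | rfl)
    · exact ⟨fun x hx => ⟨q.1, hps1 q hq, hx⟩, fun x hx => ⟨q.2, hps2 q hq, hx⟩⟩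
    · refine ⟨fun x hx => ?_, fun x hx => ?_⟩
      · obtain ⟨N, hN, h⟩ := hU x hx; exact ⟨N, hcl N hN, h⟩
      · obtain ⟨N, hN, h⟩ := hV x hx; exact ⟨N, hcl N hN, h⟩
  have hrange : ∀ x, (∃ N ∈ l, x ∈ N) → 0 < x ∧ x ≤ n := by
    rintro x ⟨N, hN, hx⟩
    have := hP.range N (Or.inl hN) x hx
    omega
  have hmem : ∀ B ∈ pm (cross ps ∪ {pr (U, V)}), ∃ q ∈ Q, B = pr q ∨ B = pr q.swap := by
    have : ∀ B ∈ cross ps ∪ {pr (U, V)}, ∃ q ∈ Q, B = pr q := by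
      intro B hB
      rw [Finset.mem_union, mem_cross, Finset.mem_singleton] at hB
      rcases hB with ⟨p, hp, rfl⟩ | rfl
      · exact ⟨p, Or.inl hp, rfl⟩
      · exact ⟨_, Or.inr rfl, rfl⟩
    intro B hB
    rcases mem_pm.1 hB with hB | hB
    · obtain ⟨q, hq, rfl⟩ := this B hB
      exact ⟨q, hq, Or.inl rfl⟩
    · obtain ⟨q, hq, e⟩ := this _ hB
      exact ⟨q, hq, Or.inr (by rw [← neg_pr, ← e, neg_neg_block])⟩
  have hna : ∀ p ∈ Q, ∀ q ∈ Q, Below p.1 q.1 → Below q.2 p.2 → ¬ Alt n (pr p) (pr q) := by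
    intro p hp q hq h h'
    exact not_alt_of_opposite (fun x hx => hrange x ((hr p hp).1 x hx))
      (fun x hx => hrange x ((hr p hp).2 x hx)) (fun x hx => hrange x ((hr q hq).1 x hx))
      (fun x hx => hrange x ((hr q hq).2 x hx)) h h'
  have hna' : ∀ p ∈ Q, ∀ q ∈ Q, Below p.1 q.2 → Below q.1 p.2 → ¬ Alt n (pr p) (pr q.swap) := by
    intro p hp q hq h h'
    exact not_alt_of_opposite (fun x hx => hrange x ((hr p hp).1 x hx))
      (fun x hx => hrange x ((hr p hp).2 x hx)) (fun x hx => hrange x ((hr q hq).2 x hx))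
      (fun x hx => hrange x ((hr q hq).1 x hx)) h h'
  have key : ∀ p ∈ Q, ∀ q ∈ Q, pr p ≠ pr q → ¬ Alt n (pr p) (pr q) := by
    rintro p hp q hq hne
    have hpq : p ≠ q := by rintro rfl; exact hne rfl
    rcases id hp with hp' | rfl <;> rcases id hq with hq' | rfl
    · rcases (pairwise_total (hb1.and hb3) hp' hq').resolve_left hpq with h | h
      · exact hna p hp q hq h.1 h.2
      · exact fun ha => hna q hq p hp h.1 h.2 ha.symm
    · exact hna p hp _ hq (hc1 p hp' U hU).1 (hc1 p hp' V hV).2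
    · exact fun ha => hna q hq _ hp (hc1 q hq' U hU).1 (hc1 q hq' V hV).2 ha.symm
    · exact absurd rfl hpq
  have key' : ∀ p ∈ Q, ∀ q ∈ Q, pr p ≠ pr q.swap → ¬ Alt n (pr p) (pr q.swap) := by
    rintro p hp q hq hne
    rcases id hp with hp' | rfl <;> rcases id hq with hq' | rfl
    · exact hna' p hp q hq (h12 p hp' q hq') (h12 q hq' p hp')
    · exact hna' p hp _ hq (hc1 p hp' V hV).1 (hc1 p hp' U hU).2
    · intro ha
      have := ha.neg (n := n)
      rw [neg_pr, neg_pr, Prod.swap_swap] at this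
      have h5 := hna' q hq (U, V) hp (hc1 q hq' V hV).1 (hc1 q hq' U hU).2
      refine h5 (this ?_ ?_).symm
      all_goals
        intro x hx
        rw [mem_ground]
        rcases mem_pr.1 hx with h | h
      · have := hrange x ((hr _ hp).1 x h); omega
      · have := hrange _ ((hr _ hp).2 _ h); omega
      · have := hrange x ((hr _ hq).2 x h); omega
      · have := hrange _ ((hr _ hq).1 _ h); omega
    · rcases hUV with rfl | h
      · exact absurd rfl hne
      · exact hna' _ hp _ hq h h
  have hpg : ∀ q ∈ Q, pr q ⊆ ground n := by
    intro q hq x hx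
    rw [mem_ground]
    rcases mem_pr.1 hx with h | h
    · have := hrange x ((hr _ hq).1 x h); omega
    · have := hrange _ ((hr _ hq).2 _ h); omega
  apply not_alt_family hP hj hI
  · intro B hB
    obtain ⟨q, hq, rfl | rfl⟩ := hmem B hB
    · exact hpg q hq
    · rw [← neg_pr]; exact neg_subset_ground (hpg q hq)
  · intro B hB x hx h0
    obtain ⟨q, hq, rfl | rfl⟩ := hmem B hB
    · rcases mem_pr.1 hx with h | h
      · exact (hr q hq).1 x h
      · have := hrange _ ((hr q hq).2 _ h); omega
    · rcases mem_pr.1 hx with h | h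
      · exact (hr q hq).2 x h
      · have := hrange _ ((hr q hq).1 _ h); omega
  · intro B hB C hC hne
    obtain ⟨p, hp, rfl | rfl⟩ := hmem B hB <;> obtain ⟨q, hq, rfl | rfl⟩ := hmem C hC
    · exact key p hp q hq hne
    · exact key' p hp q hq hne
    · exact fun ha => key' q hq p hp hne.symm ha.symm
    · intro ha
      refine key p hp q hq (fun e => hne ?_) ?_
      · rw [← neg_pr, ← neg_pr, e]
      · have := ha.neg (by rw [← neg_pr]; exact neg_subset_ground (hpg p hp))
          (by rw [← neg_pr]; exact neg_subset_ground (hpg q hq))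
        rwa [neg_pr, neg_pr, Prod.swap_swap, Prod.swap_swap] at this


/-! ### The noncrossing partitions built from words -/

theorem perm_of_eq_middle {α : Type*} {l c a b : List α} (hl : l = a ++ c ++ b.reverse) :
    l.Perm (a ++ b ++ c) := by
  rw [hl, List.append_assoc, List.append_assoc]
  exact List.Perm.append_left _ (List.perm_append_comm.trans
    (List.Perm.append_right _ (List.reverse_perm _)))

theorem perm_of_eq_last {α : Type*} {l c a b : List α} (hl : l = a ++ b.reverse ++ c) :
    l.Perm (a ++ b ++ c) := by
  rw [hl]
  exact List.Perm.append_right _ (List.Perm.append_left _ (List.reverse_perm _))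

theorem mem_NCB_of_build {n : ℕ} (hn : 1 ≤ n) {u : List Status} {l : List (Finset ℤ)}
    {D : Finset (Finset ℤ)} (hb : BuildNC n u l D) (hu : u.length = n)
    {ps : List (Finset ℤ × Finset ℤ)} {c : List (Finset ℤ)} {C : Finset (Finset ℤ)}
    (hl : l = ps.map Prod.fst ++ c ++ (ps.map Prod.snd).reverse) (hc : CenterB c C) :
    pm (D ∪ (cross ps ∪ C)) ∈ NCB n := by
  have hP : Pieces n 1 l D := by
    have := hb.pieces
    rwa [hu, sub_self, zero_add] at this
  have hperm := perm_of_eq_middle hl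
  rw [mem_NCB_iff hn]
  refine ⟨(config_B hP hperm hc).signed.isBPartition, ?_⟩
  cases hc with
  | none =>
    -- The empty set `pr (∅, ∅)` stands in for the missing central block.
    have := not_alt_pairs hP le_rfl hb.inv hl (U := ∅) (V := ∅) (by simp) (by simp) (Or.inl rfl)
    intro B hB C hC
    refine this B ?_ C ?_
    · rw [mem_pm] at hB ⊢; simp only [Finset.mem_union] at hB ⊢; tauto
    · rw [mem_pm] at hC ⊢; simp only [Finset.mem_union] at hC ⊢; tauto
  | zero M => exact not_alt_pairs hP le_rfl hb.inv hl (by simp) (by simp) (Or.inl rfl)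

theorem CenterD.mem {s t : Status} {c : List (Finset ℤ)} {S U V : Finset ℤ}
    (h : CenterD s t c S U V) : (U = ∅ ∨ U ∈ c) ∧ (V = ∅ ∨ V ∈ c) ∧ (∀ N ∈ c, N = U ∨ N = V) ∧
      (∀ x ∈ S, x = 1 ∨ x = -1) ∧ (1 ∈ S ∨ -1 ∈ S) ∧ (c = [] → S = {1} ∧ U = ∅ ∧ V = ∅) := by
  cases h <;> simp

theorem strip_union_of {S T : Finset ℤ} (hS : ∀ x ∈ S, x = 1 ∨ x = -1) (hT : 1 ∉ T)
    (hT' : -1 ∉ T) : strip (S ∪ T) = T := by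
  rw [strip_union, strip_eq_self hT hT', Finset.union_eq_right]
  intro x hx
  rw [mem_strip] at hx
  rcases hS x hx.2.2 with h | h
  · exact absurd h hx.2.1
  · exact absurd h hx.1

theorem pr_union_neg (U V : Finset ℤ) : pr (U, V) ∪ neg (pr (U, V)) = pr (U ∪ V, U ∪ V) := by
  ext x
  rw [Finset.mem_union, neg_pr, mem_pr, mem_pr, mem_pr]
  simp only [Finset.mem_union, Prod.swap]
  tauto

-- Without `±1` the blocks form a family as in `not_alt_pairs`, with central block `pr (U, V)`. For
-- the condition at the centroid the central blocks are merged into the symmetric set `pr (U ∪ V, U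
-- ∪ V)`, and `not_alt_pairs` is applied once more.
set_option maxHeartbeats 1000000 in
theorem mem_NCD_of_build {n : ℕ} (hn : 2 ≤ n) {u : List Status} {l : List (Finset ℤ)}
    {D : Finset (Finset ℤ)} (hb : BuildNC n u l D) (hu : u.length + 1 = n)
    {ps : List (Finset ℤ × Finset ℤ)} {c : List (Finset ℤ)} {s t : Status} {S U V : Finset ℤ}
    (hl : l = ps.map Prod.fst ++ c ++ (ps.map Prod.snd).reverse) (hc : CenterD s t c S U V) :
    pm (D ∪ (cross ps ∪ {S ∪ pr (U, V)})) ∈ NCD n := by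
  have hP : Pieces n 2 l D := by
    have := hb.pieces
    rwa [show (n : ℤ) - u.length + 1 = 2 by omega] at this
  have hperm := perm_of_eq_middle hl
  have hB := (config_D (by omega) hP hperm hc).signed.isBPartition
  have hsg := (config_D (by omega) hP hperm hc).signed
  obtain ⟨hU, hV, hcUV, hS, hS1, hc0⟩ := hc.mem
  have hcl : ∀ N ∈ c, ∀ x ∈ N, 2 ≤ x := fun N hN x hx =>
    (hP.range N (Or.inl (hl ▸ by simp [hN])) x hx).1
  have hps : ∀ p ∈ ps, (∀ x ∈ p.1, 2 ≤ x) ∧ ∀ x ∈ p.2, 2 ≤ x := fun p hp =>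
    ⟨fun x hx => (hP.range p.1 (Or.inl (hperm.mem_iff.2 (by
        simp only [List.mem_append, List.mem_map]; exact Or.inl (Or.inl ⟨p, hp, rfl⟩)))) x hx).1,
      fun x hx => (hP.range p.2 (Or.inl (hperm.mem_iff.2 (by
        simp only [List.mem_append, List.mem_map]; exact Or.inl (Or.inr ⟨p, hp, rfl⟩)))) x hx).1⟩
  have hU2 : ∀ x ∈ U, ∃ N ∈ c, x ∈ N := fun x hx =>
    ⟨U, hU.resolve_left (by rintro rfl; simp at hx), hx⟩
  have hV2 : ∀ x ∈ V, ∃ N ∈ c, x ∈ N := fun x hx =>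
    ⟨V, hV.resolve_left (by rintro rfl; simp at hx), hx⟩
  have hUl : ∀ x ∈ U, 2 ≤ x := fun x hx => by
    obtain ⟨N, hN, h⟩ := hU2 x hx; exact hcl N hN x h
  have hVl : ∀ x ∈ V, 2 ≤ x := fun x hx => by
    obtain ⟨N, hN, h⟩ := hV2 x hx; exact hcl N hN x h
  have hne : ∀ N ∈ c, N.Nonempty := fun N hN => hP.nonempty N (Or.inl (hl ▸ by simp [hN]))
  have hpr : ∀ {X Y : Finset ℤ}, (∀ x ∈ X, 2 ≤ x) → (∀ x ∈ Y, 2 ≤ x) → ∀ a, (a = 1 ∨ a = -1) →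
      a ∉ pr (X, Y) := by
    intro X Y hX hY a ha h
    rcases mem_pr.1 h with h | h
    · have := hX _ h; omega
    · have := hY _ h; omega
  have hst : strip (S ∪ pr (U, V)) = pr (U, V) :=
    strip_union_of hS (hpr hUl hVl 1 (by simp)) (hpr hUl hVl (-1) (by simp))
  have hother : ∀ B ∈ pm (D ∪ cross ps), strip B = B := by
    have : ∀ B ∈ D ∪ cross ps, 1 ∉ B ∧ -1 ∉ B := by
      intro B hB
      rw [Finset.mem_union, mem_cross] at hB
      rcases hB with hB | ⟨p, hp, rfl⟩
      · have := hP.range B (Or.inr hB)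
        exact ⟨fun h => by have := this _ h; omega, fun h => by have := this _ h; omega⟩
      · exact ⟨hpr (hps p hp).1 (hps p hp).2 1 (by simp), hpr (hps p hp).1 (hps p hp).2 (-1) (by simp)⟩
    intro B hB
    rcases mem_pm.1 hB with hB | hB
    · exact strip_eq_self (this B hB).1 (this B hB).2
    · have := this _ hB
      rw [mem_neg, mem_neg, neg_neg] at this
      exact strip_eq_self this.2 this.1
  have hcases : ∀ B ∈ pm (D ∪ (cross ps ∪ {S ∪ pr (U, V)})), B ∈ pm (D ∪ cross ps) ∨
      B = S ∪ pr (U, V) ∨ B = neg (S ∪ pr (U, V)) := by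
    intro B hB
    rw [← Finset.union_assoc, pm_union, Finset.mem_union] at hB
    refine hB.imp_right fun h => ?_
    rw [mem_pm, Finset.mem_singleton, Finset.mem_singleton] at h
    exact h.imp_right fun e => by rw [← e, neg_neg_block]
  have hstrip : ∀ W₁ W₂, ∀ B ∈ pm (D ∪ (cross ps ∪ {S ∪ pr (U, V)})),
      B ∈ pm (D ∪ cross ps) → strip B ∈ pm (D ∪ (cross ps ∪ {pr (W₁, W₂)})) := by
    intro W₁ W₂ B _ hB
    rw [hother B hB, ← Finset.union_assoc, pm_union]
    exact Finset.mem_union_left _ hB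
  have hstrip' : ∀ B ∈ pm (D ∪ (cross ps ∪ {S ∪ pr (U, V)})),
      strip B ∈ pm (D ∪ (cross ps ∪ {pr (U, V)})) := by
    intro B hB
    have hm : pr (U, V) ∈ pm (D ∪ (cross ps ∪ {pr (U, V)})) := mem_pm.2 (Or.inl (by simp))
    rcases hcases B hB with h | rfl | rfl
    · exact hstrip U V B hB h
    · rwa [hst]
    · rwa [strip_neg, hst, neg_mem_pm]
  have hnonzero : ∀ B ∈ pm (D ∪ cross ps), neg B ≠ B := by
    intro B hB hz
    rw [mem_pm, hz, or_self, Finset.mem_union, mem_cross] at hB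
    rcases hB with hB | ⟨p, hp, rfl⟩
    · obtain ⟨b, hb⟩ := hP.nonempty B (Or.inr hB)
      have h1 := hP.range B (Or.inr hB) b hb
      rw [← hz, mem_neg] at hb
      have h2 := hP.range B (Or.inr hB) _ hb
      omega
    · have hn4 := nodup_pairs (hperm.nodup_iff.1 hP.nodup)
      have m1 : p.1 ∈ l := hperm.mem_iff.2 (by
        simp only [List.mem_append, List.mem_map]; exact Or.inl (Or.inl ⟨p, hp, rfl⟩))
      have m2 : p.2 ∈ l := hperm.mem_iff.2 (by
        simp only [List.mem_append, List.mem_map]; exact Or.inl (Or.inr ⟨p, hp, rfl⟩))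
      obtain ⟨b, hb⟩ := hP.nonempty p.1 (Or.inl m1)
      have hb' : -b ∈ pr p := by rw [← hz, mem_neg, neg_neg, mem_pr]; exact Or.inl hb
      rcases mem_pr.1 hb' with h | h
      · have := (hps p hp).1 _ h; have := (hps p hp).1 _ hb; omega
      · rw [neg_neg] at h
        exact hn4.2.2.1 p hp p hp (hP.eq_of_mem _ _ (Or.inl m1) (Or.inl m2) b hb h)
  have hbelow : U = V ∨ Below U V := by
    have hbl := hb.inv.below
    rw [hl] at hbl
    cases hc with
    | both => exact Or.inl rfl
    | zero M => exact Or.inl rfl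
    | posit M => exact Or.inr fun _ _ _ h => by simp at h
    | negat M => exact Or.inr fun _ h => by simp at h
    | mix M N => exact Or.inr (by
        rw [List.pairwise_append, List.pairwise_append] at hbl
        simpa using hbl.1.2.1)
    | mixNeg M N => exact Or.inr (by
        rw [List.pairwise_append, List.pairwise_append] at hbl
        simpa using hbl.1.2.1)
  refine mem_NCD_of_noncrossingD hn ⟨hB, ?_⟩ ⟨?_, ?_, ?_⟩
  · intro B hB hz
    have hB1 : B = S ∪ pr (U, V) := by
      rcases hcases B hB with h | rfl | rfl
      · exact absurd hz (hnonzero B h)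
      · rfl
      · rw [neg_neg_block] at hz; exact hz.symm
    have h1 : 1 ∈ B ∧ -1 ∈ B := by
      have : ∀ x, x ∈ B → -x ∈ B := fun x hx => by rwa [← hz, mem_neg, neg_neg]
      rcases hS1 with h | h
      · have : 1 ∈ B := by rw [hB1]; exact Finset.mem_union_left _ h
        exact ⟨this, by rw [← hz, mem_neg, neg_neg]; exact this⟩
      · have : -1 ∈ B := by rw [hB1]; exact Finset.mem_union_left _ h
        exact ⟨by rw [← hz, mem_neg]; exact this, this⟩
    have hcS : ∃ M ∈ c, M ⊆ B := by
      rcases c.eq_nil_or_concat with hc' | ⟨c', M, rfl⟩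
      · obtain ⟨rfl, rfl, rfl⟩ := hc0 hc'
        have := h1.2
        rw [hB1] at this
        simp [mem_pr] at this
      · refine ⟨M, by simp, fun x hx => ?_⟩
        rcases hcUV M (by simp) with rfl | rfl
        · rw [hB1]; exact Finset.mem_union_right _ (mem_pr.2 (Or.inl hx))
        · rw [← hz, mem_neg, hB1]
          exact Finset.mem_union_right _ (mem_pr.2 (Or.inr (by rwa [neg_neg])))
    obtain ⟨M, hM, hMB⟩ := hcS
    obtain ⟨x, hx⟩ := hne M hM
    have hx2 := hcl M hM x hx
    rw [Finset.two_lt_card]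
    exact ⟨1, h1.1, -1, h1.2, x, hMB hx, by norm_num, by omega, by omega⟩
  · intro B hB hz
    rcases hcases B hB with h | rfl | rfl
    · exact absurd hz (hnonzero B h)
    · rcases hS1 with h | h
      · exact Finset.mem_union_left _ h
      · rw [← hz, mem_neg]; exact Finset.mem_union_left _ h
    · rw [neg_neg_block] at hz
      rw [← hz]
      rcases hS1 with h | h
      · exact Finset.mem_union_left _ h
      · rw [hz, mem_neg]; exact Finset.mem_union_left _ h
  · intro B hB' C hC' hne'
    by_cases he : strip B = strip C
    · have hd := hB.disjoint B hB' C hC' hne'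
      rintro ⟨b, hb, -⟩
      exact Finset.disjoint_left.1 hd (strip_subset _ hb) (strip_subset _ (he ▸ hb))
    · exact not_alt_pairs hP (by norm_num) hb.inv hl hU2 hV2 hbelow _ (hstrip' B hB') _
        (hstrip' C hC') he
  · intro _ B hB' h1B C hC' hCB hCB'
    have hBc : strip B ∪ neg (strip B) = pr (U ∪ V, U ∪ V) := by
      rcases hcases B hB' with h | rfl | rfl
      · have := hother B h
        rw [← this, mem_strip] at h1B
        exact absurd rfl h1B.2.1
      · rw [hst, pr_union_neg]
      · rw [strip_neg, hst, neg_neg_block, Finset.union_comm, pr_union_neg]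
    have hBS : B = S ∪ pr (U, V) ∨ B = neg (S ∪ pr (U, V)) := by
      refine (hcases B hB').resolve_left fun h => ?_
      have := hother B h
      rw [← this, mem_strip] at h1B
      exact absurd rfl h1B.2.1
    have hC : C ∈ pm (D ∪ cross ps) := by
      rcases hcases C hC' with h | h | h
      · exact h
      · rcases hBS with e | e
        · exact absurd (h.trans e.symm) hCB
        · exact absurd (by rw [e, neg_neg_block]; exact h) hCB'
      · rcases hBS with e | e
        · exact absurd (by rw [e]; exact h) hCB'
        · exact absurd (h.trans e.symm) hCB
    have hUV : ∀ x ∈ U ∪ V, ∃ N ∈ c, x ∈ N := fun x hx =>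
      (Finset.mem_union.1 hx).elim (hU2 x) (hV2 x)
    rw [hBc]
    refine not_alt_pairs hP (by norm_num) hb.inv hl hUV hUV (Or.inl rfl) _ ?_ _
      (hstrip _ _ C hC' hC) ?_
    · exact mem_pm.2 (Or.inl (by simp))
    · intro e
      rw [hother C hC] at e
      refine hnonzero C hC ?_
      rw [← e, neg_pr]
      rfl


/-! ### Reading the word of a noncrossing partition -/

/-- `T` is a symmetric partition of `{x | j ≤ |x| ≤ n}`. -/
structure SymPart (n : ℕ) (j : ℤ) (T : Finset (Finset ℤ)) : Prop where
  nonempty : ∀ B ∈ T, B.Nonempty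
  eq_of_mem : ∀ B ∈ T, ∀ C ∈ T, ∀ x, x ∈ B → x ∈ C → B = C
  range : ∀ B ∈ T, ∀ x ∈ B, x ∈ ground n ∧ j ≤ |x|
  cover : ∀ x ∈ ground n, j ≤ |x| → ∃ B ∈ T, x ∈ B
  neg_mem : ∀ B ∈ T, neg B ∈ T

/-- The part of `B` in `{j, j+1, …}`. -/
def upper (j : ℤ) (B : Finset ℤ) : Finset ℤ := B.filter (fun x => j ≤ x)

theorem mem_upper {j : ℤ} {B : Finset ℤ} {x : ℤ} : x ∈ upper j B ↔ x ∈ B ∧ j ≤ x := by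
  simp [upper]

theorem upper_eq_insert {j : ℤ} {B : Finset ℤ} (h : j ∈ B) :
    upper j B = insert j (upper (j + 1) B) := by
  ext x
  rw [Finset.mem_insert, mem_upper, mem_upper]
  constructor
  · rintro ⟨h1, h2⟩
    rcases h2.eq_or_lt with h2 | h2
    · exact Or.inl h2.symm
    · exact Or.inr ⟨h1, by omega⟩
  · rintro (rfl | ⟨h1, h2⟩)
    · exact ⟨h, le_rfl⟩
    · exact ⟨h1, by omega⟩

theorem upper_of_notMem {j : ℤ} {B : Finset ℤ} (h : j ∉ B) : upper j B = upper (j + 1) B := by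
  ext x
  rw [mem_upper, mem_upper]
  refine and_congr_right fun hx => ⟨fun h2 => ?_, fun h2 => by omega⟩
  rcases h2.eq_or_lt with h2 | h2
  · exact absurd (h2 ▸ hx) h
  · omega

/-- A noncrossing symmetric partition is read from its largest element down. -/
theorem SymPart.exists_build {n : ℕ} {j₀ : ℤ} (hj₀ : 1 ≤ j₀) {T : Finset (Finset ℤ)}
    (hT : SymPart n j₀ T) (hN : ∀ B ∈ T, ∀ C ∈ T, B ≠ C → ¬ Alt n B C) :
    ∀ k : ℕ, (k : ℤ) ≤ n + 1 - j₀ → ∃ u l D, BuildNC n u l D ∧ u.length = k ∧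
      (∀ N, N ∈ l ↔ ∃ B ∈ T, upper (n - k + 1) B = N ∧ N.Nonempty ∧ ∃ x ∈ B, x < n - k + 1) ∧
      (∀ N, N ∈ D ↔ N ∈ T ∧ ∀ x ∈ N, (n - k + 1 : ℤ) ≤ x) := by
  intro k
  induction k with
  | zero =>
    intro _
    refine ⟨[], [], ∅, .nil, rfl, fun N => ?_, fun N => ?_⟩
    · simp only [List.not_mem_nil, false_iff]
      rintro ⟨B, hB, rfl, ⟨x, hx⟩, -⟩
      rw [mem_upper] at hx
      have := (mem_ground.1 (hT.range B hB x hx.1).1).2.2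
      push_cast at hx
      omega
    · simp only [Finset.notMem_empty, false_iff]
      rintro ⟨hB, h⟩
      obtain ⟨x, hx⟩ := hT.nonempty N hB
      have := h x hx
      have := (mem_ground.1 (hT.range N hB x hx).1).2.2
      push_cast at *
      omega
  | succ k ih =>
    intro hk
    push_cast at hk
    obtain ⟨u, l, D, hb, hu, hl, hD⟩ := ih (by omega)
    have hp := hb.pieces
    rw [hu] at hp
    obtain ⟨i, hi⟩ : ∃ i : ℤ, i = n - k := ⟨_, rfl⟩
    have hi' : (n : ℤ) - (k + 1 : ℕ) + 1 = i := by push_cast; omega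
    have hui : (n : ℤ) - u.length = i := by omega
    rw [hi']
    rw [← hi] at hl hD hp
    have hi1 : 1 ≤ i := by omega
    obtain ⟨B, hB, hiB⟩ := hT.cover i (by rw [mem_ground]; omega) (by rw [abs_of_pos (by omega)]; omega)
    -- the other blocks
    have hoth : ∀ C ∈ T, C ≠ B → i ∉ C := fun C hC hne h => hne (hT.eq_of_mem C hC B hB i h hiB)
    have hinj : ∀ C ∈ T, (upper (i + 1) C).Nonempty → upper (i + 1) C = upper (i + 1) B → C = B := by
      rintro C hC ⟨x, hx⟩ e
      exact hT.eq_of_mem C hC B hB x (mem_upper.1 hx).1 (mem_upper.1 (e ▸ hx)).1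
    have hDj : ∀ N, (N ∈ T ∧ ∀ x ∈ N, i ≤ x) ↔ (N = B ∧ ∀ x ∈ B, i ≤ x) ∨ N ∈ D := by
      intro N
      rw [hD]
      constructor
      · rintro ⟨h1, h2⟩
        by_cases e : N = B
        · exact Or.inl ⟨e, e ▸ h2⟩
        · refine Or.inr ⟨h1, fun x hx => ?_⟩
          rcases (h2 x hx).eq_or_lt with h | h
          · exact absurd (h ▸ hx) (hoth N h1 e)
          · omega
      · rintro (⟨rfl, h⟩ | ⟨h1, h2⟩)
        · exact ⟨hB, h⟩
        · exact ⟨h1, fun x hx => by have := h2 x hx; omega⟩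
    have hlj : ∀ N, (∃ C ∈ T, upper i C = N ∧ N.Nonempty ∧ ∃ x ∈ C, x < i) ↔
        (N = upper i B ∧ ∃ x ∈ B, x < i) ∨ (N ∈ l ∧ N ≠ upper (i + 1) B) := by
      intro N
      rw [hl]
      constructor
      · rintro ⟨C, hC, rfl, hne, x, hx, hxi⟩
        by_cases e : C = B
        · subst e; exact Or.inl ⟨rfl, x, hx, hxi⟩
        · have := upper_of_notMem (hoth C hC e)
          refine Or.inr ⟨⟨C, hC, this.symm, hne, x, hx, by omega⟩, fun h => e ?_⟩
          rw [this] at h hne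
          exact hinj C hC hne h
      · rintro (⟨rfl, x, hx, hxi⟩ | ⟨⟨C, hC, rfl, hne, x, hx, hxi⟩, h⟩)
        · exact ⟨B, hB, rfl, ⟨i, mem_upper.2 ⟨hiB, le_rfl⟩⟩, x, hx, hxi⟩
        · have e : C ≠ B := by rintro rfl; exact h rfl
          have hxi' : x ≠ i := by rintro rfl; exact hoth C hC e hx
          exact ⟨C, hC, upper_of_notMem (hoth C hC e), hne, x, hx, by omega⟩
    have hins := upper_eq_insert hiB
    -- The letter of `i` is given by two questions: does its block have elements above `i`, and does
    -- it have elements below `i`.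
    by_cases hmax : upper (i + 1) B = ∅
    · rw [hmax] at hins hlj
      have hlne : ∀ N ∈ l, N ≠ ∅ := fun N hN => (hp.nonempty N (Or.inl hN)).ne_empty
      by_cases hlow : ∃ x ∈ B, x < i
      · refine ⟨_, _, _, hb.cl, by simp [hu], fun N => ?_, fun N => ?_⟩
        · rw [hlj, hui, List.mem_cons, hins]
          constructor
          · rintro (h | h)
            · exact Or.inl ⟨h, hlow⟩
            · exact Or.inr ⟨h, hlne N h⟩
          · rintro (h | h)
            · exact Or.inl h.1
            · exact Or.inr h.1
        · rw [hDj]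
          refine ⟨Or.inr, fun h => h.resolve_left ?_⟩
          rintro ⟨-, h⟩
          obtain ⟨x, hx, hxi⟩ := hlow
          have := h x hx; omega
      · have hBi : B = {i} := by
          rw [insert_empty_eq] at hins
          rw [← hins]
          ext x
          rw [mem_upper]
          push Not at hlow
          exact ⟨fun h => ⟨h, hlow x h⟩, fun h => h.1⟩
        refine ⟨_, _, _, hb.both, by simp [hu], fun N => ?_, fun N => ?_⟩
        · rw [hlj]
          constructor
          · intro h; exact Or.inr ⟨h, hlne N h⟩
          · rintro (h | h)
            · exact absurd h.2 hlow
            · exact h.1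
        · rw [hDj, hui, Finset.mem_insert, ← hBi]
          push Not at hlow
          exact or_congr_left ⟨fun h => ⟨h, hlow⟩, fun h => h.1⟩
    · have hne := Finset.nonempty_iff_ne_empty.2 hmax
      have hmem : upper (i + 1) B ∈ l := (hl _).2 ⟨B, hB, rfl, hne, i, hiB, by omega⟩
      obtain ⟨l₁, l₂, rfl⟩ := List.append_of_mem hmem
      -- A piece in front of that of `B` has an element `b'` between `i` and the piece of `B`. Its
      -- block `C` also has an element below `i`, so `C` would alternate with `B`.
      have hl1 : l₁ = [] := by
        rcases l₁ with _ | ⟨N', l₁⟩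
        · rfl
        exfalso
        have hN' := (hl N').1 (by simp)
        obtain ⟨C, hC, rfl, -, x, hx, hxi⟩ := hN'
        have hs := hp.sorted
        rw [List.cons_append, List.pairwise_cons] at hs
        obtain ⟨b', hb', hlt⟩ := hs.1 (upper (i + 1) B) (by simp)
        have hCB : C ≠ B := by
          rintro rfl
          exact lt_irrefl _ (hlt b' hb')
        obtain ⟨c, hc⟩ := hne
        have hbc := hlt c hc
        rw [mem_upper] at hb' hc
        have hxi' : x ≠ i := by rintro rfl; exact hoth C hC hCB hx
        have gx := mem_ground.1 (hT.range C hC x hx).1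
        have gc := mem_ground.1 (hT.range B hB c hc.1).1
        have k1 := key_of_pos (n := n) (a := i) (by omega)
        have k2 := key_of_pos (n := n) (a := b') (by omega)
        have k3 := key_of_pos (n := n) (a := c) (by omega)
        have k4 := key_cases n gx.1
        apply hN C hC B hB hCB
        by_cases hx0 : 0 < x
        · exact ⟨x, hx, i, hiB, b', hb'.1, c, hc.1, Or.inl (by omega)⟩
        · exact ⟨b', hb'.1, i, hiB, x, hx, c, hc.1, Or.inr (by omega)⟩
      subst hl1
      have hnd := hp.nodup
      rw [List.nil_append, List.nodup_cons] at hnd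
      have hrest : ∀ N, N ∈ [] ++ upper (i + 1) B :: l₂ ∧ N ≠ upper (i + 1) B ↔ N ∈ l₂ := by
        intro N
        rw [List.nil_append, List.mem_cons]
        constructor
        · rintro ⟨h | h, h'⟩
          · exact absurd h h'
          · exact h
        · intro h
          exact ⟨Or.inr h, by rintro rfl; exact hnd.1 h⟩
      by_cases hlow : ∃ x ∈ B, x < i
      · refine ⟨_, _, _, hb.tr rfl, by simp [hu], fun N => ?_, fun N => ?_⟩
        · rw [hlj, hui, List.mem_cons, hins, hrest, List.nil_append]
          exact or_congr_left ⟨fun h => ⟨h, hlow⟩, fun h => h.1⟩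
        · rw [hDj]
          refine ⟨Or.inr, fun h => h.resolve_left ?_⟩
          rintro ⟨-, h⟩
          obtain ⟨x, hx, hxi⟩ := hlow
          have := h x hx; omega
      · have hBi : B = upper i B := by
          ext x
          rw [mem_upper]
          push Not at hlow
          exact ⟨fun h => ⟨h, hlow x h⟩, fun h => h.1⟩
        refine ⟨_, _, _, hb.op rfl, by simp [hu], fun N => ?_, fun N => ?_⟩
        · rw [hlj, hrest, List.nil_append]
          refine ⟨Or.inr, fun h => h.resolve_left ?_⟩
          rintro ⟨-, h⟩
          exact hlow h
        · rw [hDj, hui, Finset.mem_insert, ← hins, ← hBi]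
          push Not at hlow
          exact or_congr_left ⟨fun h => ⟨h, hlow⟩, fun h => h.1⟩

/-- An involution that reverses the order of a sorted list reverses the list. -/
theorem map_eq_reverse {α : Type*} {r : α → α → Prop} {l : List α} (g : α → α) (hl : l.Pairwise r)
    (hg : ∀ a ∈ l, g a ∈ l ∧ g (g a) = a) (hr : ∀ a ∈ l, ∀ b ∈ l, r a b → ¬ r b a)
    (hgr : ∀ a ∈ l, ∀ b ∈ l, r a b → r (g b) (g a)) : l.map g = l.reverse := by
  have hnd : l.Nodup := (List.Pairwise.and_mem.1 hl).imp fun ⟨ha, _, h⟩ e =>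
    hr _ ha _ ha (e ▸ h) (e ▸ h)
  have hperm : ((l.map g).reverse).Perm l := by
    refine (List.reverse_perm _).trans ?_
    rw [List.perm_ext_iff_of_nodup ?_ hnd]
    · intro a
      rw [List.mem_map]
      constructor
      · rintro ⟨b, hb, rfl⟩; exact (hg b hb).1
      · intro ha; exact ⟨g a, (hg a ha).1, (hg a ha).2⟩
    · refine List.Nodup.map_on (fun x hx y hy e => ?_) hnd
      rw [← (hg x hx).2, e, (hg y hy).2]
  have hs : ((l.map g).reverse).Pairwise r := by
    rw [List.pairwise_reverse, List.pairwise_map]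
    exact (List.Pairwise.and_mem.1 hl).imp fun ⟨ha, hb, h⟩ => hgr _ ha _ hb h
  have := hperm.eq_of_pairwise (le := r) (fun a b ha hb h1 h2 =>
    absurd h2 (hr a (hperm.mem_iff.1 ha) b hb h1)) hs hl
  rw [← this, List.reverse_reverse, this]

/-- A list on which `g` acts as the reversal. -/
theorem exists_pairs_of_map_eq_reverse {α : Type*} (g : α → α) : ∀ l : List α,
    l.map g = l.reverse → ∃ (ps : List (α × α)) (c : List α),
      l = ps.map Prod.fst ++ c ++ (ps.map Prod.snd).reverse ∧ (∀ p ∈ ps, p.2 = g p.1) ∧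
      (c = [] ∨ ∃ M, c = [M] ∧ g M = M) := by
  intro l
  induction l using List.bidirectionalRec with
  | nil => exact fun _ => ⟨[], [], by simp⟩
  | singleton a => exact fun h => ⟨[], [a], by simp, by simp, Or.inr ⟨a, rfl, by simpa using h⟩⟩
  | cons_append a l b ih =>
    intro h
    simp only [List.map_cons, List.map_append, List.map_nil, List.reverse_cons, List.reverse_append,
      List.reverse_nil, List.nil_append, List.cons_append, List.cons.injEq] at h
    obtain ⟨h1, h2⟩ := h
    rw [List.append_singleton_inj] at h2
    obtain ⟨ps, c, rfl, h3, h4⟩ := ih h2.1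
    refine ⟨(a, b) :: ps, c, by simp, ?_, h4⟩
    intro p hp
    rcases List.mem_cons.1 hp with rfl | hp
    · exact h1.symm
    · exact h3 p hp

/-- The unfinished pieces are the upper parts of the blocks with elements on both sides. The passage
from a block to its negative induces an involution `g` on them, and `g` reverses the order because
the blocks do not cross. So the first piece is paired with the last one and so on, and a fixed piece
is that of the zero block. -/
theorem SymPart.decode {n : ℕ} {j : ℤ} (hj : 1 ≤ j) (hjn : j ≤ n + 1) {T : Finset (Finset ℤ)}
    (hT : SymPart n j T) (hA : ∀ B ∈ T, ∀ C ∈ T, B ≠ C → ¬ Alt n B C) :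
    ∃ u l D ps c C, BuildNC n u l D ∧ (u.length : ℤ) = n + 1 - j ∧
      l = ps.map Prod.fst ++ c ++ (ps.map Prod.snd).reverse ∧ CenterB c C ∧
      T = pm (D ∪ (cross ps ∪ C)) ∧ ∀ K ∈ T, neg K = K → K ∈ C := by
  obtain ⟨k, hk⟩ : ∃ k : ℕ, (k : ℤ) = n + 1 - j := ⟨(n + 1 - j).toNat, by omega⟩
  obtain ⟨u, l, D, hb, hu, hl, hD⟩ := hT.exists_build hj hA k hk.le
  rw [show (n : ℤ) - k + 1 = j by omega] at hl hD
  have hp := hb.pieces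
  rw [hu, show (n : ℤ) - k + 1 = j by omega] at hp
  have hneg : ∀ B ∈ T, ∀ x ∈ B, x < j → x < 0 := by
    intro B hB x hx hxj
    by_contra h
    have := (hT.range B hB x hx).2
    rw [abs_of_nonneg (by omega)] at this
    omega
  have hposj : ∀ B ∈ T, ∀ x ∈ B, 0 < x → j ≤ x := by
    intro B hB x hx h0
    by_contra h
    have := hneg B hB x hx (by omega)
    omega
  have hblk : ∀ N, ∃ B, N ∈ l → B ∈ T ∧ upper j B = N ∧ N.Nonempty ∧ ∃ x ∈ B, x < j := by
    intro N
    by_cases h : N ∈ l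
    · obtain ⟨B, hB⟩ := (hl N).1 h
      exact ⟨B, fun _ => hB⟩
    · exact ⟨∅, fun h' => absurd h' h⟩
  choose blk hblk using hblk
  set g : Finset ℤ → Finset ℤ := fun N => upper j (neg (blk N)) with hg
  have hsplit : ∀ B ∈ T, B = pr (upper j B, upper j (neg B)) := by
    intro B hB
    ext x
    rw [mem_pr, mem_upper, mem_upper, mem_neg, neg_neg]
    constructor
    · intro hx
      have := (mem_ground.1 (hT.range B hB x hx).1).1
      by_cases h0 : 0 < x
      · exact Or.inl ⟨hx, hposj B hB x hx h0⟩
      · exact Or.inr ⟨hx, hposj _ (hT.neg_mem B hB) _ (by rwa [mem_neg, neg_neg]) (by omega)⟩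
    · rintro (h | h) <;> exact h.1
  have hblkpr : ∀ N ∈ l, blk N = pr (N, g N) := by
    intro N hN
    have h := hblk N hN
    conv_lhs => rw [hsplit _ h.1, h.2.1]
  have hgl : ∀ N ∈ l, g N ∈ l ∧ blk (g N) = neg (blk N) := by
    intro N hN
    obtain ⟨h1, h2, ⟨y, hy⟩, x, hx, hxj⟩ := hblk N hN
    have hx0 := hneg _ h1 x hx hxj
    have hgx : -x ∈ g N := by
      rw [hg, mem_upper, mem_neg, neg_neg]
      exact ⟨hx, hposj _ (hT.neg_mem _ h1) _ (by rwa [mem_neg, neg_neg]) (by omega)⟩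
    have hm : g N ∈ l := by
      rw [hl]
      refine ⟨neg (blk N), hT.neg_mem _ h1, rfl, ⟨_, hgx⟩, -y, ?_, ?_⟩
      · rw [mem_neg, neg_neg]
        rw [← h2, mem_upper] at hy
        exact hy.1
      · have := (hp.range N (Or.inl hN) y hy).1
        omega
    refine ⟨hm, ?_⟩
    have h' := hblk _ hm
    refine hT.eq_of_mem _ h'.1 _ (hT.neg_mem _ h1) (-x) ?_ (by rwa [mem_neg, neg_neg])
    have : -x ∈ upper j (blk (g N)) := by rw [h'.2.1]; exact hgx
    exact (mem_upper.1 this).1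
  have hgg : ∀ N ∈ l, g (g N) = N := by
    intro N hN
    show upper j (neg (blk (g N))) = N
    rw [(hgl N hN).2, neg_neg_block, (hblk N hN).2.1]
  have hbelow : ∀ N ∈ l, ∀ N' ∈ l, N ≠ N' → Below N N' → Below (g N') (g N) := by
    intro N hN N' hN' hne hlt
    have hgne : g N ≠ g N' := fun e => hne (by rw [← hgg N hN, e, hgg N' hN'])
    rcases (pairwise_total hb.inv.below (hgl N hN).1 (hgl N' hN').1).resolve_left hgne with h | h
    -- If `g` kept the order of `N` and `N'`, the labels `a`, `b`, `-c`, `-d` would follow each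
    -- other clockwise and belong alternately to the two blocks.
    · exfalso
      obtain ⟨a, ha⟩ := hp.nonempty N (Or.inl hN)
      obtain ⟨b, hb'⟩ := hp.nonempty N' (Or.inl hN')
      obtain ⟨c, hc⟩ := hp.nonempty _ (Or.inl (hgl N hN).1)
      obtain ⟨d, hd⟩ := hp.nonempty _ (Or.inl (hgl N' hN').1)
      have r1 := hp.range N (Or.inl hN) a ha
      have r2 := hp.range N' (Or.inl hN') b hb'
      have r3 := hp.range _ (Or.inl (hgl N hN).1) c hc
      have r4 := hp.range _ (Or.inl (hgl N' hN').1) d hd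
      have e1 := hlt a ha b hb'
      have e2 := h c hc d hd
      have k1 := key_of_pos (n := n) (a := a) (by omega)
      have k2 := key_of_pos (n := n) (a := b) (by omega)
      have k3 := key_of_neg (n := n) (a := -c) (by omega)
      have k4 := key_of_neg (n := n) (a := -d) (by omega)
      refine hA _ (hblk N hN).1 _ (hblk N' hN').1 ?_ ⟨a, ?_, b, ?_, -c, ?_, -d, ?_, Or.inl (by omega)⟩
      · intro e
        exact hne (by rw [← (hblk N hN).2.1, e, (hblk N' hN').2.1])
      · rw [hblkpr N hN, mem_pr]; exact Or.inl ha
      · rw [hblkpr N' hN', mem_pr]; exact Or.inl hb'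
      · rw [hblkpr N hN, mem_pr, neg_neg]; exact Or.inr hc
      · rw [hblkpr N' hN', mem_pr, neg_neg]; exact Or.inr hd
    · exact h
  have hrev : l.map g = l.reverse := by
    refine map_eq_reverse (r := fun a b => Below a b ∧ a ≠ b) g (hb.inv.below.and hp.nodup)
      (fun N hN => ⟨(hgl N hN).1, hgg N hN⟩) (fun a ha b hb' h1 h2 => ?_) fun a ha b hb' h => ?_
    · obtain ⟨x, hx⟩ := hp.nonempty a (Or.inl ha)
      obtain ⟨y, hy⟩ := hp.nonempty b (Or.inl hb')
      have := h1.1 x hx y hy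
      have := h2.1 y hy x hx
      omega
    · exact ⟨hbelow a ha b hb' h.2 h.1, fun e => h.2 (by rw [← hgg a ha, ← e, hgg b hb'])⟩
  obtain ⟨ps, c, hlps, hps, hc⟩ := exists_pairs_of_map_eq_reverse g l hrev
  have hprs : ∀ p ∈ ps, p.1 ∈ l ∧ pr p = blk p.1 := by
    intro p h
    have hm : p.1 ∈ l := by
      rw [hlps]; simp only [List.mem_append, List.mem_map]; exact Or.inl (Or.inl ⟨p, h, rfl⟩)
    refine ⟨hm, ?_⟩
    rw [hblkpr _ hm, ← hps p h]
  obtain ⟨C, hC, hCmem⟩ : ∃ C, CenterB c C ∧ ∀ K, K ∈ C ↔ ∃ M ∈ c, K = blk M := by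
    rcases hc with rfl | ⟨M, rfl, hM⟩
    · exact ⟨∅, .none, by simp⟩
    · refine ⟨_, .zero M, fun K => ?_⟩
      have hm : M ∈ l := by rw [hlps]; simp
      have := hblkpr M hm
      rw [hM] at this
      simp [this]
  have hlmem : ∀ N ∈ l, (∃ p ∈ ps, N = p.1 ∨ N = p.2) ∨ N ∈ c := by
    intro N hN
    rw [hlps] at hN
    simp only [List.mem_append, List.mem_reverse, List.mem_map] at hN
    rcases hN with (⟨p, h, rfl⟩ | h) | ⟨p, h, rfl⟩
    · exact Or.inl ⟨p, h, Or.inl rfl⟩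
    · exact Or.inr h
    · exact Or.inl ⟨p, h, Or.inr rfl⟩
  refine ⟨u, l, D, ps, c, C, hb, by omega, hlps, hC, ?_, ?_⟩
  · ext B
    rw [mem_pm, Finset.mem_union, Finset.mem_union, Finset.mem_union, Finset.mem_union, mem_cross,
      mem_cross, hCmem, hCmem, hD, hD]
    constructor
    · intro hB
      by_cases h1 : ∀ x ∈ B, j ≤ x
      · exact Or.inl (Or.inl ⟨hB, h1⟩)
      by_cases h2 : ∀ x ∈ neg B, j ≤ x
      · exact Or.inr (Or.inl ⟨hT.neg_mem B hB, h2⟩)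
      push Not at h1 h2
      obtain ⟨x, hx, hxj⟩ := h1
      obtain ⟨y, hy, hyj⟩ := h2
      have hy0 := hneg _ (hT.neg_mem B hB) y hy hyj
      have hyB : -y ∈ B := mem_neg.1 hy
      have hy' : -y ∈ upper j B := mem_upper.2 ⟨hyB, hposj B hB _ hyB (by omega)⟩
      have hBl : upper j B ∈ l := (hl _).2 ⟨B, hB, rfl, ⟨_, hy'⟩, x, hx, hxj⟩
      have hBblk : blk (upper j B) = B := by
        have h := hblk _ hBl
        refine hT.eq_of_mem _ h.1 B hB (-y) ?_ hyB
        have : -y ∈ upper j (blk (upper j B)) := by rwa [h.2.1]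
        exact (mem_upper.1 this).1
      rcases hlmem _ hBl with ⟨p, hp', h | h⟩ | h
      · exact Or.inl (Or.inr (Or.inl ⟨p, hp', by rw [(hprs p hp').2, ← h, hBblk]⟩))
      · refine Or.inr (Or.inr (Or.inl ⟨p, hp', ?_⟩))
        rw [(hprs p hp').2]
        have e := (hgl _ (hprs p hp').1).2
        rw [← hps p hp', ← h, hBblk] at e
        rw [e, neg_neg_block]
      · exact Or.inl (Or.inr (Or.inr ⟨_, h, hBblk.symm⟩))
    · have hm : ∀ B, ((B ∈ T ∧ ∀ x ∈ B, j ≤ x) ∨ (∃ p ∈ ps, pr p = B) ∨ ∃ M ∈ c, B = blk M) →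
          B ∈ T := by
        rintro B (h | ⟨p, h, rfl⟩ | ⟨M, hM, rfl⟩)
        · exact h.1
        · rw [(hprs p h).2]
          exact (hblk _ (hprs p h).1).1
        · exact (hblk M (by rw [hlps]; simp [hM])).1
      rintro (h | h)
      · exact hm B h
      · have := hT.neg_mem _ (hm _ h)
        rwa [neg_neg_block] at this
  · intro K hK hz
    rw [hCmem]
    obtain ⟨x, hx⟩ := hT.nonempty K hK
    have hx0 := (mem_ground.1 (hT.range K hK x hx).1).1
    have hnx : -x ∈ K := by rw [← hz, mem_neg, neg_neg]; exact hx
    have key : ∀ x ∈ K, 0 < x → -x ∈ K → ∃ M ∈ c, K = blk M := by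
      intro x hx h0 hnx
      have hxu : x ∈ upper j K := mem_upper.2 ⟨hx, hposj K hK x hx h0⟩
      have hKl : upper j K ∈ l := (hl _).2 ⟨K, hK, rfl, ⟨x, hxu⟩, -x, hnx, by omega⟩
      have hKblk : blk (upper j K) = K := by
        have h := hblk _ hKl
        refine hT.eq_of_mem _ h.1 K hK x ?_ hx
        have : x ∈ upper j (blk (upper j K)) := by rwa [h.2.1]
        exact (mem_upper.1 this).1
      have hgK : g (upper j K) = upper j K := by
        show upper j (neg (blk (upper j K))) = _
        rw [hKblk, hz]
      have hnd := nodup_pairs ((perm_of_eq_middle hlps).nodup_iff.1 hp.nodup)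
      rcases hlmem _ hKl with ⟨p, hp', h | h⟩ | h
      · exact absurd (by rw [hps p hp', ← h, hgK]) (hnd.2.2.1 p hp' p hp')
      · have e : g p.2 = p.1 := by rw [hps p hp', hgg _ (hprs p hp').1]
        rw [← h, hgK] at e
        exact absurd (e.symm.trans h) (hnd.2.2.1 p hp' p hp')
      · exact ⟨_, h, hKblk.symm⟩
    rcases lt_or_gt_of_ne hx0 with h | h
    · exact key (-x) hnx (by omega) (by rwa [neg_neg])
    · exact key x hx h hnx

theorem exists_build_of_mem_NCB {n : ℕ} (hn : 1 ≤ n) {P : Finset (Finset ℤ)} (hP : P ∈ NCB n) :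
    ∃ u l D ps c C, BuildNC n u l D ∧ u.length = n ∧
      l = ps.map Prod.fst ++ c ++ (ps.map Prod.snd).reverse ∧ CenterB c C ∧
      P = pm (D ∪ (cross ps ∪ C)) := by
  rw [mem_NCB_iff hn] at hP
  obtain ⟨hB, hA⟩ := hP
  have hT : SymPart n 1 P := by
    refine ⟨hB.nonempty, fun B hB' C hC x h1 h2 => hB.eq_of_mem hB' hC h1 h2, fun B hB' x hx => ?_,
      fun x hx _ => hB.exists_mem hx, hB.neg_mem⟩
    have := hB.subset_ground hB' hx
    exact ⟨this, Int.one_le_abs (mem_ground.1 this).1⟩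
  obtain ⟨u, l, D, ps, c, C, h1, h2, h3, h4, h5, -⟩ := hT.decode le_rfl (by omega) hA
  exact ⟨u, l, D, ps, c, C, h1, by omega, h3, h4, h5⟩


/-! ### Reading the word of a noncrossing partition of type `D` -/

theorem IsBPartition.eq_of_forall_mem {n : ℕ} {P Q : Finset (Finset ℤ)} (hP : IsBPartition n P)
    (hQ : IsBPartition n Q) (h : ∀ B ∈ P, B ∈ Q) : P = Q := by
  ext B
  refine ⟨h B, fun hB => ?_⟩
  obtain ⟨b, hb⟩ := hQ.nonempty B hB
  obtain ⟨C, hC, hbC⟩ := hP.exists_mem (hQ.subset_ground hB hb)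
  rwa [hQ.eq_of_mem hB (h C hC) hb hbC]

/-- The blocks without `1` and `-1`. -/
def outer (P : Finset (Finset ℤ)) : Finset (Finset ℤ) := P.filter (fun C => 1 ∉ C ∧ -1 ∉ C)

theorem mem_outer {P : Finset (Finset ℤ)} {C : Finset ℤ} :
    C ∈ outer P ↔ C ∈ P ∧ 1 ∉ C ∧ -1 ∉ C := by simp [outer]

/-- `Z` holds, up to sign, the blocks that are to cover the elements of `B₁ ∪ -B₁` other than `±1`.
-/
theorem symPart_outer {n : ℕ} {P : Finset (Finset ℤ)} (hP : IsBPartition n P)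
    {B₁ : Finset ℤ} (hB : B₁ ∈ P) (h1 : 1 ∈ B₁) {Z : Finset (Finset ℤ)}
    (hne : ∀ K ∈ Z, K.Nonempty)
    (hmem : ∀ x, x ∈ strip B₁ ∪ neg (strip B₁) ↔ ∃ K ∈ pm Z, x ∈ K)
    (heq : ∀ K ∈ pm Z, ∀ K' ∈ pm Z, ∀ x ∈ K, x ∈ K' → K = K') :
    SymPart n 2 (outer P ∪ pm Z) := by
  have hB' := hP.neg_mem B₁ hB
  have h1' : -1 ∈ neg B₁ := by rw [mem_neg, neg_neg]; exact h1
  have hout : ∀ C ∈ P, C ∈ outer P ∨ C = B₁ ∨ C = neg B₁ := by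
    intro C hC
    by_cases c1 : 1 ∈ C
    · exact Or.inr (Or.inl (hP.eq_of_mem hC hB c1 h1))
    by_cases c2 : -1 ∈ C
    · exact Or.inr (Or.inr (hP.eq_of_mem hC hB' c2 h1'))
    · exact Or.inl (mem_outer.2 ⟨hC, c1, c2⟩)
  have hdisj : ∀ C ∈ outer P, ∀ x ∈ C, x ∉ strip B₁ ∪ neg (strip B₁) := by
    intro C hC x hx h
    rw [mem_outer] at hC
    rw [Finset.mem_union, mem_neg] at h
    rcases h with h | h
    · have := hP.eq_of_mem hC.1 hB hx (strip_subset _ h)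
      exact hC.2.1 (this ▸ h1)
    · have := hP.eq_of_mem hC.1 hB' hx (mem_neg.2 (strip_subset _ h))
      exact hC.2.2 (this ▸ h1')
  have habs : ∀ x ∈ ground n, x ≠ 1 → x ≠ -1 → (2 : ℤ) ≤ |x| := by
    intro x hx a b
    have := (mem_ground.1 hx).1
    rcases abs_cases x with h | h <;> omega
  refine ⟨?_, ?_, ?_, ?_, ?_⟩
  · intro B hB
    rw [Finset.mem_union, mem_outer, mem_pm] at hB
    rcases hB with h | h | h
    · exact hP.nonempty B h.1
    · exact hne B h
    · exact neg_nonempty.1 (hne _ h)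
  · intro B hB C hC x hx hx'
    rcases Finset.mem_union.1 hB with hB | hB <;> rcases Finset.mem_union.1 hC with hC | hC
    · exact hP.eq_of_mem (mem_outer.1 hB).1 (mem_outer.1 hC).1 hx hx'
    · exact absurd ((hmem x).2 ⟨C, hC, hx'⟩) (hdisj B hB x hx)
    · exact absurd ((hmem x).2 ⟨B, hB, hx⟩) (hdisj C hC x hx')
    · exact heq B hB C hC x hx hx'
  · intro B hB x hx
    rcases Finset.mem_union.1 hB with hB | hB
    · rw [mem_outer] at hB
      have hg := hP.subset_ground hB.1 hx
      exact ⟨hg, habs x hg (by rintro rfl; exact hB.2.1 hx) (by rintro rfl; exact hB.2.2 hx)⟩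
    · have := (hmem x).2 ⟨B, hB, hx⟩
      rw [Finset.mem_union, ← strip_neg] at this
      rcases this with h | h
      · have hg := hP.subset_ground ‹B₁ ∈ P› (strip_subset _ h)
        rw [mem_strip] at h
        exact ⟨hg, habs x hg h.2.1 h.1⟩
      · have hg := hP.subset_ground hB' (strip_subset _ h)
        rw [mem_strip] at h
        exact ⟨hg, habs x hg h.2.1 h.1⟩
  · intro x hx hx2
    have x1 : x ≠ 1 := by rintro rfl; norm_num at hx2
    have x2 : x ≠ -1 := by rintro rfl; norm_num at hx2
    obtain ⟨C, hC, hxC⟩ := hP.exists_mem hx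
    rcases hout C hC with h | rfl | rfl
    · exact ⟨C, Finset.mem_union_left _ h, hxC⟩
    · obtain ⟨K, hK, h⟩ := (hmem x).1 (Finset.mem_union_left _ (mem_strip.2 ⟨x2, x1, hxC⟩))
      exact ⟨K, Finset.mem_union_right _ hK, h⟩
    · obtain ⟨K, hK, h⟩ := (hmem x).1 (Finset.mem_union_right _ (by
        rw [← strip_neg]; exact mem_strip.2 ⟨x2, x1, hxC⟩))
      exact ⟨K, Finset.mem_union_right _ hK, h⟩
  · intro B hB
    rw [Finset.mem_union, mem_outer] at hB ⊢
    refine hB.imp (fun h => ⟨hP.neg_mem B h.1, ?_, ?_⟩) neg_mem_pm.2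
    · rw [mem_neg]; exact h.2.2
    · rw [mem_neg, neg_neg]; exact h.2.1

/-- The blocks of `±1` are replaced by blocks without `±1` such that the result can be decoded as in
type `B`. A zero block just loses `±1`. If the rest of `B₁` has elements of one sign only, it is
united with its negative to a zero block. If it is mixed, it is kept together with its negative, and
the condition at the centroid forces this pair to be the innermost one, which makes its two pieces
the central pieces. If it is empty, nothing is put in its place. -/
theorem exists_build_of_mem_NCD {n : ℕ} (hn : 2 ≤ n) {P : Finset (Finset ℤ)} (hPD : P ∈ NCD n) :
    ∃ u l D ps c s t S U V, BuildNC n u l D ∧ u.length + 1 = n ∧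
      l = ps.map Prod.fst ++ c ++ (ps.map Prod.snd).reverse ∧ CenterD s t c S U V ∧
      P = pm (D ∪ (cross ps ∪ {S ∪ pr (U, V)})) := by
  have hX := noncrossingD_of_mem_NCD hn hPD
  rw [NCD, Set.mem_ofPred_eq] at hPD
  have hD := hPD.1
  have hP := hD.toIsBPartition
  obtain ⟨B₁, hB, h1⟩ := hP.exists_mem (a := 1) (by rw [mem_ground]; omega)
  have hB' := hP.neg_mem B₁ hB
  have h1' : -1 ∈ neg B₁ := by rw [mem_neg, neg_neg]; exact h1
  have hsub : ∀ B ∈ P, B ⊆ ground n := fun B hB => hP.subset_ground hB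
  have houts : ∀ C ∈ outer P, strip C = C := fun C hC => by
    rw [mem_outer] at hC
    exact strip_eq_self hC.2.1 hC.2.2
  have hne1 : ∀ C ∈ outer P, C ≠ B₁ := by
    rintro C hC rfl
    exact (mem_outer.1 hC).2.1 h1
  have hne2 : ∀ C ∈ outer P, C ≠ neg B₁ := by
    rintro C hC rfl
    exact (mem_outer.1 hC).2.2 h1'
  have hmemR : ∀ C ∈ outer P, ∀ K : Finset ℤ, K.Nonempty → K ⊆ strip B₁ ∪ neg (strip B₁) →
      C ≠ K := by
    rintro C hC K ⟨x, hx⟩ hsubK rfl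
    have := hsubK hx
    rw [Finset.mem_union, mem_neg] at this
    rcases this with h | h
    · exact hne1 C hC (hP.eq_of_mem (mem_outer.1 hC).1 hB hx (strip_subset _ h))
    · exact hne2 C hC (hP.eq_of_mem (mem_outer.1 hC).1 hB' hx (mem_neg.2 (strip_subset _ h)))
  -- reading the partition with the blocks of `±1` replaced by those of `Z`
  have main : ∀ Z : Finset (Finset ℤ), (∀ K ∈ Z, K.Nonempty) →
      (∀ x, x ∈ strip B₁ ∪ neg (strip B₁) ↔ ∃ K ∈ pm Z, x ∈ K) →
      (∀ K ∈ pm Z, ∀ K' ∈ pm Z, ∀ x ∈ K, x ∈ K' → K = K') →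
      (∀ K ∈ pm Z, ∀ C ∈ outer P, ¬ Alt n K C) →
      (∀ K ∈ pm Z, ∀ K' ∈ pm Z, K ≠ K' → ¬ Alt n K K') →
      ∃ u l D ps c C, BuildNC n u l D ∧ u.length + 1 = n ∧
        l = ps.map Prod.fst ++ c ++ (ps.map Prod.snd).reverse ∧ CenterB c C ∧
        outer P ∪ pm Z = pm (D ∪ (cross ps ∪ C)) ∧
        ∀ K ∈ outer P ∪ pm Z, neg K = K → K ∈ C := by
    intro Z h1Z h2Z h3Z h4Z h5Z
    have hT := symPart_outer hP hB h1 h1Z h2Z h3Z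
    obtain ⟨u, l, D, ps, c, C, e1, e2, e3, e4, e5, e6⟩ := hT.decode (by norm_num) (by omega) (by
      intro B hB C hC hne
      rcases Finset.mem_union.1 hB with hB | hB <;> rcases Finset.mem_union.1 hC with hC | hC
      · have := hX.not_alt B (mem_outer.1 hB).1 C (mem_outer.1 hC).1 hne
        rwa [houts B hB, houts C hC] at this
      · exact fun h => h4Z C hC B hB h.symm
      · exact h4Z B hB C hC
      · exact h5Z B hB C hC hne)
    exact ⟨u, l, D, ps, c, C, e1, by omega, e3, e4, e5, e6⟩
  -- putting the blocks of `±1` back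
  have back : ∀ {u l D ps c s t S U V}, BuildNC n u l D → u.length + 1 = n →
      l = ps.map Prod.fst ++ c ++ (ps.map Prod.snd).reverse → CenterD s t c S U V →
      (B₁ = S ∪ pr (U, V) ∨ neg B₁ = S ∪ pr (U, V)) →
      (∀ B ∈ outer P, B ∈ pm (D ∪ cross ps)) → P = pm (D ∪ (cross ps ∪ {S ∪ pr (U, V)})) := by
    intro u l D ps c s t S U V hb hu hl hc hB₁ hO
    have hp : Pieces n 2 l D := by
      have := hb.pieces
      rwa [show (n : ℤ) - u.length + 1 = 2 by omega] at this
    refine hP.eq_of_forall_mem (config_D (by omega) hp (perm_of_eq_middle hl) hc).signed.isBPartition ?_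
    intro C hC
    rw [← Finset.union_assoc, pm_union, Finset.mem_union]
    have hB₁m : B₁ ∈ pm {S ∪ pr (U, V)} := by
      rw [mem_pm, Finset.mem_singleton, Finset.mem_singleton]; exact hB₁
    by_cases c1 : 1 ∈ C
    · rw [hP.eq_of_mem hC hB c1 h1]; exact Or.inr hB₁m
    by_cases c2 : -1 ∈ C
    · rw [hP.eq_of_mem hC hB' c2 h1']; exact Or.inr (neg_mem_pm.2 hB₁m)
    · exact Or.inl (hO C (mem_outer.2 ⟨hC, c1, c2⟩))
  have split : ∀ {D ps C Z}, outer P ∪ pm Z = pm (D ∪ (cross ps ∪ C)) →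
      (∀ B ∈ outer P, B ∉ pm C) → ∀ B ∈ outer P, B ∈ pm (D ∪ cross ps) := by
    intro D ps C Z h hno B hBo
    have : B ∈ pm (D ∪ (cross ps ∪ C)) := h ▸ Finset.mem_union_left _ hBo
    rw [← Finset.union_assoc, pm_union, Finset.mem_union] at this
    exact this.resolve_right (hno B hBo)
  have hnegpr : ∀ M, neg (pr (M, M)) = pr (M, M) := fun M => neg_pr _
  have hCz : ∀ {c C}, CenterB c C → ∀ K ∈ pm C, neg K = K := by
    rintro c C (_ | M) K hK
    · simp [pm] at hK
    · rw [mem_pm, Finset.mem_singleton, Finset.mem_singleton] at hK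
      rcases hK with rfl | hK
      · exact hnegpr M
      · rw [hK]; exact neg_injective (by rw [hK, hnegpr])
  by_cases hz : neg B₁ = B₁
  · -- the zero block
    have hR : neg (strip B₁) = strip B₁ := by rw [← strip_neg, hz]
    have hRne : (strip B₁).Nonempty := by
      rw [Finset.nonempty_iff_ne_empty]
      intro he
      have h2 := hD.two_lt_card B₁ hB hz
      have : B₁ ⊆ {1, -1} := by
        intro x hx
        by_contra h
        simp only [Finset.mem_insert, Finset.mem_singleton, not_or] at h
        have : x ∈ strip B₁ := mem_strip.2 ⟨h.2, h.1, hx⟩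
        rw [he] at this
        simp at this
      have := Finset.card_le_card this
      have : ({1, -1} : Finset ℤ).card = 2 := by decide
      omega
    have hpmZ : ∀ K, K ∈ pm {strip B₁} ↔ K = strip B₁ := by
      intro K
      rw [mem_pm, Finset.mem_singleton, Finset.mem_singleton]
      refine ⟨fun h => h.elim id fun h => ?_, Or.inl⟩
      exact neg_injective (h.trans hR.symm)
    have hnozero : ∀ B ∈ outer P, neg B ≠ B := fun B hBo h =>
      hne1 B hBo (hP.zero_unique B (mem_outer.1 hBo).1 B₁ hB h hz)
    obtain ⟨u, l, D, ps, c, C, e1, e2, e3, e4, e5, e6⟩ := main {strip B₁} (by simpa using hRne)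
      (fun x => by simp [hpmZ, hR]) (fun K hK K' hK' x _ _ => by
        rw [hpmZ] at hK hK'; rw [hK, hK'])
      (fun K hK C' hC' => by
        rw [hpmZ] at hK
        rw [hK, ← houts C' hC']
        exact hX.not_alt _ hB _ (mem_outer.1 hC').1 (hne1 C' hC').symm)
      (fun K hK K' hK' hne => by
        rw [hpmZ] at hK hK'; exact absurd (hK.trans hK'.symm) hne)
    have hm := e6 (strip B₁) (Finset.mem_union_right _ ((hpmZ _).2 rfl)) hR
    have hO := split e5 (fun B hBo h => hnozero B hBo (hCz e4 B h))
    cases e4 with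
    | none => simp at hm
    | zero M =>
      rw [Finset.mem_singleton] at hm
      refine ⟨u, l, D, ps, [M], _, _, _, _, _, e1, e2, e3, .zero M, back e1 e2 e3 (.zero M) ?_ hO⟩
      left
      rw [← hm]
      ext x
      simp only [Finset.mem_union, Finset.mem_insert, Finset.mem_singleton, mem_strip]
      constructor
      · intro hx; by_cases a : x = 1
        · exact Or.inl (Or.inl a)
        · by_cases b : x = -1
          · exact Or.inl (Or.inr b)
          · exact Or.inr ⟨b, a, hx⟩
      · rintro ((rfl | rfl) | h)
        · exact h1
        · rwa [hz] at h1'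
        · exact h.2.2
  -- there is no zero block
  have hnz : ∀ B ∈ P, neg B ≠ B := fun B hBP h =>
    hz (by rw [← hP.eq_of_mem hBP hB (hX.one_mem B hBP h) h1]; exact h)
  have hm1 : -1 ∉ B₁ := fun h => hz (hP.eq_of_mem hB' hB h1' h)
  have hB₁ : B₁ = {1} ∪ strip B₁ := by
    ext x
    simp only [Finset.mem_union, Finset.mem_singleton, mem_strip]
    constructor
    · intro hx; by_cases a : x = 1
      · exact Or.inl a
      · exact Or.inr ⟨by rintro rfl; exact hm1 hx, a, hx⟩
    · rintro (rfl | h)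
      · exact h1
      · exact h.2.2
  have hO' : ∀ {D ps c C Z}, CenterB c C → outer P ∪ pm Z = pm (D ∪ (cross ps ∪ C)) →
      ∀ B ∈ outer P, B ∈ pm (D ∪ cross ps) := fun e4 e5 =>
    split e5 (fun B hBo h => hnz B (mem_outer.1 hBo).1 (hCz e4 B h))
  have hRdis : ∀ x ∈ strip B₁, -x ∉ strip B₁ := by
    intro x hx h
    exact hz (hP.eq_of_mem hB' hB (mem_neg.2 (strip_subset _ h)) (strip_subset _ hx))
  have hRg : ∀ x ∈ strip B₁, x ≠ 0 := fun x hx =>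
    (mem_ground.1 (hsub _ hB (strip_subset _ hx))).1
  have hcen : ∀ C ∈ outer P, ¬ Alt n (strip B₁ ∪ neg (strip B₁)) C := by
    intro C hC
    have := hX.center hnz B₁ hB h1 C (mem_outer.1 hC).1 (hne1 C hC) (hne2 C hC)
    rwa [houts C hC] at this
  by_cases hR0 : strip B₁ = ∅
  · obtain ⟨u, l, D, ps, c, C, e1, e2, e3, e4, e5, e6⟩ := main ∅ (by simp)
      (fun x => by simp [hR0, pm, neg]) (by simp [pm]) (by simp [pm]) (by simp [pm])
    cases id e4 with
    | none =>
      refine ⟨u, l, D, ps, [], _, _, _, _, _, e1, e2, e3, .both, back e1 e2 e3 .both ?_ (hO' e4 e5)⟩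
      left
      rw [hB₁, hR0]; simp [pr, neg]
    | zero M =>
      have : pr (M, M) ∈ outer P ∪ pm ∅ := by rw [e5]; exact mem_pm.2 (Or.inl (by simp))
      simp only [pm, Finset.image_empty, Finset.union_empty] at this
      exact absurd (hnegpr M) (hnz _ (mem_outer.1 this).1)
  have hRne := Finset.nonempty_iff_ne_empty.2 hR0
  by_cases hone : (∀ x ∈ strip B₁, 0 < x) ∨ ∀ x ∈ strip B₁, x < 0
  -- The condition at the centroid says that this set, taken as a zero block, does not alternate
  -- with the other blocks.
  · set K₀ := strip B₁ ∪ neg (strip B₁) with hK₀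
    have hK₀n : neg K₀ = K₀ := by rw [hK₀, neg_union, neg_neg_block, Finset.union_comm]
    have hpmZ : ∀ K, K ∈ pm {K₀} ↔ K = K₀ := by
      intro K
      rw [mem_pm, Finset.mem_singleton, Finset.mem_singleton]
      refine ⟨fun h => h.elim id fun h => ?_, Or.inl⟩
      exact neg_injective (h.trans hK₀n.symm)
    obtain ⟨u, l, D, ps, c, C, e1, e2, e3, e4, e5, e6⟩ := main {K₀}
      (fun K hK => by
        rw [Finset.mem_singleton] at hK; rw [hK]; exact hRne.mono Finset.subset_union_left)
      (fun x => by simp [hpmZ]) (fun K hK K' hK' x _ _ => by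
        rw [hpmZ] at hK hK'; rw [hK, hK'])
      (fun K hK C' hC' => by
        rw [hpmZ] at hK
        rw [hK]
        exact hcen C' hC')
      (fun K hK K' hK' hne => by
        rw [hpmZ] at hK hK'; exact absurd (hK.trans hK'.symm) hne)
    have hm := e6 K₀ (Finset.mem_union_right _ ((hpmZ _).2 rfl)) hK₀n
    have hO := hO' e4 e5
    cases e4 with
    | none => simp at hm
    | zero M =>
      rw [Finset.mem_singleton] at hm
      have hp : Pieces n 2 l D := by
        have := e1.pieces
        rwa [show (n : ℤ) - u.length + 1 = 2 by omega] at this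
      have hM : ∀ x ∈ M, 2 ≤ x := fun x hx =>
        (hp.range M (Or.inl (e3 ▸ by simp)) x hx).1
      have hmm : ∀ x, (x ∈ strip B₁ ∨ -x ∈ strip B₁) ↔ x ∈ M ∨ -x ∈ M := by
        intro x
        rw [← mem_neg, ← Finset.mem_union, ← hK₀, hm, mem_pr]
      rcases hone with hpos | hneg
      · refine ⟨u, l, D, ps, [M], _, _, _, _, _, e1, e2, e3, .posit M,
          back e1 e2 e3 (.posit M) (Or.inl ?_) hO⟩
        have : strip B₁ = M := by
          ext x
          constructor
          · intro hx
            refine ((hmm x).1 (Or.inl hx)).resolve_right fun h => ?_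
            have := hM _ h; have := hpos x hx; omega
          · intro hx
            refine ((hmm x).2 (Or.inl hx)).resolve_right fun h => ?_
            have := hM _ hx; have := hpos _ h; omega
        conv_lhs => rw [hB₁, this]
        simp [pr, neg]
      · refine ⟨u, l, D, ps, [M], _, _, _, _, _, e1, e2, e3, .negat M,
          back e1 e2 e3 (.negat M) (Or.inl ?_) hO⟩
        have : strip B₁ = neg M := by
          ext x
          rw [mem_neg]
          constructor
          · intro hx
            refine ((hmm x).1 (Or.inl hx)).resolve_left fun h => ?_
            have := hM _ h; have := hneg x hx; omega
          · intro hx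
            refine ((hmm x).2 (Or.inr hx)).resolve_right fun h => ?_
            have := hM _ hx; have := hneg _ h; omega
        conv_lhs => rw [hB₁, this]
        simp [pr]
  -- the mixed case
  push Not at hone
  obtain ⟨⟨y, hy, hy0⟩, x, hx, hx0⟩ := hone
  have hy0' : y < 0 := lt_of_le_of_ne hy0 (hRg y hy)
  have hx0' : 0 < x := lt_of_le_of_ne hx0 (hRg x hx).symm
  have hpmZ : ∀ K, K ∈ pm {strip B₁} ↔ K = strip B₁ ∨ K = neg (strip B₁) := by
    intro K
    rw [mem_pm, Finset.mem_singleton, Finset.mem_singleton]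
    exact or_congr_right ⟨fun h => by rw [← h, neg_neg_block], fun h => by rw [h, neg_neg_block]⟩
  obtain ⟨u, l, D, ps, c, C, e1, e2, e3, e4, e5, e6⟩ := main {strip B₁} (by simpa using hRne)
    (fun x => by simp [hpmZ]) (fun K hK K' hK' x hxK hxK' => by
      rw [hpmZ] at hK hK'
      rcases hK with rfl | rfl <;> rcases hK' with rfl | rfl
      · rfl
      · exact absurd (mem_neg.1 hxK') (hRdis x hxK)
      · exact absurd (mem_neg.1 hxK) (hRdis x hxK')
      · rfl)
    (fun K hK C' hC' => by
      rw [hpmZ] at hK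
      refine fun h => hcen C' hC' (h.mono ?_ subset_rfl)
      rcases hK with rfl | rfl
      · exact Finset.subset_union_left
      · exact Finset.subset_union_right)
    (fun K hK K' hK' hne => by
      rw [hpmZ] at hK hK'
      have := hX.not_alt B₁ hB _ hB' (Ne.symm hz)
      rw [strip_neg] at this
      rcases hK with rfl | rfl <;> rcases hK' with rfl | rfl
      · exact absurd rfl hne
      · exact this
      · exact fun h => this h.symm
      · exact absurd rfl hne)
  have hp : Pieces n 2 l D := by
    have := e1.pieces
    rwa [show (n : ℤ) - u.length + 1 = 2 by omega] at this
  have hO := hO' e4 e5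
  cases e4 with
  | zero M =>
    have : pr (M, M) ∈ outer P ∪ pm {strip B₁} := by rw [e5]; exact mem_pm.2 (Or.inl (by simp))
    rw [Finset.mem_union, hpmZ] at this
    rcases this with h | h | h
    · exact absurd (hnegpr M) (hnz _ (mem_outer.1 h).1)
    · exact absurd (by rw [← mem_neg, ← h, hnegpr, h]; exact hx) (hRdis x hx)
    · refine absurd ?_ (hRdis x hx)
      rw [← mem_neg, ← h, ← hnegpr, h, neg_neg_block]; exact hx
  | none =>
    have hm : ∃ p ∈ ps, strip B₁ = pr p ∨ neg (strip B₁) = pr p := by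
      have hmT : strip B₁ ∈ outer P ∪ pm {strip B₁} :=
        Finset.mem_union_right _ ((hpmZ _).2 (Or.inl rfl))
      rw [e5, mem_pm, Finset.mem_union, Finset.mem_union, Finset.mem_union, Finset.mem_union,
        mem_cross, mem_cross] at hmT
      rcases hmT with (h | ⟨p, hp, h⟩ | h) | (h | ⟨p, hp, h⟩ | h)
      · have := hp.range _ (Or.inr h) y hy; omega
      · exact ⟨p, hp, Or.inl h.symm⟩
      · simp at h
      · have := hp.range _ (Or.inr h) (-x) (by rwa [mem_neg, neg_neg]); omega
      · exact ⟨p, hp, Or.inr h.symm⟩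
      · simp at h
    obtain ⟨p, hpps, hpR⟩ := hm
    have hpRu : strip B₁ ∪ neg (strip B₁) = pr p ∪ neg (pr p) := by
      rcases hpR with h | h
      · rw [h]
      · rw [← h, neg_neg_block, Finset.union_comm]
    have hperm := perm_of_eq_middle e3
    have hml : ∀ q ∈ ps, q.1 ∈ l ∧ q.2 ∈ l := by
      intro q hq
      rw [hperm.mem_iff, hperm.mem_iff]
      simp only [List.mem_append, List.mem_map]
      exact ⟨Or.inl (Or.inl ⟨q, hq, rfl⟩), Or.inl (Or.inr ⟨q, hq, rfl⟩)⟩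
    obtain ⟨ps₁, ps₂, rfl⟩ := List.append_of_mem hpps
    have hbel := e1.inv.below
    -- For a pair `q` inside `p`, the labels `a`, `b`, `d`, `-c` follow each other clockwise; the
    -- first and third belong to `B₁ ∪ -B₁` and the other two to `pr q`, against the condition at
    -- the centroid.
    have hps2 : ps₂ = [] := by
      rcases ps₂ with _ | ⟨q, ps₂⟩
      · rfl
      exfalso
      rw [e3] at hbel
      simp only [List.append_nil, List.map_append, List.map_cons, List.reverse_append,
        List.reverse_cons, List.append_assoc] at hbel
      have b1 : Below p.1 q.1 := by
        rw [List.pairwise_append] at hbel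
        exact (List.pairwise_cons.1 hbel.2.1).1 _ (by simp)
      have b2 : Below q.1 q.2 := by
        rw [List.pairwise_append] at hbel
        exact (List.pairwise_cons.1 (List.pairwise_cons.1 hbel.2.1).2).1 _ (by simp)
      have b3 : Below q.2 p.2 := by
        have : List.Sublist [q.2, p.2] l := by
          rw [e3]
          simp only [List.append_nil, List.map_append, List.map_cons, List.reverse_append,
            List.reverse_cons, List.append_assoc]
          refine List.Sublist.trans ?_ (List.sublist_append_right _ _)
          refine List.Sublist.trans ?_ (List.sublist_cons_self _ _)
          refine List.Sublist.trans ?_ (List.sublist_cons_self _ _)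
          refine List.Sublist.trans ?_ (List.sublist_append_right _ _)
          refine List.Sublist.trans ?_ (List.sublist_append_right _ _)
          simp
        have := e1.inv.below.sublist this
        simpa using this
      have hq : q ∈ ps₁ ++ p :: q :: ps₂ := by simp
      obtain ⟨a, ha⟩ := hp.nonempty p.1 (Or.inl (hml p hpps).1)
      obtain ⟨b, hb⟩ := hp.nonempty q.1 (Or.inl (hml q hq).1)
      obtain ⟨c, hc⟩ := hp.nonempty q.2 (Or.inl (hml q hq).2)
      obtain ⟨d, hd⟩ := hp.nonempty p.2 (Or.inl (hml p hpps).2)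
      have r1 := hp.range _ (Or.inl (hml p hpps).1) a ha
      have r2 := hp.range _ (Or.inl (hml q hq).1) b hb
      have r3 := hp.range _ (Or.inl (hml q hq).2) c hc
      have r4 := hp.range _ (Or.inl (hml p hpps).2) d hd
      have i1 := b1 a ha b hb
      have i2 := b2 b hb c hc
      have i3 := b3 c hc d hd
      have hqT : pr q ∈ outer P ∪ pm {strip B₁} := by
        rw [e5]
        refine mem_pm.2 (Or.inl ?_)
        rw [Finset.mem_union, Finset.mem_union, mem_cross]
        exact Or.inr (Or.inl ⟨q, hq, rfl⟩)
      have hbp : b ∉ pr p ∧ b ∉ neg (pr p) := by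
        rw [neg_pr, mem_pr, mem_pr]
        have hn4 := nodup_pairs (hperm.nodup_iff.1 hp.nodup)
        have n1 : b ∉ p.1 := fun h => by have := b1 b h b hb; omega
        have n2 : b ∉ p.2 := fun h => by have := b2 b hb c hc; have := b3 c hc b h; omega
        have n3 : -b ∉ p.1 := fun h => by
          have := hp.range _ (Or.inl (hml p hpps).1) _ h; omega
        have n4 : -b ∉ p.2 := fun h => by
          have := hp.range _ (Or.inl (hml p hpps).2) _ h; omega
        exact ⟨fun h => h.elim n1 n4, fun h => h.elim n2 n3⟩
      rw [Finset.mem_union, hpmZ] at hqT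
      have hbq : b ∈ pr q := mem_pr.2 (Or.inl hb)
      have hqo : pr q ∈ outer P := by
        refine hqT.resolve_right ?_
        intro h
        have : b ∈ strip B₁ ∪ neg (strip B₁) := by
          rw [Finset.mem_union]
          exact h.imp (fun e => by rw [← e]; exact hbq) (fun e => by rw [← e]; exact hbq)
        rw [hpRu, Finset.mem_union] at this
        exact this.elim hbp.1 hbp.2
      apply hcen _ hqo
      rw [hpRu]
      have k1 := key_of_pos (n := n) (a := a) (by omega)
      have k2 := key_of_pos (n := n) (a := b) (by omega)
      have k3 := key_of_neg (n := n) (a := -c) (by omega)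
      have k4 := key_of_pos (n := n) (a := d) (by omega)
      refine ⟨a, ?_, b, hbq, d, ?_, -c, ?_, Or.inl (by omega)⟩
      · exact Finset.mem_union_left _ (mem_pr.2 (Or.inl ha))
      · refine Finset.mem_union_right _ ?_
        rw [mem_neg, mem_pr, neg_neg]; exact Or.inr hd
      · rw [mem_pr, neg_neg]; exact Or.inr hc
    subst hps2
    have e3' : l = ps₁.map Prod.fst ++ [p.1, p.2] ++ (ps₁.map Prod.snd).reverse := by
      rw [e3]; simp
    have hO2 : ∀ B ∈ outer P, B ∈ pm (D ∪ cross ps₁) := by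
      intro B hBo
      have h := hO B hBo
      have hBp : B ≠ pr p ∧ neg B ≠ pr p := by
        have hpne : (pr p).Nonempty :=
          (hp.nonempty p.1 (Or.inl (hml p hpps).1)).mono Finset.subset_union_left
        refine ⟨hmemR B hBo _ hpne (hpRu ▸ Finset.subset_union_left), fun h => ?_⟩
        refine hmemR B hBo (neg (pr p)) (neg_nonempty.2 hpne)
          (hpRu ▸ Finset.subset_union_right) ?_
        rw [← h, neg_neg_block]
      rw [mem_pm, Finset.mem_union, Finset.mem_union, mem_cross, mem_cross] at h ⊢
      rcases h with (h | ⟨q, hq, h⟩) | (h | ⟨q, hq, h⟩)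
      · exact Or.inl (Or.inl h)
      · refine Or.inl (Or.inr ⟨q, ?_, h⟩)
        rw [List.mem_append, List.mem_singleton] at hq
        exact hq.resolve_right (by rintro rfl; exact hBp.1 h.symm)
      · exact Or.inr (Or.inl h)
      · refine Or.inr (Or.inr ⟨q, ?_, h⟩)
        rw [List.mem_append, List.mem_singleton] at hq
        exact hq.resolve_right (by rintro rfl; exact hBp.2 h.symm)
    rcases hpR with h | h
    · exact ⟨u, l, D, ps₁, _, _, _, _, _, _, e1, e2, e3', .mix p.1 p.2,
        back e1 e2 e3' (.mix p.1 p.2) (Or.inl (by conv_lhs => rw [hB₁, h])) hO2⟩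
    · refine ⟨u, l, D, ps₁, _, _, _, _, _, _, e1, e2, e3', .mixNeg p.1 p.2,
        back e1 e2 e3' (.mixNeg p.1 p.2) (Or.inr ?_) hO2⟩
      conv_lhs => rw [hB₁, neg_union, h]
      rfl


/-! ### Uniqueness of the words -/

theorem split_unique {ps ps' : List (Finset ℤ × Finset ℤ)} {c c' : List (Finset ℤ)}
    (h : ps.map Prod.fst ++ c ++ (ps.map Prod.snd).reverse =
      ps'.map Prod.fst ++ c' ++ (ps'.map Prod.snd).reverse) (hc : c.length = c'.length) :
    ps = ps' ∧ c = c' := by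
  have hl := congrArg List.length h
  simp only [List.length_append, List.length_map, List.length_reverse] at hl
  have hlen : ps.length = ps'.length := by omega
  rw [List.append_assoc, List.append_assoc] at h
  obtain ⟨h1, h2⟩ := List.append_inj h (by simpa using hlen)
  obtain ⟨h3, h4⟩ := List.append_inj h2 hc
  rw [List.reverse_inj] at h4
  refine ⟨?_, h3⟩
  exact (List.zip_of_prod h1 h4).trans (List.zip_of_prod rfl rfl).symm

theorem CenterB.unique {c c' : List (Finset ℤ)} {C C' : Finset (Finset ℤ)} (h : CenterB c C)
    (h' : CenterB c' C') (he : c = c') : C = C' := by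
  subst he
  cases h <;> cases h' <;> rfl

theorem CenterB.length {c : List (Finset ℤ)} {C : Finset (Finset ℤ)} (h : CenterB c C) :
    c.length ≤ 1 := by
  cases h <;> simp

/-- The noncrossing partition of type `B` with a given word is unique. -/
theorem ncB_unique {n : ℕ} {u : List Status} {l l' : List (Finset ℤ)} {D D' : Finset (Finset ℤ)}
    {ps ps' : List (Finset ℤ × Finset ℤ)} {c c' : List (Finset ℤ)} {C C' : Finset (Finset ℤ)}
    (hb : BuildNC n u l D) (hl : l = ps.map Prod.fst ++ c ++ (ps.map Prod.snd).reverse)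
    (hc : CenterB c C) (hb' : BuildNC n u l' D')
    (hl' : l' = ps'.map Prod.fst ++ c' ++ (ps'.map Prod.snd).reverse) (hc' : CenterB c' C') :
    pm (D ∪ (cross ps ∪ C)) = pm (D' ∪ (cross ps' ∪ C')) := by
  obtain ⟨e, rfl⟩ := hb.unique hb'
  have e1 := hl'.symm.trans (e.trans hl)
  have hlen := congrArg List.length e1
  simp only [List.length_append, List.length_map, List.length_reverse] at hlen
  have := hc.length
  have := hc'.length
  obtain ⟨rfl, rfl⟩ := split_unique e1 (by omega)
  rw [hc.unique hc' rfl]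

theorem mem_pr_pos {X Y : Finset ℤ} (hY : ∀ y ∈ Y, 0 < y) {x : ℤ} (hx : 0 < x) :
    x ∈ pr (X, Y) ↔ x ∈ X := by
  rw [mem_pr]
  refine ⟨fun h => h.resolve_right fun h => ?_, Or.inl⟩
  have := hY _ h; omega

theorem mem_pr_neg {X Y : Finset ℤ} (hX : ∀ y ∈ X, 0 < y) {x : ℤ} (hx : x < 0) :
    x ∈ pr (X, Y) ↔ -x ∈ Y := by
  rw [mem_pr]
  refine ⟨fun h => h.resolve_left fun h => ?_, Or.inr⟩
  have := hX _ h; omega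

theorem pos_pr {X Y : Finset ℤ} (hX : ∀ x ∈ X, 0 < x) (hY : ∀ y ∈ Y, 0 < y) :
    pos (pr (X, Y)) = X := by
  ext x
  rw [mem_pos]
  exact ⟨fun h => (mem_pr_pos hY h.2).1 h.1, fun h => ⟨(mem_pr_pos hY (hX x h)).2 h, hX x h⟩⟩

theorem ngt_pr {X Y : Finset ℤ} (hX : ∀ x ∈ X, 0 < x) (hY : ∀ y ∈ Y, 0 < y) :
    ngt (pr (X, Y)) = neg Y := by
  ext x
  rw [mem_ngt, mem_neg]
  refine ⟨fun h => (mem_pr_neg hX h.2).1 h.1, fun h => ?_⟩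
  have := hY _ h
  exact ⟨(mem_pr_neg hX (by omega)).2 h, by omega⟩

/-- The block of `1` in a partition of type `D` built from a word. -/
inductive OneBlock : Status → List (Finset ℤ) → Finset ℤ → Finset ℤ → Finset ℤ → Prop
  | both : OneBlock .both [] {1} ∅ ∅
  | zero (M : Finset ℤ) : OneBlock .tr [M] {1, -1} M M
  | posit (M : Finset ℤ) : OneBlock .op [M] {1} M ∅
  | negat (M : Finset ℤ) : OneBlock .cl [M] {1} ∅ M
  | mix (M N : Finset ℤ) : OneBlock .tr [M, N] {1} M N
  | mixNeg (M N : Finset ℤ) : OneBlock .op [M, N] {1} N M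

/-- Only for `mixNeg` the central block is that of `-1`, and its negative has to be taken. -/
theorem CenterD.oneBlock {s t : Status} {c : List (Finset ℤ)} {S U V : Finset ℤ}
    (h : CenterD s t c S U V) (X : Finset (Finset ℤ)) : ∃ S' U' V', OneBlock s c S' U' V' ∧
      S' ∪ pr (U', V') ∈ pm (X ∪ {S ∪ pr (U, V)}) := by
  have main : S ∪ pr (U, V) ∈ pm (X ∪ {S ∪ pr (U, V)}) := mem_pm.2 (Or.inl (by simp))
  cases h with
  | both => exact ⟨_, _, _, .both, main⟩
  | zero M => exact ⟨_, _, _, .zero _, main⟩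
  | posit M => exact ⟨_, _, _, .posit _, main⟩
  | negat M => exact ⟨_, _, _, .negat _, main⟩
  | mix M N => exact ⟨_, _, _, .mix _ _, main⟩
  | mixNeg M N =>
    refine ⟨_, _, _, .mixNeg _ _, ?_⟩
    rw [← neg_mem_pm, neg_union, neg_pr] at main
    exact main

theorem OneBlock.mem {s : Status} {c : List (Finset ℤ)} {S U V : Finset ℤ}
    (h : OneBlock s c S U V) : (∀ x ∈ U, ∃ N ∈ c, x ∈ N) ∧ (∀ x ∈ V, ∃ N ∈ c, x ∈ N) ∧ 1 ∈ S ∧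
      (∀ x ∈ S, x = 1 ∨ x = -1) := by
  cases h <;> simp <;> grind

theorem oneBlock_parts {S U V S' U' V' : Finset ℤ} (hS : ∀ x ∈ S, x = 1 ∨ x = -1)
    (hU : ∀ x ∈ U, 2 ≤ x) (hV : ∀ x ∈ V, 2 ≤ x) (hS' : ∀ x ∈ S', x = 1 ∨ x = -1)
    (hU' : ∀ x ∈ U', 2 ≤ x) (hV' : ∀ x ∈ V', 2 ≤ x) (h : S ∪ pr (U, V) = S' ∪ pr (U', V')) :
    S = S' ∧ U = U' ∧ V = V' := by
  have key : ∀ {S U V S' U' V' : Finset ℤ}, (∀ x ∈ S, x = 1 ∨ x = -1) →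
      (∀ x ∈ U, 2 ≤ x) → (∀ x ∈ V, 2 ≤ x) → (∀ x ∈ S', x = 1 ∨ x = -1) →
      (∀ x ∈ U', 2 ≤ x) → (∀ x ∈ V', 2 ≤ x) → S ∪ pr (U, V) = S' ∪ pr (U', V') →
      S ⊆ S' ∧ U ⊆ U' ∧ V ⊆ V' := by
    intro S U V S' U' V' hS hU hV hS' hU' hV' h
    have hm : ∀ x, (x ∈ S ∨ x ∈ U ∨ -x ∈ V) → (x ∈ S' ∨ x ∈ U' ∨ -x ∈ V') := by
      intro x
      rw [← mem_pr (p := (U, V)), ← mem_pr (p := (U', V')), ← Finset.mem_union, h,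
        Finset.mem_union]
      exact id
    refine ⟨fun x hx => ?_, fun x hx => ?_, fun x hx => ?_⟩
    · have := hS x hx
      rcases hm x (Or.inl hx) with h | h | h
      · exact h
      · have := hU' x h; omega
      · have := hV' _ h; omega
    · have := hU x hx
      rcases hm x (Or.inr (Or.inl hx)) with h | h | h
      · have := hS' x h; omega
      · exact h
      · have := hV' _ h; omega
    · have := hV x hx
      rcases hm (-x) (Or.inr (Or.inr (by rwa [neg_neg]))) with h | h | h
      · have := hS' _ h; omega
      · have := hU' _ h; omega
      · rwa [neg_neg] at h
  obtain ⟨a1, a2, a3⟩ := key hS hU hV hS' hU' hV' h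
  obtain ⟨b1, b2, b3⟩ := key hS' hU' hV' hS hU hV h.symm
  exact ⟨a1.antisymm b1, a2.antisymm b2, a3.antisymm b3⟩

/-- Only `mix` and `mixNeg` can give the same block with different letters. They are told apart by
the order of the two pieces in the list. -/
theorem OneBlock.unique {s s' : Status} {c c' : List (Finset ℤ)} {S U V S' U' V' : Finset ℤ}
    (h : OneBlock s c S U V) (h' : OneBlock s' c' S' U' V') (hS : S = S') (hU : U = U') (hV : V = V')
    (hne : ∀ N ∈ c, N.Nonempty)
    (hne' : ∀ N ∈ c', N.Nonempty) (hnd : c.Nodup) (hlen : c.length % 2 = c'.length % 2)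
    (hcc : c.length = c'.length → c = c') : s = s' := by
  have : ({1} : Finset ℤ) ≠ {1, -1} := by decide
  cases h <;> cases h' <;> first | rfl | grind [Finset.not_nonempty_empty]

/-- The letters of `2, …, n` are found from least and greatest elements of blocks. The letter of `1`
cannot be found in this way, as `1` is neither least nor greatest in a mixed central block in both
cases `mix` and `mixNeg`; it comes from the block of `1` and the order of the pieces. -/
theorem ncD_word_unique {n : ℕ} (hn : 1 ≤ n) {u u' : List Status} {l l' : List (Finset ℤ)}
    {D D' : Finset (Finset ℤ)} {ps ps' : List (Finset ℤ × Finset ℤ)} {c c' : List (Finset ℤ)}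
    {s s' t t' : Status} {S U V S' U' V' : Finset ℤ}
    (hb : BuildNC n u l D) (hu : u.length + 1 = n)
    (hl : l = ps.map Prod.fst ++ c ++ (ps.map Prod.snd).reverse) (hc : CenterD s t c S U V)
    (hb' : BuildNC n u' l' D') (hu' : u'.length + 1 = n)
    (hl' : l' = ps'.map Prod.fst ++ c' ++ (ps'.map Prod.snd).reverse)
    (hc' : CenterD s' t' c' S' U' V')
    (h : pm (D ∪ (cross ps ∪ {S ∪ pr (U, V)})) = pm (D' ∪ (cross ps' ∪ {S' ∪ pr (U', V')}))) :
    s = s' ∧ u = u' := by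
  have hj : (n : ℤ) - u.length + 1 = 2 := by omega
  have hj' : (n : ℤ) - u'.length + 1 = 2 := by omega
  have hp := hb.pieces
  have hp' := hb'.pieces
  rw [hj] at hp
  rw [hj'] at hp'
  have hcf := config_D hn hp (perm_of_eq_middle hl) hc
  have hcf' := config_D hn hp' (perm_of_eq_middle hl') hc'
  have huu : u = u' := Config.word_unique hb (by rwa [hj]) hb' (by rwa [hj']) (by omega)
    (by omega) h
  refine ⟨?_, huu⟩
  subst huu
  obtain ⟨e, rfl⟩ := hb.unique hb'
  have hsplit := hl'.symm.trans (e.trans hl)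
  obtain ⟨S₁, U₁, V₁, ho, hm⟩ := hc.oneBlock (D' ∪ cross ps)
  obtain ⟨S₂, U₂, V₂, ho', hm'⟩ := hc'.oneBlock (D' ∪ cross ps')
  rw [Finset.union_assoc] at hm hm'
  rw [h] at hm
  have hcl : ∀ N ∈ c, N ∈ l := fun N hN => by rw [hl]; simp [hN]
  have hcl' : ∀ N ∈ c', N ∈ l' := fun N hN => by rw [hl']; simp [hN]
  have m := ho.mem
  have m' := ho'.mem
  have r : ∀ N ∈ c, ∀ x ∈ N, 2 ≤ x := fun N hN x hx => (hp.range N (Or.inl (hcl N hN)) x hx).1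
  have r' : ∀ N ∈ c', ∀ x ∈ N, 2 ≤ x := fun N hN x hx => (hp'.range N (Or.inl (hcl' N hN)) x hx).1
  have heq := hcf'.signed.isBPartition.eq_of_mem hm hm' (a := 1)
    (Finset.mem_union_left _ m.2.2.1) (Finset.mem_union_left _ m'.2.2.1)
  obtain ⟨rfl, rfl, rfl⟩ := oneBlock_parts m.2.2.2
    (fun x hx => by obtain ⟨N, hN, h⟩ := m.1 x hx; exact r N hN x h)
    (fun x hx => by obtain ⟨N, hN, h⟩ := m.2.1 x hx; exact r N hN x h) m'.2.2.2
    (fun x hx => by obtain ⟨N, hN, h⟩ := m'.1 x hx; exact r' N hN x h)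
    (fun x hx => by obtain ⟨N, hN, h⟩ := m'.2.1 x hx; exact r' N hN x h) heq
  have hlen := congrArg List.length hsplit
  simp only [List.length_append, List.length_map, List.length_reverse] at hlen
  refine ho.unique ho' rfl rfl rfl (fun N hN => hp.nonempty N (Or.inl (hcl N hN)))
    (fun N hN => hp'.nonempty N (Or.inl (hcl' N hN))) ?_ (by omega)
    (fun hh => (split_unique hsplit hh.symm).2.symm)
  have := hp.nodup
  rw [hl, List.nodup_append, List.nodup_append] at this
  exact this.1.2.1


theorem mem_opSet_cons {n : ℕ} {s : Status} {u : List Status} {i : ℤ} :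
    i ∈ opSet n (s :: u) ↔ (i = n - u.length ∧ (s = .both ∨ s = .op)) ∨ i ∈ opSet n u := by
  cases s <;> simp [opSet]

theorem mem_clSet_cons {n : ℕ} {s : Status} {u : List Status} {i : ℤ} :
    i ∈ clSet n (s :: u) ↔ (i = n - u.length ∧ (s = .both ∨ s = .cl)) ∨ i ∈ clSet n u := by
  cases s <;> simp [clSet]

theorem Build.pieces_of_length {ok : List (Finset ℤ) → List (Finset ℤ) → Prop} {n : ℕ} {j : ℤ}
    {u : List Status} {l : List (Finset ℤ)} {D : Finset (Finset ℤ)} (h : Build ok n u l D)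
    (hj : (u.length : ℤ) = n + 1 - j) : Pieces n j l D := by
  have := h.pieces
  rwa [show (n : ℤ) - u.length + 1 = j by omega] at this

/-- A noncrossing partition of both types has the same word in both types. -/
theorem nc_word_unique {n : ℕ} (hn : 2 ≤ n) {s s' t : Status} {u u' : List Status}
    {l₁ l : List (Finset ℤ)} {D₁ D : Finset (Finset ℤ)} {qs ps : List (Finset ℤ × Finset ℤ)}
    {c₁ c : List (Finset ℤ)} {C : Finset (Finset ℤ)} {S U V : Finset ℤ}
    (hb₁ : BuildNC n (s :: u) l₁ D₁) (hu : u.length + 1 = n)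
    (hl₁ : l₁ = qs.map Prod.fst ++ c₁ ++ (qs.map Prod.snd).reverse) (hC : CenterB c₁ C)
    (hb : BuildNC n u' l D) (hu' : u'.length + 1 = n)
    (hl : l = ps.map Prod.fst ++ c ++ (ps.map Prod.snd).reverse) (hc : CenterD s' t c S U V)
    (h : pm (D₁ ∪ (cross qs ∪ C)) = pm (D ∪ (cross ps ∪ {S ∪ pr (U, V)}))) : s = s' ∧ u = u' := by
  have hp₁ : Pieces n 1 l₁ D₁ := hb₁.pieces_of_length (by simp; omega)
  have hp : Pieces n 2 l D := hb.pieces_of_length (by omega)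
  have hcf₁ := config_B hp₁ (perm_of_eq_middle hl₁) hC
  have hcf := config_D (by omega) hp (perm_of_eq_middle hl) hc
  have hP := hcf.signed.isBPartition
  have hop := hcf₁.openers_eq hb₁ (by simpa using hu)
  have hcl := hcf₁.closers_eq hb₁ (by simpa using hu)
  rw [h] at hop hcl
  have huu : u = u' := by
    apply word_ext (n := n) (by omega)
    · ext i
      by_cases hi : 1 < i
      · have h1 : i ∈ opSet n (s :: u) ↔ i ∈ opSet n u := by
          rw [mem_opSet_cons]
          exact or_iff_right fun h => by omega
        rw [← h1, ← hop, mem_openers_iff,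
          ← Config.least_iff hb (by rwa [show (n : ℤ) - u'.length + 1 = 2 by omega]) (by omega)
            (by omega)]
        exact and_iff_right (by omega)
      · exact iff_of_false (fun h => by have := lt_of_mem_opSet h; omega)
          (fun h => by have := lt_of_mem_opSet h; omega)
    · ext i
      by_cases hi : 1 < i
      · have h1 : i ∈ clSet n (s :: u) ↔ i ∈ clSet n u := by
          rw [mem_clSet_cons]
          exact or_iff_right fun h => by omega
        rw [← h1, ← hcl, mem_closers_iff hP,
          ← Config.greatest_iff hb (by rwa [show (n : ℤ) - u'.length + 1 = 2 by omega]) (by omega)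
            (by omega)]
        exact and_iff_right (by omega)
      · exact iff_of_false (fun h => by have := lt_of_mem_clSet h; omega)
          (fun h => by have := lt_of_mem_clSet h; omega)
  refine ⟨?_, huu⟩
  subst huu
  have hone : (n : ℤ) - u.length = 1 := by omega
  obtain ⟨S₁, U₁, V₁, ho, hm⟩ := hc.oneBlock (D ∪ cross ps)
  rw [Finset.union_assoc] at hm
  have m := ho.mem
  have h1K : (1 : ℤ) ∈ S₁ ∪ pr (U₁, V₁) := Finset.mem_union_left _ m.2.2.1
  -- In type `B` the letter of `1` tells whether `1` is the least and whether it is the greatest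
  -- element of its block; this is compared with the shape of the block in type `D`.
  have hop1 : (s = .both ∨ s = .op) ↔ ∀ x ∈ S₁ ∪ pr (U₁, V₁), 1 ≤ x := by
    have e1 : (1 : ℤ) ∈ opSet n (s :: u) ↔ (s = .both ∨ s = .op) := by
      rw [mem_opSet_cons, hone]
      refine ⟨fun h => h.elim And.right fun h => ?_, fun h => Or.inl ⟨rfl, h⟩⟩
      have := lt_of_mem_opSet h; omega
    rw [← e1, ← hop, mem_openers_iff]
    constructor
    · rintro ⟨-, B, hB, h1, h2⟩ x hx
      rw [hP.eq_of_mem hm hB h1K (Finset.mem_coe.1 h1)] at hx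
      exact h2 (Finset.mem_coe.2 hx)
    · exact fun h => ⟨by norm_num, _, hm, h1K, fun x hx => h x (Finset.mem_coe.1 hx)⟩
  have hcl1 : (s = .both ∨ s = .cl) ↔ ∀ x ∈ S₁ ∪ pr (U₁, V₁), x ≤ 1 := by
    have e1 : (1 : ℤ) ∈ clSet n (s :: u) ↔ (s = .both ∨ s = .cl) := by
      rw [mem_clSet_cons, hone]
      refine ⟨fun h => h.elim And.right fun h => ?_, fun h => Or.inl ⟨rfl, h⟩⟩
      have := lt_of_mem_clSet h; omega
    rw [← e1, ← hcl, mem_closers_iff hP]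
    constructor
    · rintro ⟨-, B, hB, h1, h2⟩ x hx
      rw [hP.eq_of_mem hm hB h1K (Finset.mem_coe.1 h1)] at hx
      exact h2 (Finset.mem_coe.2 hx)
    · exact fun h => ⟨by norm_num, _, hm, h1K, fun x hx => h x (Finset.mem_coe.1 hx)⟩
  have hcl' : ∀ N ∈ c, N ∈ l := fun N hN => by rw [hl]; simp [hN]
  have hne : ∀ N ∈ c, ∃ x ∈ N, (2 : ℤ) ≤ x := fun N hN => by
    obtain ⟨x, hx⟩ := hp.nonempty N (Or.inl (hcl' N hN))
    exact ⟨x, hx, (hp.range N (Or.inl (hcl' N hN)) x hx).1⟩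
  have hr : ∀ N ∈ c, ∀ x ∈ N, (2 : ℤ) ≤ x := fun N hN x hx =>
    (hp.range N (Or.inl (hcl' N hN)) x hx).1
  have hbig : U₁.Nonempty → ¬ ∀ x ∈ S₁ ∪ pr (U₁, V₁), x ≤ 1 := by
    rintro ⟨x, hx⟩ h
    obtain ⟨N, hN, hxN⟩ := m.1 x hx
    have := h x (Finset.mem_union_right _ (mem_pr.2 (Or.inl hx)))
    have := hr N hN x hxN
    omega
  have hneg : V₁.Nonempty → ¬ ∀ x ∈ S₁ ∪ pr (U₁, V₁), 1 ≤ x := by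
    rintro ⟨x, hx⟩ h
    obtain ⟨N, hN, hxN⟩ := m.2.1 x hx
    have := h (-x) (Finset.mem_union_right _ (mem_pr.2 (Or.inr (by rwa [neg_neg]))))
    have := hr N hN x hxN
    omega
  have hnec : ∀ N ∈ c, N.Nonempty := fun N hN => by
    obtain ⟨x, hx, -⟩ := hne N hN; exact ⟨x, hx⟩
  have hpos : ∀ N ∈ c, ∀ x ∈ ({1} : Finset ℤ) ∪ pr (N, ∅), 1 ≤ x := by
    intro N hN x hx
    rw [Finset.mem_union, mem_pr, Finset.mem_singleton] at hx
    rcases hx with h | h | h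
    · omega
    · have := hr N hN x h; omega
    · simp at h
  have hle : ∀ N ∈ c, ∀ x ∈ ({1} : Finset ℤ) ∪ pr (∅, N), x ≤ 1 := by
    intro N hN x hx
    rw [Finset.mem_union, mem_pr, Finset.mem_singleton] at hx
    rcases hx with h | h | h
    · omega
    · simp at h
    · have := hr N hN _ h; omega
  have htr : ¬ (s = .both ∨ s = .op) → ¬ (s = .both ∨ s = .cl) → s = .tr := by
    intro h1 h2; cases s <;> simp_all
  cases ho with
  | both =>
    have a := hop1.2 (by simp [pr, neg])
    have b := hcl1.2 (by simp [pr, neg])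
    cases s <;> simp_all
  | zero M =>
    have hM := hnec U₁ (by simp)
    exact htr (fun h => hneg hM (hop1.1 h)) (fun h => hbig hM (hcl1.1 h))
  | posit M =>
    have a := hop1.2 (hpos U₁ (by simp))
    have b := fun h => hbig (hnec U₁ (by simp)) (hcl1.1 h)
    cases s <;> simp_all
  | negat M =>
    have a := hcl1.2 (hle V₁ (by simp))
    have b := fun h => hneg (hnec V₁ (by simp)) (hop1.1 h)
    cases s <;> simp_all
  | mix M N =>
    exact htr (fun h => hneg (hnec V₁ (by simp)) (hop1.1 h))
      (fun h => hbig (hnec U₁ (by simp)) (hcl1.1 h))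
  -- The type `B` reading would make `1` transient and add it to the first unfinished piece. In type
  -- `D` the block of `1` has the second central piece as its positive part, and this is not the
  -- first piece of the list.
  | mixNeg M N =>
    have hs : s = .tr := htr (fun h => hneg (hnec V₁ (by simp)) (hop1.1 h))
      (fun h => hbig (hnec U₁ (by simp)) (hcl1.1 h))
    exfalso
    subst hs
    cases hb₁ with
    | @tr _ a N₀ l₂ _ hb₀ hok =>
      subst hok
      obtain ⟨e1, rfl⟩ := hb.unique hb₀
      rw [List.nil_append] at e1
      have hlen := congrArg List.length (e1.trans hl)
      have hlen₁ := congrArg List.length hl₁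
      simp only [List.length_append, List.length_map, List.length_reverse, List.length_cons,
        List.length_nil, List.nil_append] at hlen hlen₁
      have hc₁ : c₁ = [] := by
        have := hC.length
        rw [← List.length_eq_zero_iff]
        omega
      subst hc₁
      obtain ⟨q, qs, rfl⟩ : ∃ q qs', qs = q :: qs' := List.exists_cons_of_ne_nil (by
        rintro rfl
        simp at hlen₁)
      have hq1 : q.1 = insert 1 N₀ := by
        simp only [List.nil_append, List.map_cons, List.append_nil, List.cons_append,
          List.cons.injEq, hone] at hl₁
        exact hl₁.1.symm
      have hqP : pr q ∈ pm (D₁ ∪ (cross (q :: qs) ∪ C)) := mem_pm.2 (Or.inl (by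
        rw [Finset.mem_union, Finset.mem_union, mem_cross]
        exact Or.inr (Or.inl ⟨q, by simp, rfl⟩)))
      rw [h] at hqP
      have hN0 : N₀ ∈ l := by rw [← e1]; simp
      have hUl : U₁ ∈ l := hcl' _ (by simp)
      have hqeq := hP.eq_of_mem hqP hm (mem_pr.2 (Or.inl (by rw [hq1]; simp))) h1K
      obtain ⟨x, hx⟩ := hp.nonempty N₀ (Or.inl hN0)
      have hx2 := (hp.range N₀ (Or.inl hN0) x hx).1
      have hxm : x ∈ pr q := mem_pr.2 (Or.inl (by rw [hq1]; exact Finset.mem_insert_of_mem hx))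
      rw [hqeq, Finset.mem_union, mem_pr, Finset.mem_singleton] at hxm
      have hNU : N₀ = U₁ := by
        rcases hxm with h | h | h
        · omega
        · exact hp.eq_of_mem _ _ (Or.inl hN0) (Or.inl hUl) x hx h
        · have := hr V₁ (by simp) _ h
          omega
      have hnd := hp.nodup
      have e2 := e1.trans hl
      rw [hl] at hnd
      rcases ps with _ | ⟨p, ps⟩
      · simp only [List.map_nil, List.nil_append, List.reverse_nil, List.append_nil,
          List.cons.injEq] at e2 hnd
        rw [List.nodup_cons] at hnd
        exact hnd.1 (by rw [← e2.1, hNU]; simp)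
      · simp only [List.map_cons, List.cons_append, List.cons.injEq] at e2 hnd
        rw [List.nodup_cons] at hnd
        exact hnd.1 (by rw [← e2.1, hNU]; simp)


/-! ### Evaluating the ingredients of the maps -/

theorem sMin_eq_coe {B : Finset ℤ} {x : ℤ} :
    sMin B = (x : WithTop ℤ) ↔ x ∈ pos B ∧ ∀ y ∈ pos B, x ≤ y := by
  rw [sMin]
  constructor
  · intro h
    exact ⟨Finset.mem_of_min h, fun y hy => WithTop.coe_le_coe.1 (h ▸ Finset.min_le hy)⟩
  · rintro ⟨h1, h2⟩
    refine le_antisymm (Finset.min_le h1) ?_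
    exact Finset.le_min fun y hy => WithTop.coe_le_coe.2 (h2 y hy)

/-- The value `⊤` for a block without positive elements agrees with `MinLT`, whose condition is
empty if the second set is. -/
theorem sMin_lt_iff {B C : Finset ℤ} : sMin B < sMin C ↔ MinLT (pos B) (pos C) := by
  constructor
  · intro h
    obtain ⟨b, hb⟩ := WithTop.ne_top_iff_exists.1 (ne_top_of_lt h)
    have hb' := sMin_eq_coe.1 hb.symm
    refine ⟨b, hb'.1, fun c hc => WithTop.coe_lt_coe.1 ?_⟩
    rw [hb]
    exact h.trans_le (Finset.min_le hc)
  · rintro ⟨b, hb, h⟩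
    refine (Finset.min_le hb).trans_lt ?_
    rcases (pos C).eq_empty_or_nonempty with e | hne
    · rw [sMin, e, Finset.min_empty]; exact WithTop.coe_lt_top b
    · rw [sMin, ← Finset.coe_min' hne, WithTop.coe_lt_coe]
      exact h _ (Finset.min'_mem _ _)

/-- A block is identified by its least positive element, so the sorted list of these elements is
carried to `L` by `blockOf`. -/
theorem sortedBlocks_eq {n : ℕ} {P : Finset (Finset ℤ)} (hP : IsBPartition n P)
    (p : Finset ℤ → Prop) [DecidablePred p] (L : List (Finset ℤ))
    (hs : L.Pairwise (fun B C => MinLT (pos B) (pos C)))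
    (hL : ∀ B, B ∈ L ↔ B ∈ P ∧ (pos B).Nonempty ∧ p B) : sortedBlocks n P p = L := by
  have hm : ∀ B, ∃ m : ℤ, B ∈ L → m ∈ pos B ∧ ∀ y ∈ pos B, m ≤ y := by
    intro B
    by_cases h : B ∈ L
    · have hne := ((hL B).1 h).2.1
      exact ⟨(pos B).min' hne, fun _ => ⟨Finset.min'_mem _ _, fun y hy => Finset.min'_le _ _ hy⟩⟩
    · exact ⟨0, fun h' => absurd h' h⟩
  choose m hm using hm
  have hbl : ∀ B ∈ L, blockOf P (m B) = B := fun B hB =>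
    blockOf_eq hP ((hL B).1 hB).1 (mem_pos.1 (hm B hB).1).1
  have hsm : (L.map m).Pairwise (· < ·) := by
    rw [List.pairwise_map]
    refine (List.Pairwise.and_mem.1 hs).imp ?_
    rintro B C ⟨hB, hC, b, hb, h⟩
    exact ((hm B hB).2 b hb).trans_lt (h _ (hm C hC).1)
  have hfil : (Finset.Icc 1 (n : ℤ)).filter
      (fun x => sMin (blockOf P x) = (x : WithTop ℤ) ∧ p (blockOf P x)) = (L.map m).toFinset := by
    ext x
    rw [Finset.mem_filter, Finset.mem_Icc, List.mem_toFinset, List.mem_map, sMin_eq_coe]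
    constructor
    · rintro ⟨hx, ⟨h1, h2⟩, h3⟩
      obtain ⟨B, hB, hxB⟩ := hP.exists_mem (a := x) (by rw [mem_ground]; omega)
      rw [blockOf_eq hP hB hxB] at h1 h2 h3
      have hBL := (hL B).2 ⟨hB, ⟨x, h1⟩, h3⟩
      exact ⟨B, hBL, le_antisymm ((hm B hBL).2 x h1) (h2 _ (hm B hBL).1)⟩
    · rintro ⟨B, hB, rfl⟩
      rw [hbl B hB]
      have h := (hL B).1 hB
      have hmB := hm B hB
      have hg := mem_ground.1 (hP.subset_ground h.1 (mem_pos.1 hmB.1).1)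
      have := (mem_pos.1 hmB.1).2
      exact ⟨⟨by omega, by omega⟩, hmB, h.2.2⟩
  rw [sortedBlocks, hfil, (List.toFinset_sort (r := (· ≤ ·)) (hsm.imp ne_of_lt)).2
    (hsm.imp le_of_lt), List.map_map]
  conv_rhs => rw [← List.map_id L]
  exact List.map_congr_left fun B hB => hbl B hB

/-- The pairs are nested: the first components increase and the second ones decrease. -/
structure Nested (ps : List (Finset ℤ × Finset ℤ)) : Prop where
  fst : ps.Pairwise (fun p q => MinLT p.1 q.1)
  snd : ps.Pairwise (fun p q => MinLT q.2 p.2)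
  lt : ∀ p ∈ ps, MinLT p.1 p.2

theorem Nested.of_sorted {ps : List (Finset ℤ × Finset ℤ)} {l : List (Finset ℤ)}
    (hl : l.Pairwise MinLT) (h : (ps.map Prod.fst ++ (ps.map Prod.snd).reverse).Sublist l) :
    Nested ps := by
  have := hl.sublist h
  rw [List.pairwise_append, List.pairwise_reverse, List.pairwise_map, List.pairwise_map] at this
  exact ⟨this.1, this.2.1, fun p hp => this.2.2 _ (List.mem_map_of_mem hp) _
    (List.mem_reverse.2 (List.mem_map_of_mem hp))⟩

section cross

variable {n : ℕ} {j : ℤ} {l : List (Finset ℤ)} {D : Finset (Finset ℤ)}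
  {ps : List (Finset ℤ × Finset ℤ)} {c : List (Finset ℤ)}

theorem mem_list_of_perm (hl : l.Perm (ps.map Prod.fst ++ ps.map Prod.snd ++ c)) :
    (∀ p ∈ ps, p.1 ∈ l ∧ p.2 ∈ l) ∧ ∀ N ∈ c, N ∈ l := by
  refine ⟨fun p hp => ?_, fun N hN => hl.mem_iff.2 (List.mem_append_right _ hN)⟩
  rw [hl.mem_iff, hl.mem_iff]
  simp only [List.mem_append, List.mem_map]
  exact ⟨Or.inl (Or.inl ⟨p, hp, rfl⟩), Or.inl (Or.inr ⟨p, hp, rfl⟩)⟩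

theorem Pieces.pos_of_mem (hP : Pieces n j l D) (hj : 1 ≤ j) :
    ∀ B, B ∈ l ∨ B ∈ D → ∀ x ∈ B, 0 < x := fun B hB x hx => by
  have := hP.range B hB x hx; omega

theorem mem_pm_pieces {B : Finset ℤ} (h : B ∈ pm (D ∪ cross ps)) :
    B ∈ D ∨ neg B ∈ D ∨ (∃ p ∈ ps, B = pr p) ∨ ∃ p ∈ ps, B = pr p.swap := by
  rw [mem_pm, Finset.mem_union, Finset.mem_union, mem_cross, mem_cross] at h
  rcases h with (h | ⟨p, hp, rfl⟩) | (h | ⟨p, hp, h⟩)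
  · exact Or.inl h
  · exact Or.inr (Or.inr (Or.inl ⟨p, hp, rfl⟩))
  · exact Or.inr (Or.inl h)
  · exact Or.inr (Or.inr (Or.inr ⟨p, hp, by rw [← neg_pr, h, neg_neg_block]⟩))

theorem pr_inj {X Y X' Y' : Finset ℤ} (hX : ∀ x ∈ X, 0 < x) (hY : ∀ y ∈ Y, 0 < y)
    (hX' : ∀ x ∈ X', 0 < x) (hY' : ∀ y ∈ Y', 0 < y) (h : pr (X, Y) = pr (X', Y')) :
    X = X' ∧ Y = Y' :=
  ⟨by rw [← pos_pr hX hY, h, pos_pr hX' hY'],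
    neg_injective (by rw [← ngt_pr hX hY, h, ngt_pr hX' hY'])⟩

theorem neg_ne_of_mem (hP : Pieces n j l D) (hj : 1 ≤ j)
    (hl : l.Perm (ps.map Prod.fst ++ ps.map Prod.snd ++ c)) :
    ∀ B ∈ pm (D ∪ cross ps), neg B ≠ B := by
  have hD : ∀ B ∈ D, neg B ≠ B := by
    intro B hB hz
    obtain ⟨b, hb⟩ := hP.nonempty B (Or.inr hB)
    have h1 := hP.range B (Or.inr hB) b hb
    rw [← hz, mem_neg] at hb
    have h2 := hP.range B (Or.inr hB) _ hb
    omega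
  have hm := (mem_list_of_perm hl).1
  have hC : ∀ p ∈ ps, neg (pr p) ≠ pr p := by
    intro p hp hz
    rw [neg_pr] at hz
    have h1 := hP.pos_of_mem hj p.1 (Or.inl (hm p hp).1)
    have h2 := hP.pos_of_mem hj p.2 (Or.inl (hm p hp).2)
    exact (nodup_pairs (hl.nodup_iff.1 hP.nodup)).2.2.1 p hp p hp (pr_inj h2 h1 h1 h2 hz).2
  intro B hB hz
  rw [mem_pm, hz, or_self, Finset.mem_union, mem_cross] at hB
  rcases hB with hB | ⟨p, hp, rfl⟩
  · exact hD B hB hz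
  · exact hC p hp hz

theorem mixed_pr {X Y : Finset ℤ} (hX : ∀ x ∈ X, 0 < x) (hY : ∀ y ∈ Y, 0 < y) (hXn : X.Nonempty)
    (hYn : Y.Nonempty) : Mixed (pr (X, Y)) := by
  rw [Mixed, pos_pr hX hY, ngt_pr hX hY]
  exact ⟨hXn, neg_nonempty.2 hYn⟩

/-- As `p.1` has a smaller least element than `p.2`, the condition selects `pr p` from the two
blocks `pr p` and `-pr p`. -/
theorem mixed_lt_iff (hP : Pieces n j l D) (hj : 1 ≤ j)
    (hl : l.Perm (ps.map Prod.fst ++ ps.map Prod.snd ++ c)) (hN : Nested ps) {B : Finset ℤ}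
    (hB : B ∈ pm (D ∪ cross ps)) : (Mixed B ∧ sMin B < sMin (neg B)) ↔ ∃ p ∈ ps, pr p = B := by
  have hm := (mem_list_of_perm hl).1
  have h1 : ∀ p ∈ ps, ∀ x ∈ p.1, 0 < x := fun p hp => hP.pos_of_mem hj p.1 (Or.inl (hm p hp).1)
  have h2 : ∀ p ∈ ps, ∀ x ∈ p.2, 0 < x := fun p hp => hP.pos_of_mem hj p.2 (Or.inl (hm p hp).2)
  have hpos := fun B hB => hP.pos_of_mem hj B (Or.inr hB)
  constructor
  · rintro ⟨⟨⟨x, hx⟩, ⟨y, hy⟩⟩, hlt⟩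
    rw [mem_pos] at hx
    rw [mem_ngt] at hy
    rcases mem_pm_pieces hB with h | h | ⟨p, hp, rfl⟩ | ⟨p, hp, rfl⟩
    · have := hpos B h y hy.1; omega
    · have := hpos _ h (-x) (by rw [mem_neg, neg_neg]; exact hx.1); omega
    · exact ⟨p, hp, rfl⟩
    · exfalso
      rw [sMin_lt_iff, neg_pr, Prod.swap_swap] at hlt
      rw [show p.swap = (p.2, p.1) from rfl, pos_pr (h2 p hp) (h1 p hp),
        show p = (p.1, p.2) from rfl, pos_pr (h1 p hp) (h2 p hp)] at hlt
      obtain ⟨b, hb, h⟩ := hlt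
      obtain ⟨a, ha, h'⟩ := hN.lt p hp
      exact lt_asymm (h a ha) (h' b hb)
  · rintro ⟨p, hp, rfl⟩
    refine ⟨mixed_pr (h1 p hp) (h2 p hp) (hP.nonempty _ (Or.inl (hm p hp).1))
      (hP.nonempty _ (Or.inl (hm p hp).2)), ?_⟩
    rw [sMin_lt_iff, neg_pr, show p.swap = (p.2, p.1) from rfl, pos_pr (h2 p hp) (h1 p hp),
      show p = (p.1, p.2) from rfl, pos_pr (h1 p hp) (h2 p hp)]
    exact hN.lt p hp

theorem map_pos_pr (h : ∀ p ∈ ps, (∀ x ∈ p.1, 0 < x) ∧ ∀ x ∈ p.2, 0 < x) :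
    (ps.map pr).map pos = ps.map Prod.fst := by
  rw [List.map_map]
  exact List.map_congr_left fun p hp => pos_pr (h p hp).1 (h p hp).2

theorem map_ngt_pr (h : ∀ p ∈ ps, (∀ x ∈ p.1, 0 < x) ∧ ∀ x ∈ p.2, 0 < x) :
    (ps.map pr).map ngt = (ps.map Prod.snd).map neg := by
  rw [List.map_map, List.map_map]
  exact List.map_congr_left fun p hp => ngt_pr (h p hp).1 (h p hp).2

end cross

/-- The shifted unions in the definition of `xi` become the blocks of new pairs, followed by the new
central block `X ∪ Y`. -/
theorem zipWith_fst_snd (ps : List (Finset ℤ × Finset ℤ)) (X Y : Finset ℤ) :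
    List.zipWith (· ∪ ·) (ps.map Prod.fst ++ [X]) ((ps.map Prod.snd).map neg ++ [Y]) =
      ps.map pr ++ [X ∪ Y] := by
  induction ps with
  | nil => rfl
  | cons p ps ih => simp only [List.map_cons, List.cons_append, List.zipWith_cons_cons, ih]; rfl

theorem zipWith_snd_fst (ps : List (Finset ℤ × Finset ℤ)) (X Y : Finset ℤ) :
    List.zipWith (· ∪ ·) ((ps.map Prod.snd).map neg ++ [X]) (ps.map Prod.fst ++ [Y]) =
      ps.map pr ++ [X ∪ Y] := by
  induction ps with
  | nil => rfl
  | cons p ps ih =>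
    simp only [List.map_cons, List.cons_append, List.zipWith_cons_cons, ih]
    rw [Finset.union_comm]; rfl

/-- Replacing the blocks given by the pairs of `os`. -/
theorem replaceBlocks_cross {D : Finset (Finset ℤ)} {ps os : List (Finset ℤ × Finset ℤ)}
    {new : List (Finset ℤ)} (hD : ∀ B ∈ D, B.Nonempty ∧ ∀ x ∈ B, 2 ≤ x)
    (hps : ∀ q ∈ ps, q.1.Nonempty ∧ (∀ x ∈ q.1, 2 ≤ x) ∧ ∀ x ∈ q.2, 2 ≤ x)
    (hos : ∀ r ∈ os, (∀ x ∈ r.1, 1 ≤ x) ∧ (∀ x ∈ r.2, 1 ≤ x) ∧ r.1.Nonempty ∧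
      (r.2.Nonempty ∨ 1 ∈ r.1)) (h : ∀ q ∈ ps, ∀ r ∈ os, q.1 ≠ r.1 ∧ q.1 ≠ r.2) :
    replaceBlocks (pm (D ∪ cross ps ∪ cross os)) (os.map pr) new =
      pm (D ∪ cross ps ∪ new.toFinset) := by
  have hpos : ∀ {X : Finset ℤ} {k : ℤ}, 1 ≤ k → (∀ x ∈ X, k ≤ x) → ∀ x ∈ X, 0 < x := by
    intro X k hk hX x hx; have := hX x hx; omega
  refine replaceBlocks_pm (fun B => ?_) (fun B => ?_) ?_
  · rw [mem_pm, cross, List.mem_toFinset, List.mem_toFinset]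
  · rw [mem_pm, List.mem_toFinset, List.mem_toFinset]
  intro B hB hBO
  obtain ⟨r, hr, hBr⟩ : ∃ r ∈ os, B = pr (r.1, r.2) ∨ B = pr (r.2, r.1) := by
    rw [mem_pm, mem_cross, mem_cross] at hBO
    rcases hBO with ⟨r, hr, e⟩ | ⟨r, hr, e⟩
    · exact ⟨r, hr, Or.inl e.symm⟩
    · exact ⟨r, hr, Or.inr (by rw [← neg_neg_block B, ← e, neg_pr]; rfl)⟩
  obtain ⟨h1, h2, h3, h4⟩ := hos r hr
  have p1 := hpos le_rfl h1
  have p2 := hpos le_rfl h2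
  rw [Finset.mem_union, mem_cross] at hB
  rcases hB with hB | ⟨q, hq, rfl⟩
  · have hBp := fun x hx => (hD B hB).2 x hx
    obtain ⟨x, hx⟩ := h3
    rcases hBr with rfl | rfl
    · rcases h4 with ⟨y, hy⟩ | h4
      · have := hBp (-y) (mem_pr.2 (Or.inr (by rwa [neg_neg])))
        have := h2 y hy
        omega
      · have := hBp 1 (mem_pr.2 (Or.inl h4))
        omega
    · have := hBp (-x) (mem_pr.2 (Or.inr (by rwa [neg_neg])))
      have := h1 x hx
      omega
  · have q1 := hpos (by norm_num) (hps q hq).2.1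
    have q2 := hpos (by norm_num) (hps q hq).2.2
    rcases hBr with e | e
    · exact (h q hq r hr).1 (pr_inj q1 q2 p1 p2 e).1
    · exact (h q hq r hr).2 (pr_inj q1 q2 p2 p1 e).1


/-! ### The map `ξ` -/

/-- The ingredients are variables here, so that they can be computed before the cases are
distinguished. -/
theorem xi_eq {n : ℕ} {P : Finset (Finset ℤ)} {B₀ B₁ R : Finset ℤ} {L : List (Finset ℤ)}
    (h0 : zeroBlock P = B₀) (h1 : blockOf P 1 = B₁) (hR : B₁.erase 1 = R)
    (hL : sortedBlocks n P (fun B => Mixed B ∧ neg B ≠ B ∧ B ≠ B₁ ∧ B ≠ neg B₁ ∧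
      sMin B < sMin (neg B)) = L) : xi n P =
    if (1 ∉ B₀ ∧ B₀ ≠ ∅) ∧ Mixed R then
      replaceBlocks P [B₀, B₁] [B₀ ∪ {1, -1}, R]
    else if B₀ = ∅ ∧ Mixed R ∧ L ≠ [] then
      replaceBlocks P [B₁, L.getLastD ∅] [R, L.getLastD ∅ ∪ {1}]
    else if B₀ = ∅ ∧ R ≠ ∅ ∧ (∀ x ∈ R, 0 < x) ∧ L ≠ [] then
      replaceBlocks P (B₁ :: L) (List.zipWith (· ∪ ·) (R :: L.map pos) (L.map ngt ++ [{1}]))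
    else if B₀ = ∅ ∧ R ≠ ∅ ∧ (∀ x ∈ R, x < 0) ∧ L ≠ [] then
      replaceBlocks P (B₁ :: L) (List.zipWith (· ∪ ·) (R :: L.map ngt) (L.map pos ++ [{1}]))
    else if (1 ∉ B₀ ∧ B₀ ≠ ∅) ∧ ∀ x ∈ B₁, 0 < x then
      replaceBlocks P (B₀ :: B₁ :: L)
        (List.zipWith (· ∪ ·) (R :: L.map pos) (L.map ngt ++ [{-1} ∪ ngt B₀]))
    else P := by
  subst h0 h1 hR hL; rfl

section

variable {n : ℕ} {l : List (Finset ℤ)} {D : Finset (Finset ℤ)} {qs : List (Finset ℤ × Finset ℤ)}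
  {c : List (Finset ℤ)} {C : Finset (Finset ℤ)}

theorem CenterB.neg_eq (h : CenterB c C) : ∀ K ∈ pm C, neg K = K := by
  rcases h with _ | M
  · intro K hK; simp [pm] at hK
  · intro K hK
    rw [mem_pm, Finset.mem_singleton, Finset.mem_singleton] at hK
    rcases hK with rfl | hK
    · exact neg_pr _
    · rw [hK]; exact neg_injective (by rw [hK]; exact neg_pr _)

theorem zeroBlock_none (hP : Pieces n 1 l D)
    (hl : l = qs.map Prod.fst ++ [] ++ (qs.map Prod.snd).reverse) :
    zeroBlock (pm (D ∪ (cross qs ∪ ∅))) = ∅ := by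
  rw [Finset.union_empty]
  exact zeroBlock_eq_empty (neg_ne_of_mem hP le_rfl (perm_of_eq_middle hl))

theorem zeroBlock_zero {M : Finset ℤ} (hP : Pieces n 1 l D)
    (hl : l = qs.map Prod.fst ++ [M] ++ (qs.map Prod.snd).reverse) :
    zeroBlock (pm (D ∪ (cross qs ∪ {pr (M, M)}))) = pr (M, M) :=
  zeroBlock_eq (config_B hP (perm_of_eq_middle hl) (.zero M)).signed.isBPartition
    (mem_pm.2 (Or.inl (by simp))) (neg_pr _)

theorem blockOf_one (hP : Pieces n 1 l D)
    (hl : l = qs.map Prod.fst ++ c ++ (qs.map Prod.snd).reverse) (hC : CenterB c C)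
    {B : Finset ℤ} (hB : B ∈ D ∪ (cross qs ∪ C)) (h1 : 1 ∈ B) :
    blockOf (pm (D ∪ (cross qs ∪ C))) 1 = B :=
  blockOf_eq (config_B hP (perm_of_eq_middle hl) hC).signed.isBPartition (mem_pm.2 (Or.inl hB)) h1

theorem Nested.of_split {j : ℤ} (hP : Pieces n j l D)
    (hl : l = qs.map Prod.fst ++ c ++ (qs.map Prod.snd).reverse) : Nested qs := by
  refine Nested.of_sorted hP.sorted ?_
  rw [hl, List.append_assoc]
  exact List.Sublist.append_left (List.sublist_append_right _ _) _

theorem pieces_pos {j : ℤ} (hj : 1 ≤ j) (hP : Pieces n j l D)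
    (hl : l = qs.map Prod.fst ++ c ++ (qs.map Prod.snd).reverse) :
    (∀ p ∈ qs, (∀ x ∈ p.1, 0 < x) ∧ ∀ x ∈ p.2, 0 < x) ∧ (∀ N ∈ c, ∀ x ∈ N, 0 < x) := by
  have hm := mem_list_of_perm (perm_of_eq_middle hl)
  exact ⟨fun p hp => ⟨hP.pos_of_mem hj _ (Or.inl (hm.1 p hp).1),
    hP.pos_of_mem hj _ (Or.inl (hm.1 p hp).2)⟩, fun N hN => hP.pos_of_mem hj _ (Or.inl (hm.2 N hN))⟩

theorem pieces_nonempty {j : ℤ} (hP : Pieces n j l D)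
    (hl : l = qs.map Prod.fst ++ c ++ (qs.map Prod.snd).reverse) :
    (∀ p ∈ qs, p.1.Nonempty ∧ p.2.Nonempty) ∧ (∀ N ∈ c, N.Nonempty) := by
  have hm := mem_list_of_perm (perm_of_eq_middle hl)
  exact ⟨fun p hp => ⟨hP.nonempty _ (Or.inl (hm.1 p hp).1),
    hP.nonempty _ (Or.inl (hm.1 p hp).2)⟩, fun N hN => hP.nonempty _ (Or.inl (hm.2 N hN))⟩

/-- The list consists of all pairs except possibly that of the block of `1`; nestedness of the pairs
gives its order. -/
theorem xi_list (hP : Pieces n 1 l D)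
    (hl : l = qs.map Prod.fst ++ c ++ (qs.map Prod.snd).reverse) (hC : CenterB c C)
    {B₁ : Finset ℤ} {qs' : List (Finset ℤ × Finset ℤ)} (hsub : qs'.Sublist qs)
    (hq : ∀ q ∈ qs, q ∈ qs' ↔ pr q ≠ B₁ ∧ pr q ≠ neg B₁) :
    sortedBlocks n (pm (D ∪ (cross qs ∪ C))) (fun B => Mixed B ∧ neg B ≠ B ∧ B ≠ B₁ ∧
      B ≠ neg B₁ ∧ sMin B < sMin (neg B)) = qs'.map pr := by
  have hperm := perm_of_eq_middle hl
  have hN := Nested.of_split hP hl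
  have hpos := (pieces_pos le_rfl hP hl).1
  refine sortedBlocks_eq (config_B hP hperm hC).signed.isBPartition _ _ ?_ ?_
  · rw [List.pairwise_map]
    refine (List.Pairwise.and_mem.1 (hN.fst.sublist hsub)).imp ?_
    rintro p q ⟨hp, hq, h⟩
    have h1 := hpos p (hsub.subset hp)
    have h2 := hpos q (hsub.subset hq)
    rwa [show p = (p.1, p.2) from rfl, pos_pr h1.1 h1.2, show q = (q.1, q.2) from rfl,
      pos_pr h2.1 h2.2]
  · intro B
    rw [List.mem_map]
    constructor
    · rintro ⟨q, hq', rfl⟩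
      have hqq := hsub.subset hq'
      have hB : pr q ∈ pm (D ∪ cross qs) := mem_pm.2 (Or.inl (by
        rw [Finset.mem_union, mem_cross]; exact Or.inr ⟨q, hqq, rfl⟩))
      have hB' : pr q ∈ pm (D ∪ (cross qs ∪ C)) := by
        rw [← Finset.union_assoc, pm_union]; exact Finset.mem_union_left _ hB
      have h1 := (mixed_lt_iff hP le_rfl hperm hN hB).2 ⟨q, hqq, rfl⟩
      have h2 := neg_ne_of_mem hP le_rfl hperm _ hB
      have h3 := (hq q hqq).1 hq'
      exact ⟨hB', h1.1.1, h1.1, h2, h3.1, h3.2, h1.2⟩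
    · rintro ⟨hB, -, h1, h2, h3, h4, h5⟩
      rw [← Finset.union_assoc, pm_union, Finset.mem_union] at hB
      have hB := hB.resolve_right fun h => h2 (hC.neg_eq B h)
      obtain ⟨q, hqq, rfl⟩ := (mixed_lt_iff hP le_rfl hperm hN hB).1 ⟨h1, h5⟩
      exact ⟨q, (hq q hqq).2 ⟨h3, h4⟩, rfl⟩

theorem xi_list_tail {q : Finset ℤ × Finset ℤ} (hP : Pieces n 1 l D)
    (hl : l = (q :: qs).map Prod.fst ++ c ++ ((q :: qs).map Prod.snd).reverse) (hC : CenterB c C) :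
    sortedBlocks n (pm (D ∪ (cross (q :: qs) ∪ C))) (fun B => Mixed B ∧ neg B ≠ B ∧ B ≠ pr q ∧
      B ≠ neg (pr q) ∧ sMin B < sMin (neg B)) = qs.map pr := by
  refine xi_list hP hl hC (List.sublist_cons_self _ _) fun r hr => ?_
  have hpos := (pieces_pos le_rfl hP hl).1
  have hnd := (perm_of_eq_middle hl).nodup_iff.1 hP.nodup
  have hnd' := nodup_pairs hnd
  have hq : q ∈ q :: qs := List.mem_cons_self
  constructor
  · intro hr'
    refine ⟨fun e => ?_, fun e => ?_⟩
    · have := (pr_inj (hpos r hr).1 (hpos r hr).2 (hpos q hq).1 (hpos q hq).2 e).1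
      have := hnd'.1 r hr q hq this
      subst this
      rw [List.append_assoc, List.map_cons, List.cons_append, List.nodup_cons] at hnd
      exact hnd.1 (List.mem_append_left _ (List.mem_map_of_mem hr'))
    · rw [neg_pr] at e
      have := (pr_inj (hpos r hr).1 (hpos r hr).2 (hpos q hq).2 (hpos q hq).1 e).1
      exact hnd'.2.2.1 r hr q hq this
  · rintro ⟨h, -⟩
    exact (List.mem_cons.1 hr).resolve_left (by rintro rfl; exact h rfl)

theorem xi_list_finished {B : Finset ℤ} (hP : Pieces n 1 l D)
    (hl : l = qs.map Prod.fst ++ c ++ (qs.map Prod.snd).reverse) (hC : CenterB c C)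
    (hB : ∀ x ∈ B, 0 < x) :
    sortedBlocks n (pm (D ∪ (cross qs ∪ C))) (fun K => Mixed K ∧ neg K ≠ K ∧ K ≠ B ∧
      K ≠ neg B ∧ sMin K < sMin (neg K)) = qs.map pr := by
  refine xi_list hP hl hC (List.Sublist.refl _) fun q hq => iff_of_true hq ⟨?_, ?_⟩
  · rintro rfl
    obtain ⟨x, hx⟩ := ((pieces_nonempty hP hl).1 q hq).2
    have := ((pieces_pos le_rfl hP hl).1 q hq).2 x hx
    have := hB (-x) (mem_pr.2 (Or.inr (by rwa [neg_neg])))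
    omega
  · intro e
    obtain ⟨x, hx⟩ := ((pieces_nonempty hP hl).1 q hq).1
    have := ((pieces_pos le_rfl hP hl).1 q hq).1 x hx
    have h : x ∈ neg B := by rw [← e]; exact mem_pr.2 (Or.inl hx)
    rw [mem_neg] at h
    have := hB _ h
    omega

end

theorem cross_nil : cross [] = ∅ := rfl

theorem cross_cons (p : Finset ℤ × Finset ℤ) (ps : List (Finset ℤ × Finset ℤ)) :
    cross (p :: ps) = {pr p} ∪ cross ps := by
  rw [cross, List.map_cons, List.toFinset_cons, Finset.insert_eq]; rfl

theorem toFinset_cons_eq (B : Finset ℤ) (L : List (Finset ℤ)) :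
    (B :: L).toFinset = {B} ∪ L.toFinset := by
  rw [List.toFinset_cons, Finset.insert_eq]

theorem cross_append (ps qs : List (Finset ℤ × Finset ℤ)) :
    cross (ps ++ qs) = cross ps ∪ cross qs := by
  simp [cross]

theorem pr_empty (X : Finset ℤ) : pr (X, ∅) = X := by simp [pr, neg]

theorem erase_one_pr {A Z : Finset ℤ} (hA : 1 ∉ A) (hZ : ∀ x ∈ Z, 0 < x) :
    (pr (insert 1 A, Z)).erase 1 = pr (A, Z) := by
  ext x
  simp only [Finset.mem_erase, mem_pr, Finset.mem_insert]
  constructor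
  · rintro ⟨h1, (h | h) | h⟩
    · exact absurd h h1
    · exact Or.inl h
    · exact Or.inr h
  · intro h
    refine ⟨?_, h.imp_left Or.inr⟩
    rintro rfl
    rcases h with h | h
    · exact hA h
    · have := hZ _ h; omega

/-- The facts on the pieces of the word without its first letter used in the evaluation of `ξ`. -/
theorem pieces_two {n : ℕ} {l : List (Finset ℤ)} {D : Finset (Finset ℤ)} (hP : Pieces n 2 l D) :
    (∀ B ∈ D, B.Nonempty ∧ ∀ x ∈ B, 2 ≤ x) ∧ ∀ N ∈ l, N.Nonempty ∧ ∀ x ∈ N, 2 ≤ x :=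
  ⟨fun B hB => ⟨hP.nonempty B (Or.inr hB), fun x hx => (hP.range B (Or.inr hB) x hx).1⟩,
    fun B hB => ⟨hP.nonempty B (Or.inl hB), fun x hx => (hP.range B (Or.inl hB) x hx).1⟩⟩

section

variable {n : ℕ} {l : List (Finset ℤ)} {D : Finset (Finset ℤ)} {A Z M N : Finset ℤ}
  {ps : List (Finset ℤ × Finset ℤ)}

/-- The first case of `ξ`. -/
theorem xi_transient_zero (h2 : Pieces n 2 l D)
    (hl : l = ((A, Z) :: ps).map Prod.fst ++ [M] ++ (((A, Z) :: ps).map Prod.snd).reverse)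
    (h1 : Pieces n 1 (insert 1 A :: l.tail) D) :
    xi n (pm (D ∪ (cross ((insert 1 A, Z) :: ps) ∪ {pr (M, M)}))) =
      pm (D ∪ (cross ((A, Z) :: ps) ∪ {{1, -1} ∪ pr (M, M)})) := by
  have hl1 : insert 1 A :: l.tail = ((insert 1 A, Z) :: ps).map Prod.fst ++ [M] ++
      (((insert 1 A, Z) :: ps).map Prod.snd).reverse := by rw [hl]; simp
  obtain ⟨hD, hN⟩ := pieces_two h2
  have hm := mem_list_of_perm (perm_of_eq_middle hl)
  have hnd := nodup_pairs ((perm_of_eq_middle hl).nodup_iff.1 h2.nodup)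
  have hA := hN A (hm.1 (A, Z) (by simp)).1
  have hZ := hN Z (hm.1 (A, Z) (by simp)).2
  have hM := hN M (hm.2 M (by simp))
  have hZ0 : ∀ x ∈ Z, 0 < x := fun x hx => by have := hZ.2 x hx; omega
  have hA0 : ∀ x ∈ A, 0 < x := fun x hx => by have := hA.2 x hx; omega
  have hA1 : 1 ∉ A := fun h => by have := hA.2 1 h; omega
  have hM1 : (1 ∉ pr (M, M) ∧ pr (M, M) ≠ ∅) := by
    refine ⟨fun h => ?_, (hM.1.mono Finset.subset_union_left).ne_empty⟩
    rcases mem_pr.1 h with h | h <;> have := hM.2 _ h <;> omega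
  rw [xi_eq (zeroBlock_zero h1 hl1) (blockOf_one h1 hl1 (.zero M) (B := pr (insert 1 A, Z))
    (by simp [mem_cross]) (by simp [mem_pr])) (erase_one_pr hA1 hZ0)
    (xi_list_tail h1 hl1 (.zero M)), if_pos ⟨hM1, mixed_pr hA0 hZ0 hA.1 hZ.1⟩]
  have := replaceBlocks_cross (D := D) (ps := ps) (os := [(M, M), (insert 1 A, Z)])
    (new := [pr (M, M) ∪ {1, -1}, pr (A, Z)]) hD ?_ ?_ ?_
  · have e1 : D ∪ (cross ((insert 1 A, Z) :: ps) ∪ {pr (M, M)}) =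
        D ∪ cross ps ∪ cross [(M, M), (insert 1 A, Z)] := by
      simp only [cross_cons, cross_nil, Finset.union_empty]
      ac_rfl
    rw [e1]
    refine this.trans (congrArg pm ?_)
    simp only [cross_cons, toFinset_cons_eq, List.toFinset_nil, Finset.union_empty]
    rw [Finset.union_comm {1, -1}]
    ac_rfl
  · intro q hq
    have hq' := hm.1 q (List.mem_cons_of_mem _ hq)
    exact ⟨(hN _ hq'.1).1, (hN _ hq'.1).2, (hN _ hq'.2).2⟩
  · intro r hr
    simp only [List.mem_cons, List.not_mem_nil, or_false] at hr
    rcases hr with rfl | rfl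
    · exact ⟨fun x hx => by have := hM.2 x hx; omega, fun x hx => by have := hM.2 x hx; omega, hM.1,
        Or.inl hM.1⟩
    · refine ⟨fun x hx => ?_, fun x hx => by have := hZ0 x hx; omega, Finset.insert_nonempty _ _,
        Or.inl hZ.1⟩
      rcases Finset.mem_insert.1 hx with rfl | hx
      · exact le_rfl
      · have := hA0 x hx; omega
  · intro q hq r hr
    have hq' : q ∈ (A, Z) :: ps := List.mem_cons_of_mem _ hq
    have hq1 := hN _ (hm.1 q hq').1
    simp only [List.mem_cons, List.not_mem_nil, or_false] at hr
    have hMq : q.1 ≠ M := by rintro rfl; exact (hnd.2.2.2 q hq').1 (by simp)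
    rcases hr with rfl | rfl
    · exact ⟨hMq, hMq⟩
    · refine ⟨fun e => ?_, fun e => hnd.2.2.1 q hq' (A, Z) (by simp) e⟩
      have := hq1.2 1 (by rw [e]; simp)
      omega

/-- The second case of `ξ`. -/
theorem xi_transient_mixed (h2 : Pieces n 2 l D)
    (hl : l = ((A, Z) :: ps).map Prod.fst ++ [M, N] ++ (((A, Z) :: ps).map Prod.snd).reverse)
    (h1 : Pieces n 1 (insert 1 A :: l.tail) D) :
    xi n (pm (D ∪ (cross ((insert 1 A, Z) :: (ps ++ [(M, N)])) ∪ ∅))) =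
      pm (D ∪ (cross ((A, Z) :: ps) ∪ {{1} ∪ pr (M, N)})) := by
  have hl1 : insert 1 A :: l.tail = ((insert 1 A, Z) :: (ps ++ [(M, N)])).map Prod.fst ++ [] ++
      (((insert 1 A, Z) :: (ps ++ [(M, N)])).map Prod.snd).reverse := by rw [hl]; simp
  obtain ⟨hD, hN⟩ := pieces_two h2
  have hm := mem_list_of_perm (perm_of_eq_middle hl)
  have hnd := nodup_pairs ((perm_of_eq_middle hl).nodup_iff.1 h2.nodup)
  have hA := hN A (hm.1 (A, Z) (by simp)).1
  have hZ := hN Z (hm.1 (A, Z) (by simp)).2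
  have hM := hN M (hm.2 M (by simp))
  have hNN := hN N (hm.2 N (by simp))
  have hZ0 : ∀ x ∈ Z, 0 < x := fun x hx => by have := hZ.2 x hx; omega
  have hA0 : ∀ x ∈ A, 0 < x := fun x hx => by have := hA.2 x hx; omega
  have hA1 : 1 ∉ A := fun h => by have := hA.2 1 h; omega
  rw [xi_eq (zeroBlock_none h1 hl1) (blockOf_one h1 hl1 .none (B := pr (insert 1 A, Z))
    (by simp [mem_cross]) (by simp [mem_pr])) (erase_one_pr hA1 hZ0)
    (xi_list_tail h1 hl1 .none), if_neg (by simp),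
    if_pos ⟨rfl, mixed_pr hA0 hZ0 hA.1 hZ.1, by simp⟩]
  have hlast : ((ps ++ [(M, N)]).map pr).getLastD ∅ = pr (M, N) := by simp
  rw [hlast]
  have := replaceBlocks_cross (D := D) (ps := ps) (os := [(insert 1 A, Z), (M, N)])
    (new := [pr (A, Z), pr (M, N) ∪ {1}]) hD ?_ ?_ ?_
  · have e1 : D ∪ (cross ((insert 1 A, Z) :: (ps ++ [(M, N)])) ∪ ∅) =
        D ∪ cross ps ∪ cross [(insert 1 A, Z), (M, N)] := by
      simp only [cross_cons, cross_append, cross_nil, Finset.union_empty]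
      ac_rfl
    rw [e1]
    refine this.trans (congrArg pm ?_)
    simp only [cross_cons, toFinset_cons_eq, List.toFinset_nil, Finset.union_empty]
    rw [Finset.union_comm {1}]
    ac_rfl
  · intro q hq
    have hq' := hm.1 q (List.mem_cons_of_mem _ hq)
    exact ⟨(hN _ hq'.1).1, (hN _ hq'.1).2, (hN _ hq'.2).2⟩
  · intro r hr
    simp only [List.mem_cons, List.not_mem_nil, or_false] at hr
    rcases hr with rfl | rfl
    · refine ⟨fun x hx => ?_, fun x hx => by have := hZ0 x hx; omega, Finset.insert_nonempty _ _,
        Or.inl hZ.1⟩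
      rcases Finset.mem_insert.1 hx with rfl | hx
      · exact le_rfl
      · have := hA0 x hx; omega
    · exact ⟨fun x hx => by have := hM.2 x hx; omega, fun x hx => by have := hNN.2 x hx; omega, hM.1,
        Or.inl hNN.1⟩
  · intro q hq r hr
    have hq' : q ∈ (A, Z) :: ps := List.mem_cons_of_mem _ hq
    have hq1 := hN _ (hm.1 q hq').1
    simp only [List.mem_cons, List.not_mem_nil, or_false] at hr
    rcases hr with rfl | rfl
    · refine ⟨fun e => ?_, fun e => hnd.2.2.1 q hq' (A, Z) (by simp) e⟩
      have := hq1.2 1 (by rw [e]; simp)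
      omega
    · exact ⟨by rintro e; exact (hnd.2.2.2 q hq').1 (by simp [e]),
        by rintro e; exact (hnd.2.2.2 q hq').1 (by simp [e])⟩

theorem blockOf_one_finished {qs : List (Finset ℤ × Finset ℤ)} {c : List (Finset ℤ)}
    {C : Finset (Finset ℤ)} {l : List (Finset ℤ)} (hP : Pieces n 1 l (insert (insert 1 A) D))
    (hl : l = qs.map Prod.fst ++ c ++ (qs.map Prod.snd).reverse) (hC : CenterB c C) :
    blockOf (pm (insert (insert 1 A) D ∪ (cross qs ∪ C))) 1 = insert 1 A :=
  blockOf_one hP hl hC (by simp) (by simp)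

/-- The third case of `ξ`. -/
theorem xi_opener_odd {qs : List (Finset ℤ × Finset ℤ)} (h2 : Pieces n 2 l D)
    (hl : l = ((A, Z) :: ps).map Prod.fst ++ [M] ++ (((A, Z) :: ps).map Prod.snd).reverse)
    (h1 : Pieces n 1 l.tail (insert (insert 1 A) D)) (hq1 : qs.map Prod.fst = ps.map Prod.fst ++ [M])
    (hq2 : qs.map Prod.snd = Z :: ps.map Prod.snd) :
    xi n (pm (insert (insert 1 A) D ∪ (cross qs ∪ ∅))) =
      pm (D ∪ (cross ((A, Z) :: ps) ∪ {{1} ∪ pr (M, ∅)})) := by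
  have hl1 : l.tail = qs.map Prod.fst ++ [] ++ (qs.map Prod.snd).reverse := by
    rw [hl, hq1, hq2]; simp
  obtain ⟨hD, hN⟩ := pieces_two h2
  have hm := mem_list_of_perm (perm_of_eq_middle hl)
  have hA := hN A (hm.1 (A, Z) (by simp)).1
  have hA0 : ∀ x ∈ A, 0 < x := fun x hx => by have := hA.2 x hx; omega
  have hA1 : 1 ∉ A := fun h => by have := hA.2 1 h; omega
  have hB0 : ∀ x ∈ insert 1 A, 0 < x := by
    intro x hx
    rcases Finset.mem_insert.1 hx with rfl | hx
    · norm_num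
    · exact hA0 x hx
  have hqpos := (pieces_pos le_rfl h1 hl1).1
  have hqne := (pieces_nonempty h1 hl1).1
  have hqs : qs ≠ [] := by rintro rfl; simp at hq2
  have hnotmixed : ¬ Mixed A := by
    rintro ⟨-, x, hx⟩
    rw [mem_ngt] at hx
    have := hA0 x hx.1; omega
  rw [xi_eq (zeroBlock_none h1 hl1) (blockOf_one_finished h1 hl1 .none)
    (Finset.erase_insert hA1) (xi_list_finished h1 hl1 .none hB0), if_neg (by simp),
    if_neg (fun h => hnotmixed h.2.1), if_pos ⟨rfl, hA.1.ne_empty, hA0, by simpa using hqs⟩]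
  -- Finishing the first piece `A` with `1` has removed it from the list and thereby shifted all
  -- partners by one place; the unions shift them back and leave `M` over for the centre.
  have hnew : List.zipWith (· ∪ ·) (A :: (qs.map pr).map pos) ((qs.map pr).map ngt ++ [{1}]) =
      ((A, Z) :: ps).map pr ++ [M ∪ {1}] := by
    rw [map_pos_pr hqpos, map_ngt_pr hqpos, hq1, hq2, ← zipWith_fst_snd]
    rfl
  rw [hnew]
  -- The block of `1` is treated as a pair with empty second component.
  have := replaceBlocks_cross (D := D) (ps := []) (os := (insert 1 A, ∅) :: qs)
    (new := ((A, Z) :: ps).map pr ++ [M ∪ {1}]) hD (by simp) ?_ (by simp)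
  · have e1 : insert (insert 1 A) D ∪ (cross qs ∪ ∅) =
        D ∪ cross [] ∪ cross ((insert 1 A, ∅) :: qs) := by
      simp only [cross_cons, cross_nil, Finset.union_empty, pr_empty, Finset.insert_eq (insert 1 A)]
      ac_rfl
    rw [e1]
    rw [List.map_cons, pr_empty] at this
    refine this.trans (congrArg pm ?_)
    rw [List.toFinset_append, cross_nil, Finset.union_empty, cross]
    simp only [toFinset_cons_eq, List.toFinset_nil, Finset.union_empty, pr_empty]
    rw [Finset.union_comm {1} M]
  · intro r hr
    rcases List.mem_cons.1 hr with rfl | hr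
    · refine ⟨fun x hx => hB0 x hx, by simp, Finset.insert_nonempty _ _, Or.inr (by simp)⟩
    · exact ⟨(hqpos r hr).1, (hqpos r hr).2, (hqne r hr).1, Or.inl (hqne r hr).2⟩

/-- The fifth case of `ξ`. -/
theorem xi_opener_even {qs : List (Finset ℤ × Finset ℤ)} (h2 : Pieces n 2 l D)
    (hl : l = ps.map Prod.fst ++ [M, N] ++ (ps.map Prod.snd).reverse)
    (h1 : Pieces n 1 l.tail (insert (insert 1 A) D))
    (hq1 : A :: qs.map Prod.fst = ps.map Prod.fst ++ [M]) (hq2 : qs.map Prod.snd = ps.map Prod.snd) :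
    xi n (pm (insert (insert 1 A) D ∪ (cross qs ∪ {pr (N, N)}))) =
      pm (D ∪ (cross ps ∪ {{-1} ∪ pr (M, N)})) := by
  -- `A` is the first unfinished piece: the first one of the outermost pair, or `M` if there are no
  -- pairs.
  have hlA : l = A :: (qs.map Prod.fst ++ [N] ++ (qs.map Prod.snd).reverse) := by
    rw [hl, hq2, show ps.map Prod.fst ++ [M, N] = (ps.map Prod.fst ++ [M]) ++ [N] by simp, ← hq1]
    simp
  have hl1 : l.tail = qs.map Prod.fst ++ [N] ++ (qs.map Prod.snd).reverse := by
    rw [hlA]; rfl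
  obtain ⟨hD, hN⟩ := pieces_two h2
  have hA := hN A (by rw [hlA]; simp)
  have hNN := hN N (by rw [hl]; simp)
  have hA0 : ∀ x ∈ A, 0 < x := fun x hx => by have := hA.2 x hx; omega
  have hN0 : ∀ x ∈ N, 0 < x := fun x hx => by have := hNN.2 x hx; omega
  have hA1 : 1 ∉ A := fun h => by have := hA.2 1 h; omega
  have hB0 : ∀ x ∈ insert 1 A, 0 < x := by
    intro x hx
    rcases Finset.mem_insert.1 hx with rfl | hx
    · norm_num
    · exact hA0 x hx
  have hqpos := (pieces_pos le_rfl h1 hl1).1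
  have hqne := (pieces_nonempty h1 hl1).1
  have hnotmixed : ¬ Mixed A := by
    rintro ⟨-, x, hx⟩
    rw [mem_ngt] at hx
    have := hA0 x hx.1; omega
  have hne : pr (N, N) ≠ ∅ := (hNN.1.mono Finset.subset_union_left).ne_empty
  have h1N : 1 ∉ pr (N, N) := by
    intro h
    rcases mem_pr.1 h with h | h <;> have := hNN.2 _ h <;> omega
  rw [xi_eq (zeroBlock_zero h1 hl1) (blockOf_one_finished h1 hl1 (.zero N))
    (Finset.erase_insert hA1) (xi_list_finished h1 hl1 (.zero N) hB0),
    if_neg (fun h => hnotmixed h.2), if_neg (fun h => hne h.1), if_neg (fun h => hne h.1),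
    if_neg (fun h => hne h.1), if_pos ⟨⟨h1N, hne⟩, hB0⟩]
  -- With `A` removed from the list, the innermost remaining piece `N` has become the zero block.
  -- The shift frees `M`, which is joined to `-N` and `-1`.
  have hnew : List.zipWith (· ∪ ·) (A :: (qs.map pr).map pos)
      ((qs.map pr).map ngt ++ [{-1} ∪ ngt (pr (N, N))]) =
      ps.map pr ++ [M ∪ ({-1} ∪ neg N)] := by
    rw [map_pos_pr hqpos, map_ngt_pr hqpos, hq1, hq2, ngt_pr hN0 hN0, zipWith_fst_snd]
  rw [hnew]
  have := replaceBlocks_cross (D := D) (ps := []) (os := (N, N) :: (insert 1 A, ∅) :: qs)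
    (new := ps.map pr ++ [M ∪ ({-1} ∪ neg N)]) hD (by simp) ?_ (by simp)
  · have e1 : insert (insert 1 A) D ∪ (cross qs ∪ {pr (N, N)}) =
        D ∪ cross [] ∪ cross ((N, N) :: (insert 1 A, ∅) :: qs) := by
      simp only [cross_cons, cross_nil, Finset.union_empty, pr_empty, Finset.insert_eq (insert 1 A)]
      ac_rfl
    rw [e1]
    rw [List.map_cons, List.map_cons, pr_empty] at this
    refine this.trans (congrArg pm ?_)
    rw [List.toFinset_append, cross_nil, Finset.union_empty, ← cross]
    simp only [toFinset_cons_eq, List.toFinset_nil, Finset.union_empty]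
    rw [Finset.union_left_comm M]
    rfl
  · intro r hr
    rcases List.mem_cons.1 hr with rfl | hr
    · exact ⟨hN0, hN0, hNN.1, Or.inl hNN.1⟩
    rcases List.mem_cons.1 hr with rfl | hr
    · refine ⟨fun x hx => hB0 x hx, by simp, Finset.insert_nonempty _ _, Or.inr (by simp)⟩
    · exact ⟨(hqpos r hr).1, (hqpos r hr).2, (hqne r hr).1, Or.inl (hqne r hr).2⟩

/-- The fourth case of `ξ`. -/
theorem xi_closer {qs : List (Finset ℤ × Finset ℤ)} (h2 : Pieces n 2 l D)
    (hl : l = ((A, Z) :: ps).map Prod.fst ++ [M] ++ (((A, Z) :: ps).map Prod.snd).reverse)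
    (h1 : Pieces n 1 ({1} :: l) D) (hq1 : qs.map Prod.fst = A :: ps.map Prod.fst)
    (hq2 : qs.map Prod.snd = ps.map Prod.snd ++ [M]) :
    xi n (pm (D ∪ (cross (({1}, Z) :: qs) ∪ ∅))) =
      pm (D ∪ (cross ((A, Z) :: ps) ∪ {{1} ∪ pr (∅, M)})) := by
  have hl1 : {1} :: l = (({1}, Z) :: qs).map Prod.fst ++ [] ++
      ((({1}, Z) :: qs).map Prod.snd).reverse := by
    rw [List.map_cons, List.map_cons, hl, hq1, hq2]; simp
  obtain ⟨hD, hN⟩ := pieces_two h2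
  have hm := mem_list_of_perm (perm_of_eq_middle hl)
  have hZ := hN Z (hm.1 (A, Z) (by simp)).2
  have hM := hN M (hm.2 M (by simp))
  have hZ0 : ∀ x ∈ Z, 0 < x := fun x hx => by have := hZ.2 x hx; omega
  have hqpos := (pieces_pos le_rfl h1 hl1).1
  have hqne := (pieces_nonempty h1 hl1).1
  have hqs : qs ≠ [] := by rintro rfl; simp at hq1
  have hneg : ∀ x ∈ neg Z, x < 0 := fun x hx => by
    rw [mem_neg] at hx; have := hZ0 _ hx; omega
  have hZn : (neg Z).Nonempty := neg_nonempty.2 hZ.1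
  have hR : (pr (({1} : Finset ℤ), Z)).erase 1 = neg Z := by
    have := erase_one_pr (A := ∅) (Z := Z) (by simp) hZ0
    rw [insert_empty_eq] at this
    rw [this, pr, Finset.empty_union]
  have hnotmixed : ¬ Mixed (neg Z) := by
    rintro ⟨⟨x, hx⟩, -⟩
    rw [mem_pos] at hx
    have := hneg x hx.1; omega
  have hnotpos : ¬ ∀ x ∈ neg Z, 0 < x := fun h => by
    obtain ⟨x, hx⟩ := hZn
    have := h x hx; have := hneg x hx; omega
  rw [xi_eq (zeroBlock_none h1 hl1) (blockOf_one h1 hl1 .none (B := pr ({1}, Z))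
    (by simp [mem_cross]) (by simp [mem_pr])) hR (xi_list_tail h1 hl1 .none), if_neg (by simp),
    if_neg (fun h => hnotmixed h.2.1), if_neg (fun h => hnotpos h.2.2.1),
    if_pos ⟨rfl, hZn.ne_empty, hneg, by simpa using hqs⟩]
  have hqpos' := fun p hp => hqpos p (List.mem_cons_of_mem ({1}, Z) hp)
  -- The new piece `{1}` has taken the last piece `Z` as partner, and all other partners have moved
  -- by one place; the unions undo this and leave `-M` to `1`.
  have hnew : List.zipWith (· ∪ ·) (neg Z :: (qs.map pr).map ngt) ((qs.map pr).map pos ++ [{1}]) =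
      ((A, Z) :: ps).map pr ++ [neg M ∪ {1}] := by
    rw [map_pos_pr hqpos', map_ngt_pr hqpos', hq1, hq2, ← zipWith_snd_fst]
    simp
  rw [hnew]
  have := replaceBlocks_cross (D := D) (ps := []) (os := ({1}, Z) :: qs)
    (new := ((A, Z) :: ps).map pr ++ [neg M ∪ {1}]) hD (by simp) ?_ (by simp)
  · have e1 : D ∪ (cross (({1}, Z) :: qs) ∪ ∅) = D ∪ cross [] ∪ cross (({1}, Z) :: qs) := by
      simp only [cross_nil, Finset.union_empty]
    rw [e1]
    refine this.trans (congrArg pm ?_)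
    rw [List.toFinset_append, cross_nil, Finset.union_empty, ← cross]
    simp only [toFinset_cons_eq, List.toFinset_nil, Finset.union_empty, pr, Finset.empty_union]
    rw [Finset.union_comm {1}]
  · intro r hr
    exact ⟨(hqpos r hr).1, (hqpos r hr).2, (hqne r hr).1, Or.inl (hqne r hr).2⟩

end

/-! The cases in which `ξ` is the identity. -/

theorem xi_eq_self_of_mem {n : ℕ} {P : Finset (Finset ℤ)} (h : 1 ∈ zeroBlock P) : xi n P = P := by
  have hne : zeroBlock P ≠ ∅ := fun e => by rw [e] at h; simp at h
  rw [xi_eq rfl rfl rfl rfl, if_neg (fun h' => h'.1.1 h), if_neg (fun h' => hne h'.1),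
    if_neg (fun h' => hne h'.1), if_neg (fun h' => hne h'.1), if_neg (fun h' => h'.1.1 h)]

/-- Without a zero block, all cases in which something is replaced need a nonempty `R` and a further
mixed block. -/
theorem xi_eq_self_of_nil {n : ℕ} {P : Finset (Finset ℤ)} {B₁ : Finset ℤ} (h : zeroBlock P = ∅)
    (h1 : blockOf P 1 = B₁) (hL : B₁.erase 1 = ∅ ∨
      sortedBlocks n P (fun B => Mixed B ∧ neg B ≠ B ∧ B ≠ B₁ ∧ B ≠ neg B₁ ∧
      sMin B < sMin (neg B)) = []) : xi n P = P := by
  rw [xi_eq h h1 rfl rfl]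
  have hm : ¬ Mixed (∅ : Finset ℤ) := by simp [Mixed, pos]
  rcases hL with hR | hL
  · rw [hR, if_neg (by simp), if_neg (fun h => hm h.2.1), if_neg (by simp), if_neg (by simp),
      if_neg (by simp)]
  · rw [hL, if_neg (by simp), if_neg (by simp), if_neg (by simp), if_neg (by simp), if_neg (by simp)]


section

variable {n : ℕ} {u : List Status} {l : List (Finset ℤ)} {D : Finset (Finset ℤ)}

theorem BuildNC.both_one (h : BuildNC n u l D) (hu : u.length + 1 = n) :
    BuildNC n (.both :: u) l (insert {1} D) ∧ Pieces n 1 l (insert {1} D) := by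
  have := Build.both h
  rw [show (n : ℤ) - u.length = 1 by omega] at this
  exact ⟨this, this.pieces_of_length (by simp; omega)⟩

theorem BuildNC.cl_one (h : BuildNC n u l D) (hu : u.length + 1 = n) :
    BuildNC n (.cl :: u) ({1} :: l) D ∧ Pieces n 1 ({1} :: l) D := by
  have := Build.cl h
  rw [show (n : ℤ) - u.length = 1 by omega] at this
  exact ⟨this, this.pieces_of_length (by simp; omega)⟩

theorem BuildNC.tr_one {A : Finset ℤ} (h : BuildNC n u (A :: l) D) (hu : u.length + 1 = n) :
    BuildNC n (.tr :: u) (insert 1 A :: l) D ∧ Pieces n 1 (insert 1 A :: l) D := by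
  have := Build.tr (ok := fun l₁ _ => l₁ = []) (l₁ := []) h rfl
  rw [show (n : ℤ) - u.length = 1 by omega, List.nil_append] at this
  exact ⟨this, this.pieces_of_length (by simp; omega)⟩

theorem BuildNC.op_one {A : Finset ℤ} (h : BuildNC n u (A :: l) D) (hu : u.length + 1 = n) :
    BuildNC n (.op :: u) l (insert (insert 1 A) D) ∧ Pieces n 1 l (insert (insert 1 A) D) := by
  have := Build.op (ok := fun l₁ _ => l₁ = []) (l₁ := []) h rfl
  rw [show (n : ℤ) - u.length = 1 by omega, List.nil_append] at this
  exact ⟨this, this.pieces_of_length (by simp; omega)⟩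

end

theorem exists_pairs {α β : Type*} {F : List α} {G : List β} (h : F.length = G.length) :
    ∃ qs : List (α × β), qs.map Prod.fst = F ∧ qs.map Prod.snd = G :=
  ⟨F.zip G, List.map_fst_zip h.le, List.map_snd_zip h.ge⟩

theorem exists_cons_eq_append {α : Type*} (F : List α) (x : α) : ∃ a G, F ++ [x] = a :: G := by
  cases F with
  | nil => exact ⟨x, [], rfl⟩
  | cons a F => exact ⟨a, F ++ [x], rfl⟩

/-- The map `ξ` sends the noncrossing partition of type `B` to the noncrossing partition of type `D`
with the same word. -/
theorem xi_noncrossing {n : ℕ} {u : List Status} {l : List (Finset ℤ)} {D : Finset (Finset ℤ)}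
    {ps : List (Finset ℤ × Finset ℤ)} {c : List (Finset ℤ)} {s t : Status} {S U V : Finset ℤ}
    (hb : BuildNC n u l D) (hu : u.length + 1 = n)
    (hl : l = ps.map Prod.fst ++ c ++ (ps.map Prod.snd).reverse) (hc : CenterD s t c S U V) :
    ∃ l₁ D₁ qs c₁ C, BuildNC n (s :: u) l₁ D₁ ∧
      l₁ = qs.map Prod.fst ++ c₁ ++ (qs.map Prod.snd).reverse ∧ CenterB c₁ C ∧
      xi n (pm (D₁ ∪ (cross qs ∪ C))) = pm (D ∪ (cross ps ∪ {S ∪ pr (U, V)})) := by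
  have h2 : Pieces n 2 l D := hb.pieces_of_length (by omega)
  obtain ⟨hD, hN⟩ := pieces_two h2
  have hone : ∀ {N}, N ∈ l → 1 ∉ N := fun {N} h h' => by have := (hN N h).2 1 h'; omega
  cases hc with
  | both =>
    obtain ⟨h1, h1p⟩ := BuildNC.both_one hb hu
    refine ⟨_, _, ps, [], ∅, h1, hl, .none, ?_⟩
    rw [xi_eq_self_of_nil (zeroBlock_none h1p hl)
      (blockOf_one h1p hl .none (B := {1}) (by simp) (by simp)) (Or.inl (by simp)), pr_empty,
      Finset.union_empty, Finset.union_empty, Finset.insert_eq]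
    congr 1
    ac_rfl
  | zero M =>
    -- The transient element `1` has been added to the first unfinished piece. Without pairs this is
    -- the central piece, and nothing has to be changed; otherwise it belongs to the outermost pair,
    -- and `1` is moved to the centre.
    rcases ps with _ | ⟨⟨A, Z⟩, ps⟩
    · have hl' : l = [U] := by rw [hl]; rfl
      rw [hl'] at hb
      obtain ⟨h1, h1p⟩ := BuildNC.tr_one hb hu
      refine ⟨_, _, [], _, _, h1, rfl, .zero _, ?_⟩
      have h0 := zeroBlock_zero (qs := []) h1p rfl
      rw [xi_eq_self_of_mem (by rw [h0, mem_pr]; simp)]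
      congr 4
      ext x
      simp only [mem_pr, Finset.mem_union, Finset.mem_insert, Finset.mem_singleton,
        neg_eq_iff_eq_neg]
      tauto
    · have hl' : l = A :: l.tail := by rw [hl]; rfl
      have hb' := hb
      rw [hl'] at hb'
      obtain ⟨h1, h1p⟩ := BuildNC.tr_one hb' hu
      refine ⟨_, _, (insert 1 A, Z) :: ps, _, _, h1, ?_, .zero U, xi_transient_zero h2 hl h1p⟩
      rw [hl]; simp
  | posit M =>
    rcases ps with _ | ⟨⟨A, Z⟩, ps⟩
    · have hl' : l = [U] := by rw [hl]; rfl
      rw [hl'] at hb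
      obtain ⟨h1, h1p⟩ := BuildNC.op_one hb hu
      refine ⟨_, _, [], [], ∅, h1, rfl, .none, ?_⟩
      have hU := hN U (by rw [hl']; simp)
      have hpos : ∀ x ∈ insert 1 U, 0 < x := by
        intro x hx
        rcases Finset.mem_insert.1 hx with rfl | hx
        · norm_num
        · have := hU.2 x hx; omega
      rw [xi_eq_self_of_nil (zeroBlock_none h1p rfl)
        (blockOf_one_finished h1p rfl .none) (Or.inr ?_)]
      · rw [pr_empty, cross_nil, Finset.union_empty, Finset.union_empty,
          Finset.insert_eq (insert 1 U), Finset.empty_union, Finset.union_comm D,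
          Finset.insert_eq 1 U]
      · exact xi_list_finished (qs := []) h1p rfl .none hpos
    · have hl' : l = A :: l.tail := by rw [hl]; rfl
      have hb' := hb
      rw [hl'] at hb'
      obtain ⟨h1, h1p⟩ := BuildNC.op_one hb' hu
      obtain ⟨qs, hq1, hq2⟩ := exists_pairs (F := ps.map Prod.fst ++ [U])
        (G := Z :: ps.map Prod.snd) (by simp)
      refine ⟨_, _, qs, [], ∅, h1, ?_, .none, xi_opener_odd h2 hl h1p hq1 hq2⟩
      rw [hl, hq1, hq2]; simp
  | negat M =>
    obtain ⟨h1, h1p⟩ := BuildNC.cl_one hb hu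
    rcases ps with _ | ⟨⟨A, Z⟩, ps⟩
    · have hl' : l = [V] := by rw [hl]; rfl
      have hl1 : {1} :: l = [(({1} : Finset ℤ), V)].map Prod.fst ++ [] ++
          ([(({1} : Finset ℤ), V)].map Prod.snd).reverse := by rw [hl']; rfl
      refine ⟨_, _, [({1}, V)], [], ∅, h1, hl1, .none, ?_⟩
      rw [xi_eq_self_of_nil (zeroBlock_none h1p hl1)
        (blockOf_one h1p hl1 .none (B := pr ({1}, V)) (by simp [mem_cross]) (by simp [mem_pr]))
        (Or.inr (xi_list_tail h1p hl1 .none))]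
      rw [cross_cons, cross_nil, Finset.union_empty, Finset.union_empty, Finset.empty_union, pr, pr,
        Finset.empty_union]
    · obtain ⟨qs, hq1, hq2⟩ := exists_pairs (F := A :: ps.map Prod.fst)
        (G := ps.map Prod.snd ++ [V]) (by simp)
      refine ⟨_, _, ({1}, Z) :: qs, [], ∅, h1, ?_, .none, xi_closer h2 hl h1p hq1 hq2⟩
      rw [List.map_cons, List.map_cons, hl, hq1, hq2]; simp
  | mix M N =>
    rcases ps with _ | ⟨⟨A, Z⟩, ps⟩
    · have hl' : l = [U, V] := by rw [hl]; rfl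
      rw [hl'] at hb
      obtain ⟨h1, h1p⟩ := BuildNC.tr_one hb hu
      have hl1 : [insert 1 U, V] = [(insert 1 U, V)].map Prod.fst ++ [] ++
          ([(insert 1 U, V)].map Prod.snd).reverse := rfl
      refine ⟨_, _, [(insert 1 U, V)], [], ∅, h1, hl1, .none, ?_⟩
      rw [xi_eq_self_of_nil (zeroBlock_none h1p hl1)
        (blockOf_one h1p hl1 .none (B := pr (insert 1 U, V)) (by simp [mem_cross]) (by simp [mem_pr]))
        (Or.inr (xi_list_tail h1p hl1 .none))]
      rw [cross_cons, cross_nil, Finset.union_empty, Finset.union_empty, Finset.empty_union, pr, pr,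
        Finset.insert_eq, Finset.union_assoc]
    · have hl' : l = A :: l.tail := by rw [hl]; rfl
      have hb' := hb
      rw [hl'] at hb'
      obtain ⟨h1, h1p⟩ := BuildNC.tr_one hb' hu
      refine ⟨_, _, (insert 1 A, Z) :: (ps ++ [(U, V)]), [], ∅, h1, ?_, .none,
        xi_transient_mixed h2 hl h1p⟩
      rw [hl]; simp
  | mixNeg M N =>
    -- After removal of the head `A`, the first components together with `U` are matched with the
    -- old second components, and `V` is the piece in the middle.
    obtain ⟨A, F, hAF⟩ := exists_cons_eq_append (ps.map Prod.fst) U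
    have hlen := congrArg List.length hAF
    simp only [List.length_append, List.length_map, List.length_cons, List.length_nil] at hlen
    obtain ⟨qs, hq1, hq2⟩ := exists_pairs (F := F) (G := ps.map Prod.snd) (by simp; omega)
    have hl' : l = A :: (qs.map Prod.fst ++ [V] ++ (qs.map Prod.snd).reverse) := by
      rw [hl, hq1, hq2, show ps.map Prod.fst ++ [U, V] = (ps.map Prod.fst ++ [U]) ++ [V] by simp,
        hAF]
      simp
    have hb' := hb
    rw [hl'] at hb'
    obtain ⟨h1, h1p⟩ := BuildNC.op_one hb' hu
    refine ⟨_, _, qs, [V], _, h1, rfl, .zero V, xi_opener_even h2 hl ?_ (by rw [hq1, hAF]) hq2⟩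
    rw [hl']
    exact h1p


/-! ### The root posets -/

theorem e_apply (a t : ℤ) : e a t = if t = |a| then a.sign else 0 := by
  rw [e, Pi.smul_apply, Pi.single_apply, smul_eq_mul]
  split_ifs <;> simp

theorem e_neg (a : ℤ) : e (-a) = -e a := by
  ext t
  rw [Pi.neg_apply, e_apply, e_apply, abs_neg, Int.sign_neg]
  split_ifs <;> simp

theorem e_zero : e 0 = 0 := by
  ext t
  rw [e_apply]
  simp

theorem e_injective : Function.Injective e := by
  intro a b h
  have h1 := congrFun h |a|
  have h2 := congrFun h |b|
  rw [e_apply, e_apply, if_pos rfl] at h1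
  rw [e_apply, e_apply, if_pos rfl] at h2
  by_cases hab : |a| = |b|
  · rw [if_pos hab] at h1
    rw [← Int.sign_mul_abs a, ← Int.sign_mul_abs b, h1, hab]
  · rw [if_neg hab, Int.sign_eq_zero_iff_zero] at h1
    rw [if_neg (Ne.symm hab), eq_comm, Int.sign_eq_zero_iff_zero] at h2
    rw [h1, h2]

/-- Since `c` exceeds `|d|`, the coefficient at `c` on the right is `1`, which forces `a` or `b` to
be `c`. -/
theorem e_add_e {a b c d : ℤ} (hd : |d| < c) (h : e a + e b = e c + e d) :
    (a = c ∧ b = d) ∨ (a = d ∧ b = c) := by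
  have hc : 0 < c := (abs_nonneg d).trans_lt hd
  have h1 := congrFun h c
  rw [Pi.add_apply, Pi.add_apply, e_apply, e_apply, e_apply, e_apply, abs_of_pos hc, if_pos rfl,
    if_neg hd.ne', Int.sign_eq_one_of_pos hc] at h1
  have key : ∀ x : ℤ, (if c = |x| then x.sign else 0) = 1 → x = c := by
    intro x hx
    split_ifs at hx with hcx
    · rw [Int.sign_eq_one_iff_pos] at hx
      rw [hcx, abs_of_pos hx]
    · simp at hx
  have hle : ∀ x : ℤ, (if c = |x| then x.sign else 0) ≤ 1 := by
    intro x
    split_ifs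
    · rcases lt_trichotomy x 0 with h | rfl | h
      · rw [Int.sign_eq_neg_one_of_neg h]; norm_num
      · simp
      · rw [Int.sign_eq_one_of_pos h]
    · norm_num
  by_cases ha : (if c = |a| then a.sign else 0) = 1
  · have := key a ha
    subst this
    exact Or.inl ⟨rfl, e_injective (add_left_cancel h)⟩
  · have := hle a
    have := hle b
    have := key b (by omega)
    subst this
    rw [add_comm (e b)] at h
    exact Or.inr ⟨e_injective (add_right_cancel h), rfl⟩

theorem e_sub_e {a b k i : ℤ} (hi : |i| < k) (h : e a - e b = e k - e i) :
    (a = k ∧ b = i) ∨ (a = -i ∧ b = -k) := by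
  have : e a + e (-b) = e k + e (-i) := by rw [e_neg, e_neg, ← sub_eq_add_neg, h, sub_eq_add_neg]
  rcases e_add_e (by rwa [abs_neg]) this with h | h
  · exact Or.inl ⟨h.1, by omega⟩
  · exact Or.inr ⟨h.1, by omega⟩

/-- The sums of the coefficients from the index `c` on are the linear forms by which roots are
compared. -/
theorem sum_e {n : ℕ} {c a : ℤ} (hc : 1 ≤ c) (ha : |a| ≤ n) :
    ∑ t ∈ Finset.Icc c (n : ℤ), e a t = if c ≤ a then 1 else if a ≤ -c then -1 else 0 := by
  simp only [e_apply, Finset.sum_ite_eq', Finset.mem_Icc]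
  rcases lt_trichotomy a 0 with h | rfl | h
  · rw [abs_of_neg h] at *
    rw [Int.sign_eq_neg_one_of_neg h]
    split_ifs <;> omega
  · simp
    omega
  · rw [abs_of_pos h] at *
    rw [Int.sign_eq_one_of_pos h]
    split_ifs <;> omega

theorem closure_nonneg {R : Set (ℤ → ℤ)} (φ : (ℤ → ℤ) → ℤ) (h0 : φ 0 = 0)
    (hadd : ∀ v w, φ (v + w) = φ v + φ w) (hR : ∀ v ∈ R, 0 ≤ φ v) {v : ℤ → ℤ}
    (hv : v ∈ AddSubmonoid.closure R) : 0 ≤ φ v := by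
  induction hv using AddSubmonoid.closure_induction with
  | mem v hv => exact hR v hv
  | zero => exact h0.ge
  | add v w _ _ h1 h2 => rw [hadd]; exact add_nonneg h1 h2

theorem sum_root_nonneg {n : ℕ} {c : ℤ} (hc : 1 ≤ c) :
    ∀ v ∈ rootsB n, 0 ≤ ∑ t ∈ Finset.Icc c (n : ℤ), v t := by
  rintro v (⟨i, h1, h2, rfl⟩ | ⟨i, j, h1, h2, h3, rfl | rfl⟩)
  · rw [sum_e hc (by rw [abs_of_pos (by omega)]; omega)]
    split_ifs <;> omega
  · simp only [Pi.sub_apply, Finset.sum_sub_distrib]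
    rw [sum_e hc (by rw [abs_of_pos (by omega)]; omega),
      sum_e hc (by rw [abs_of_pos (by omega)]; omega)]
    split_ifs <;> omega
  · simp only [Pi.add_apply, Finset.sum_add_distrib]
    rw [sum_e hc (by rw [abs_of_pos (by omega)]; omega),
      sum_e hc (by rw [abs_of_pos (by omega)]; omega)]
    split_ifs <;> omega

/-- The forms `v ↦ ∑ t ≥ c, v t` are nonnegative on the positive roots, hence monotone for the order
of both types. Taking `c = k` gives the first inequality, and `c = i'`, `k` or `-i` gives the second
one. Thus the arc of a smaller root lies under the arc of a larger root. -/
theorem rootLE_imp {n : ℕ} {R : Set (ℤ → ℤ)} (hR : R ⊆ rootsB n) {k i k' i' : ℤ} (hi : |i| < k)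
    (hk : k ≤ n) (hi' : |i'| < k') (hk' : k' ≤ n) (h : RootLE R (e k - e i) (e k' - e i')) :
    k ≤ k' ∧ i' ≤ i := by
  have h1 := abs_lt.1 hi
  have h2 := abs_lt.1 hi'
  have main : ∀ c : ℤ, 1 ≤ c → 0 ≤ ((if c ≤ k' then 1 else if k' ≤ -c then -1 else 0) -
      (if c ≤ i' then 1 else if i' ≤ -c then -1 else 0)) -
      ((if c ≤ k then 1 else if k ≤ -c then -1 else 0) -
      (if c ≤ i then 1 else if i ≤ -c then -1 else 0) : ℤ) := by
    intro c hc
    have := closure_nonneg (fun v => ∑ t ∈ Finset.Icc c (n : ℤ), v t) (by simp)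
      (fun v w => by simp [Finset.sum_add_distrib]) (fun v hv => sum_root_nonneg hc v (hR hv)) h
    simp only [Pi.sub_apply, Finset.sum_sub_distrib] at this
    rwa [sum_e hc (by rw [abs_of_pos (by omega)]; omega), sum_e hc (by omega),
      sum_e hc (by rw [abs_of_pos (by omega)]; omega), sum_e hc (by omega)] at this
  have hkk : k ≤ k' := by
    by_contra hlt
    have := main k (by omega)
    split_ifs at this <;> omega
  refine ⟨hkk, ?_⟩
  by_contra hlt
  by_cases h0 : 0 < i'
  · by_cases hik : i' ≤ k
    · have := main i' (by omega)
      split_ifs at this <;> omega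
    · have := main k (by omega)
      split_ifs at this <;> omega
  · have := main (-i) (by omega)
    split_ifs at this <;> omega

/-- The roots `e_k - e_1` and `e_{k'} + e_1` of type `D` are not comparable. -/
theorem not_rootLE_one {n : ℕ} {k k' : ℤ} (hk : 2 ≤ k) (hk' : 2 ≤ k') (hkn : k ≤ n) (hkn' : k' ≤ n) :
    ¬ RootLE (rootsD n) (e k - e 1) (e k' - e (-1)) := by
  intro h
  have hv : ∀ a : ℤ, 1 ≤ a → e a 1 = if a = 1 then 1 else 0 := by
    intro a ha
    rw [e_apply, abs_of_pos (by omega), Int.sign_eq_one_of_pos (by omega)]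
    split_ifs <;> omega
  have hs : ∀ a : ℤ, 1 ≤ a → a ≤ n → ∑ t ∈ Finset.Icc 2 (n : ℤ), e a t = if a = 1 then 0 else 1 := by
    intro a ha han
    rw [sum_e (by norm_num) (by rw [abs_of_pos (by omega)]; omega)]
    split_ifs <;> omega
  -- The sum of all coefficients with the sign at `e_1` reversed is nonnegative on the roots of type
  -- `D`, though not on the root `e_1` of type `B`. On the difference of the two roots it is `-2`.
  have := closure_nonneg (fun v => ∑ t ∈ Finset.Icc 2 (n : ℤ), v t - v 1) (by simp)
    (fun v w => by simp only [Pi.add_apply, Finset.sum_add_distrib]; ring) ?_ h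
  · simp only [Pi.sub_apply, Finset.sum_sub_distrib, e_neg, Pi.neg_apply, Finset.sum_neg_distrib] at this
    rw [hv k (by omega), hv k' (by omega), hv 1 le_rfl, hs k (by omega) hkn, hs k' (by omega) hkn',
      hs 1 le_rfl (by omega)] at this
    split_ifs at this <;> omega
  · rintro v ⟨i, j, h1, h2, h3, rfl | rfl⟩
    · simp only [Pi.sub_apply, Finset.sum_sub_distrib]
      rw [hv i (by omega), hv j (by omega), hs i (by omega) (by omega), hs j (by omega) (by omega)]
      split_ifs <;> omega
    · simp only [Pi.add_apply, Finset.sum_add_distrib]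
      rw [hv i (by omega), hv j (by omega), hs i (by omega) (by omega), hs j (by omega) (by omega)]
      split_ifs <;> omega

/-- The roots of type `D` in the form `e_k - e_i`. -/
theorem mem_rootsD_iff {n : ℕ} {v : ℤ → ℤ} :
    v ∈ rootsD n ↔ ∃ k i : ℤ, i ≠ 0 ∧ |i| < k ∧ k ≤ n ∧ v = e k - e i := by
  constructor
  · rintro ⟨i, j, h1, h2, h3, rfl | rfl⟩
    · exact ⟨i, j, by omega, by rwa [abs_of_pos (by omega)], h3, rfl⟩
    · refine ⟨i, -j, by omega, by rwa [abs_neg, abs_of_pos (by omega)], h3, ?_⟩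
      rw [e_neg, sub_neg_eq_add]
  · rintro ⟨k, i, h1, h2, h3, rfl⟩
    rcases lt_or_gt_of_ne h1 with h | h
    · rw [abs_of_neg h] at h2
      refine ⟨k, -i, by omega, h2, h3, Or.inr ?_⟩
      rw [e_neg, sub_eq_add_neg]
    · rw [abs_of_pos h] at h2
      exact ⟨k, i, by omega, h2, h3, Or.inl rfl⟩

/-- The difference is zero or a positive root unless `b = -a`. Then it is `2 e_a`, the sum of `e_a -
e_1` and `e_a + e_1`, which needs `a ≥ 2`; this accounts for the exception. -/
theorem e_sub_e_mem_closure {n : ℕ} {a b : ℤ} (ha : a ∈ ground n) (hb : b ∈ ground n) (hba : b ≤ a)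
    (h1 : ¬ (a = 1 ∧ b = -1)) : e a - e b ∈ AddSubmonoid.closure (rootsD n) := by
  rw [mem_ground] at ha hb
  rcases hba.eq_or_lt with rfl | hlt
  · rw [sub_self]; exact AddSubmonoid.zero_mem _
  rcases lt_trichotomy |b| |a| with h | h | h
  · refine AddSubmonoid.subset_closure (mem_rootsD_iff.2 ⟨a, b, hb.1, ?_, by omega, rfl⟩)
    have : 0 < a := by
      by_contra h0
      rw [abs_of_neg (by omega : a < 0), abs_of_neg (by omega : b < 0)] at h
      omega
    rwa [abs_of_pos this] at h
  · have hba' : b = -a ∧ 0 < a := by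
      rcases abs_eq_abs.1 h with e | e <;> omega
    have e1 : e a - e b = (e a - e 1) + (e a + e 1) := by
      rw [hba'.1, e_neg]; abel
    rw [e1]
    exact AddSubmonoid.add_mem _
      (AddSubmonoid.subset_closure ⟨a, 1, le_rfl, by omega, by omega, Or.inl rfl⟩)
      (AddSubmonoid.subset_closure ⟨a, 1, le_rfl, by omega, by omega, Or.inr rfl⟩)
  · refine AddSubmonoid.subset_closure (mem_rootsD_iff.2 ⟨-b, -a, by omega, ?_, by omega, ?_⟩)
    · have : b < 0 := by
        by_contra h0
        rw [abs_of_pos (by omega : 0 < b), abs_of_pos (by omega : 0 < a)] at h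
        omega
      rwa [abs_neg, ← abs_of_neg this]
    · rw [e_neg, e_neg]; abel

theorem arc_neg {A : Set (ℤ → ℤ)} {a b : ℤ} : Arc A (-b) (-a) ↔ Arc A a b := by
  rw [Arc, Arc, e_neg, e_neg, show -e b - -e a = e a - e b by abel]

/-- The arcs of an antichain of type `D`. -/
theorem arc_bounds {n : ℕ} {A : Set (ℤ → ℤ)} (hA : A ⊆ rootsD n) {a b : ℤ} (h : Arc A a b) :
    a ∈ ground n ∧ b ∈ ground n ∧ b < a ∧ b ≠ -a := by
  obtain ⟨k, i, h1, h2, h3, h4⟩ := mem_rootsD_iff.1 (hA h)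
  have h5 := abs_lt.1 h2
  rw [mem_ground, mem_ground]
  rcases e_sub_e h2 h4 with ⟨rfl, rfl⟩ | ⟨rfl, rfl⟩ <;> omega

/-- If one arc lies under another, the difference of their roots is a sum of the differences at the
two ends, and these are sums of roots unless one is `2 e_1`. The lower ends `1` and `-1` must
therefore be excepted; the bound on `m'` excludes the same problem at the upper ends. -/
theorem arc_antichain {n : ℕ} {A : Set (ℤ → ℤ)} (hA : A ⊆ rootsD n)
    (hanti : IsAntichain (RootLE (rootsD n)) A) {m y m' y' : ℤ} (h : Arc A m y) (h' : Arc A m' y')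
    (hm : 2 ≤ m') (hmm : m' ≤ m) (hy : y ≤ y') (hex : ¬ (y' = 1 ∧ y = -1)) : m' = m ∧ y' = y := by
  obtain ⟨g1, g2, g3, g4⟩ := arc_bounds hA h
  obtain ⟨g1', g2', g3', g4'⟩ := arc_bounds hA h'
  have hle : RootLE (rootsD n) (e m' - e y') (e m - e y) := by
    rw [RootLE, show e m - e y - (e m' - e y') = (e m - e m') + (e y' - e y) by abel]
    exact AddSubmonoid.add_mem _ (e_sub_e_mem_closure g1 g1' hmm (by omega))
      (e_sub_e_mem_closure g2' g2 hy hex)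
  have heq := hanti.eq h' h hle
  obtain ⟨k, i, h1, h2, h3, h4⟩ := mem_rootsD_iff.1 (hA h)
  have h5 := abs_lt.1 h2
  rcases e_sub_e h2 h4 with ⟨rfl, rfl⟩ | ⟨rfl, rfl⟩ <;>
    rcases e_sub_e h2 (heq.trans h4) with ⟨rfl, rfl⟩ | ⟨rfl, rfl⟩ <;> omega


open Relation (EqvGen)

/-! ### The partition of an antichain -/

/-- `i` and `k` are consecutive elements of `B`. -/
def Consec (B : Finset ℤ) (i k : ℤ) : Prop := i ∈ B ∧ k ∈ B ∧ i < k ∧ ∀ x ∈ B, ¬ (i < x ∧ x < k)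

theorem Consec.right_unique {B : Finset ℤ} {i k k' : ℤ} (h : Consec B i k) (h' : Consec B i k') :
    k = k' := by
  have h1 := h.2.2.2 k' h'.2.1
  have h2 := h'.2.2.2 k h.2.1
  have := h.2.2.1
  have := h'.2.2.1
  omega

theorem consec_singleton {a i k : ℤ} : ¬ Consec {a} i k := by
  rintro ⟨h1, h2, h3, -⟩
  rw [Finset.mem_singleton] at h1 h2
  omega

theorem consec_insert {N : Finset ℤ} {a i k : ℤ} (h : ∀ x ∈ N, a < x) :
    Consec (insert a N) i k ↔ Consec N i k ∨ (i = a ∧ IsLeast (N : Set ℤ) k) := by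
  simp only [Consec, Finset.mem_insert]
  constructor
  · rintro ⟨rfl | h1, rfl | h2, h3, h4⟩
    · omega
    · refine Or.inr ⟨rfl, h2, fun x hx => ?_⟩
      have := h4 x (Or.inr hx)
      have := h x hx
      omega
    · have := h i h1; omega
    · exact Or.inl ⟨h1, h2, h3, fun x hx => h4 x (Or.inr hx)⟩
  · rintro (⟨h1, h2, h3, h4⟩ | ⟨rfl, h1, h2⟩)
    · refine ⟨Or.inr h1, Or.inr h2, h3, ?_⟩
      rintro x (rfl | hx)
      · have := h i h1; omega
      · exact h4 x hx
    · refine ⟨Or.inl rfl, Or.inr h1, h k h1, ?_⟩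
      rintro x (rfl | hx)
      · omega
      · have : k ≤ x := h2 hx
        omega

theorem exists_consec {B : Finset ℤ} {m k : ℤ} (hm : m ∈ B) (hk : k ∈ B) (h : m < k) :
    ∃ i, Consec B i k := by
  have hne : (B.filter (· < k)).Nonempty := ⟨m, Finset.mem_filter.2 ⟨hm, h⟩⟩
  have hmem := Finset.mem_filter.1 ((B.filter (· < k)).max'_mem hne)
  refine ⟨(B.filter (· < k)).max' hne, hmem.1, hk, hmem.2, fun x hx hxk => ?_⟩
  have := (B.filter (· < k)).le_max' x (Finset.mem_filter.2 ⟨hx, hxk.2⟩)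
  omega

theorem exists_isLeast {B : Finset ℤ} (h : B.Nonempty) : ∃ m, IsLeast (B : Set ℤ) m :=
  ⟨B.min' h, B.isLeast_min' h⟩

theorem MinLT.lt {B C : Finset ℤ} (h : MinLT B C) {b c : ℤ} (hb : IsLeast (B : Set ℤ) b)
    (hc : IsLeast (C : Set ℤ) c) : b < c := by
  obtain ⟨x, hx, h⟩ := h
  have h1 : b ≤ x := hb.2 hx
  exact h1.trans_lt (h c hc.1)

theorem eqvGen_of_consec {A : Set (ℤ → ℤ)} {B : Finset ℤ} (h : ∀ i k, Consec B i k → Arc A k i) :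
    ∀ x ∈ B, ∀ y ∈ B, EqvGen (Arc A) x y := by
  have main : ∀ (m : ℕ), ∀ x ∈ B, ∀ y ∈ B, x ≤ y → y - x ≤ m → EqvGen (Arc A) x y := by
    intro m
    induction m with
    | zero => intro x _ y _ h1 h2; rw [show x = y by push_cast at h2; omega]; exact .refl _
    | succ m ih =>
      intro x hx y hy h1 h2
      push_cast at h2
      rcases h1.eq_or_lt with rfl | h1
      · exact .refl _
      by_cases hz : ∃ z ∈ B, x < z ∧ z < y
      · obtain ⟨z, hz, h3, h4⟩ := hz
        exact .trans _ z _ (ih x hx z hz h3.le (by omega)) (ih z hz y hy h4.le (by omega))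
      · push Not at hz
        exact .symm _ _ (.rel _ _ (h x y ⟨hx, hy, h1, fun z hzB hlt => by
          have := hz z hzB hlt.1; omega⟩))
  intro x hx y hy
  rcases le_total x y with h1 | h1
  · exact main (y - x).toNat x hx y hy h1 (by omega)
  · exact .symm _ _ (main (x - y).toNat y hy x hx h1 (by omega))

theorem eqvGen_neg {A : Set (ℤ → ℤ)} {a b : ℤ} (h : EqvGen (Arc A) a b) :
    EqvGen (Arc A) (-a) (-b) := by
  induction h with
  | rel x y h => exact .symm _ _ (.rel _ _ (arc_neg.2 h))
  | refl x => exact .refl _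
  | symm x y _ ih => exact .symm _ _ ih
  | trans x y z _ _ ih ih' => exact .trans _ _ _ ih ih'

/-- The arc `{k, i}` stays inside `B`, where `0` belongs to the zero block. -/
def Inside (B : Finset ℤ) (k i : ℤ) : Prop := k ∈ B ∧ (i ∈ B ∨ (i = 0 ∧ neg B = B))

-- The blocks are connected, and no arc leads from one block to another. For this `0` is counted as
-- a member of the zero block, so that a chain through `0` does not leave it.
open Classical in
theorem chainPartition_eq {n : ℕ} {A : Set (ℤ → ℤ)} {P : Finset (Finset ℤ)}
    (hP : IsBPartition n P) (h1 : ∀ B ∈ P, ∀ x ∈ B, ∀ y ∈ B, EqvGen (Arc A) x y)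
    (h2 : ∀ v ∈ A, ∃ k i, |i| < k ∧ v = e k - e i ∧ ∃ B ∈ P, Inside B k i) :
    chainPartition n A = P := by
  have h0 : ∀ B ∈ P, (0 : ℤ) ∉ B := fun B hB h => by
    have := mem_ground.1 (hP.subset_ground hB h)
    omega
  have huniq : ∀ {B C : Finset ℤ} {a : ℤ}, B ∈ P → C ∈ P → (a ∈ B ∨ (a = 0 ∧ neg B = B)) →
      (a ∈ C ∨ (a = 0 ∧ neg C = C)) → B = C := by
    rintro B C a hB hC (h | ⟨rfl, h⟩) (h' | ⟨h'', h'⟩)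
    · exact hP.eq_of_mem hB hC h h'
    · subst h''; exact absurd h (h0 B hB)
    · exact absurd h' (h0 C hC)
    · exact hP.zero_unique B hB C hC h h'
  have hrel : ∀ a b, Arc A a b → ∃ B ∈ P, (a ∈ B ∨ (a = 0 ∧ neg B = B)) ∧
      (b ∈ B ∨ (b = 0 ∧ neg B = B)) := by
    intro a b hab
    obtain ⟨k, i, hi, hv, B, hB, hk, hi'⟩ := h2 _ hab
    rcases e_sub_e hi hv with ⟨rfl, rfl⟩ | ⟨rfl, rfl⟩
    · exact ⟨B, hB, Or.inl hk, hi'⟩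
    · refine ⟨neg B, hP.neg_mem B hB, ?_, Or.inl (by rwa [mem_neg, neg_neg])⟩
      rcases hi' with h | ⟨rfl, h⟩
      · exact Or.inl (by rwa [mem_neg, neg_neg])
      · exact Or.inr ⟨neg_zero, by rw [h, h]⟩
  have hinv : ∀ a b, EqvGen (Arc A) a b → ∀ B ∈ P, (a ∈ B ∨ (a = 0 ∧ neg B = B)) ↔
      (b ∈ B ∨ (b = 0 ∧ neg B = B)) := by
    intro a b hab
    induction hab with
    | rel a b h =>
      intro B hB
      obtain ⟨C, hC, ha, hb⟩ := hrel a b h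
      exact ⟨fun h => huniq hC hB ha h ▸ hb, fun h => huniq hC hB hb h ▸ ha⟩
    | refl a => exact fun _ _ => Iff.rfl
    | symm a b _ ih => exact fun B hB => (ih B hB).symm
    | trans a b c _ _ ih ih' => exact fun B hB => (ih B hB).trans (ih' B hB)
  have hclass : ∀ B ∈ P, ∀ a ∈ B, (ground n).filter (fun b => EqvGen (Arc A) a b) = B := by
    intro B hB a ha
    ext b
    rw [Finset.mem_filter]
    constructor
    · rintro ⟨hb, hab⟩
      rcases (hinv a b hab B hB).1 (Or.inl ha) with h | ⟨rfl, -⟩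
      · exact h
      · exact absurd rfl (mem_ground.1 hb).1
    · exact fun hb => ⟨hP.subset_ground hB hb, h1 B hB a ha b hb⟩
  ext B
  rw [chainPartition, Finset.mem_image]
  constructor
  · rintro ⟨a, ha, rfl⟩
    obtain ⟨B, hB, haB⟩ := hP.exists_mem ha
    rwa [hclass B hB a haB]
  · intro hB
    obtain ⟨a, ha⟩ := hP.nonempty B hB
    exact ⟨a, hP.subset_ground hB ha, hclass B hB a ha⟩

/-- The pieces are connected by arcs between consecutive elements, and the two parts of a mixed
block by one further arc. Only the connectedness of the central block remains as a hypothesis. -/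
theorem chainPartition_config {n : ℕ} {j : ℤ} {l : List (Finset ℤ)} {D C : Finset (Finset ℤ)}
    {ps : List (Finset ℤ × Finset ℤ)} (hc : Config n j l D (cross ps ∪ C))
    (hps : ∀ p ∈ ps, p.1 ∈ l ∧ p.2 ∈ l) {A : Set (ℤ → ℤ)}
    (h1 : ∀ X, X ∈ l ∨ X ∈ D → ∀ i k, Consec X i k → Arc A k i)
    (h2 : ∀ p ∈ ps, ∃ x ∈ p.1, ∃ y ∈ p.2, Arc A y (-x))
    (h3 : ∀ B ∈ C, ∀ x ∈ B, ∀ y ∈ B, EqvGen (Arc A) x y)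
    (h4 : ∀ v ∈ A, ∃ k i, |i| < k ∧ v = e k - e i ∧ ((∃ X, (X ∈ l ∨ X ∈ D) ∧ k ∈ X ∧ i ∈ X) ∨
      ∃ B ∈ cross ps ∪ C, Inside B k i ∨ Inside (neg B) k i)) :
    chainPartition n A = pm (D ∪ (cross ps ∪ C)) := by
  have hX := fun X hX => eqvGen_of_consec (h1 X hX)
  have hconn : ∀ B ∈ D ∪ (cross ps ∪ C), ∀ x ∈ B, ∀ y ∈ B, EqvGen (Arc A) x y := by
    intro B hB
    simp only [Finset.mem_union, mem_cross] at hB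
    rcases hB with hB | ⟨p, hp, rfl⟩ | hB
    · exact hX B (Or.inr hB)
    · obtain ⟨a, ha, b, hb, hab⟩ := h2 p hp
      have hroot : ∀ x ∈ pr p, EqvGen (Arc A) (-x) b := by
        intro x hx
        rcases mem_pr.1 hx with hx | hx
        · exact .trans _ _ _ (eqvGen_neg (hX p.1 (Or.inl (hps p hp).1) x hx a ha))
            (.symm _ _ (.rel _ _ hab))
        · exact hX p.2 (Or.inl (hps p hp).2) _ hx b hb
      intro x hx y hy
      have := eqvGen_neg (EqvGen.trans _ _ _ (hroot x hx) (.symm _ _ (hroot y hy)))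
      rwa [neg_neg, neg_neg] at this
    · exact h3 B hB
  refine chainPartition_eq hc.signed.isBPartition ?_ ?_
  · intro B hB
    rcases mem_pm.1 hB with hB | hB
    · exact hconn B hB
    · intro x hx y hy
      have := eqvGen_neg (hconn _ hB (-x) (by rwa [mem_neg, neg_neg]) (-y) (by rwa [mem_neg, neg_neg]))
      rwa [neg_neg, neg_neg] at this
  · intro v hv
    obtain ⟨k, i, hi, rfl, h⟩ := h4 v hv
    refine ⟨k, i, hi, rfl, ?_⟩
    rcases h with ⟨X, hX | hX, hk, hi⟩ | ⟨B, hB, h⟩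
    · obtain ⟨B, hB, hXB⟩ := hc.exists_carry X hX
      refine ⟨B, ?_, hXB.1 hk, Or.inl (hXB.1 hi)⟩
      rw [pm_union]
      exact Finset.mem_union_right _ hB
    · exact ⟨X, mem_pm.2 (Or.inl (Finset.mem_union_left _ hX)), hk, Or.inl hi⟩
    · have hB' := Finset.mem_union_right D hB
      rcases h with h | h
      · exact ⟨B, mem_pm.2 (Or.inl hB'), h⟩
      · exact ⟨neg B, mem_pm.2 (Or.inr (by rwa [neg_neg_block])), h⟩


open Relation (EqvGen)

/-! ### The antichain of a nonnesting construction -/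

/-- The invariants of the nonnesting construction: no arc covers another one, and no arc lies
below the least element of an unfinished piece. -/
structure NNInv (l : List (Finset ℤ)) (D : Finset (Finset ℤ)) : Prop where
  arc : ∀ X Y, (X ∈ l ∨ X ∈ D) → (Y ∈ l ∨ Y ∈ D) → ∀ i k i' k', Consec X i k → Consec Y i' k' →
    i < i' → k < k'
  mark : ∀ X, (X ∈ l ∨ X ∈ D) → ∀ i k, Consec X i k → ∀ N ∈ l, ∃ x ∈ N, x < k

/-- The new arc starts below all others and ends at the least element of the last piece, the largest
of all least elements of unfinished pieces. Older arcs end above all these least elements, hence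
above the new arc. -/
theorem BuildNN.inv {n : ℕ} {u : List Status} {l : List (Finset ℤ)} {D : Finset (Finset ℤ)}
    (h : BuildNN n u l D) : NNInv l D := by
  have hsingle : ∀ {u : List Status} {l D} {l' : List (Finset ℤ)} {D' : Finset (Finset ℤ)},
      Pieces n (n - u.length + 1) l D → NNInv l D →
      (∀ X, X ∈ l' ∨ X ∈ D' ↔ X = {(n - u.length : ℤ)} ∨ X ∈ l ∨ X ∈ D) →
      (∀ X ∈ l', X = {(n - u.length : ℤ)} ∨ X ∈ l) → NNInv l' D' := by
    intro u l D l' D' hp ih hmem hl'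
    have hc : ∀ X, X ∈ l' ∨ X ∈ D' → ∀ i k, Consec X i k → X ∈ l ∨ X ∈ D := by
      intro X hX i k hik
      rcases (hmem X).1 hX with rfl | h
      · exact absurd hik consec_singleton
      · exact h
    refine ⟨fun X Y hX hY i k i' k' h1 h2 => ih.arc X Y (hc X hX i k h1) (hc Y hY i' k' h2) i k i' k' h1 h2,
      fun X hX i k h N hN => ?_⟩
    rcases hl' N hN with rfl | hN
    · have := (hp.range X (hc X hX i k h) k h.2.1).1
      exact ⟨_, Finset.mem_singleton_self _, by omega⟩
    · exact ih.mark X (hc X hX i k h) i k h N hN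
  have hjoin : ∀ {u : List Status} {l₁ N D} {l' : List (Finset ℤ)} {D' : Finset (Finset ℤ)},
      Pieces n (n - u.length + 1) (l₁ ++ [N]) D → NNInv (l₁ ++ [N]) D →
      (∀ X, X ∈ l' ∨ X ∈ D' ↔ X = insert (n - u.length : ℤ) N ∨ X ∈ l₁ ∨ X ∈ D) →
      (∀ X ∈ l', X = insert (n - u.length : ℤ) N ∨ X ∈ l₁) → NNInv l' D' := by
    intro u l₁ N D l' D' hp ih hmem hl'
    have hN : N ∈ l₁ ++ [N] ∨ N ∈ D := Or.inl (by simp)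
    have hlow : ∀ x ∈ N, (n - u.length : ℤ) < x := fun x hx => by
      have := (hp.range N hN x hx).1; omega
    obtain ⟨m, hm⟩ := exists_isLeast (hp.nonempty N hN)
    have hc : ∀ X, X ∈ l' ∨ X ∈ D' → ∀ i k, Consec X i k →
        (∃ Y, (Y ∈ l₁ ++ [N] ∨ Y ∈ D) ∧ Consec Y i k) ∨ (i = n - u.length ∧ k = m) := by
      intro X hX i k hik
      rcases (hmem X).1 hX with rfl | h
      · rcases (consec_insert hlow).1 hik with h | ⟨rfl, h⟩
        · exact Or.inl ⟨N, hN, h⟩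
        · exact Or.inr ⟨rfl, h.unique hm⟩
      · exact Or.inl ⟨X, h.imp_left (by simp +contextual), hik⟩
    constructor
    · intro X Y hX hY i k i' k' h1 h2 hlt
      rcases hc X hX i k h1 with ⟨X', hX', h1⟩ | ⟨rfl, rfl⟩ <;>
        rcases hc Y hY i' k' h2 with ⟨Y', hY', h2⟩ | ⟨rfl, rfl⟩
      · exact ih.arc X' Y' hX' hY' i k i' k' h1 h2 hlt
      · have := (hp.range X' hX' i h1.1).1; omega
      · obtain ⟨x, hx, h⟩ := ih.mark Y' hY' i' k' h2 N (by simp)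
        exact (hm.2 hx).trans_lt h
      · omega
    · intro X hX i k h M hM
      rcases hc X hX i k h with ⟨X', hX', h⟩ | ⟨rfl, rfl⟩
      · rcases hl' M hM with rfl | hM
        · obtain ⟨x, hx, h⟩ := ih.mark X' hX' i k h N (by simp)
          exact ⟨x, Finset.mem_insert_of_mem hx, h⟩
        · exact ih.mark X' hX' i k h M (by simp [hM])
      · rcases hl' M hM with rfl | hM
        · exact ⟨_, Finset.mem_insert_self _ _, hlow _ hm.1⟩
        · have := hp.sorted
          rw [List.pairwise_append] at this
          obtain ⟨x, hx, h⟩ := this.2.2 M hM N (by simp)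
          exact ⟨x, hx, h _ hm.1⟩
  induction h with
  | nil => exact ⟨by simp, by simp⟩
  | both h ih =>
    refine hsingle h.pieces ih (fun X => ?_) (fun X hX => Or.inr hX)
    rw [Finset.mem_insert]; exact or_left_comm
  | cl h ih =>
    refine hsingle h.pieces ih (fun X => ?_) (fun X hX => List.mem_cons.1 hX)
    rw [List.mem_cons, or_assoc]
  | tr h hok ih =>
    subst hok
    refine hjoin h.pieces ih (fun X => ?_) (fun X hX => ?_)
    · rw [List.append_nil, List.mem_cons, or_assoc]
    · rwa [List.append_nil, List.mem_cons] at hX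
  | op h hok ih =>
    subst hok
    refine hjoin h.pieces ih (fun X => ?_) (fun X hX => ?_)
    · rw [List.append_nil, Finset.mem_insert]; exact or_left_comm
    · rw [List.append_nil] at hX; exact Or.inr hX

/-- The antichain consists of the arcs between consecutive elements of pieces (`PA`), one arc from
the least element of `p.2` to minus the least element of `p.1` for each pair `p` (`XA`), and the
arcs `T` at the centre. Apart from arcs of `T`, no arc lies under another one: by `NNInv` for
pieces, by the nesting of the pairs, and because the central pieces come last. By `rootLE_imp` this
gives incomparable roots; for two arcs of `T` this is assumed. -/
theorem exists_antichain {n : ℕ} {j : ℤ} {l : List (Finset ℤ)} {D C : Finset (Finset ℤ)}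
    {ps : List (Finset ℤ × Finset ℤ)} {c : List (Finset ℤ)} {R : Set (ℤ → ℤ)} (hj : 1 ≤ j)
    (hP : Pieces n j l D) (hinv : NNInv l D)
    (hl : l = ps.map Prod.fst ++ (ps.map Prod.snd).reverse ++ c)
    (hY : Config n j l D (cross ps ∪ C)) (hR : R ⊆ rootsB n) (hDR : rootsD n ⊆ R)
    (T : ℤ → ℤ → Prop)
    (hT : ∀ k i, T k i → |i| < j ∧ e k - e i ∈ R ∧ (∃ N ∈ c, IsLeast (N : Set ℤ) k) ∧
      ∃ B ∈ C, Inside B k i ∨ Inside (neg B) k i)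
    (hTT : ∀ k i k' i', T k i → T k' i' → k ≤ k' → i' ≤ i →
      (k = k' ∧ i = i') ∨ ¬ RootLE R (e k - e i) (e k' - e i'))
    (hC : ∀ A : Set (ℤ → ℤ), (∀ k i, T k i → Arc A k i) →
      (∀ N ∈ c, ∀ x ∈ N, ∀ y ∈ N, EqvGen (Arc A) x y) →
      ∀ B ∈ C, ∀ x ∈ B, ∀ y ∈ B, EqvGen (Arc A) x y) :
    ∃ A ⊆ R, IsAntichain (RootLE R) A ∧ pm (D ∪ (cross ps ∪ C)) = chainPartition n A := by
  have hps : ∀ p ∈ ps, p.1 ∈ l ∧ p.2 ∈ l := fun p hp => by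
    rw [hl]
    simp only [List.mem_append, List.mem_reverse, List.mem_map]
    exact ⟨Or.inl (Or.inl ⟨p, hp, rfl⟩), Or.inl (Or.inr ⟨p, hp, rfl⟩)⟩
  have hcl : ∀ N ∈ c, N ∈ l := fun N hN => by rw [hl]; exact List.mem_append_right _ hN
  have hsort := hP.sorted
  rw [hl] at hsort
  have hnest : Nested ps := Nested.of_sorted hsort (List.sublist_append_left _ _)
  have hpc : ∀ p ∈ ps, ∀ N ∈ c, MinLT p.2 N := fun p hp N hN =>
    (List.pairwise_append.1 hsort).2.2 _ (List.mem_append_right _ (List.mem_reverse.2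
      (List.mem_map_of_mem hp))) N hN
  let PA : ℤ → ℤ → Prop := fun k i => ∃ X, (X ∈ l ∨ X ∈ D) ∧ Consec X i k
  let XA : ℤ → ℤ → Prop := fun k i => ∃ p ∈ ps, IsLeast (p.2 : Set ℤ) k ∧ IsLeast (p.1 : Set ℤ) (-i)
  let W : ℤ → ℤ → Prop := fun k i => PA k i ∨ XA k i ∨ T k i
  have hlr : ∀ N ∈ l, ∀ k ∈ N, j ≤ k ∧ k ≤ n := fun N hN k hk => hP.range N (Or.inl hN) k hk
  have hPb : ∀ {k i}, PA k i → j ≤ i ∧ i < k ∧ k ≤ n := by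
    rintro k i ⟨X, hX, h⟩
    exact ⟨(hP.range X hX i h.1).1, h.2.2.1, (hP.range X hX k h.2.1).2⟩
  have hXb : ∀ {k i}, XA k i → i ≤ -j ∧ -i < k ∧ k ≤ n ∧ ∃ N ∈ l, IsLeast (N : Set ℤ) k := by
    rintro k i ⟨p, hp, h1, h2⟩
    have := (hlr p.1 (hps p hp).1 _ h2.1).1
    exact ⟨by omega, (hnest.lt p hp).lt h2 h1, (hlr p.2 (hps p hp).2 _ h1.1).2, p.2, (hps p hp).2, h1⟩
  have hTb : ∀ {k i}, T k i → |i| < j ∧ j ≤ k ∧ k ≤ n ∧ ∃ N ∈ l, IsLeast (N : Set ℤ) k := by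
    intro k i h
    obtain ⟨h1, -, ⟨N, hN, h2⟩, -⟩ := hT k i h
    have := hlr N (hcl N hN) k h2.1
    exact ⟨h1, this.1, this.2, N, hcl N hN, h2⟩
  have hWb : ∀ {k i}, W k i → |i| < k ∧ k ≤ n := by
    rintro k i (h | h | h)
    · have := hPb h; rw [abs_of_pos (by omega)]; omega
    · have := hXb h; rw [abs_of_neg (by omega)]; omega
    · have := hTb h; omega
  have hmark : ∀ {k i k'}, PA k i → (∃ N ∈ l, IsLeast (N : Set ℤ) k') → k' < k := by
    rintro k i k' ⟨X, hX, h⟩ ⟨N, hN, h'⟩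
    obtain ⟨x, hx, hlt⟩ := hinv.mark X hX i k h N hN
    exact (h'.2 hx).trans_lt hlt
  have hWW : ∀ {k i k' i'}, W k i → W k' i' → k ≤ k' → i' ≤ i →
      (k = k' ∧ i = i') ∨ ¬ RootLE R (e k - e i) (e k' - e i') := by
    rintro k i k' i' (h | h | h) (h' | h' | h') hk hi
    · obtain ⟨X, hX, h⟩ := h
      obtain ⟨Y, hY, h'⟩ := h'
      rcases hi.eq_or_lt with rfl | hlt
      · have := hP.eq_of_mem X Y hX hY _ h.1 h'.1
        subst this
        exact Or.inl ⟨h.right_unique h', rfl⟩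
      · have := hinv.arc Y X hY hX _ _ _ _ h' h hlt; omega
    · have := hmark h (hXb h').2.2.2; omega
    · have := hmark h (hTb h').2.2.2; omega
    · have := hPb h'; have := hXb h; omega
    · obtain ⟨p, hp, h1, h2⟩ := h
      obtain ⟨q, hq, h3, h4⟩ := h'
      by_cases hpq : p = q
      · subst hpq
        have := h2.unique h4
        exact Or.inl ⟨h1.unique h3, by omega⟩
      · rcases pairwise_total (hnest.fst.and hnest.snd) hp hq with h | h | h
        · exact absurd h hpq
        · have := h.2.lt h3 h1; omega
        · have := h.1.lt h4 h2; omega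
    · have := hXb h; have := abs_lt.1 (hTb h').1; omega
    · have := hPb h'; have := abs_lt.1 (hTb h).1; omega
    · obtain ⟨-, -, ⟨N, hN, h1⟩, -⟩ := hT k i h
      obtain ⟨p, hp, h2, -⟩ := h'
      have := (hpc p hp N hN).lt h2 h1; omega
    · exact hTT k i k' i' h h' hk hi
  have hWR : ∀ {k i}, W k i → e k - e i ∈ R := by
    intro k i h
    have hb := hWb h
    rcases h with h | h | h
    · have := hPb h; exact hDR (mem_rootsD_iff.2 ⟨k, i, by omega, hb.1, hb.2, rfl⟩)
    · have := hXb h; exact hDR (mem_rootsD_iff.2 ⟨k, i, by omega, hb.1, hb.2, rfl⟩)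
    · exact (hT k i h).2.1
  refine ⟨{v | ∃ k i, W k i ∧ v = e k - e i}, ?_, ?_, ?_⟩
  · rintro _ ⟨k, i, h, rfl⟩; exact hWR h
  · rintro _ ⟨k, i, h, rfl⟩ _ ⟨k', i', h', rfl⟩ hne hle
    obtain ⟨h1, h2⟩ := rootLE_imp hR (hWb h).1 (hWb h).2 (hWb h').1 (hWb h').2 hle
    rcases hWW h h' h1 h2 with ⟨rfl, rfl⟩ | h3
    · exact hne rfl
    · exact h3 hle
  · have harc : ∀ {k i}, W k i → Arc {v | ∃ k i, W k i ∧ v = e k - e i} k i :=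
      fun h => ⟨_, _, h, rfl⟩
    have hcons : ∀ X, X ∈ l ∨ X ∈ D → ∀ i k, Consec X i k →
        Arc {v | ∃ k i, W k i ∧ v = e k - e i} k i := fun X hX i k h => harc (Or.inl ⟨X, hX, h⟩)
    refine (chainPartition_config hY hps hcons ?_ ?_ ?_).symm
    · intro p hp
      obtain ⟨x, hx⟩ := exists_isLeast (hP.nonempty p.1 (Or.inl (hps p hp).1))
      obtain ⟨y, hy⟩ := exists_isLeast (hP.nonempty p.2 (Or.inl (hps p hp).2))
      exact ⟨x, hx.1, y, hy.1, harc (Or.inr (Or.inl ⟨p, hp, hy, by rwa [neg_neg]⟩))⟩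
    · exact hC _ (fun k i h => harc (Or.inr (Or.inr h))) fun N hN =>
        eqvGen_of_consec (hcons N (Or.inl (hcl N hN)))
    · rintro _ ⟨k, i, h, rfl⟩
      refine ⟨k, i, (hWb h).1, rfl, ?_⟩
      rcases h with ⟨X, hX, h⟩ | ⟨p, hp, h1, h2⟩ | h
      · exact Or.inl ⟨X, hX, h.2.1, h.1⟩
      · refine Or.inr ⟨pr p, Finset.mem_union_left _ (mem_cross.2 ⟨p, hp, rfl⟩), Or.inr ?_⟩
        rw [Inside, neg_pr, mem_pr, mem_pr]
        exact ⟨Or.inl h1.1, Or.inl (Or.inr h2.1)⟩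
      · obtain ⟨-, -, -, B, hB, h⟩ := hT k i h
        exact Or.inr ⟨B, Finset.mem_union_right _ hB, h⟩


open Relation (EqvGen)

/-- The zero block `±M` is held together by the arcs that join `0` to the least element of `M` and
to its negative. -/
theorem mem_NNB_of_build {n : ℕ} {u : List Status} {l : List (Finset ℤ)}
    {D : Finset (Finset ℤ)} (hb : BuildNN n u l D) (hu : u.length = n)
    {ps : List (Finset ℤ × Finset ℤ)} {c : List (Finset ℤ)} {C : Finset (Finset ℤ)}
    (hl : l = ps.map Prod.fst ++ (ps.map Prod.snd).reverse ++ c) (hc : CenterB c C) :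
    pm (D ∪ (cross ps ∪ C)) ∈ NNB n := by
  have hP : Pieces n 1 l D := hb.pieces_of_length (by rw [hu]; ring)
  have hperm : l.Perm (ps.map Prod.fst ++ ps.map Prod.snd ++ c) :=
    perm_of_eq_last hl
  have hY := config_B hP hperm hc
  cases hc with
  | none =>
    exact exists_antichain le_rfl hP hb.inv hl hY subset_rfl (fun v hv => Or.inr hv)
      (fun _ _ => False) (by simp) (by simp) (by simp)
  | zero M =>
    have hM : M ∈ l := by rw [hl]; simp
    refine exists_antichain le_rfl hP hb.inv hl hY subset_rfl (fun v hv => Or.inr hv)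
      (fun k i => i = 0 ∧ IsLeast (M : Set ℤ) k) ?_ ?_ ?_
    · rintro k i ⟨rfl, hk⟩
      have := hP.range M (Or.inl hM) k hk.1
      refine ⟨by norm_num, Or.inl ⟨k, this.1, this.2, by rw [e_zero, sub_zero]⟩, ⟨M, by simp, hk⟩,
        _, Finset.mem_singleton_self _, Or.inl ⟨mem_pr.2 (Or.inl hk.1), Or.inr ⟨rfl, by rw [neg_pr]; rfl⟩⟩⟩
    · rintro k i k' i' ⟨rfl, hk⟩ ⟨rfl, hk'⟩ _ _
      exact Or.inl ⟨hk.unique hk', rfl⟩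
    · intro A hA hM' B hB
      rw [Finset.mem_singleton] at hB
      subst hB
      obtain ⟨m, hm⟩ := exists_isLeast (hP.nonempty M (Or.inl hM))
      have h0 : ∀ x ∈ M, EqvGen (Arc A) x 0 := fun x hx =>
        .trans _ m _ (hM' M (by simp) x hx m hm.1) (.rel _ _ (hA m 0 ⟨rfl, hm⟩))
      have : ∀ x ∈ pr (M, M), EqvGen (Arc A) x 0 := by
        intro x hx
        rcases mem_pr.1 hx with hx | hx
        · exact h0 x hx
        · have := eqvGen_neg (h0 _ hx)
          rwa [neg_neg, neg_zero] at this
      exact fun x hx y hy => .trans _ _ _ (this x hx) (.symm _ _ (this y hy))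

/-- The pieces `X`, `Y` of the central block `S ∪ U ∪ -V` that are joined to `1` and to `-1`. -/
def Ends (S U V X Y : Finset ℤ) : Prop :=
  (S = {1} ∧ X = U ∧ Y = V) ∨ (S = {1, -1} ∧ U = V ∧ X = U ∧ Y = U) ∨ (S = {-1} ∧ X = V ∧ Y = U)

theorem CenterD.exists_ends {s t : Status} {c : List (Finset ℤ)} {S U V : Finset ℤ}
    (h : CenterD s t c S U V) : ∃ X Y, Ends S U V X Y ∧ (X = ∅ ∨ X ∈ c) ∧ (Y = ∅ ∨ Y ∈ c) ∧
      (S = {1, -1} → X ∈ c) := by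
  have h1 : ({1} : Finset ℤ) ≠ {1, -1} := by decide
  have h2 : ({-1} : Finset ℤ) ≠ {1, -1} := by decide
  cases h with
  | mixNeg => exact ⟨V, U, Or.inr (Or.inr ⟨rfl, rfl, rfl⟩), by simp [h2]⟩
  | zero => exact ⟨U, U, Or.inr (Or.inl ⟨rfl, rfl, rfl, rfl⟩), by simp⟩
  | _ => exact ⟨_, _, Or.inl ⟨rfl, rfl, rfl⟩, by simp [h1]⟩

theorem Ends.inside {S U V X Y : Finset ℤ} (h : Ends S U V X Y) {k : ℤ} :
    (k ∈ X → Inside (S ∪ pr (U, V)) k 1 ∨ Inside (neg (S ∪ pr (U, V))) k 1) ∧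
    (k ∈ Y → Inside (S ∪ pr (U, V)) k (-1) ∨ Inside (neg (S ∪ pr (U, V))) k (-1)) := by
  rcases h with ⟨rfl, rfl, rfl⟩ | ⟨rfl, rfl, rfl, rfl⟩ | ⟨rfl, rfl, rfl⟩ <;>
    simp +contextual [Inside, mem_neg, mem_pr]

theorem Ends.connected {S U V X Y : Finset ℤ} (h : Ends S U V X Y) {A : Set (ℤ → ℤ)}
    (hX : ∀ x ∈ X, EqvGen (Arc A) x 1) (hY : ∀ y ∈ Y, EqvGen (Arc A) y (-1))
    (hne : S = {1, -1} → X.Nonempty) :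
    ∀ x ∈ S ∪ pr (U, V), ∀ y ∈ S ∪ pr (U, V), EqvGen (Arc A) x y := by
  suffices ∃ r, ∀ x ∈ S ∪ pr (U, V), EqvGen (Arc A) x r by
    obtain ⟨r, hr⟩ := this
    exact fun x hx y hy => .trans _ _ _ (hr x hx) (.symm _ _ (hr y hy))
  have hX' : ∀ x, -x ∈ X → EqvGen (Arc A) x (-1) := fun x hx => by
    have := eqvGen_neg (hX _ hx); rwa [neg_neg] at this
  have hY' : ∀ y, -y ∈ Y → EqvGen (Arc A) y 1 := fun x hx => by
    have := eqvGen_neg (hY _ hx); rwa [neg_neg, neg_neg] at this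
  rcases h with ⟨rfl, rfl, rfl⟩ | ⟨rfl, rfl, rfl, rfl⟩ | ⟨rfl, rfl, rfl⟩
  · refine ⟨1, fun x hx => ?_⟩
    simp only [Finset.mem_union, Finset.mem_singleton, mem_pr] at hx
    rcases hx with rfl | hx | hx
    · exact .refl _
    · exact hX x hx
    · exact hY' x hx
  · refine ⟨1, fun x hx => ?_⟩
    simp only [Finset.mem_union, Finset.mem_insert, Finset.mem_singleton, mem_pr] at hx
    rcases hx with (rfl | rfl) | hx | hx
    · exact .refl _
    · obtain ⟨m, hm⟩ := hne rfl
      exact .trans _ _ _ (.symm _ _ (hY m hm)) (hX m hm)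
    · exact hX x hx
    · exact hY' x hx
  · refine ⟨-1, fun x hx => ?_⟩
    simp only [Finset.mem_union, Finset.mem_singleton, mem_pr] at hx
    rcases hx with rfl | hx | hx
    · exact .refl _
    · exact hY x hx
    · exact hX' x hx

/-- The central block is held together by arcs from the least elements of `X` and `Y` to `1` and
`-1`. These arcs may lie under each other, but their roots are incomparable in type `D` by
`not_rootLE_one`. -/
theorem mem_NND_of_build {n : ℕ} (hn : 1 ≤ n) {u : List Status} {l : List (Finset ℤ)}
    {D : Finset (Finset ℤ)} (hb : BuildNN n u l D) (hu : u.length + 1 = n)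
    {ps : List (Finset ℤ × Finset ℤ)} {c : List (Finset ℤ)} {s t : Status} {S U V : Finset ℤ}
    (hl : l = ps.map Prod.fst ++ (ps.map Prod.snd).reverse ++ c) (hc : CenterD s t c S U V) :
    pm (D ∪ (cross ps ∪ {S ∪ pr (U, V)})) ∈ NND n := by
  have hP : Pieces n 2 l D := hb.pieces_of_length (by rw [← hu]; push_cast; ring)
  have hperm : l.Perm (ps.map Prod.fst ++ ps.map Prod.snd ++ c) :=
    perm_of_eq_last hl
  have hY := config_D hn hP hperm hc
  obtain ⟨X, Y, hE, hXc, hYc, hXne⟩ := hc.exists_ends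
  have hcl : ∀ N ∈ c, N ∈ l := fun N hN => by rw [hl]; exact List.mem_append_right _ hN
  have hmemc : ∀ {Z : Finset ℤ} {k : ℤ}, (Z = ∅ ∨ Z ∈ c) → k ∈ Z → Z ∈ c ∧ 2 ≤ k ∧ k ≤ n := by
    intro Z k hZ hk
    have hZ := hZ.resolve_left (Finset.ne_empty_of_mem hk)
    exact ⟨hZ, hP.range Z (Or.inl (hcl Z hZ)) k hk⟩
  have hone : |(1 : ℤ)| = 1 := abs_one
  have hone' : |(-1 : ℤ)| = 1 := by rw [abs_neg, abs_one]
  refine exists_antichain (by norm_num) hP hb.inv hl hY (fun v hv => Or.inr hv) subset_rfl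
    (fun k i => (i = 1 ∧ IsLeast (X : Set ℤ) k) ∨ (i = -1 ∧ IsLeast (Y : Set ℤ) k)) ?_ ?_ ?_
  · rintro k i (⟨rfl, hk⟩ | ⟨rfl, hk⟩)
    · obtain ⟨h1, h2, h3⟩ := hmemc hXc hk.1
      exact ⟨by norm_num, mem_rootsD_iff.2 ⟨k, 1, by norm_num, by omega, h3, rfl⟩, ⟨X, h1, hk⟩,
        _, Finset.mem_singleton_self _, hE.inside.1 hk.1⟩
    · obtain ⟨h1, h2, h3⟩ := hmemc hYc hk.1
      exact ⟨by norm_num, mem_rootsD_iff.2 ⟨k, -1, by norm_num, by omega, h3, rfl⟩, ⟨Y, h1, hk⟩,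
        _, Finset.mem_singleton_self _, hE.inside.2 hk.1⟩
  · rintro k i k' i' (⟨rfl, hk⟩ | ⟨rfl, hk⟩) (⟨rfl, hk'⟩ | ⟨rfl, hk'⟩) _ hi
    · exact Or.inl ⟨hk.unique hk', rfl⟩
    · obtain ⟨-, h2, h3⟩ := hmemc hXc hk.1
      obtain ⟨-, h2', h3'⟩ := hmemc hYc hk'.1
      exact Or.inr (not_rootLE_one h2 h2' h3 h3')
    · omega
    · exact Or.inl ⟨hk.unique hk', rfl⟩
  · intro A hA hN B hB
    rw [Finset.mem_singleton] at hB
    subst hB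
    have hZ : ∀ {Z : Finset ℤ} {r : ℤ}, (Z = ∅ ∨ Z ∈ c) →
        (∀ k, IsLeast (Z : Set ℤ) k → Arc A k r) → ∀ x ∈ Z, EqvGen (Arc A) x r := by
      intro Z r hZ h x hx
      obtain ⟨m, hm⟩ := exists_isLeast ⟨x, hx⟩
      exact .trans _ m _ (hN Z (hmemc hZ hx).1 x hx m hm.1) (.rel _ _ (h m hm))
    exact hE.connected (hZ hXc fun k hk => hA k 1 (Or.inl ⟨rfl, hk⟩))
      (hZ hYc fun k hk => hA k (-1) (Or.inr ⟨rfl, hk⟩))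
      fun h => hP.nonempty X (Or.inl (hcl X (hXne h)))


open Relation (EqvGen)

/-! ### The nonnesting construction of an antichain of type `D` -/

/-- The pieces `l`, `D` are cut out of `{j, …, n}` by the arcs of `A`; the lists contains the pieces
with an arc to an element smaller than `j`. -/
structure Traces (n : ℕ) (A : Set (ℤ → ℤ)) (j : ℤ) (l : List (Finset ℤ)) (D : Finset (Finset ℤ)) :
    Prop extends Pieces n j l D where
  arc : ∀ X, X ∈ l ∨ X ∈ D → ∀ i k, Consec X i k → Arc A k i
  joined : ∀ i k, j ≤ i → Arc A k i → ∃ X, (X ∈ l ∨ X ∈ D) ∧ k ∈ X ∧ i ∈ X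
  down : ∀ N ∈ l, ∀ m, IsLeast (N : Set ℤ) m → ∃ y < j, Arc A m y
  closed : ∀ X ∈ D, ∀ m, IsLeast (X : Set ℤ) m → ∀ y, ¬ Arc A m y

/-- If `k` were not least in its piece, the arc to its predecessor would lie under the arc to `y`.
The piece is unfinished, as least elements of finished pieces have no arcs downwards. -/
theorem Traces.isLeast {n : ℕ} {A : Set (ℤ → ℤ)} {j : ℤ} {l : List (Finset ℤ)}
    {D : Finset (Finset ℤ)} (hA : A ⊆ rootsD n) (hanti : IsAntichain (RootLE (rootsD n)) A)
    (h : Traces n A j l D) (hj : 2 ≤ j) {k y : ℤ} (hky : Arc A k y) (hk : j ≤ k) (hy : y < j) :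
    ∃ X ∈ l, IsLeast (X : Set ℤ) k := by
  have hb := arc_bounds hA hky
  obtain ⟨X, hX, hkX⟩ := h.cover k hk (mem_ground.1 hb.1).2.2
  obtain ⟨m, hm⟩ := exists_isLeast ⟨k, hkX⟩
  have hmk : m = k := by
    by_contra hne
    obtain ⟨i, hi⟩ := exists_consec hm.1 hkX (lt_of_le_of_ne (hm.2 hkX) hne)
    have h1 := (h.range X hX i hi.1).1
    have := arc_antichain hA hanti hky (h.arc X hX i k hi) (by omega) le_rfl (by omega) (by omega)
    omega
  subst hmk
  rcases hX with hX | hX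
  · exact ⟨X, hX, hm⟩
  · exact absurd hky (h.closed X hX m hm y)

/-- The letter of `a` says whether `a` has an arc upwards and whether it has one downwards. An arc
upwards is unique and ends at the least element of the last unfinished piece, as the nonnesting rule
demands. The reading stops at `2`, because at `±1` arcs may lie under each other. -/
theorem exists_traces {n : ℕ} {A : Set (ℤ → ℤ)} (hA : A ⊆ rootsD n)
    (hanti : IsAntichain (RootLE (rootsD n)) A) (m : ℕ) (hm : m + 1 ≤ n) :
    ∃ u l D, u.length = m ∧ BuildNN n u l D ∧ Traces n A (n - m + 1) l D := by
  induction m with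
  | zero =>
    refine ⟨[], [], ∅, rfl, .nil, ?_, by simp, fun i k h1 h2 => ?_, by simp, by simp⟩
    · have := (Build.nil (ok := fun _ l₂ => l₂ = []) (n := n)).pieces
      simpa using this
    · have hb := arc_bounds hA h2
      have := mem_ground.1 hb.1
      push_cast at h1
      omega
  | succ m ih =>
    obtain ⟨u, l, D, rfl, hb, ht⟩ := ih (by omega)
    have hcast : ((u.length + 1 : ℕ) : ℤ) = u.length + 1 := by push_cast; rfl
    have hj : (n : ℤ) - ((u.length + 1 : ℕ) : ℤ) + 1 = n - u.length := by push_cast; ring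
    rw [hj]
    set a : ℤ := n - u.length with ha
    have ha2 : 2 ≤ a := by omega
    have hpiece : ∀ {u' l' D'}, BuildNN n u' l' D' → u'.length = u.length + 1 →
        Pieces n a l' D' := fun h hl => h.pieces_of_length (by rw [hl]; push_cast; omega)
    have huniq : ∀ k k', Arc A k a → Arc A k' a → k = k' := by
      intro k k' h h'
      have h1 := arc_bounds hA h
      have h2 := arc_bounds hA h'
      rcases le_total k k' with hle | hle
      · exact (arc_antichain hA hanti h' h (by omega) hle le_rfl (by omega)).1
      · exact (arc_antichain hA hanti h h' (by omega) hle le_rfl (by omega)).1.symm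
    by_cases hup : ∃ k, Arc A k a
    · obtain ⟨k, hk⟩ := hup
      have hka := (arc_bounds hA hk).2.2.1
      obtain ⟨N, hN, hkN⟩ := ht.isLeast hA hanti (by omega) hk (by omega) (by omega)
      obtain ⟨l₁, l₂, rfl⟩ := List.append_of_mem hN
      have hs := ht.sorted
      rw [List.pairwise_append, List.pairwise_cons] at hs
      -- The least element of a later piece has an arc to some `y ≤ a`, and the arc from `k` to `a`
      -- would lie under it.
      have hl₂ : l₂ = [] := by
        refine List.eq_nil_iff_forall_not_mem.2 fun N' hN' => ?_
        obtain ⟨m', hm'⟩ := exists_isLeast (ht.nonempty N' (Or.inl (by simp [hN'])))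
        have hlt := (hs.2.1.1 N' hN').lt hkN hm'
        obtain ⟨y, hy, hy'⟩ := ht.down N' (by simp [hN']) m' hm'
        have := arc_antichain hA hanti hy' hk (by omega) hlt.le (by omega) (by omega)
        omega
      subst hl₂
      have hlow : ∀ x ∈ N, a < x := fun x hx => by
        have := (ht.range N (Or.inl hN) x hx).1; omega
      have hgen : ∀ {u' l' D'}, BuildNN n u' l' D' → u'.length = u.length + 1 →
          (∀ X, X ∈ l' ∨ X ∈ D' ↔ X = insert a N ∨ X ∈ l₁ ∨ X ∈ D) →
          (∀ X ∈ l', X ∈ l₁ ∨ (X = insert a N ∧ ∃ y, Arc A a y)) →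
          (∀ X ∈ D', X ∈ D ∨ (X = insert a N ∧ ∀ y, ¬ Arc A a y)) → Traces n A a l' D' := by
        intro u' l' D' hb' hlen hmem hl' hD'
        have hleast : ∀ {m}, IsLeast ((insert a N : Finset ℤ) : Set ℤ) m → m = a := by
          intro m hm
          have h1 : m ≤ a := hm.2 (Finset.mem_insert_self a N)
          rcases Finset.mem_insert.1 hm.1 with h | h
          · exact h
          · have := hlow m h; omega
        refine ⟨hpiece hb' hlen, ?_, ?_, ?_, ?_⟩
        · intro X hX i k' hik
          rcases (hmem X).1 hX with rfl | hX
          · rcases (consec_insert hlow).1 hik with h | ⟨rfl, h⟩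
            · exact ht.arc N (Or.inl hN) i k' h
            · rwa [h.unique hkN]
          · exact ht.arc X (hX.imp_left (by simp +contextual)) i k' hik
        · intro i k' hi hik
          rcases hi.eq_or_lt with rfl | hi
          · rw [huniq k' k hik hk]
            exact ⟨insert a N, (hmem _).2 (Or.inl rfl), Finset.mem_insert_of_mem hkN.1,
              Finset.mem_insert_self _ _⟩
          · obtain ⟨X, hX, h1, h2⟩ := ht.joined i k' (by omega) hik
            by_cases hXN : X = N
            · subst hXN
              exact ⟨insert a X, (hmem _).2 (Or.inl rfl), Finset.mem_insert_of_mem h1,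
                Finset.mem_insert_of_mem h2⟩
            · exact ⟨X, (hmem _).2 (Or.inr (by simpa [hXN] using hX)), h1, h2⟩
        · intro M hM m hm
          rcases hl' M hM with hM | ⟨rfl, y, hy⟩
          · obtain ⟨y, hy, hmy⟩ := ht.down M (by simp [hM]) m hm
            refine ⟨y, ?_, hmy⟩
            rcases (show y ≤ a by omega).eq_or_lt with rfl | h
            · rw [huniq m k hmy hk] at hm
              exact absurd ((hs.2.2 M hM N (by simp)).lt hm hkN) (lt_irrefl _)
            · exact h
          · rw [hleast hm]
            exact ⟨y, (arc_bounds hA hy).2.2.1, hy⟩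
        · intro X hX m hm
          rcases hD' X hX with hX | ⟨rfl, hy⟩
          · exact ht.closed X hX m hm
          · rw [hleast hm]; exact hy
      by_cases hdown : ∃ y, Arc A a y
      · have hb' := Build.tr hb rfl
        refine ⟨_, _, _, by simp, hb', hgen hb' (by simp) (fun X => ?_) (fun X hX => ?_)
          (fun X hX => Or.inl hX)⟩
        · rw [List.append_nil, List.mem_cons, or_assoc]
        · rw [List.append_nil, List.mem_cons] at hX
          exact hX.elim (fun h => Or.inr ⟨h, hdown⟩) Or.inl
      · have hb' := Build.op hb rfl
        refine ⟨_, _, _, by simp, hb', hgen hb' (by simp) (fun X => ?_)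
          (fun X hX => Or.inl (by rwa [List.append_nil] at hX)) (fun X hX => ?_)⟩
        · rw [List.append_nil, Finset.mem_insert]; exact or_left_comm
        · exact (Finset.mem_insert.1 hX).elim (fun h => Or.inr ⟨h, not_exists.1 hdown⟩) Or.inl
    · have hgen : ∀ {u' l' D'}, BuildNN n u' l' D' → u'.length = u.length + 1 →
          (∀ X, X ∈ l' ∨ X ∈ D' ↔ X = {a} ∨ X ∈ l ∨ X ∈ D) →
          (∀ X ∈ l', X ∈ l ∨ (X = {a} ∧ ∃ y, Arc A a y)) →
          (∀ X ∈ D', X ∈ D ∨ (X = {a} ∧ ∀ y, ¬ Arc A a y)) → Traces n A a l' D' := by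
        intro u' l' D' hb' hlen hmem hl' hD'
        have hleast : ∀ {m}, IsLeast (({a} : Finset ℤ) : Set ℤ) m → m = a := fun hm =>
          Finset.mem_singleton.1 hm.1
        refine ⟨hpiece hb' hlen, ?_, ?_, ?_, ?_⟩
        · intro X hX i k' hik
          rcases (hmem X).1 hX with rfl | hX
          · exact absurd hik consec_singleton
          · exact ht.arc X hX i k' hik
        · intro i k' hi hik
          rcases hi.eq_or_lt with rfl | hi
          · exact absurd ⟨k', hik⟩ hup
          · obtain ⟨X, hX, h⟩ := ht.joined i k' (by omega) hik
            exact ⟨X, (hmem _).2 (Or.inr hX), h⟩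
        · intro M hM m hm
          rcases hl' M hM with hM | ⟨rfl, y, hy⟩
          · obtain ⟨y, hy, hmy⟩ := ht.down M hM m hm
            refine ⟨y, ?_, hmy⟩
            rcases (show y ≤ a by omega).eq_or_lt with rfl | h
            · exact absurd ⟨m, hmy⟩ hup
            · exact h
          · rw [hleast hm]
            exact ⟨y, (arc_bounds hA hy).2.2.1, hy⟩
        · intro X hX m hm
          rcases hD' X hX with hX | ⟨rfl, hy⟩
          · exact ht.closed X hX m hm
          · rw [hleast hm]; exact hy
      by_cases hdown : ∃ y, Arc A a y
      · have hb' := Build.cl hb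
        refine ⟨_, _, _, by simp, hb', hgen hb' (by simp) (fun X => ?_) (fun X hX => ?_)
          (fun X hX => Or.inl hX)⟩
        · rw [List.mem_cons, or_assoc]
        · exact (List.mem_cons.1 hX).elim (fun h => Or.inr ⟨h, hdown⟩) Or.inl
      · have hb' := Build.both hb
        refine ⟨_, _, _, by simp, hb', hgen hb' (by simp) (fun X => ?_)
          (fun X hX => Or.inl hX) (fun X hX => ?_)⟩
        · rw [Finset.mem_insert]; exact or_left_comm
        · exact (Finset.mem_insert.1 hX).elim (fun h => Or.inr ⟨h, not_exists.1 hdown⟩) Or.inl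


open Relation (EqvGen)

theorem filter_append_filter_not {α : Type*} (p : α → Bool) : ∀ {l : List α},
    l.Pairwise (fun a b => p b = true → p a = true) → l = l.filter p ++ l.filter (fun a => !p a)
  | [], _ => rfl
  | a :: l, h => by
    rw [List.pairwise_cons] at h
    by_cases ha : p a = true
    · have ih := filter_append_filter_not p h.2
      rw [List.filter_cons_of_pos ha, List.filter_cons_of_neg (by simp [ha]), List.cons_append, ← ih]
    · have h1 : l.filter p = [] := List.filter_eq_nil_iff.2 fun b hb hpb => ha (h.1 b hb hpb)
      have h2 : l.filter (fun a => !p a) = l := List.filter_eq_self.2 fun b hb => by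
        by_contra hpb
        exact ha (h.1 b hb (by simpa using hpb))
      rw [List.filter_cons_of_neg ha, List.filter_cons_of_pos (by simp [ha]), h1, h2, List.nil_append]

/-- `q₁` and `q₂` stand for having an arc to `1` and to `-1`. Each of them holds for at most one
piece, so there are at most two pieces, and the possibilities are those of `CenterD`. -/
theorem exists_center {c : List (Finset ℤ)} {q₁ q₂ : Finset ℤ → Prop} (hnd : c.Nodup)
    (h : ∀ N ∈ c, q₁ N ∨ q₂ N) (h1 : ∀ M ∈ c, ∀ N ∈ c, q₁ M → q₁ N → M = N)
    (h2 : ∀ M ∈ c, ∀ N ∈ c, q₂ M → q₂ N → M = N) :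
    ∃ s t S U V X Y, CenterD s t c S U V ∧ Ends S U V X Y ∧ (∀ N ∈ c, q₁ N → N = X) ∧
      (∀ N ∈ c, q₂ N → N = Y) ∧ (X = ∅ ∨ X ∈ c ∧ q₁ X) ∧ (Y = ∅ ∨ Y ∈ c ∧ q₂ Y) ∧
      (S = {1, -1} → X ∈ c) := by
  have e1 : ({1} : Finset ℤ) ≠ {1, -1} := by decide
  have e2 : ({-1} : Finset ℤ) ≠ {1, -1} := by decide
  match c, hnd, h, h1, h2 with
  | [], _, _, _, _ => exact ⟨_, _, _, _, _, ∅, ∅, .both, Or.inl ⟨rfl, rfl, rfl⟩, by simp [e1]⟩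
  | [M], _, h, h1, h2 =>
    by_cases hM1 : q₁ M
    · by_cases hM2 : q₂ M
      · exact ⟨_, _, _, _, _, M, M, .zero M, Or.inr (Or.inl ⟨rfl, rfl, rfl, rfl⟩),
          by simp [hM1, hM2]⟩
      · exact ⟨_, _, _, _, _, M, ∅, .posit M, Or.inl ⟨rfl, rfl, rfl⟩, by simp [hM1, hM2, e1]⟩
    · have hM2 := (h M (by simp)).resolve_left hM1
      exact ⟨_, _, _, _, _, ∅, M, .negat M, Or.inl ⟨rfl, rfl, rfl⟩, by simp [hM1, hM2, e1]⟩
  | [M, N], hnd, h, h1, h2 =>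
    have hne : M ≠ N := by simpa using hnd
    by_cases hM1 : q₁ M
    · have hN1 : ¬ q₁ N := fun hN => hne (h1 M (by simp) N (by simp) hM1 hN)
      have hN2 := (h N (by simp)).resolve_left hN1
      have hM2 : ¬ q₂ M := fun hM => hne (h2 M (by simp) N (by simp) hM hN2)
      exact ⟨_, _, _, _, _, M, N, .mix M N, Or.inl ⟨rfl, rfl, rfl⟩, by simp [hM1, hM2, hN1, hN2, e1]⟩
    · have hM2 := (h M (by simp)).resolve_left hM1
      have hN2 : ¬ q₂ N := fun hN => hne (h2 M (by simp) N (by simp) hM2 hN)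
      have hN1 := (h N (by simp)).resolve_right hN2
      exact ⟨_, _, _, _, _, N, M, .mixNeg M N, Or.inr (Or.inr ⟨rfl, rfl, rfl⟩),
        by simp [hM1, hM2, hN1, hN2, e2]⟩
  | M :: N :: K :: c, hnd, h, h1, h2 =>
    simp only [List.nodup_cons, List.mem_cons, not_or] at hnd
    have hM := h M (by simp)
    have hN := h N (by simp)
    have hK := h K (by simp)
    have := h1 M (by simp) N (by simp)
    have := h1 M (by simp) K (by simp)
    have := h1 N (by simp) K (by simp)
    have := h2 M (by simp) N (by simp)
    have := h2 M (by simp) K (by simp)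
    have := h2 N (by simp) K (by simp)
    grind

/-- After reading the letters of `n, …, 2`, the least element of each unfinished piece has an arc to
some `y < 2`. The pieces with `y ≤ -2` are joined to one another and come first in the list; the
involution `g` that sends a piece to its partner reverses their order and has no fixed piece, as no
root gives an arc from `m` to `-m`. The remaining pieces are joined to `1` or `-1` and form the
centre. -/
theorem exists_build_of_mem_NND {n : ℕ} (hn : 2 ≤ n) {P : Finset (Finset ℤ)} (hPm : P ∈ NND n) :
    ∃ u l D ps c s t S U V, BuildNN n u l D ∧ u.length + 1 = n ∧
      l = ps.map Prod.fst ++ (ps.map Prod.snd).reverse ++ c ∧ CenterD s t c S U V ∧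
      P = pm (D ∪ (cross ps ∪ {S ∪ pr (U, V)})) := by
  obtain ⟨A, hA, hanti, rfl⟩ := hPm
  obtain ⟨u, l, D, hu, hb, ht⟩ := exists_traces hA hanti (n - 1) (by omega)
  rw [show (n : ℤ) - ((n - 1 : ℕ) : ℤ) + 1 = 2 by omega] at ht
  have hnd := ht.nodup
  -- Two different arcs downwards from the same element lie under each other, so they must be the
  -- exceptional arcs to `1` and `-1`.
  have harc : ∀ {m y y'}, 2 ≤ m → Arc A m y → Arc A m y' → (y = y' ∨ y = 1 ∨ y' = 1) := by
    intro m y y' hm h h'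
    by_contra hne
    push Not at hne
    rcases le_total y y' with hle | hle
    · exact hne.1 (arc_antichain hA hanti h h' hm le_rfl hle (by omega)).2.symm
    · exact hne.1 (arc_antichain hA hanti h' h hm le_rfl hle (by omega)).2
  have hex : ∀ N : Finset ℤ, ∃ m y, N ∈ l → IsLeast (N : Set ℤ) m ∧ 2 ≤ m ∧ Arc A m y ∧ y < 2 ∧
      y ≠ 0 := by
    intro N
    by_cases hN : N ∈ l
    · obtain ⟨m, hm⟩ := exists_isLeast (ht.nonempty N (Or.inl hN))
      obtain ⟨y, hy, hmy⟩ := ht.down N hN m hm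
      exact ⟨m, y, fun _ => ⟨hm, (ht.range N (Or.inl hN) m hm.1).1, hmy, hy,
        (mem_ground.1 (arc_bounds hA hmy).2.1).1⟩⟩
    · exact ⟨0, 0, fun h => absurd h hN⟩
  choose lst mk hlm using hex
  have hinj : ∀ M ∈ l, ∀ N ∈ l, lst M = lst N → M = N := fun M hM N hN h =>
    ht.eq_of_mem M N (Or.inl hM) (Or.inl hN) _ (hlm M hM).1.1 (h ▸ (hlm N hN).1.1)
  have hsame : ∀ {M N y}, M ∈ l → N ∈ l → Arc A (lst M) y → Arc A (lst N) y → M = N := by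
    intro M N y hM hN h h'
    apply hinj M hM N hN
    rcases le_total (lst M) (lst N) with hle | hle
    · exact (arc_antichain hA hanti h' h (hlm M hM).2.1 hle le_rfl (by omega)).1
    · exact (arc_antichain hA hanti h h' (hlm N hN).2.1 hle le_rfl (by omega)).1.symm
  let p : Finset ℤ → Bool := fun N => decide (mk N ≤ -2)
  have hp : ∀ N, p N = true ↔ mk N ≤ -2 := fun N => decide_eq_true_iff
  have hmono : ∀ M ∈ l, ∀ N ∈ l, MinLT M N → mk N ≤ mk M → mk M = 1 ∧ mk N = -1 := by
    intro M hM N hN hlt hle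
    by_contra hne
    have h1 := hlt.lt (hlm M hM).1 (hlm N hN).1
    have := arc_antichain hA hanti (hlm N hN).2.2.1 (hlm M hM).2.2.1 (hlm M hM).2.1 h1.le hle hne
    omega
  have hl : l = l.filter p ++ l.filter (fun N => !p N) := by
    apply filter_append_filter_not
    refine (List.Pairwise.and_mem.1 ht.sorted).imp ?_
    rintro M N ⟨hM, hN, hlt⟩ h
    rw [hp] at h ⊢
    by_contra hM'
    have := hmono M hM N hN hlt (by omega)
    omega
  -- the partner of a piece
  have hpart : ∀ N : Finset ℤ, ∃ M, N ∈ l → mk N ≤ -2 →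
      M ∈ l ∧ IsLeast (M : Set ℤ) (-mk N) ∧ lst M = -mk N ∧ mk M = -lst N := by
    intro N
    by_cases hN : N ∈ l ∧ mk N ≤ -2
    · obtain ⟨h1, h2, h3, h4, h5⟩ := hlm N hN.1
      have h6 := arc_neg.2 h3
      obtain ⟨M, hM, hMl⟩ := ht.isLeast hA hanti le_rfl h6 (by omega) (by omega)
      have h7 := (hlm M hM).1.unique hMl
      have h8 := (hlm M hM).2.2.1
      have h9 := (hlm M hM).2.2.2
      rw [h7] at h8
      refine ⟨M, fun _ _ => ⟨hM, hMl, h7, ?_⟩⟩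
      rcases harc (by omega) h8 h6 with h | h | h
      · exact h
      · have := arc_antichain hA hanti h6 h8 (by omega) le_rfl (by omega) (by omega)
        omega
      · omega
    · exact ⟨∅, fun h h' => absurd ⟨h, h'⟩ hN⟩
  choose g hg using hpart
  have hmemp : ∀ N, N ∈ l.filter p ↔ N ∈ l ∧ mk N ≤ -2 := fun N => by rw [List.mem_filter, hp]
  have hgp : ∀ N ∈ l.filter p, g N ∈ l.filter p ∧ g (g N) = N := by
    intro N hN
    rw [hmemp] at hN
    obtain ⟨h1, h2, h3, h4⟩ := hg N hN.1 hN.2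
    have h5 := (hlm N hN.1).2.1
    refine ⟨(hmemp _).2 ⟨h1, by omega⟩, ?_⟩
    obtain ⟨h6, h7, h8, h9⟩ := hg (g N) h1 (by omega)
    exact hinj _ h6 _ hN.1 (by omega)
  have hsort : (l.filter p).Pairwise MinLT := ht.sorted.sublist List.filter_sublist
  have hrev : (l.filter p).map g = (l.filter p).reverse := by
    refine map_eq_reverse g hsort hgp (fun M hM N hN h => ?_) ?_
    · have hM := (hlm M (List.mem_of_mem_filter hM)).1
      have hN := (hlm N (List.mem_of_mem_filter hN)).1
      exact fun h' => lt_asymm (h.lt hM hN) (h'.lt hN hM)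
    · intro M hM N hN hlt
      rw [hmemp] at hM hN
      have h1 : mk M < mk N := by
        by_contra h
        have := hmono M hM.1 N hN.1 hlt (by omega)
        omega
      refine ⟨_, (hg N hN.1 hN.2).2.1.1, fun c hc => ?_⟩
      have := (hg M hM.1 hM.2).2.1.2 hc
      omega
  obtain ⟨ps, c₀, hlps, hps, hc₀⟩ := exists_pairs_of_map_eq_reverse g _ hrev
  -- A piece that is its own partner would need an arc from its least element `m` to `-m`, which
  -- does not occur in type `D`.
  have hc₀ : c₀ = [] := by
    rcases hc₀ with h | ⟨M, rfl, hM⟩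
    · exact h
    · have hM' := (hmemp M).1 (by rw [hlps]; simp)
      have h1 := (hg M hM'.1 hM'.2).2.2.1
      rw [hM] at h1
      have := (arc_bounds hA (hlm M hM'.1).2.2.1).2.2.2
      omega
  subst hc₀
  rw [List.append_nil] at hlps
  have hpsm : ∀ p' ∈ ps, p'.1 ∈ l.filter p ∧ p'.2 ∈ l.filter p := fun q hq => by
    rw [hlps]
    simp only [List.mem_append, List.mem_reverse, List.mem_map]
    exact ⟨Or.inl ⟨q, hq, rfl⟩, Or.inr ⟨q, hq, rfl⟩⟩
  have hcm : ∀ N, N ∈ l.filter (fun N => !p N) ↔ N ∈ l ∧ ¬ mk N ≤ -2 := fun N => by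
    rw [List.mem_filter, ← hp]; simp
  obtain ⟨s, t, S, U, V, X, Y, hcd, hE, hX, hY, hX', hY', hS⟩ :=
    exists_center (c := l.filter (fun N => !p N)) (q₁ := fun N => Arc A (lst N) 1)
      (q₂ := fun N => Arc A (lst N) (-1)) (hnd.filter _) (fun N hN => by
        obtain ⟨hN, h1⟩ := (hcm N).1 hN
        obtain ⟨-, -, h2, h3, h4⟩ := hlm N hN
        rcases (show mk N = 1 ∨ mk N = -1 by omega) with h | h <;> rw [h] at h2
        · exact Or.inl h2
        · exact Or.inr h2)
      (fun M hM N hN => hsame ((hcm M).1 hM).1 ((hcm N).1 hN).1)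
      (fun M hM N hN => hsame ((hcm M).1 hM).1 ((hcm N).1 hN).1)
  have hlc : l = ps.map Prod.fst ++ (ps.map Prod.snd).reverse ++ l.filter (fun N => !p N) := by
    rw [← hlps]; exact hl
  refine ⟨u, l, D, ps, _, s, t, S, U, V, hb, by omega, hlc, hcd, ?_⟩
  have hperm : l.Perm (ps.map Prod.fst ++ ps.map Prod.snd ++ l.filter (fun N => !p N)) :=
    perm_of_eq_last hlc
  refine chainPartition_config (config_D (by omega) ht.toPieces hperm hcd)
    (fun q hq => ⟨List.mem_of_mem_filter (hpsm q hq).1, List.mem_of_mem_filter (hpsm q hq).2⟩)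
    ht.arc ?_ ?_ ?_
  · intro q hq
    have h1 := (hmemp _).1 (hpsm q hq).1
    have h2 := hg _ h1.1 h1.2
    exact ⟨_, (hlm _ h1.1).1.1, _, hps q hq ▸ h2.2.1.1, arc_neg.2 (hlm _ h1.1).2.2.1⟩
  · intro B hB
    rw [Finset.mem_singleton] at hB
    subst hB
    have hcon : ∀ {Z : Finset ℤ} {r : ℤ}, (Z = ∅ ∨ Z ∈ l.filter (fun N => !p N) ∧
        Arc A (lst Z) r) → ∀ x ∈ Z, EqvGen (Arc A) x r := by
      rintro Z r (rfl | ⟨hZ, h⟩) x hx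
      · exact absurd hx (Finset.notMem_empty x)
      · have hZl := ((hcm Z).1 hZ).1
        exact .trans _ _ _ (eqvGen_of_consec (ht.arc Z (Or.inl hZl)) x hx _ (hlm Z hZl).1.1)
          (.rel _ _ h)
    exact hE.connected (hcon hX') (hcon hY') fun h =>
      ht.nonempty X (Or.inl ((hcm X).1 (hS h)).1)
  · intro v hv
    obtain ⟨k, i, hi0, hik, hkn, rfl⟩ := mem_rootsD_iff.1 (hA hv)
    have hki : Arc A k i := hv
    refine ⟨k, i, hik, rfl, ?_⟩
    have hab := abs_lt.1 hik
    by_cases hi2 : 2 ≤ i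
    · exact Or.inl (ht.joined i k hi2 hki)
    have hk2 : 2 ≤ k := by omega
    obtain ⟨N, hN, hNk⟩ := ht.isLeast hA hanti le_rfl hki hk2 (by omega)
    obtain rfl := (hlm N hN).1.unique hNk
    have hmk := (hlm N hN).2.2.1
    have hcase : mk N ≤ -2 ∨ i ≤ -2 → mk N = i := by
      intro h
      rcases le_total i (mk N) with hle | hle
      · exact (arc_antichain hA hanti hki hmk hk2 le_rfl hle (by omega)).2
      · exact (arc_antichain hA hanti hmk hki hk2 le_rfl hle (by omega)).2.symm
    by_cases hN2 : mk N ≤ -2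
    · have hi := hcase (Or.inl hN2)
      obtain ⟨h1, h2, -, -⟩ := hg N hN hN2
      rw [hi] at h2
      have hNp := (hmemp N).2 ⟨hN, hN2⟩
      have hgg := (hgp N hNp).2
      rw [hlps, List.mem_append, List.mem_reverse, List.mem_map, List.mem_map] at hNp
      refine Or.inr ?_
      rcases hNp with ⟨q, hq, rfl⟩ | ⟨q, hq, rfl⟩
      · refine ⟨pr q, Finset.mem_union_left _ (mem_cross.2 ⟨q, hq, rfl⟩), Or.inl ⟨?_, Or.inl ?_⟩⟩
        · exact mem_pr.2 (Or.inl hNk.1)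
        · exact mem_pr.2 (Or.inr (hps q hq ▸ h2.1))
      · refine ⟨pr q, Finset.mem_union_left _ (mem_cross.2 ⟨q, hq, rfl⟩), Or.inr ⟨?_, Or.inl ?_⟩⟩ <;>
          rw [neg_pr]
        · exact mem_pr.2 (Or.inl hNk.1)
        · refine mem_pr.2 (Or.inr ?_)
          rw [hps q hq, (hgp _ (hpsm q hq).1).2] at h2
          exact h2.1
    · have hNc := (hcm N).2 ⟨hN, hN2⟩
      refine Or.inr ⟨_, Finset.mem_union_right _ (Finset.mem_singleton_self _), ?_⟩
      have : ¬ i ≤ -2 := fun h => hN2 (hcase (Or.inr h) ▸ h)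
      rcases (show i = 1 ∨ i = -1 by omega) with rfl | rfl
      · exact hE.inside.1 (hX N hNc hki ▸ hNk.1)
      · exact hE.inside.2 (hY N hNc hki ▸ hNk.1)


/-! ### The map `ι` -/

theorem iota_eq {n : ℕ} {P : Finset (Finset ℤ)} {B₀ B₁ : Finset ℤ} {L : List (Finset ℤ)}
    (h0 : zeroBlock P = B₀) (h1 : blockOf P 1 = B₁)
    (hL : sortedBlocks n P (fun B => Mixed B ∧ neg B ≠ B ∧ wMin B < sMin B) = L) : iota n P =
    if B₀ = ∅ ∧ Mixed B₁ ∧ sMin (B₁.erase 1) < wMin B₁ then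
      replaceBlocks P [B₁] [(pos B₁).erase 1 ∪ neg ((pos B₁).erase 1), neg (ngt B₁) ∪ {1}]
    else if 1 ∈ B₀ ∧ L ≠ [] ∧ L.Pairwise (fun B C => wMin C < wMin B) then
      replaceBlocks P (B₀ :: L)
        ((pos (L.getLastD ∅) ∪ neg (pos (L.getLastD ∅))) ::
          List.zipWith (· ∪ ·) (L.tail.map ngt ++ [ngt B₀])
            (neg (ngt (L.headD ∅)) :: L.dropLast.map pos))
    else P := by
  subst h0 h1 hL
  rfl

/-- Partitions without zero block that are fixed by `ι`. -/
theorem iota_eq_self {n : ℕ} {l : List (Finset ℤ)} {D : Finset (Finset ℤ)}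
    {qs : List (Finset ℤ × Finset ℤ)} {B₁ : Finset ℤ} (hP : Pieces n 1 l D)
    (hl : l.Perm (qs.map Prod.fst ++ qs.map Prod.snd ++ []))
    (hB : B₁ ∈ pm (D ∪ cross qs)) (h1 : 1 ∈ B₁)
    (h : Mixed B₁ → ¬ MinLT (pos (B₁.erase 1)) (pos (neg B₁))) :
    iota n (pm (D ∪ (cross qs ∪ ∅))) = pm (D ∪ (cross qs ∪ ∅)) := by
  have hb := (config_B hP hl .none).signed.isBPartition
  rw [Finset.union_empty] at hb ⊢
  rw [iota_eq (zeroBlock_eq_empty (neg_ne_of_mem hP le_rfl hl)) (blockOf_eq hb hB h1) rfl,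
    if_neg, if_neg]
  · exact fun h => Finset.notMem_empty _ h.1
  · rintro ⟨-, hm, hlt⟩
    rw [wMin, sMin_lt_iff] at hlt
    exact h hm hlt

theorem MinLT.asymm {B C : Finset ℤ} (h : MinLT B C) : ¬ MinLT C B := by
  rintro ⟨c, hc, h'⟩
  obtain ⟨b, hb, h⟩ := h
  have := h c hc
  have := h' b hb
  omega

/-- The first case of `ι`. -/
theorem iota_mixed {n : ℕ} {l : List (Finset ℤ)} {D : Finset (Finset ℤ)}
    {ps : List (Finset ℤ × Finset ℤ)} {U V : Finset ℤ} (hP : Pieces n 2 l D)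
    (hl : l.Perm (ps.map Prod.fst ++ ps.map Prod.snd ++ [U, V])) (hUV : MinLT U V)
    (hB : IsBPartition n (pm (D ∪ (cross ps ∪ {{1} ∪ pr (U, V)})))) :
    iota n (pm (D ∪ (cross ps ∪ {{1} ∪ pr (U, V)}))) =
      pm (insert (insert 1 V) D ∪ (cross ps ∪ {pr (U, U)})) := by
  obtain ⟨hD, hN⟩ := pieces_two hP
  have hmem := mem_list_of_perm hl
  have hU := hN U (hmem.2 U (by simp))
  have hV := hN V (hmem.2 V (by simp))
  have hpos : ∀ {X : Finset ℤ}, (∀ x ∈ X, 2 ≤ x) → ∀ x ∈ X, 0 < x := fun h x hx => by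
    have := h x hx; omega
  have hU1 : 1 ∉ U := fun h => by have := hU.2 1 h; omega
  have hpos1 : ∀ x ∈ insert 1 U, 0 < x := by
    intro x hx
    rcases Finset.mem_insert.1 hx with rfl | hx
    · norm_num
    · exact hpos hU.2 x hx
  have hB1 : ({1} : Finset ℤ) ∪ pr (U, V) = pr (insert 1 U, V) := by
    rw [pr, pr, Finset.insert_eq, Finset.union_assoc]
  rw [hB1] at hB ⊢
  have hmB : pr (insert 1 U, V) ∈ pm (D ∪ (cross ps ∪ {pr (insert 1 U, V)})) :=
    mem_pm.2 (Or.inl (by simp))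
  have h1B : (1 : ℤ) ∈ pr (insert 1 U, V) := mem_pr.2 (Or.inl (by simp))
  have hnz : ∀ B ∈ pm (D ∪ (cross ps ∪ {pr (insert 1 U, V)})), neg B ≠ B := by
    intro B hB
    rw [← Finset.union_assoc, pm_union, Finset.mem_union] at hB
    rcases hB with hB | hB
    · exact neg_ne_of_mem hP (by norm_num) hl B hB
    · have : neg (pr (insert 1 U, V)) ≠ pr (insert 1 U, V) := by
        rw [neg_pr]
        intro e
        have := (pr_inj (hpos hV.2) hpos1 hpos1 (hpos hV.2) e).1
        have := hV.2 1 (this ▸ Finset.mem_insert_self 1 U)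
        omega
      rcases mem_pm.1 hB with h | h <;> rw [Finset.mem_singleton] at h
      · rwa [h]
      · rw [← h, neg_neg_block] at this
        exact this.symm
  rw [iota_eq (zeroBlock_eq_empty hnz) (blockOf_eq hB hmB h1B) rfl, if_pos]
  · rw [pos_pr hpos1 (hpos hV.2), ngt_pr hpos1 (hpos hV.2), neg_neg_block, Finset.erase_insert hU1]
    rw [← Finset.union_assoc, replaceBlocks_pm (X := D ∪ cross ps) (O := {pr (insert 1 U, V)})
      (N := {pr (U, U), insert 1 V})]
    · congr 1
      rw [Finset.insert_eq (insert 1 V) D, Finset.insert_eq (pr (U, U))]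
      ac_rfl
    · intro B; rw [mem_pm]; simp
    · intro B
      rw [mem_pm, Finset.union_comm V, ← Finset.insert_eq]
      simp [pr]
    · intro B hB hB'
      have hno : ∀ x ∈ B, x ≠ 1 ∧ x ≠ -1 := by
        intro x hx
        rw [Finset.mem_union, mem_cross] at hB
        rcases hB with hB | ⟨p, hp, rfl⟩
        · have := (hD B hB).2 x hx; omega
        · rcases mem_pr.1 hx with hx | hx
          · have := (hN _ (hmem.1 p hp).1).2 _ hx; omega
          · have := (hN _ (hmem.1 p hp).2).2 _ hx; omega
      rcases mem_pm.1 hB' with h | h <;> rw [Finset.mem_singleton] at h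
      · exact (hno 1 (h ▸ h1B)).1 rfl
      · rw [← h, mem_neg] at h1B
        exact (hno _ h1B).2 rfl
  · refine ⟨rfl, mixed_pr hpos1 (hpos hV.2) (Finset.insert_nonempty _ _) hV.1, ?_⟩
    rw [wMin, sMin_lt_iff, erase_one_pr hU1 (hpos hV.2), pos_pr (hpos hU.2) (hpos hV.2), neg_pr,
      Prod.swap, pos_pr (hpos hV.2) hpos1]
    exact hUV

/-- The second case of `ι`. -/
theorem iota_zero {n : ℕ} {l : List (Finset ℤ)} {D : Finset (Finset ℤ)}
    {p q : Finset ℤ × Finset ℤ} {ps ps' qs : List (Finset ℤ × Finset ℤ)} {M : Finset ℤ}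
    (hP : Pieces n 2 l D)
    (hl : l = (p :: ps).map Prod.fst ++ ((p :: ps).map Prod.snd).reverse ++ [M])
    (hB : IsBPartition n (pm (D ∪ (cross (p :: ps) ∪ {{1, -1} ∪ pr (M, M)}))))
    (hps : p :: ps = ps' ++ [q]) (hq1 : qs.map Prod.fst = insert 1 M :: ps'.map Prod.fst)
    (hq2 : qs.map Prod.snd = ps.map Prod.snd ++ [q.1]) :
    iota n (pm (D ∪ (cross (p :: ps) ∪ {{1, -1} ∪ pr (M, M)}))) =
      pm (D ∪ (cross qs ∪ {pr (p.2, p.2)})) := by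
  have hnest : Nested (p :: ps) := Nested.of_sorted hP.sorted (by
    rw [hl]; exact List.sublist_append_left _ _)
  have hperm : l.Perm ((p :: ps).map Prod.fst ++ (p :: ps).map Prod.snd ++ [M]) :=
    perm_of_eq_last hl
  obtain ⟨hD, hN⟩ := pieces_two hP
  have hmem := mem_list_of_perm hperm
  have hM := hN M (hmem.2 M (by simp))
  have hpos : ∀ {X : Finset ℤ}, (∀ x ∈ X, 2 ≤ x) → ∀ x ∈ X, 0 < x := fun h x hx => by
    have := h x hx; omega
  have hp : ∀ r ∈ p :: ps, (∀ x ∈ r.1, 0 < x) ∧ ∀ x ∈ r.2, 0 < x := fun r hr =>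
    ⟨hpos (hN _ (hmem.1 r hr).1).2, hpos (hN _ (hmem.1 r hr).2).2⟩
  have hpn : ∀ r ∈ p :: ps, r.1.Nonempty ∧ r.2.Nonempty := fun r hr =>
    ⟨(hN _ (hmem.1 r hr).1).1, (hN _ (hmem.1 r hr).2).1⟩
  have hpos1 : ∀ x ∈ insert 1 M, 0 < x := by
    intro x hx
    rcases Finset.mem_insert.1 hx with rfl | hx
    · norm_num
    · exact hpos hM.2 x hx
  have hB0 : ({1, -1} : Finset ℤ) ∪ pr (M, M) = pr (insert 1 M, insert 1 M) := by
    ext x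
    simp only [Finset.mem_union, Finset.mem_insert, Finset.mem_singleton, mem_pr]
    rw [show -x = 1 ↔ x = -1 by omega]
    tauto
  rw [hB0] at hB ⊢
  set B₀ := pr (insert 1 M, insert 1 M) with hB₀
  have hz : neg B₀ = B₀ := neg_pr _
  have h1B : (1 : ℤ) ∈ B₀ := mem_pr.2 (Or.inl (by simp))
  have hmB : B₀ ∈ pm (D ∪ (cross (p :: ps) ∪ {B₀})) := mem_pm.2 (Or.inl (by simp))
  have hswap : ∀ r : Finset ℤ × Finset ℤ, pr r.swap = neg (pr r) := fun r => (neg_pr r).symm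
  -- The condition selects the negatives of the blocks `pr r`, and sorting by `s` reverses the list
  -- of pairs: the innermost pair gives the first block and the outermost pair the last one.
  have hL : sortedBlocks n (pm (D ∪ (cross (p :: ps) ∪ {B₀})))
      (fun B => Mixed B ∧ neg B ≠ B ∧ wMin B < sMin B) =
      ((p :: ps).map fun r => pr r.swap).reverse := by
    refine sortedBlocks_eq hB _ _ ?_ ?_
    · rw [List.pairwise_reverse, List.pairwise_map]
      refine (List.Pairwise.and_mem.1 hnest.snd).imp ?_
      rintro r r' ⟨hr, hr', h⟩
      rw [Prod.swap, Prod.swap, pos_pr (hp r' hr').2 (hp r' hr').1, pos_pr (hp r hr).2 (hp r hr).1]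
      exact h
    · intro B
      rw [List.mem_reverse, List.mem_map]
      constructor
      · rintro ⟨r, hr, rfl⟩
        have hmem' : pr r.swap ∈ pm (D ∪ cross (p :: ps)) := by
          rw [hswap, neg_mem_pm]
          exact mem_pm.2 (Or.inl (Finset.mem_union_right _ (mem_cross.2 ⟨r, hr, rfl⟩)))
        have hmix : Mixed (pr r.swap) := mixed_pr (hp r hr).2 (hp r hr).1 (hpn r hr).2 (hpn r hr).1
        refine ⟨?_, hmix.1, hmix, neg_ne_of_mem hP (by norm_num) hperm _ hmem', ?_⟩
        · rw [← Finset.union_assoc, pm_union]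
          exact Finset.mem_union_left _ hmem'
        · have := ((mixed_lt_iff hP (by norm_num) hperm hnest (B := pr r) (mem_pm.2 (Or.inl
            (Finset.mem_union_right _ (mem_cross.2 ⟨r, hr, rfl⟩))))).2 ⟨r, hr, rfl⟩).2
          rwa [wMin, hswap, neg_neg_block]
      · rintro ⟨hBm, -, hmix, hne, hlt⟩
        rw [← Finset.union_assoc, pm_union, Finset.mem_union] at hBm
        rcases hBm with hBm | hBm
        · have hmix' : Mixed (neg B) := by
            obtain ⟨⟨x, hx⟩, ⟨y, hy⟩⟩ := hmix
            rw [mem_pos] at hx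
            rw [mem_ngt] at hy
            exact ⟨⟨-y, mem_pos.2 ⟨by rw [mem_neg, neg_neg]; exact hy.1, by omega⟩⟩,
              ⟨-x, mem_ngt.2 ⟨by rw [mem_neg, neg_neg]; exact hx.1, by omega⟩⟩⟩
          obtain ⟨r, hr, h⟩ := (mixed_lt_iff hP (by norm_num) hperm hnest
            (neg_mem_pm.2 hBm)).1 ⟨hmix', by rw [neg_neg_block]; exact hlt⟩
          exact ⟨r, hr, by rw [hswap, h, neg_neg_block]⟩
        · rcases mem_pm.1 hBm with h | h <;> rw [Finset.mem_singleton] at h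
          · rw [h] at hne; exact absurd hz hne
          · rw [← hz, neg_injective.eq_iff] at h
            rw [h] at hne; exact absurd hz hne
  have hLpos : (((p :: ps).map fun r => pr r.swap).reverse).map pos =
      ((p :: ps).map Prod.snd).reverse := by
    rw [List.map_reverse, List.map_map]
    congr 1
    exact List.map_congr_left fun r hr => pos_pr (hp r hr).2 (hp r hr).1
  have hLngt : (((p :: ps).map fun r => pr r.swap).reverse).map ngt =
      (((p :: ps).map Prod.fst).map neg).reverse := by
    rw [List.map_reverse, List.map_map, List.map_map]
    congr 1
    exact List.map_congr_left fun r hr => ngt_pr (hp r hr).2 (hp r hr).1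
  have hlast : pos ((((p :: ps).map fun r => pr r.swap).reverse).getLastD ∅) = p.2 := by
    rw [List.map_cons, List.reverse_cons, List.getLastD_concat]
    exact pos_pr (hp p (by simp)).2 (hp p (by simp)).1
  have hhead : neg (ngt ((((p :: ps).map fun r => pr r.swap).reverse).headD ∅)) = q.1 := by
    have hq : q ∈ p :: ps := by rw [hps]; simp
    rw [hps, List.map_append, List.reverse_append, List.map_singleton, List.reverse_singleton,
      List.singleton_append, List.headD_cons]
    exact (congrArg neg (ngt_pr (hp q hq).2 (hp q hq).1)).trans (neg_neg_block _)
  rw [iota_eq (zeroBlock_eq hB hmB hz) (blockOf_eq hB hmB h1B) hL, if_neg, if_pos]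
  -- By adding `1` to the last piece `M` it moves to the front of the list. Then `p.2` is the last
  -- piece and gives the zero block, and all partners are shifted by one place, which is what `qs`
  -- describes.
  · have hX : ((((p :: ps).map fun r => pr r.swap).reverse).tail.map ngt ++ [ngt B₀]) =
        qs.reverse.map (neg ∘ Prod.fst) := by
      rw [List.map_tail, hLngt, hB₀, ngt_pr hpos1 hpos1, hps, ← List.map_map, List.map_reverse, hq1]
      simp
    have hY : q.1 :: (((p :: ps).map fun r => pr r.swap).reverse).dropLast.map pos =
        qs.reverse.map Prod.snd := by
      rw [List.map_dropLast, hLpos, List.map_reverse, hq2]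
      simp
    have hzip : ∀ rs : List (Finset ℤ × Finset ℤ), List.zipWith (· ∪ ·)
        (rs.map (neg ∘ Prod.fst)) (rs.map Prod.snd) = rs.map fun r => pr r.swap := by
      intro rs
      induction rs with
      | nil => rfl
      | cons r rs ih =>
        rw [List.map_cons, List.map_cons, List.map_cons, List.zipWith_cons_cons, ih]
        congr 1
        exact Finset.union_comm _ _
    rw [hlast, hhead, hX, hY, hzip]
    have hmm : ∀ (rs : List (Finset ℤ × Finset ℤ)) (B : Finset ℤ),
        ((B ∈ (rs.map fun r => pr r.swap) ∨ neg B ∈ (rs.map fun r => pr r.swap)) ↔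
        B ∈ pm (cross rs)) := by
      intro rs B
      rw [mem_pm, mem_cross, mem_cross, List.mem_map, List.mem_map, or_comm]
      refine or_congr ?_ ?_
      · refine exists_congr fun r => and_congr_right fun _ => ?_
        rw [hswap, neg_injective.eq_iff]
      · refine exists_congr fun r => and_congr_right fun _ => ?_
        rw [hswap]
        exact ⟨fun h => by rw [← h, neg_neg_block], fun h => by rw [h, neg_neg_block]⟩
    rw [replaceBlocks_pm (X := D) (O := cross (p :: ps) ∪ {B₀}) (N := cross qs ∪ {pr (p.2, p.2)})]
    · intro B
      have := hmm (p :: ps) B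
      rw [pm_union, Finset.mem_union, ← this, mem_pm]
      simp only [List.mem_cons, List.mem_reverse, Finset.mem_singleton]
      exact or_or_or_comm .. |>.trans or_comm
    · intro B
      have := hmm qs B
      rw [pm_union, Finset.mem_union, ← this, mem_pm]
      simp only [List.mem_cons, List.mem_map, List.mem_reverse, Finset.mem_singleton]
      exact or_or_or_comm .. |>.trans or_comm
    · intro B hBD hB'
      have hno : ∀ x ∈ B, 0 < x := hpos (hD B hBD).2
      have : ∃ x ∈ B, x < 0 := by
        rw [pm_union, Finset.mem_union] at hB'
        rcases hB' with h | h
        · rcases mem_pm.1 h with h | h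
          · obtain ⟨r, hr, rfl⟩ := mem_cross.1 h
            obtain ⟨x, hx⟩ := (hpn r hr).2
            have := (hp r hr).2 x hx
            exact ⟨-x, mem_pr.2 (Or.inr (by rwa [neg_neg])), by omega⟩
          · obtain ⟨r, hr, h⟩ := mem_cross.1 h
            obtain ⟨x, hx⟩ := (hpn r hr).1
            have h1 := (hp r hr).1 x hx
            have h2 : x ∈ neg B := h ▸ mem_pr.2 (Or.inl hx)
            exact ⟨-x, mem_neg.1 h2, by omega⟩
        · have : B = B₀ := by
            rcases mem_pm.1 h with h | h <;> rw [Finset.mem_singleton] at h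
            · exact h
            · rw [← hz] at h; exact neg_injective h
          rw [this]
          exact ⟨-1, by rw [← hz, mem_neg, neg_neg]; exact h1B, by norm_num⟩
      obtain ⟨x, hx, hlt⟩ := this
      have := hno x hx
      omega
  · refine ⟨h1B, by simp, ?_⟩
    rw [List.pairwise_reverse, List.pairwise_map]
    refine (List.Pairwise.and_mem.1 hnest.fst).imp ?_
    rintro r r' ⟨hr, hr', h⟩
    rw [wMin, wMin, hswap, hswap, neg_neg_block, neg_neg_block, sMin_lt_iff,
      pos_pr (hp r hr).1 (hp r hr).2, pos_pr (hp r' hr').1 (hp r' hr').2]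
    exact h
  · rintro ⟨h, -⟩
    rw [h] at h1B
    exact Finset.notMem_empty _ h1B

/-- The map `ι` sends a nonnesting partition of type `D` to the nonnesting partition of type `B`
with the same word. -/
theorem iota_nonnesting {n : ℕ} {u : List Status} {l : List (Finset ℤ)} {D : Finset (Finset ℤ)}
    {ps : List (Finset ℤ × Finset ℤ)} {c : List (Finset ℤ)} {s t : Status} {S U V : Finset ℤ}
    (hb : BuildNN n u l D) (hu : u.length + 1 = n)
    (hl : l = ps.map Prod.fst ++ (ps.map Prod.snd).reverse ++ c) (hc : CenterD s t c S U V) :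
    ∃ l₁ D₁ qs c₁ C, BuildNN n (t :: u) l₁ D₁ ∧
      l₁ = qs.map Prod.fst ++ (qs.map Prod.snd).reverse ++ c₁ ∧ CenterB c₁ C ∧
      iota n (pm (D ∪ (cross ps ∪ {S ∪ pr (U, V)}))) = pm (D₁ ∪ (cross qs ∪ C)) := by
  have h2 : Pieces n 2 l D := hb.pieces_of_length (by omega)
  have hn1 : (n : ℤ) - u.length = 1 := by omega
  have hperm : l.Perm (ps.map Prod.fst ++ ps.map Prod.snd ++ c) :=
    perm_of_eq_last hl
  have hB := (config_D (by omega) h2 hperm hc).signed.isBPartition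
  obtain ⟨hD, hN⟩ := pieces_two h2
  have hcl : ∀ N ∈ c, N.Nonempty ∧ (∀ x ∈ N, 0 < x) ∧ 1 ∉ N := fun N hNc => by
    obtain ⟨h1, h2⟩ := hN N (by rw [hl]; exact List.mem_append_right _ hNc)
    exact ⟨h1, fun x hx => by have := h2 x hx; omega, fun h => by have := h2 1 h; omega⟩
  have hpieces : ∀ {t l₁ D₁}, BuildNN n (t :: u) l₁ D₁ → Pieces n 1 l₁ D₁ := fun h =>
    h.pieces_of_length (by rw [List.length_cons]; push_cast; omega)
  have hperm' : ∀ {l₁ : List (Finset ℤ)} {qs : List (Finset ℤ × Finset ℤ)} {c₁ : List (Finset ℤ)},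
      l₁ = qs.map Prod.fst ++ (qs.map Prod.snd).reverse ++ c₁ →
      l₁.Perm (qs.map Prod.fst ++ qs.map Prod.snd ++ c₁) := by
    rintro _ qs c₁ rfl
    exact List.Perm.append_right _ (List.Perm.append_left _ (List.reverse_perm _))
  have hnomix : ∀ {B : Finset ℤ}, (∀ x ∈ B, 0 < x) → ¬ Mixed B := by
    rintro B h ⟨-, x, hx⟩
    rw [mem_ngt] at hx
    have := h x hx.1
    omega
  cases hc with
  | both =>
    have h1 := Build.both hb
    rw [hn1] at h1
    have e : pm (D ∪ (cross ps ∪ {{1} ∪ pr (∅, ∅)})) = pm (insert {1} D ∪ (cross ps ∪ ∅)) := by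
      rw [pr_empty, Finset.union_empty, Finset.union_empty, Finset.insert_eq]
      congr 1
      ac_rfl
    refine ⟨_, _, ps, [], ∅, h1, hl, .none, ?_⟩
    rw [e, iota_eq_self (hpieces h1) (hperm' hl) (B₁ := {1}) (mem_pm.2 (Or.inl (by simp))) (by simp)]
    exact fun h => absurd h (hnomix (by simp))
  | posit M =>
    rw [hl] at hb
    have h1 := Build.op hb rfl
    rw [hn1, List.append_nil] at h1
    have e : pm (D ∪ (cross ps ∪ {{1} ∪ pr (U, ∅)})) =
        pm (insert (insert 1 U) D ∪ (cross ps ∪ ∅)) := by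
      rw [pr_empty, Finset.union_empty, Finset.insert_eq (insert 1 U), Finset.insert_eq 1 U]
      congr 1
      ac_rfl
    refine ⟨_, _, ps, [], ∅, h1, (List.append_nil _).symm, .none, ?_⟩
    rw [e, iota_eq_self (hpieces h1) (hperm' (List.append_nil _).symm) (B₁ := insert 1 U)
      (mem_pm.2 (Or.inl (by simp))) (by simp)]
    refine fun h => absurd h (hnomix fun x hx => ?_)
    rcases Finset.mem_insert.1 hx with rfl | hx
    · norm_num
    · exact (hcl U (by simp)).2.1 x hx
  | negat M =>
    have h1 := Build.cl hb
    rw [hn1] at h1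
    have hl₁ : {1} :: l = (({1}, V) :: ps).map Prod.fst ++
        ((({1}, V) :: ps).map Prod.snd).reverse ++ [] := by
      rw [hl]; simp
    have e : pm (D ∪ (cross ps ∪ {{1} ∪ pr (∅, V)})) = pm (D ∪ (cross (({1}, V) :: ps) ∪ ∅)) := by
      rw [cross_cons, Finset.union_empty, show ({1} : Finset ℤ) ∪ pr (∅, V) = pr ({1}, V) by
        rw [pr, pr, Finset.empty_union], Finset.union_comm (cross ps)]
    refine ⟨_, _, (({1}, V) :: ps), [], ∅, h1, hl₁, .none, ?_⟩
    rw [e, iota_eq_self (hpieces h1) (hperm' hl₁) (B₁ := pr ({1}, V))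
      (mem_pm.2 (Or.inl (by simp [cross]))) (mem_pr.2 (Or.inl (by simp)))]
    rintro - ⟨x, hx, -⟩
    rw [mem_pos, Finset.mem_erase, mem_pr, Finset.mem_singleton] at hx
    rcases hx.1.2 with h | h
    · exact hx.1.1 h
    · have := (hcl V (by simp)).2.1 _ h
      omega
  | zero M =>
    rcases ps with _ | ⟨p, ps⟩
    · rw [hl, List.map_nil, List.map_nil, List.reverse_nil] at hb
      have h1 := Build.tr hb rfl
      rw [hn1, List.append_nil] at h1
      have h0 : ({1, -1} : Finset ℤ) ∪ pr (U, U) = pr (insert 1 U, insert 1 U) := by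
        ext x
        simp only [Finset.mem_union, Finset.mem_insert, Finset.mem_singleton, mem_pr]
        rw [show -x = 1 ↔ x = -1 by omega]
        tauto
      refine ⟨_, _, [], [insert 1 U], _, h1, rfl, .zero _, ?_⟩
      rw [h0] at hB ⊢
      have hm : pr (insert 1 U, insert 1 U) ∈
          pm (D ∪ (cross [] ∪ {pr (insert 1 U, insert 1 U)})) := mem_pm.2 (Or.inl (by simp))
      have hz : neg (pr (insert 1 U, insert 1 U)) = pr (insert 1 U, insert 1 U) := neg_pr _
      have h1m : (1 : ℤ) ∈ pr (insert 1 U, insert 1 U) := mem_pr.2 (Or.inl (by simp))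
      have hL : sortedBlocks n (pm (D ∪ (cross [] ∪ {pr (insert 1 U, insert 1 U)})))
          (fun B => Mixed B ∧ neg B ≠ B ∧ wMin B < sMin B) = [] := by
        refine sortedBlocks_eq hB _ _ List.Pairwise.nil fun B => ?_
        simp only [List.not_mem_nil, false_iff]
        rintro ⟨h, -, ⟨⟨x, hx⟩, ⟨y, hy⟩⟩, hne, -⟩
        rw [mem_pos] at hx
        rw [mem_ngt] at hy
        rw [mem_pm, cross_nil, Finset.empty_union, Finset.mem_union, Finset.mem_union,
          Finset.mem_singleton, Finset.mem_singleton] at h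
        rcases h with (h | rfl) | (h | h)
        · have := (hD B h).2 y hy.1; omega
        · exact hne hz
        · have := (hD _ h).2 (-x) (by rw [mem_neg, neg_neg]; exact hx.1); omega
        · rw [← hz, neg_injective.eq_iff] at h
          exact hne (h ▸ hz)
      rw [iota_eq (zeroBlock_eq hB hm hz) (blockOf_eq hB hm h1m) hL, if_neg, if_neg]
      · exact fun h => h.2.1 rfl
      · exact fun h => Finset.notMem_empty _ (h.1 ▸ h1m)
    · have hb' := hb
      rw [hl] at hb'
      have h1 := Build.tr hb' rfl
      rw [hn1, List.append_nil] at h1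
      obtain ⟨ps', q, hps⟩ : ∃ ps' q, p :: ps = ps' ++ [q] :=
        ⟨_, _, (List.dropLast_append_getLast (List.cons_ne_nil p ps)).symm⟩
      have hlen : ps.length = ps'.length := by simpa using congrArg List.length hps
      obtain ⟨qs, hq1, hq2⟩ := exists_pairs (F := insert 1 U :: ps'.map Prod.fst)
        (G := ps.map Prod.snd ++ [q.1]) (by simp [hlen])
      refine ⟨_, _, qs, [p.2], _, h1, ?_, .zero _, iota_zero h2 hl hB hps hq1 hq2⟩
      rw [hq1, hq2]
      have := congrArg (List.map Prod.fst) hps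
      rw [this]
      simp
  -- The last piece `V` is finished by `1`. Then `U` is the last piece, and it gives the zero block.
  | mix M N =>
    have hl' : l = ps.map Prod.fst ++ (ps.map Prod.snd).reverse ++ [U] ++ V :: [] := by
      rw [hl]; simp
    have hs := h2.sorted
    rw [hl, List.pairwise_append, List.pairwise_pair] at hs
    rw [hl'] at hb
    have h1 := Build.op hb rfl
    rw [hn1, List.append_nil] at h1
    exact ⟨_, _, ps, [U], _, h1, rfl, .zero U, iota_mixed h2 hperm hs.2.1 hB⟩
  -- The last piece `V` receives `1` and moves to the front, where it forms the outermost pair with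
  -- `U`, now the last piece. This is the negative of the given central block, so the partition
  -- stays the same.
  | mixNeg M N =>
    have hl' : l = ps.map Prod.fst ++ (ps.map Prod.snd).reverse ++ [U] ++ V :: [] := by
      rw [hl]; simp
    have hs := h2.sorted
    rw [hl, List.pairwise_append, List.pairwise_pair] at hs
    rw [hl'] at hb
    have h1 := Build.tr hb rfl
    rw [hn1, List.append_nil] at h1
    have hl₁ : insert 1 V :: (ps.map Prod.fst ++ (ps.map Prod.snd).reverse ++ [U]) =
        ((insert 1 V, U) :: ps).map Prod.fst ++
        (((insert 1 V, U) :: ps).map Prod.snd).reverse ++ [] := by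
      simp
    have hU := hcl U (by simp)
    have hV := hcl V (by simp)
    have e : pm (D ∪ (cross ps ∪ {{-1} ∪ pr (U, V)})) =
        pm (D ∪ (cross ((insert 1 V, U) :: ps) ∪ ∅)) := by
      have hneg : ({-1} : Finset ℤ) ∪ pr (U, V) = neg (pr (insert 1 V, U)) := by
        ext x
        rw [neg_pr]
        simp only [Finset.mem_union, Finset.mem_insert, Finset.mem_singleton, mem_pr, Prod.swap]
        rw [show -x = 1 ↔ x = -1 by omega]
        tauto
      have hpn : ∀ B : Finset ℤ, pm {neg B} = pm {B} := by
        intro B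
        ext K
        rw [mem_pm, mem_pm, Finset.mem_singleton, Finset.mem_singleton, Finset.mem_singleton,
          Finset.mem_singleton, neg_injective.eq_iff, or_comm]
        refine or_congr_right ?_
        exact ⟨fun h => by rw [h, neg_neg_block], fun h => by rw [← h, neg_neg_block]⟩
      rw [cross_cons, Finset.union_empty, hneg, pm_union, pm_union, hpn, pm_union, pm_union,
        Finset.union_comm (pm (cross ps))]
    refine ⟨_, _, ((insert 1 V, U) :: ps), [], ∅, h1, hl₁, .none, ?_⟩
    rw [e, iota_eq_self (hpieces h1) (hperm' hl₁) (B₁ := pr (insert 1 V, U))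
      (mem_pm.2 (Or.inl (by simp [cross]))) (mem_pr.2 (Or.inl (by simp)))]
    have hpos1 : ∀ x ∈ insert 1 V, 0 < x := by
      intro x hx
      rcases Finset.mem_insert.1 hx with rfl | hx
      · norm_num
      · exact hV.2.1 x hx
    intro _
    rw [erase_one_pr hV.2.2 hU.2.1, pos_pr hV.2.1 hU.2.1, neg_pr, Prod.swap, pos_pr hU.2.1 hpos1]
    exact hs.2.1.asymm


/-! ### Noncrossing partitions with a given word -/

/-- `P` is the noncrossing partition of type `B` with the word `w`. -/
def HasWordB (n : ℕ) (w : List Status) (P : Finset (Finset ℤ)) : Prop :=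
  ∃ l D ps c C, BuildNC n w l D ∧ w.length = n ∧
    l = ps.map Prod.fst ++ c ++ (ps.map Prod.snd).reverse ∧ CenterB c C ∧
    P = pm (D ∪ (cross ps ∪ C))

/-- `P` is the noncrossing partition of type `D` with the word `s :: u`. -/
def HasWordD (n : ℕ) (s : Status) (u : List Status) (P : Finset (Finset ℤ)) : Prop :=
  ∃ l D ps c t S U V, BuildNC n u l D ∧ u.length + 1 = n ∧
    l = ps.map Prod.fst ++ c ++ (ps.map Prod.snd).reverse ∧ CenterD s t c S U V ∧
    P = pm (D ∪ (cross ps ∪ {S ∪ pr (U, V)}))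

section words

variable {n : ℕ} {w u u' : List Status} {s s' : Status} {P Q : Finset (Finset ℤ)}

theorem HasWordB.mem (h : HasWordB n w P) (hn : 1 ≤ n) : P ∈ NCB n := by
  obtain ⟨l, D, ps, c, C, hb, hw, hl, hc, rfl⟩ := h
  exact mem_NCB_of_build hn hb hw hl hc

theorem HasWordB.unique (h : HasWordB n w P) (h' : HasWordB n w Q) : P = Q := by
  obtain ⟨l, D, ps, c, C, hb, -, hl, hc, rfl⟩ := h
  obtain ⟨l', D', ps', c', C', hb', -, hl', hc', rfl⟩ := h'
  exact ncB_unique hb hl hc hb' hl' hc'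

theorem HasWordB.openers_closers (h : HasWordB n w P) :
    openers P = opSet n w ∧ closers P = clSet n w := by
  obtain ⟨l, D, ps, c, C, hb, hw, hl, hc, rfl⟩ := h
  have := config_B (hb.pieces_of_length (by rw [hw]; ring)) (perm_of_eq_middle hl) hc
  exact ⟨this.openers_eq hb hw, this.closers_eq hb hw⟩

theorem exists_hasWordB (hn : 1 ≤ n) (h : P ∈ NCB n) : ∃ w, w.length = n ∧ HasWordB n w P := by
  obtain ⟨w, l, D, ps, c, C, hb, hw, hl, hc, rfl⟩ := exists_build_of_mem_NCB hn h
  exact ⟨w, hw, l, D, ps, c, C, hb, hw, hl, hc, rfl⟩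

theorem HasWordD.mem (h : HasWordD n s u P) (hn : 2 ≤ n) : P ∈ NCD n := by
  obtain ⟨l, D, ps, c, t, S, U, V, hb, hu, hl, hc, rfl⟩ := h
  exact mem_NCD_of_build hn hb hu hl hc

theorem exists_hasWordD (hn : 2 ≤ n) (h : P ∈ NCD n) : ∃ s u, HasWordD n s u P := by
  obtain ⟨u, l, D, ps, c, s, t, S, U, V, hb, hu, hl, hc, rfl⟩ := exists_build_of_mem_NCD hn h
  exact ⟨s, u, l, D, ps, c, t, S, U, V, hb, hu, hl, hc, rfl⟩

theorem HasWordD.word_unique (h : HasWordD n s u P) (h' : HasWordD n s' u' P) (hn : 1 ≤ n) :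
    s = s' ∧ u = u' := by
  obtain ⟨l, D, ps, c, t, S, U, V, hb, hu, hl, hc, rfl⟩ := h
  obtain ⟨l', D', ps', c', t', S', U', V', hb', hu', hl', hc', he⟩ := h'
  exact ncD_word_unique hn hb hu hl hc hb' hu' hl' hc' he

theorem HasWordB.word_eq (h : HasWordB n (s :: u) P) (h' : HasWordD n s' u' P) (hn : 2 ≤ n) :
    s = s' ∧ u = u' := by
  obtain ⟨l, D, ps, c, C, hb, hw, hl, hc, rfl⟩ := h
  obtain ⟨l', D', ps', c', t', S', U', V', hb', hu', hl', hc', he⟩ := h'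
  exact nc_word_unique hn hb hw hl hc hb' hu' hl' hc' he

theorem HasWordD.exists_B (h : HasWordD n s u P) : ∃ Q, HasWordB n (s :: u) Q ∧ xi n Q = P := by
  obtain ⟨l, D, ps, c, t, S, U, V, hb, hu, hl, hc, rfl⟩ := h
  obtain ⟨l₁, D₁, qs, c₁, C, hb₁, hl₁, hC, hx⟩ := xi_noncrossing hb hu hl hc
  exact ⟨_, ⟨l₁, D₁, qs, c₁, C, hb₁, hu, hl₁, hC, rfl⟩, hx⟩

/-- Some partition of type `B` with this word is sent to `P`, and there is only one with this word.
In particular the word determines `P`. -/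
theorem HasWordD.xi_eq (h : HasWordD n s u P) (h' : HasWordB n (s :: u) Q) : xi n Q = P := by
  obtain ⟨Q', hQ', hx⟩ := h.exists_B
  rw [h'.unique hQ', hx]

end words

/-! ### The composition of `f` and `ι` -/

theorem exists_split {α : Type*} (l : List α) (m r : ℕ) (h : l.length = 2 * m + r) :
    ∃ F c G : List α, l = F ++ c ++ G ∧ F.length = m ∧ c.length = r ∧ G.length = m := by
  refine ⟨l.take m, (l.drop m).take r, (l.drop m).drop r, ?_, ?_, ?_, ?_⟩
  · rw [List.append_assoc, List.take_append_drop, List.take_append_drop]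
  all_goals simp only [List.length_take, List.length_drop]; omega

theorem exists_split_middle {α : Type*} (l : List α) (m r : ℕ) (h : l.length = 2 * m + r) :
    ∃ (ps : List (α × α)) (c : List α), l = ps.map Prod.fst ++ c ++ (ps.map Prod.snd).reverse ∧
      c.length = r := by
  obtain ⟨F, c, G, rfl, hF, hc, hG⟩ := exists_split l m r h
  obtain ⟨ps, rfl, h2⟩ := exists_pairs (F := F) (G := G.reverse) (by simp [hF, hG])
  exact ⟨ps, c, by rw [h2, List.reverse_reverse], hc⟩

theorem exists_split_last {α : Type*} (l : List α) (m r : ℕ) (h : l.length = 2 * m + r) :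
    ∃ (ps : List (α × α)) (c : List α), l = ps.map Prod.fst ++ (ps.map Prod.snd).reverse ++ c ∧
      c.length = r := by
  obtain ⟨F, c, G, rfl, hF, hc, hG⟩ := exists_split l m r h
  obtain ⟨H, K, hHK, hH, hK⟩ : ∃ H K, c ++ G = H ++ K ∧ H.length = m ∧ K.length = r := by
    refine ⟨(c ++ G).take m, (c ++ G).drop m, (List.take_append_drop _ _).symm, ?_, ?_⟩ <;>
      simp only [List.length_take, List.length_drop, List.length_append] <;> omega
  obtain ⟨ps, rfl, h2⟩ := exists_pairs (F := F) (G := H.reverse) (by simp [hF, hH])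
  exact ⟨ps, K, by rw [h2, List.reverse_reverse, List.append_assoc, hHK, List.append_assoc], hK⟩

theorem exists_centerB {c : List (Finset ℤ)} (h : c.length ≤ 1) : ∃ C, CenterB c C := by
  match c, h with
  | [], _ => exact ⟨_, .none⟩
  | [M], _ => exact ⟨_, .zero M⟩
  | _ :: _ :: _, h => simp at h

/-- The exchange of `mix` and `mixNeg` makes up for the opposite letters on the two sides. So a
letter of `1` occurs with a given number of central pieces on one side if it does on the other. -/
theorem CenterD.exists_swap {s t : Status} {c c' : List (Finset ℤ)} {S U V : Finset ℤ}
    (h : CenterD s t c S U V) (hc : c'.length = c.length) :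
    ∃ S' U' V', CenterD t s c' S' U' V' := by
  cases h with
  | both => obtain rfl := List.length_eq_zero_iff.1 hc; exact ⟨_, _, _, .both⟩
  | zero => obtain ⟨M, rfl⟩ := List.length_eq_one_iff.1 hc; exact ⟨_, _, _, .zero M⟩
  | posit => obtain ⟨M, rfl⟩ := List.length_eq_one_iff.1 hc; exact ⟨_, _, _, .posit M⟩
  | negat => obtain ⟨M, rfl⟩ := List.length_eq_one_iff.1 hc; exact ⟨_, _, _, .negat M⟩
  | mix => obtain ⟨M, N, rfl⟩ := List.length_eq_two.1 hc; exact ⟨_, _, _, .mixNeg M N⟩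
  | mixNeg => obtain ⟨M, N, rfl⟩ := List.length_eq_two.1 hc; exact ⟨_, _, _, .mix M N⟩

theorem exists_center_split (l : List (Finset ℤ)) :
    ∃ (ps : List (Finset ℤ × Finset ℤ)) (c : List (Finset ℤ)) (C : Finset (Finset ℤ)),
      l = ps.map Prod.fst ++ c ++ (ps.map Prod.snd).reverse ∧ CenterB c C := by
  obtain ⟨ps, c, hl, hc⟩ := exists_split_middle l (l.length / 2) (l.length % 2) (by omega)
  obtain ⟨C, hC⟩ := exists_centerB (c := c) (by omega)
  exact ⟨ps, c, C, hl, hC⟩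

/-- The map `f` sends a nonnesting partition of type `B` to the noncrossing partition of type `B`
with the same word. -/
theorem f_nonnesting {n : ℕ} (hn : 1 ≤ n) {w : List Status} {l : List (Finset ℤ)}
    {D : Finset (Finset ℤ)} (hb : BuildNN n w l D) (hw : w.length = n)
    {ps : List (Finset ℤ × Finset ℤ)} {c : List (Finset ℤ)} {C : Finset (Finset ℤ)}
    (hl : l = ps.map Prod.fst ++ (ps.map Prod.snd).reverse ++ c) (hc : CenterB c C) :
    HasWordB n w (f n (pm (D ∪ (cross ps ∪ C)))) := by
  have hmem := mem_NNB_of_build hb hw hl hc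
  have hperm : l.Perm (ps.map Prod.fst ++ ps.map Prod.snd ++ c) :=
    perm_of_eq_last hl
  have hcf := config_B (hb.pieces_of_length (by rw [hw]; ring)) hperm hc
  have hop := hcf.openers_eq hb hw
  have hcl := hcf.closers_eq hb hw
  set P := pm (D ∪ (cross ps ∪ C)) with hP
  obtain ⟨l', D', hb', -⟩ := hb.exists_NC
  obtain ⟨ps', c', C', hl', hc'⟩ := exists_center_split l'
  have hQ : HasWordB n w (pm (D' ∪ (cross ps' ∪ C'))) := ⟨l', D', ps', c', C', hb', hw, hl', hc', rfl⟩
  have hex : P ∈ NNB n ∧ ∃! Q, Q ∈ NCB n ∧ openers Q = openers P ∧ closers Q = closers P ∧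
      transients n Q = transients n P := by
    obtain ⟨h1, h2⟩ := hQ.openers_closers
    refine ⟨hmem, _, ⟨hQ.mem hn, by rw [h1, hop], by rw [h2, hcl], ?_⟩, ?_⟩
    · rw [transients, transients, h1, h2, hop, hcl]
    -- Openers and closers determine the word, and the word determines the noncrossing partition.
    · rintro Q ⟨hQm, h3, h4, -⟩
      obtain ⟨w', hw', hQ'⟩ := exists_hasWordB hn hQm
      obtain ⟨h5, h6⟩ := hQ'.openers_closers
      have : w' = w := word_ext (hw'.trans hw.symm) (by rw [← h5, h3, hop]) (by rw [← h6, h4, hcl])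
      subst this
      exact hQ'.unique hQ
  obtain ⟨h1, h2⟩ := hQ.openers_closers
  rw [f, dif_pos hex, ← hex.2.choose_spec.2 _ ⟨hQ.mem hn, by rw [h1, hop], by rw [h2, hcl],
    by rw [transients, transients, h1, h2, hop, hcl]⟩]
  exact hQ

/-- The noncrossing rule reads the same word and leaves the same number of pieces, so there is also
a noncrossing partition of type `D` with this word, with the central block provided by
`CenterD.exists_swap`. -/
theorem exists_word_of_mem_image {n : ℕ} (hn : 2 ≤ n) {Q : Finset (Finset ℤ)}
    (h : Q ∈ (f n ∘ iota n) '' NND n) :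
    ∃ s u R, HasWordB n (s :: u) Q ∧ HasWordD n s u R := by
  obtain ⟨P, hP, rfl⟩ := h
  obtain ⟨u, l, D, ps, c, s, t, S, U, V, hb, hu, hl, hc, rfl⟩ := exists_build_of_mem_NND hn hP
  obtain ⟨l₁, D₁, qs, c₁, C, hb₁, hl₁, hC, hi⟩ := iota_nonnesting hb hu hl hc
  obtain ⟨l', D', hb', hlen⟩ := hb.exists_NC
  obtain ⟨ps', c', hl', hcl⟩ := exists_split_middle l' ps.length c.length (by
    rw [hlen, hl]; simp; omega)
  obtain ⟨S', U', V', hc'⟩ := hc.exists_swap hcl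
  refine ⟨t, u, _, ?_, l', D', ps', c', s, S', U', V', hb', hu, hl', hc', rfl⟩
  rw [Function.comp_apply, hi]
  exact f_nonnesting (by omega) hb₁ (by simpa using hu) hl₁ hC

/-- The same argument with the nonnesting rule: every word of a noncrossing partition of type `D`
comes from a nonnesting partition of type `D`. -/
theorem HasWordD.exists_mem_image {n : ℕ} {s : Status} {u : List Status} {R : Finset (Finset ℤ)}
    (h : HasWordD n s u R) : ∃ Q ∈ (f n ∘ iota n) '' NND n, HasWordB n (s :: u) Q := by
  obtain ⟨l, D, ps, c, t, S, U, V, hb, hu, hl, hc, rfl⟩ := h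
  obtain ⟨l', D', hb', hlen⟩ := hb.exists_NN
  obtain ⟨ps', c', hl', hcl⟩ := exists_split_last l' ps.length c.length (by
    rw [hlen, hl]; simp; omega)
  obtain ⟨S', U', V', hc'⟩ := hc.exists_swap hcl
  obtain ⟨l₁, D₁, qs, c₁, C, hb₁, hl₁, hC, hi⟩ := iota_nonnesting hb' hu hl' hc'
  refine ⟨_, ⟨_, mem_NND_of_build (by omega) hb' hu hl' hc', rfl⟩, ?_⟩
  rw [Function.comp_apply, hi]
  exact f_nonnesting (by omega) hb₁ (by simpa using hu) hl₁ hC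

end NCNN

/-! ### The theorem -/

theorem theoremt3 (n : ℕ) (hn : 2 ≤ n) :
    (NCNN.f n ∘ NCNN.iota n) '' NCNN.NND n ⊆ NCNN.NCB n ∧
    Set.EqOn (NCNN.xi n) id ((NCNN.f n ∘ NCNN.iota n) '' NCNN.NND n ∩ NCNN.NCD n) ∧
    Set.BijOn (NCNN.xi n) ((NCNN.f n ∘ NCNN.iota n) '' NCNN.NND n) (NCNN.NCD n) ∧
    NCNN.xi n '' ((NCNN.f n ∘ NCNN.iota n) '' NCNN.NND n \ NCNN.NCD n) =
      NCNN.NCD n \ NCNN.NCB n := by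
  have hmem : ∀ Q ∈ (NCNN.f n ∘ NCNN.iota n) '' NCNN.NND n, ∃ s u, NCNN.HasWordB n (s :: u) Q ∧
      NCNN.HasWordD n s u (NCNN.xi n Q) := by
    intro Q hQ
    obtain ⟨s, u, R, hB, hD⟩ := NCNN.exists_word_of_mem_image hn hQ
    exact ⟨s, u, hB, by rwa [hD.xi_eq hB]⟩
  have hfix : ∀ Q ∈ (NCNN.f n ∘ NCNN.iota n) '' NCNN.NND n, Q ∈ NCNN.NCD n →
      NCNN.xi n Q = Q := by
    intro Q hQ hQD
    obtain ⟨s, u, hB, -⟩ := hmem Q hQ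
    obtain ⟨s', u', hD⟩ := NCNN.exists_hasWordD hn hQD
    obtain ⟨rfl, rfl⟩ := hB.word_eq hD hn
    exact hD.xi_eq hB
  have hbij : Set.BijOn (NCNN.xi n) ((NCNN.f n ∘ NCNN.iota n) '' NCNN.NND n) (NCNN.NCD n) := by
    refine ⟨fun Q hQ => ?_, fun Q hQ Q' hQ' h => ?_, fun R hR => ?_⟩
    · obtain ⟨s, u, -, hD⟩ := hmem Q hQ
      exact hD.mem hn
    · obtain ⟨s, u, hB, hD⟩ := hmem Q hQ
      obtain ⟨s', u', hB', hD'⟩ := hmem Q' hQ'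
      rw [h] at hD
      obtain ⟨rfl, rfl⟩ := hD.word_unique hD' (by omega)
      exact hB.unique hB'
    · obtain ⟨s, u, hD⟩ := NCNN.exists_hasWordD hn hR
      obtain ⟨Q, hQ, hB⟩ := hD.exists_mem_image
      exact ⟨Q, hQ, hD.xi_eq hB⟩
  refine ⟨fun Q hQ => ?_, fun Q hQ => hfix Q hQ.1 hQ.2, hbij, ?_⟩
  · obtain ⟨s, u, hB, -⟩ := hmem Q hQ
    exact hB.mem (by omega)
  · apply Set.Subset.antisymm
    · rintro _ ⟨Q, ⟨hQ, hQD⟩, rfl⟩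
      refine ⟨hbij.mapsTo hQ, fun hRB => hQD ?_⟩
      obtain ⟨w, hw, hB⟩ := NCNN.exists_hasWordB (by omega) hRB
      obtain ⟨s, u, hD⟩ := NCNN.exists_hasWordD hn (hbij.mapsTo hQ)
      obtain ⟨s', u', rfl⟩ := List.exists_cons_of_length_pos (l := w) (by omega)
      -- The image of `Q` is noncrossing in both types, so its two words agree. The partition `R` of
      -- type `B` with this word equals that image and is sent to it by `xi`, just as `Q` is;
      -- injectivity gives `R = Q`, so `Q` would be noncrossing of type `D`.
      obtain ⟨rfl, rfl⟩ := hB.word_eq hD hn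
      obtain ⟨R, hR, hB'⟩ := hD.exists_mem_image
      have hRQ : R = NCNN.xi n Q := hB'.unique hB
      have hRx : NCNN.xi n R = NCNN.xi n Q := hD.xi_eq hB'
      rw [← hbij.injOn hR hQ hRx, hRQ]
      exact hbij.mapsTo hQ
    · rintro R ⟨hR, hRB⟩
      obtain ⟨Q, hQ, rfl⟩ := hbij.surjOn hR
      refine ⟨Q, ⟨hQ, fun hQD => hRB ?_⟩, rfl⟩
      rw [hfix Q hQ hQD]
      obtain ⟨s, u, hB, -⟩ := hmem Q hQ
      exact hB.mem (by omega)
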